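/- **Setting.** Let $\Lambda=\mathbb Z^2$, let $U\subset\mathbb R^2$ be a convex open affine chart with coordinates $x=(x_0,x_1)$, $m_0\in U$, $r\ge 0$, and let $h=\mathrm{diag}(e^{-\phi_1},\dots,e^{-\phi_r})$ with $\phi_i\in C^\infty(U,\mathbb R)$ be a fibre-constant metric on the trivial bundle $E$ of rank $r$; put $A_q=\mathrm{diag}(-\partial\phi_i/\partial x_q)$. Forms on $U$ (or on the cover below) with values in $\mathrm{End}\,E\oplus T$, depending on $\hbar>0$, smooth for each $\hbar$, are expanded in monomials $t^s\mathfrak w^m$, $s\in\mathbb N$, $m\in\Lambda$, with finitely many $m$ for each $s$. Fix $\kappa\in\mathbb C$ (a normalisation constant), set $\nabla_q(f\mathfrak w^m)=(m_qf+\kappa\hbar\,\partial f/\partial x_q)\mathfrak w^m$ on functions and $\nabla_qN+\kappa\hbar[A_q,N]$ on $\mathrm{End}\,E$, and consider the symplectic dgLa of the pair $(\check X,E)$: the bracket is $\{(N,\psi),(N',\psi')\}=(\psi^j\nabla_jN'-\psi'^j\nabla_jN+[N,N'],\ \psi^j\nabla_j\psi'-\psi'^j\nabla_j\psi)$, extended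 to forms by the wedge product, and $d_W(N,\psi)=(dN+\hat B\psi,d\psi)$ with $\hat B\psi=\kappa\hbar\sum_j dA_j\wedge\psi^j$. Gauge transformations act on $0$ by $e^\varphi*0=-\sum_{k\ge0}\frac{\mathrm{ad}_\varphi^k}{(k+1)!}d_W\varphi$. The extended tropical vertex group is $\tilde{\mathbb V}=\exp(\tilde{\mathfrak h})$, $\tilde{\mathfrak h}=\bigoplus_{m\ne0}\mathfrak w^m\,(\mathfrak m_t\,\mathfrak{gl}_r(\mathbb C)\oplus \mathfrak m_t\otimes m^\perp)$. A wall is $(m,P,\theta)$ with $m\in\Lambda\setminus0$, $P$ the line $m_0+\mathbb Rm$ or the ray $m_0+\mathbb R_{\ge0}m$, and $\log\theta\in\tilde{\mathfrak h}$ with modes $km$, $k\ge1$; a scattering diagram is a family of walls, only finitely many of which are non-trivial modulo each power of $t$. Let $\{(m_1,P_1,\theta_1),(m_2,P_2,\theta_2)\}$ be an initial diagram of two non-parallel lines. Write $x=m_0+\alpha m_1+\beta m_2$, and let $\delta_1,\delta_2$ be the Gaussian forms $\frac{e^{-u^2/\hbar}}{\sqrt{\pi\hbar}}du$ with $u=\beta$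 and $u=\alpha$ respectively. The wall solutions are $\bar\Pi_i=-\log\theta_i\,\delta_i+(\Pi_{i,R},0)$, where $\Pi_{i,R}=\kappa\hbar\sum_j\psi^jA_j\,\delta_i$ and $\psi$ is the vector part of $\log\theta_i$. Let $q_0\in U$ be a base point with $\alpha,\beta<0$. In the metric in which $m_1,m_2$ are orthonormal let $u_m,u_{m^\perp}$ be orthogonal linear coordinates along and across $m$, vanishing at $q_0$; assume that $U$ contains, for all $m\in\Lambda$, $m\neq0$, and $x\in U$, the orthogonal projection of $x$ along $m$ to the line $u_m=0$ (for instance $U=\mathbb R^2$ or a disc centred at $q_0$). On $2$-forms put $H(f\,du_m\wedge du_{m^\perp}\mathfrak w^m)=\mathfrak w^m\big(\int_0^{u_m}f(s,u_{m^\perp})ds\big)du_{m^\perp}$ componentwise and $\mathbf H=H-H\hat BH$, so that $d_W\mathbf H=\mathrm{id}$ on $2$-forms. Let $(\rho,\vartheta)$ be polar coordinates given by $\alpha=\rho\cos\vartheta$, $\beta=\rho\sin\vartheta$, let $\vartheta_0\in(\pi,3\pi/2)$ be the angle of $q_0$, $0<\epsilon_0\le\vartheta_0-\pi$, and let $\tilde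 A_0=\{\rho>0,\ \vartheta_0-\epsilon_0<\vartheta<\vartheta_0+2\pi\}$ be the corresponding part of the universal cover of $U\setminus\{m_0\}$; a tilde denotes pull-back, and $q_0$ is lifted to angle $\vartheta_0$. For $a\in(\mathbb Z^2_{\ge0})_{\mathrm{prim}}$ put $m_a=a_1m_1+a_2m_2$ and let $P_a$ be $P_1$, $P_2$ for $a=(1,0),(0,1)$ and the ray $m_0+\mathbb R_{\ge0}m_a$ otherwise. For $a=(1,0)$, resp. $(0,1)$, $H_{m_a,\pm}\subset\tilde A_0$ are the preimages of $\{\pm\beta>0\}$, resp. $\{\pm\alpha>0\}$; otherwise $H_{m_a,\pm}=\{\pm(\vartheta-\vartheta_a)>0\}$, with $\vartheta_a\in(\vartheta_0,\vartheta_0+2\pi)$ the angle of $P_a$. With derivatives in the affine coordinates, $\mathcal W_0^s$ (resp. $\mathcal W_k^{-\infty}$) denotes functions (resp. $k$-forms) that, locally and for all $j$, satisfy $|\nabla^jf|\le C_j\hbar^{-(s+j)/2}$ (resp. $|\nabla^jf|\le C_je^{-c/\hbar}$ with $c>0$ independent of $j$) as $\hbar\to0^+$. **Theorem.** 1. There is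 a form $\Phi\in t\,\Omega^1(U,\mathrm{End}\,E\oplus T)[\![t]\!]$ with $\Phi=\bar\Pi_1+\bar\Pi_2-\tfrac12\mathbf H\{\Phi,\Phi\}$. It is unique, and it solves the Maurer–Cartan equation $d_W\Phi+\tfrac12\{\Phi,\Phi\}=0$ on $U$. 2. $\Phi=\sum_{a}\Phi_a$ over $a\in(\mathbb Z^2_{\ge0})_{\mathrm{prim}}$, where $\Phi_a$ is the part of $\Phi$ with Fourier modes $lm_a$, $l\ge1$; moreover $\Phi_{(1,0)}=\bar\Pi_1$ and $\Phi_{(0,1)}=\bar\Pi_2$. 3. For each such $a$ there is a gauge $\varphi_a\in t\,\Omega^0(\tilde A_0,\mathrm{End}\,E\oplus T)[\![t]\!]$, with modes $lm_a$, $l\ge1$, such that $\varphi_a(q_0)=0$ and $e^{\varphi_a}*0=\tilde\Phi_a$ modulo $\mathcal W_1^{-\infty}(\tilde A_0)$. Any two gauges with these two properties (whatever their modes) differ by an element of $\mathcal W_0^{-\infty}(\tilde A_0)$. 4. For each such $a$ there is a unique $L_a=\sum_{s,l\ge1}(B_{s,l},b_{s,l}\partial_{n_a})t^s\mathfrak w^{lm_a}\in\tilde{\mathfrak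 h}$, with $n_a\perp m_a$, such that every gauge $\varphi_a$ with $\varphi_a(q_0)=0$ and $e^{\varphi_a}*0=\tilde\Phi_a$ modulo $\mathcal W_1^{-\infty}(\tilde A_0)$ satisfies, coefficientwise in $t^s\mathfrak w^m$, $\varphi_a\in L_a+\mathcal W_0^{-1}$ (hence also in $L_a+\mathcal W_0^0$) on $H_{m_a,+}$, and $\varphi_a\in\mathcal W_0^{-\infty}$ on $H_{m_a,-}$. 5. $L_{(1,0)}=\log\theta_1$, $L_{(0,1)}=\log\theta_2$, and $\mathfrak D_\infty=\{(m_a,P_a,\exp L_a)\}_a$ is a scattering diagram, which contains the two initial walls. -/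

import Mathlib

open Filter Topology
open scoped ContDiff

namespace ExtScattering

/-! ## Formal series -/

/-- The lattice of Fourier modes, in the basis of the chosen affine coordinates. -/
abbrev Lam := Fin 2 → ℤ

/-- Points of the affine chart, and also points of the plane of polar coordinates. -/
abbrev Pt := Fin 2 → ℝ

/-- Complex functions of a point that depend on the parameter `ħ`: the first argument is `ħ`. -/
abbrev HFun := ℝ → Pt → ℂ

/-- `K[Λ][[t]]`: formal power series in `t` whose coefficients are finite sums of
`f · 𝔴 ^ m` with `f ∈ K`, `m ∈ Λ`. -/
abbrev Ser (K : Type) [CommRing K] := PowerSeries (AddMonoidAlgebra K Lam)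

/-- The coefficient of `t ^ s 𝔴 ^ m`. -/
noncomputable def Ser.cf {K : Type} [CommRing K] (f : Ser K) (s : ℕ) (m : Lam) : K :=
  (PowerSeries.coeff s f).coeff m

/-- The scalar `c`, as a series. -/
noncomputable def Ser.const {K : Type} [CommRing K] (c : K) : Ser K :=
  PowerSeries.C (AddMonoidAlgebra.single 0 c)

/-- Apply to each coefficient an additive operator that may depend on the mode. -/
noncomputable def Ser.mapModes {K K' : Type} [CommRing K] [CommRing K']
    (T : Lam → K → K') (f : Ser K) : Ser K' :=
  PowerSeries.mk fun s =>
    (PowerSeries.coeff s f).coeff.sum fun m c => AddMonoidAlgebra.single m (T m c)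

/-- `gl_r ⊕ ∂`-valued series: pairs `(N, ψ)` of an `r × r` matrix and a vector field
`ψ = ψ ^ 0 ∂_0 + ψ ^ 1 ∂_1`.  For `K = HFun` these are the sections of `End E ⊕ T`; for `K = ℂ`
they contain the extended tropical vertex Lie algebra. -/
abbrev Sec (r : ℕ) (K : Type) [CommRing K] := Matrix (Fin r) (Fin r) (Ser K) × (Fin 2 → Ser K)

/-- The scalar components of a section: matrix entries and components of the vector field. -/
abbrev Comp (r : ℕ) := (Fin r × Fin r) ⊕ Fin 2

/-- The coefficient of `t ^ s 𝔴 ^ m` in the component `c` of `X`. -/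
noncomputable def cf {r : ℕ} {K : Type} [CommRing K] (X : Sec r K) (c : Comp r) (s : ℕ)
    (m : Lam) : K :=
  match c with
  | Sum.inl ij => (X.1 ij.1 ij.2).cf s m
  | Sum.inr j => (X.2 j).cf s m

/-- Apply an operator to each coefficient of each component. -/
noncomputable def mapSec {r : ℕ} {K K' : Type} [CommRing K] [CommRing K']
    (T : Lam → K → K') (X : Sec r K) : Sec r K' :=
  (fun i j => (X.1 i j).mapModes T, fun j => (X.2 j).mapModes T)

/-- A `1`-form `α_0 dx_0 + α_1 dx_1` with values in `End E ⊕ T`.  A `0`-form is an element of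
`Sec r HFun`, and a `2`-form `β dx_0 ∧ dx_1` is represented by its coefficient `β`. -/
abbrev Form1 (r : ℕ) := Fin 2 → Sec r HFun

/-! ## Extended tropical vertex Lie algebra, walls, scattering diagrams -/

/-- Membership in
`⨁_{m ≠ 0} z ^ m · (𝔪_t gl_r(ℂ) ⊕ 𝔪_t ⊗ m^⊥)`:
positive order in `t`, no mode `0`, and the vector part in mode `m` annihilates `m`. -/
def InExtLie {r : ℕ} (L : Sec r ℂ) : Prop :=
  (∀ c s m, (s = 0 ∨ m = 0) → cf L c s m = 0) ∧
    ∀ s m, ∑ q, (m q : ℂ) * cf L (Sum.inr q) s m = 0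

/-- A lattice vector, as a vector of the plane. -/
def toPt (m : Lam) : Pt := fun q => (m q : ℝ)

/-- The line `m0 + ℝ m`. -/
def line (m0 : Pt) (m : Lam) : Set Pt := {x | ∃ t : ℝ, x = m0 + t • toPt m}

/-- The ray `m0 + ℝ_{≥ 0} m`. -/
def ray (m0 : Pt) (m : Lam) : Set Pt := {x | ∃ t : ℝ, 0 ≤ t ∧ x = m0 + t • toPt m}

/-- The modes of `X` are positive multiples of `m`. -/
def ModesAlong {r : ℕ} {K : Type} [CommRing K] (m : Lam) (X : Sec r K) : Prop :=
  ∀ c s m', cf X c s m' ≠ 0 → ∃ l : ℕ, 1 ≤ l ∧ m' = l • m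

/-- The data `(m, P, θ)` of a wall.  The automorphism `θ` in the group `exp` of the extended
tropical vertex Lie algebra is given by its logarithm. -/
structure Wall (r : ℕ) where
  m : Lam
  P : Set Pt
  logθ : Sec r ℂ

/-- `w` is a wall through (or emanating from) `m0`. -/
def IsWall {r : ℕ} (m0 : Pt) (w : Wall r) : Prop :=
  w.m ≠ 0 ∧ (w.P = line m0 w.m ∨ w.P = ray m0 w.m) ∧ InExtLie w.logθ ∧ ModesAlong w.m w.logθ

/-- A family of walls of which only finitely many are non-trivial modulo each power of `t`. -/
def IsScatteringDiagram {r : ℕ} {ι : Type} (m0 : Pt) (D : ι → Wall r) : Prop :=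
  (∀ i, IsWall m0 (D i)) ∧
    ∀ k : ℕ, {i | ∃ c s m, s < k ∧ cf (D i).logθ c s m ≠ 0}.Finite

/-! ## Differential calculus in an affine chart and on the cover

All operators are taken with respect to a local diffeomorphism `ϖ` into the affine chart
(the identity on the chart itself, polar coordinates on the cover), and forms and vector fields
are written in the frame of the affine coordinates, pulled back by `ϖ`. -/

/-- The derivative `∂ / ∂x_q` with respect to the affine coordinates `x = ϖ p`. -/
noncomputable def pd (ϖ : Pt → Pt) (q : Fin 2) (f : Pt → ℂ) (p : Pt) : ℂ :=
  fderiv ℝ f p ((fderiv ℝ ϖ p).inverse (Pi.single q 1))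

/-- Iterated partial derivatives in the affine coordinates. -/
noncomputable def iterPd (ϖ : Pt → Pt) : List (Fin 2) → (Pt → ℂ) → Pt → ℂ
  | [], f => f
  | q :: l, f => pd ϖ q (iterPd ϖ l f)

/-- `f ∈ 𝓦_0^{-∞}(S)`: locally, all derivatives are `O(e ^ (-c / ħ))` as `ħ → 0`. -/
def WExp (ϖ : Pt → Pt) (S : Set Pt) (f : HFun) : Prop :=
  ∀ q ∈ S, ∃ V ∈ 𝓝 q, ∃ c : ℝ, 0 < c ∧ ∀ j : ℕ, ∃ C : ℝ, ∀ᶠ ħ in 𝓝[>] (0 : ℝ),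
    ∀ x ∈ V, ∀ l : List (Fin 2), l.length = j →
      ‖iterPd ϖ l (f ħ) x‖ ≤ C * Real.exp (-c / ħ)

/-- `f ∈ 𝓦_0^s(S)`: locally, derivatives of order `j` are `O(ħ ^ (-(s + j) / 2))` as `ħ → 0`. -/
def WPow (ϖ : Pt → Pt) (s : ℤ) (S : Set Pt) (f : HFun) : Prop :=
  ∀ q ∈ S, ∃ V ∈ 𝓝 q, ∀ j : ℕ, ∃ C : ℝ, ∀ᶠ ħ in 𝓝[>] (0 : ℝ),
    ∀ x ∈ V, ∀ l : List (Fin 2), l.length = j →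
      ‖iterPd ϖ l (f ħ) x‖ ≤ C * ħ ^ (-((s : ℝ) + j) / 2)

/-- All coefficients are smooth on `S`, for each `ħ > 0`. -/
def SmoothOn {r : ℕ} (S : Set Pt) (X : Sec r HFun) : Prop :=
  ∀ c s m, ∀ ħ : ℝ, 0 < ħ → ContDiffOn ℝ ∞ (cf X c s m ħ) S

/-- All coefficients agree on `S`, for each `ħ > 0`. -/
def AgreeOn {r : ℕ} (S : Set Pt) (X Y : Sec r HFun) : Prop :=
  ∀ c s m, ∀ ħ : ℝ, 0 < ħ → ∀ x ∈ S, cf X c s m ħ x = cf Y c s m ħ x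

/-- The function `ħ`. -/
def hbar : HFun := fun ħ _ => (ħ : ℂ)

/-- Derivative of the coefficients with respect to `x_q`. -/
noncomputable def dSer (ϖ : Pt → Pt) (q : Fin 2) : Ser HFun → Ser HFun :=
  Ser.mapModes fun _ f ħ => pd ϖ q (f ħ)

/-- The derivative along `∂_q`: `f 𝔴 ^ m ↦ (m_q f + κ ħ ∂f/∂x_q) 𝔴 ^ m`. -/
noncomputable def covSer (κ : ℂ) (ϖ : Pt → Pt) (q : Fin 2) : Ser HFun → Ser HFun :=
  Ser.mapModes fun m f ħ p => (m q : ℂ) * f ħ p + κ * ħ * pd ϖ q (f ħ) p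

section dgLa

variable {r : ℕ} (κ : ℂ) (ϖ : Pt → Pt) (ϕ : Fin r → Pt → ℝ)

/-- The matrix `A_q = diag(-∂ϕ_i/∂x_q)` of the Chern connection `d + κ ħ A_q` of the trivial
bundle with the metric `diag(e ^ (-ϕ_i))`; here `ϕ` is a function on the affine chart. -/
noncomputable def connMat (q : Fin 2) : Matrix (Fin r) (Fin r) (Ser HFun) :=
  Matrix.diagonal fun i => Ser.const fun _ p => -pd id q (fun x => (ϕ i x : ℂ)) (ϖ p)

/-- `κ ħ`, as a scalar. -/
noncomputable def kh : Ser HFun := Ser.const fun ħ _ => κ * ħ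

/-- The Chern connection on `End E` in the direction `∂_q`. -/
noncomputable def covEnd (q : Fin 2) (N : Matrix (Fin r) (Fin r) (Ser HFun)) :
    Matrix (Fin r) (Fin r) (Ser HFun) :=
  N.map (covSer κ ϖ q) + kh κ • (connMat ϖ ϕ q * N - N * connMat ϖ ϕ q)

/-- The bracket of `0`-forms,
`{(N, ψ), (N', ψ')} = (ψ ⌟ ∇N' - ψ' ⌟ ∇N + [N, N'], [ψ, ψ'])`. -/
noncomputable def br (X Y : Sec r HFun) : Sec r HFun :=
  (∑ j, X.2 j • covEnd κ ϖ ϕ j Y.1 - ∑ j, Y.2 j • covEnd κ ϖ ϕ j X.1 + (X.1 * Y.1 - Y.1 * X.1),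
    fun k => ∑ j, (X.2 j * covSer κ ϖ j (Y.2 k) - Y.2 j * covSer κ ϖ j (X.2 k)))

/-- The bracket of a `0`-form and a `1`-form. -/
noncomputable def br01 (X : Sec r HFun) (α : Form1 r) : Form1 r := fun q => br κ ϖ ϕ X (α q)

/-- The bracket of two `1`-forms. -/
noncomputable def br11 (α β : Form1 r) : Sec r HFun :=
  br κ ϖ ϕ (α 0) (β 1) - br κ ϖ ϕ (α 1) (β 0)

/-- The differential `d_W (N, ψ) = (dN + B̂ψ, dψ)` on `0`-forms, with
`B̂ψ = κ ħ ∑_j dA_j ∧ ψ ^ j` the contraction with the curvature. -/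
noncomputable def dW0 (X : Sec r HFun) : Form1 r := fun q =>
  (X.1.map (dSer ϖ q) + kh κ • ∑ j, X.2 j • (connMat ϖ ϕ j).map (dSer ϖ q),
    fun j => dSer ϖ q (X.2 j))

/-- The operator `B̂` on `1`-forms with values in vector fields. -/
noncomputable def curv1 (ψ : Fin 2 → Fin 2 → Ser HFun) : Matrix (Fin r) (Fin r) (Ser HFun) :=
  kh κ • ∑ j, (ψ 1 j • (connMat ϖ ϕ j).map (dSer ϖ 0) - ψ 0 j • (connMat ϖ ϕ j).map (dSer ϖ 1))

/-- The differential `d_W` on `1`-forms. -/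
noncomputable def dW1 (α : Form1 r) : Sec r HFun :=
  ((α 1).1.map (dSer ϖ 0) - (α 0).1.map (dSer ϖ 1) + curv1 κ ϖ ϕ (fun q => (α q).2),
    fun j => dSer ϖ 0 ((α 1).2 j) - dSer ϖ 1 ((α 0).2 j))

/-- The partial sum over `k < n` of `e ^ X * 0 = -∑_k ad_X ^ k (d_W X) / (k + 1)!`.
If `X` has positive order in `t`, then the term of index `k` has order at least `k + 1`, so that
the coefficient of `t ^ s` of `e ^ X * 0` is that of the partial sum with `n = s`. -/
noncomputable def gaugeZero (n : ℕ) (X : Sec r HFun) : Form1 r :=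
  -∑ k ∈ Finset.range n,
    (((k + 1).factorial : ℂ)⁻¹) • (br01 κ ϖ ϕ X)^[k] (dW0 κ ϖ ϕ X)

end dgLa

/-! ## Initial data -/

/-- Coordinates of a vector in the basis `m1`, `m2`. -/
noncomputable def coords (m1 m2 : Lam) (v : Pt) : Pt :=
  ![(v 0 * m2 1 - v 1 * m2 0) / (m1 0 * m2 1 - m1 1 * m2 0),
    (m1 0 * v 1 - m1 1 * v 0) / (m1 0 * m2 1 - m1 1 * m2 0)]

/-- Polar coordinates `(ρ, ϑ)` centred at `m0`, in which `m1` has angle `0` and `m2` has angle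
`π / 2`. -/
noncomputable def polar (m0 : Pt) (m1 m2 : Lam) (p : Pt) : Pt :=
  m0 + (p 0 * Real.cos (p 1)) • toPt m1 + (p 0 * Real.sin (p 1)) • toPt m2

/-- The flow time along `m` from the line through `q0` orthogonal to `m` to the point `x`; the
metric is the one for which `m1`, `m2` is an orthonormal basis. -/
noncomputable def flowTime (m1 m2 : Lam) (q0 : Pt) (m : Lam) (x : Pt) : ℝ :=
  (coords m1 m2 (toPt m) ⬝ᵥ coords m1 m2 (x - q0)) /
    (coords m1 m2 (toPt m) ⬝ᵥ coords m1 m2 (toPt m))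

/-- An initial scattering diagram that consists of two non-parallel lines through `m0`, together
with the affine chart `U`, the metric, the base point and the opening of the cut. -/
structure Setup (r : ℕ) where
  /-- the two walls -/
  w1 : Wall r
  w2 : Wall r
  /-- the common point of the two lines -/
  m0 : Pt
  isWall1 : IsWall m0 w1
  isWall2 : IsWall m0 w2
  line1 : w1.P = line m0 w1.m
  line2 : w2.P = line m0 w2.m
  nonparallel : w1.m 0 * w2.m 1 - w1.m 1 * w2.m 0 ≠ 0
  /-- the normalisation constant of the derivative terms of the bracket -/
  κ : ℂ
  /-- the affine chart -/
  U : Set Pt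
  isOpen_U : IsOpen U
  convex_U : Convex ℝ U
  m0_mem : m0 ∈ U
  /-- the weights of the metric `diag(e ^ (-ϕ_i))` -/
  ϕ : Fin r → Pt → ℝ
  smooth_ϕ : ∀ i, ContDiffOn ℝ ∞ (ϕ i) U
  /-- polar coordinates of the base point, which lies on the negative side of both walls -/
  ρ0 : ℝ
  ϑ0 : ℝ
  ρ0_pos : 0 < ρ0
  lt_ϑ0 : Real.pi < ϑ0
  ϑ0_lt : ϑ0 < 3 * Real.pi / 2
  q0_mem : polar m0 w1.m w2.m ![ρ0, ϑ0] ∈ U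
  /-- the paths along which the homotopy operator integrates stay in `U` -/
  foot_mem : ∀ (m : Lam), ∀ x ∈ U,
    x - flowTime w1.m w2.m (polar m0 w1.m w2.m ![ρ0, ϑ0]) m x • toPt m ∈ U
  /-- the overlap of the cut plane does not meet any wall -/
  ε : ℝ
  ε_pos : 0 < ε
  ε_le : ε ≤ ϑ0 - Real.pi

/-- The primitive elements of `ℤ_{≥ 0} ^ 2`. -/
abbrev Prim := {a : ℕ × ℕ // Nat.Coprime a.1 a.2}

/-- The primitive vectors of the two initial walls. -/
def e1 : Prim := ⟨(1, 0), by decide⟩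
def e2 : Prim := ⟨(0, 1), by decide⟩

namespace Setup

variable {r : ℕ} (S : Setup r)

/-- The base point, in polar coordinates. -/
def p0 : Pt := ![S.ρ0, S.ϑ0]

/-- The projection from the cover, in polar coordinates. -/
noncomputable def pol : Pt → Pt := polar S.m0 S.w1.m S.w2.m

/-- The base point `q0`. -/
noncomputable def q0 : Pt := S.pol S.p0

/-- `m_a = a_1 m_1 + a_2 m_2`. -/
def mA (a : Prim) : Lam := a.1.1 • S.w1.m + a.1.2 • S.w2.m

/-- The Gaussian function of a real coordinate `u`. -/
noncomputable def gauss (u : Pt → ℝ) : HFun := fun ħ x =>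
  ((Real.exp (-(u x) ^ 2 / ħ) / Real.sqrt (Real.pi * ħ) : ℝ) : ℂ)

/-- The coordinate `i` of `x - m0` in the basis `m_1`, `m_2`.  The coordinate `1` is normal to the
first wall, the coordinate `0` to the second; both are negative at the base point. -/
noncomputable def coord (i : Fin 2) (x : Pt) : ℝ := coords S.w1.m S.w2.m (x - S.m0) i

/-- The Gaussian one-form `δ = e ^ (-u ^ 2 / ħ) / √(π ħ) du`, with `u` the coordinate `i`. -/
noncomputable def delta (i : Fin 2) : Fin 2 → HFun := fun q ħ x =>
  gauss (S.coord i) ħ x * (coords S.w1.m S.w2.m (Pi.single q 1) i : ℂ)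

/-- The solution `Π̄ = (Π_E + Π_{E,R}, Π^{CLM})` of the Maurer–Cartan equation attached to a wall:
`Π_E = -(matrix part of log θ) δ`, `Π^{CLM} = -(vector part of log θ) δ`, and
`Π_{E,R} = -κ ħ ∑_j (Π^{CLM}) ^ j A_j`. -/
noncomputable def wallForm (L : Sec r ℂ) (i : Fin 2) : Form1 r := fun q =>
  let X : Sec r HFun := mapSec (fun _ (z : ℂ) ħ x => -z * S.delta i q ħ x) L
  (X.1 - kh S.κ • ∑ j, X.2 j • connMat id S.ϕ j, X.2)

noncomputable def Pi1 : Form1 r := S.wallForm S.w1.logθ 1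
noncomputable def Pi2 : Form1 r := S.wallForm S.w2.logθ 0

/-- Integration along the flow of `m`, starting from the line through the base point orthogonal
to `m`. -/
noncomputable def flowInt (m : Lam) (f : HFun) : HFun := fun ħ x =>
  ∫ σ in (0 : ℝ)..(flowTime S.w1.m S.w2.m S.q0 m x), f ħ (x - σ • toPt m)

/-- The scalar homotopy operator on `2`-forms: in coordinates `u_m` along `m` and `u_⊥` across,
which vanish at the base point, it maps
`f du_m ∧ du_⊥ 𝔴 ^ m` to `𝔴 ^ m (∫_0^{u_m} f(s, u_⊥) ds) du_⊥`. -/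
noncomputable def homSer (q : Fin 2) : Ser HFun → Ser HFun :=
  Ser.mapModes fun m f ħ x => (![-(m 1 : ℂ), (m 0 : ℂ)] q) * S.flowInt m f ħ x

/-- The homotopy operator on `2`-forms with values in `End E ⊕ T`, which inverts `d_W`:
the scalar operator `H` on each component, with the correction term `-H B̂ H` due to the component
`B̂` of `d_W`. -/
noncomputable def hom (X : Sec r HFun) : Form1 r := fun q =>
  let ψ : Fin 2 → Fin 2 → Ser HFun := fun q' j => S.homSer q' (X.2 j)
  ((X.1 - curv1 S.κ id S.ϕ ψ).map (S.homSer q), ψ q)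

/-- `Φ` has positive order in `t`, is smooth, and solves `Φ = Π̄_1 + Π̄_2 - ½ H {Φ, Φ}`. -/
def IsKuranishi (Φ : Form1 r) : Prop :=
  (∀ q c m, cf (Φ q) c 0 m = 0) ∧ (∀ q, SmoothOn S.U (Φ q)) ∧
    ∀ q, AgreeOn S.U (Φ q)
      ((S.Pi1 + S.Pi2 - (2⁻¹ : ℂ) • S.hom (br11 S.κ id S.ϕ Φ Φ)) q)

/-- The Maurer–Cartan equation `d_W Φ + ½ {Φ, Φ} = 0` on the chart. -/
def IsMaurerCartan (Φ : Form1 r) : Prop :=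
  AgreeOn S.U (dW1 S.κ id S.ϕ Φ + (2⁻¹ : ℂ) • br11 S.κ id S.ϕ Φ Φ) 0

open scoped Classical in
/-- `Φ_a`: the part of `Φ` with Fourier modes `l m_a`, `l ≥ 1`. -/
noncomputable def part (a : Prim) (Φ : Form1 r) : Form1 r := fun q =>
  mapSec (fun m f => if ∃ l : ℕ, 1 ≤ l ∧ m = l • S.mA a then f else 0) (Φ q)

/-- The pull-back to the cover. -/
noncomputable def pull (Φ : Form1 r) : Form1 r := fun q =>
  mapSec (fun _ f ħ p => f ħ (S.pol p)) (Φ q)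

/-- The cut cover of the punctured chart, in polar coordinates. -/
def cover : Set Pt :=
  {p | 0 < p 0 ∧ S.ϑ0 - S.ε < p 1 ∧ p 1 < S.ϑ0 + 2 * Real.pi ∧ S.pol p ∈ S.U}

/-- The angle in `(ϑ0, ϑ0 + 2π)` of the ray with direction `m_a`. -/
noncomputable def angle (a : Prim) : ℝ := 2 * Real.pi + Complex.arg ⟨(a.1.1 : ℝ), (a.1.2 : ℝ)⟩

/-- The support of `Φ_a`: the two initial lines, and rays otherwise. -/
noncomputable def supp (a : Prim) : Set Pt :=
  if a = e1 ∨ a = e2 then line S.m0 (S.mA a) else ray S.m0 (S.mA a)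

/-- The positive side of the support of `Φ_a` in the cover: the preimage of an open half-plane for
the two lines, and the points beyond the lift of the ray otherwise. -/
noncomputable def Hplus (a : Prim) : Set Pt :=
  {p ∈ S.cover | if a = e1 then 0 < Real.sin (p 1) else if a = e2 then 0 < Real.cos (p 1)
    else angle a < p 1}

/-- The negative side, which contains the base point. -/
noncomputable def Hminus (a : Prim) : Set Pt :=
  {p ∈ S.cover | if a = e1 then Real.sin (p 1) < 0 else if a = e2 then Real.cos (p 1) < 0
    else p 1 < angle a}

/-- `φ` is a gauge on the cover, normalised to vanish at the base point, with
`e ^ φ * 0 = Φ̃_a` up to exponentially small `1`-forms. -/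
def IsGauge (Φ : Form1 r) (a : Prim) (φ : Sec r HFun) : Prop :=
  (∀ c m, cf φ c 0 m = 0) ∧ SmoothOn S.cover φ ∧
    (∀ c s m, ∀ ħ : ℝ, 0 < ħ → cf φ c s m ħ S.p0 = 0) ∧
    ∀ q c s m, WExp S.pol S.cover
      (cf (gaugeZero S.κ S.pol S.ϕ s φ q) c s m - cf (S.pull (S.part a Φ) q) c s m)

/-- `L` is the leading term of `φ` on the positive side, with corrections in `𝓦_0^{-1}`, and `φ`
is exponentially small on the negative side. -/
def HasAsymptotics (a : Prim) (φ : Sec r HFun) (L : Sec r ℂ) : Prop :=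
  ∀ c s m, WPow S.pol (-1) (S.Hplus a) (fun ħ p => cf φ c s m ħ p - cf L c s m) ∧
    WExp S.pol (S.Hminus a) (cf φ c s m)

/-- `L` is an element of the extended tropical vertex Lie algebra with modes `l m_a`, and it is
the leading term of every normalised gauge of `Φ̃_a`. -/
def IsLeadingTerm (Φ : Form1 r) (a : Prim) (L : Sec r ℂ) : Prop :=
  InExtLie L ∧ ModesAlong (S.mA a) L ∧ ∀ φ, S.IsGauge Φ a φ → S.HasAsymptotics a φ L

/-- The scattering diagram `D_∞` with the walls `(m_a, P_a, exp L_a)`. -/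
noncomputable def diagram (L : Prim → Sec r ℂ) (a : Prim) : Wall r := ⟨S.mA a, S.supp a, L a⟩

end Setup

end ExtScattering

open ExtScattering

namespace ExtScattering

/-! ## Coefficients of series and sections -/

section Coefficients

variable {K : Type} [CommRing K]

namespace Ser

@[simp] lemma cf_zero (s : ℕ) (m : Lam) : (0 : Ser K).cf s m = 0 := by simp [Ser.cf]
@[simp] lemma cf_add (f g : Ser K) (s : ℕ) (m : Lam) : (f + g).cf s m = f.cf s m + g.cf s m := by
  simp [Ser.cf]
@[simp] lemma cf_sub (f g : Ser K) (s : ℕ) (m : Lam) : (f - g).cf s m = f.cf s m - g.cf s m := by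
  rw [eq_sub_iff_add_eq, ← cf_add, sub_add_cancel]
@[simp] lemma cf_neg (f : Ser K) (s : ℕ) (m : Lam) : (-f).cf s m = -f.cf s m := by
  rw [eq_neg_iff_add_eq_zero, ← cf_add, neg_add_cancel, cf_zero]
@[simp] lemma cf_sum {ι : Type*} (T : Finset ι) (f : ι → Ser K) (s : ℕ) (m : Lam) :
    (∑ i ∈ T, f i).cf s m = ∑ i ∈ T, (f i).cf s m := by
  classical
  induction T using Finset.induction_on with
  | empty => simp
  | insert a T ha ih => simp [Finset.sum_insert ha, ih]

lemma cf_smul (z : ℂ) (f : Ser HFun) (s : ℕ) (m : Lam) : (z • f).cf s m = z • f.cf s m := by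
  simp [Ser.cf]

lemma ext {f g : Ser K} (h : ∀ s m, f.cf s m = g.cf s m) : f = g := by
  ext s m : 3
  exact h s m

lemma cf_mapModes {K' : Type} [CommRing K'] (T : Lam → K → K') (hT : ∀ m, T m 0 = 0)
    (f : Ser K) (s : ℕ) (m : Lam) : (f.mapModes T).cf s m = T m (f.cf s m) := by
  classical
  simp only [Ser.cf, Ser.mapModes, PowerSeries.coeff_mk]
  rw [Finsupp.sum, AddMonoidAlgebra.coeff_sum, Finsupp.finsetSum_apply]
  simp only [AddMonoidAlgebra.coeff_single, Finsupp.single_apply]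
  rw [Finset.sum_ite_eq']
  split_ifs with h
  · rfl
  · rw [Finsupp.notMem_support_iff.mp h, hT]

lemma cf_mul (f g : Ser K) (s : ℕ) (m : Lam) (T : Finset Lam)
    (hT : ∀ s' ≤ s, ∀ m', f.cf s' m' ≠ 0 → m' ∈ T) :
    (f * g).cf s m =
      ∑ p ∈ Finset.HasAntidiagonal.antidiagonal s, ∑ m' ∈ T, f.cf p.1 m' * g.cf p.2 (m - m') := by
  classical
  rw [Ser.cf, PowerSeries.coeff_mul, AddMonoidAlgebra.coeff_sum, Finsupp.finsetSum_apply]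
  refine Finset.sum_congr rfl fun p hp => ?_
  rw [AddMonoidAlgebra.coeff_mul, Finsupp.sum]
  have hsub : (PowerSeries.coeff p.1 f).coeff.support ⊆ T := fun m' hm' =>
    hT p.1 (Finset.HasAntidiagonal.mem_antidiagonal.mp hp ▸ Nat.le_add_right _ _) m' (Finsupp.mem_support_iff.mp hm')
  rw [Finset.sum_subset hsub]
  · refine Finset.sum_congr rfl fun m' _ => ?_
    simp only [eq_sub_iff_add_eq'.symm, Finsupp.sum]
    rw [Finset.sum_ite_eq']
    split_ifs with h
    · rfl
    · rw [Ser.cf, Ser.cf, Finsupp.notMem_support_iff.mp h, mul_zero]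
  · intro m' _ h
    rw [Finsupp.notMem_support_iff.mp h]
    simp [Finsupp.sum]

lemma cf_mul' (f g : Ser K) (s : ℕ) (m : Lam) (T : Finset Lam)
    (hT : ∀ s' ≤ s, ∀ m', f.cf s' m' ≠ 0 → m' ∈ T) :
    (g * f).cf s m = ∑ p ∈ Finset.HasAntidiagonal.antidiagonal s,
      ∑ m' ∈ T, f.cf p.1 m' * g.cf p.2 (m - m') := by
  rw [mul_comm, cf_mul f g s m T hT]

lemma cf_const_mul (c : K) (f : Ser K) (s : ℕ) (m : Lam) :
    (Ser.const c * f).cf s m = c * f.cf s m := by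
  classical
  rw [Ser.cf, Ser.const, PowerSeries.coeff_C_mul]
  have := AddMonoidAlgebra.coeff_single_mul_eq_mul_coeff (x := PowerSeries.coeff s f) (r := c)
    (m := (0 : Lam)) (m₁ := m) m (by intro m' _; simp)
  exact this

lemma mapModes_const {K' : Type} [CommRing K'] (T : Lam → K → K') (hT : ∀ m, T m 0 = 0) (c : K) :
    (Ser.const c).mapModes T = Ser.const (T 0 c) := by
  classical
  refine Ser.ext fun s m => ?_
  rw [cf_mapModes _ hT]
  simp only [Ser.cf, Ser.const, PowerSeries.coeff_C]
  split_ifs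
  · simp only [AddMonoidAlgebra.coeff_single, Finsupp.single_apply]
    split_ifs with h
    · rw [h]
    · exact hT m
  · simpa using hT m

end Ser

variable {r : ℕ}

lemma cf_zero (c : Comp r) (s : ℕ) (m : Lam) : cf (0 : Sec r K) c s m = 0 := by
  rcases c with c | c <;> simp [cf]
lemma cf_add (X Y : Sec r K) (c : Comp r) (s : ℕ) (m : Lam) :
    cf (X + Y) c s m = cf X c s m + cf Y c s m := by
  rcases c with c | c <;> simp [cf]
lemma cf_sub (X Y : Sec r K) (c : Comp r) (s : ℕ) (m : Lam) :
    cf (X - Y) c s m = cf X c s m - cf Y c s m := by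
  rcases c with c | c <;> simp [cf]
lemma cf_neg (X : Sec r K) (c : Comp r) (s : ℕ) (m : Lam) :
    cf (-X) c s m = -cf X c s m := by
  rcases c with c | c <;> simp [cf]
lemma cf_sum {ι : Type*} (T : Finset ι) (X : ι → Sec r K) (c : Comp r) (s : ℕ) (m : Lam) :
    cf (∑ i ∈ T, X i) c s m = ∑ i ∈ T, cf (X i) c s m := by
  classical
  induction T using Finset.induction_on with
  | empty => simp [cf_zero]
  | insert a T ha ih => simp [Finset.sum_insert ha, ih, cf_add]
lemma cf_smul (z : ℂ) (X : Sec r HFun) (c : Comp r) (s : ℕ) (m : Lam) :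
    cf (z • X) c s m = z • cf X c s m := by
  rcases c with c | c <;> simp [cf, Ser.cf_smul]

lemma sec_ext {X Y : Sec r K} (h : ∀ c s m, cf X c s m = cf Y c s m) : X = Y := by
  refine Prod.ext ?_ ?_
  · funext i j
    exact Ser.ext fun s m => h (Sum.inl (i, j)) s m
  · ext j : 1
    exact Ser.ext fun s m => h (Sum.inr j) s m

lemma cf_mapSec {K' : Type} [CommRing K'] (T : Lam → K → K') (hT : ∀ m, T m 0 = 0)
    (X : Sec r K) (c : Comp r) (s : ℕ) (m : Lam) :
    cf (mapSec T X) c s m = T m (cf X c s m) := by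
  rcases c with c | c <;> simp only [cf, mapSec] <;> exact Ser.cf_mapModes T hT _ s m

/-- A finite set of modes that contains all modes of order at most `s`. -/
lemma exists_modes (X : Sec r K) (s : ℕ) :
    ∃ T : Finset Lam, ∀ c, ∀ s' ≤ s, ∀ m, cf X c s' m ≠ 0 → m ∈ T := by
  classical
  have key : ∀ f : Ser K, ∃ T : Finset Lam, ∀ s' ≤ s, ∀ m, f.cf s' m ≠ 0 → m ∈ T := fun f =>
    ⟨(Finset.range (s + 1)).biUnion fun s' => (PowerSeries.coeff s' f).coeff.support,
      fun s' hs' m hm => Finset.mem_biUnion.mpr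
        ⟨s', Finset.mem_range.mpr (by omega), Finsupp.mem_support_iff.mpr hm⟩⟩
  have key' : ∀ c : Comp r, ∃ T : Finset Lam, ∀ s' ≤ s, ∀ m, cf X c s' m ≠ 0 → m ∈ T := by
    rintro (c | c)
    · exact key (X.1 c.1 c.2)
    · exact key (X.2 c)
  choose T hT using key'
  exact ⟨Finset.univ.biUnion T, fun c s' hs' m hm =>
    Finset.mem_biUnion.mpr ⟨c, Finset.mem_univ _, hT c s' hs' m hm⟩⟩

/-- The section whose coefficient of order `s` is that of `Z s`. -/
noncomputable def diagSec (Z : ℕ → Sec r K) : Sec r K :=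
  (fun i j => PowerSeries.mk fun s => PowerSeries.coeff s ((Z s).1 i j),
    fun j => PowerSeries.mk fun s => PowerSeries.coeff s ((Z s).2 j))

lemma cf_diagSec (Z : ℕ → Sec r K) (c : Comp r) (s : ℕ) (m : Lam) :
    cf (diagSec Z) c s m = cf (Z s) c s m := by
  rcases c with c | c <;> simp [cf, diagSec, Ser.cf]

/-- Coefficients of order less than `n` agree. -/
def EqBelow (n : ℕ) (X Y : Sec r K) : Prop := ∀ c, ∀ s < n, ∀ m, cf X c s m = cf Y c s m

/-- A `t`-adic contraction has a fixed point. -/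
lemma exists_fixedPoint (T : Sec r K → Sec r K) (h0 : ∀ X c m, cf (T X) c 0 m = 0)
    (hT : ∀ n X Y, (∀ c m, cf X c 0 m = 0) → (∀ c m, cf Y c 0 m = 0) → EqBelow n X Y →
      EqBelow (n + 1) (T X) (T Y)) :
    ∃ X, T X = X ∧ ∀ c m, cf X c 0 m = 0 := by
  have z0 : ∀ n c m, cf (T^[n] 0) c 0 m = 0 := by
    intro n c m
    cases n with
    | zero => simp [cf_zero]
    | succ n => rw [Function.iterate_succ_apply']; exact h0 _ c m
  have step : ∀ n k, EqBelow n (T^[n] 0) (T^[n + k] 0) := by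
    intro n
    induction n with
    | zero => intro k c s hs; omega
    | succ n ih =>
      intro k
      rw [show n + 1 + k = (n + k) + 1 by ring, Function.iterate_succ_apply',
        Function.iterate_succ_apply']
      exact hT n _ _ (z0 n) (z0 _) (ih k)
  have hX : ∀ n, EqBelow n (diagSec fun s => T^[s + 1] 0) (T^[n] 0) := by
    intro n c s hs m
    rw [cf_diagSec]
    obtain ⟨k, rfl⟩ := Nat.exists_eq_add_of_le (Nat.succ_le_of_lt hs)
    exact step (s + 1) k c s (Nat.lt_succ_self s) m
  have hX0 : ∀ c m, cf (diagSec fun s => T^[s + 1] 0) c 0 m = 0 := fun c m => by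
    rw [cf_diagSec]; exact z0 1 c m
  refine ⟨diagSec fun s => T^[s + 1] 0, sec_ext fun c s m => ?_, hX0⟩
  rw [hT (s + 1) _ _ hX0 (z0 (s + 1)) (hX (s + 1)) c s (by omega) m, cf_diagSec,
    ← Function.iterate_succ_apply' T]
  exact (step (s + 1) 1 c s (by omega) m).symm

end Coefficients

/-! ## The bracket in terms of coefficients -/

section Bracket

variable {r : ℕ} (κ : ℂ) (ϖ : Pt → Pt)

/-- The connection coefficients as functions. -/
noncomputable def connFun (ϖ : Pt → Pt) (ϕ : Fin r → Pt → ℝ) (q : Fin 2) (i : Fin r) : Pt → ℂ :=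
  fun p => -pd id q (fun x => (ϕ i x : ℂ)) (ϖ p)

/-- The covariant derivative of the component `c` of a section in mode `m`. -/
noncomputable def covC (a : Fin 2 → Fin r → Pt → ℂ) (c : Comp r) (m : Lam) (k : Fin 2)
    (f : HFun) : HFun := fun ħ p =>
  (m k : ℂ) * f ħ p + κ * ħ * pd ϖ k (f ħ) p +
    (match c with
    | Sum.inl ij => κ * ħ * ((a k ij.1 p - a k ij.2 p) * f ħ p)
    | Sum.inr _ => 0)

/-- The bracket of the coefficients in the modes `m` and `m'`. -/
noncomputable def brc (a : Fin 2 → Fin r → Pt → ℂ) (m m' : Lam) (x y : Comp r → HFun) :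
    Comp r → HFun := fun c =>
  ∑ k, (x (Sum.inr k) * covC κ ϖ a c m' k (y c) - y (Sum.inr k) * covC κ ϖ a c m k (x c)) +
    (match c with
    | Sum.inl ij => ∑ l, (x (Sum.inl (ij.1, l)) * y (Sum.inl (l, ij.2)) -
        x (Sum.inl (l, ij.2)) * y (Sum.inl (ij.1, l)))
    | Sum.inr _ => 0)

variable (ϕ : Fin r → Pt → ℝ)

@[simp] lemma pd_zero (q : Fin 2) : pd ϖ q (0 : Pt → ℂ) = 0 := by
  ext p
  simp [pd]

lemma cf_covSer (k : Fin 2) (f : Ser HFun) (s : ℕ) (m : Lam) :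
    (covSer κ ϖ k f).cf s m =
      fun ħ p => (m k : ℂ) * f.cf s m ħ p + κ * ħ * pd ϖ k (f.cf s m ħ) p := by
  rw [covSer, Ser.cf_mapModes]
  intro m'
  ext ħ p
  have : (fun _ => 0 : Pt → ℂ) = 0 := rfl
  simp

lemma cf_dSer (k : Fin 2) (f : Ser HFun) (s : ℕ) (m : Lam) :
    (dSer ϖ k f).cf s m = fun ħ => pd ϖ k (f.cf s m ħ) := by
  rw [dSer, Ser.cf_mapModes]
  intro m'
  ext ħ p
  simp

lemma cf_covEnd (k : Fin 2) (N : Matrix (Fin r) (Fin r) (Ser HFun)) (i j : Fin r)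
    (s : ℕ) (m : Lam) :
    (covEnd κ ϖ ϕ k N i j).cf s m =
      covC κ ϖ (connFun ϖ ϕ) (Sum.inl (i, j)) m k ((N i j).cf s m) := by
  simp only [covEnd, Matrix.add_apply, Matrix.map_apply, Matrix.smul_apply, smul_eq_mul,
    Matrix.sub_apply, connMat, Matrix.diagonal_mul, Matrix.mul_diagonal, Ser.cf_add, kh,
    Ser.cf_const_mul, Ser.cf_sub, mul_comm (N i j), cf_covSer]
  ext ħ p
  simp only [covC, connFun, Pi.add_apply, Pi.mul_apply, Pi.sub_apply]
  ring

lemma cf_br (X Y : Sec r HFun) (c : Comp r) (s : ℕ) (m : Lam) (T : Finset Lam)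
    (hT : ∀ c, ∀ s' ≤ s, ∀ m', cf X c s' m' ≠ 0 → m' ∈ T) :
    cf (br κ ϖ ϕ X Y) c s m = ∑ p ∈ Finset.HasAntidiagonal.antidiagonal s, ∑ m' ∈ T,
      brc κ ϖ (connFun ϖ ϕ) m' (m - m') (fun c => cf X c p.1 m')
        (fun c => cf Y c p.2 (m - m')) c := by
  have cov0 : ∀ c m k, covC κ ϖ (connFun ϖ ϕ) c m k 0 = 0 := by
    intro c m k
    ext ħ p
    rcases c with c | c <;> simp [covC]
  have e1 : ∀ i j, ∀ s' ≤ s, ∀ m', (X.1 i j).cf s' m' ≠ 0 → m' ∈ T :=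
    fun i j => hT (Sum.inl (i, j))
  have e2 : ∀ j, ∀ s' ≤ s, ∀ m', (X.2 j).cf s' m' ≠ 0 → m' ∈ T := fun j => hT (Sum.inr j)
  rcases c with ⟨i, j⟩ | j
  · simp only [cf, br, Matrix.add_apply, Matrix.sub_apply, Matrix.sum_apply, Matrix.smul_apply,
      smul_eq_mul, Matrix.mul_apply, Ser.cf_add, Ser.cf_sub, Ser.cf_sum, brc]
    have h1 : ∀ k, (X.2 k * covEnd κ ϖ ϕ k Y.1 i j).cf s m = _ := fun k =>
      Ser.cf_mul _ _ s m T (e2 k)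
    have h2 : ∀ k, (Y.2 k * covEnd κ ϖ ϕ k X.1 i j).cf s m = _ := fun k => by
      refine Ser.cf_mul' _ _ s m T fun s' hs' m' h => e1 i j s' hs' m' fun h0 => h ?_
      rw [cf_covEnd, h0, cov0]
    have h3 : ∀ k, (X.1 i k * Y.1 k j).cf s m = _ := fun k => Ser.cf_mul _ _ s m T (e1 i k)
    have h4 : ∀ k, (Y.1 i k * X.1 k j).cf s m = _ := fun k => by
      exact Ser.cf_mul' _ _ s m T (e1 k j)
    simp only [h1, h2, h3, h4, cf_covEnd, Finset.sum_add_distrib, Finset.sum_sub_distrib]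
    simp only [Finset.sum_comm (s := (Finset.univ : Finset (Fin 2))),
      Finset.sum_comm (s := (Finset.univ : Finset (Fin r)))]
    simp only [mul_comm]
  · simp only [cf, br, Ser.cf_sub, Ser.cf_sum, brc, add_zero]
    have h1 : ∀ k, (X.2 k * covSer κ ϖ k (Y.2 j)).cf s m = _ := fun k =>
      Ser.cf_mul _ _ s m T (e2 k)
    have h2 : ∀ k, (Y.2 k * covSer κ ϖ k (X.2 j)).cf s m = _ := fun k => by
      refine Ser.cf_mul' _ _ s m T fun s' hs' m' h => e2 j s' hs' m' fun h0 => h ?_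
      rw [cf_covSer, h0]
      ext ħ p
      simp
    have h3 : ∀ (f : HFun) (m : Lam) (k : Fin 2), covC κ ϖ (connFun ϖ ϕ) (Sum.inr j) m k f =
        fun ħ p => (m k : ℂ) * f ħ p + κ * ħ * pd ϖ k (f ħ) p := fun f m k => by
      funext ħ p
      simp [covC]
    simp only [h1, h2, cf_covSer, Finset.sum_sub_distrib, h3]
    simp only [Finset.sum_comm (s := (Finset.univ : Finset (Fin 2)))]
    simp only [mul_comm]

/-- Compatibility of a relation between functions with the bracket of coefficients. -/
lemma brc_rel (a : Fin 2 → Fin r → Pt → ℂ) (P Q R : HFun → HFun → Prop) (m m' : Lam)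
    (hP : ∀ c k f f', P f f' → P (covC κ ϖ a c m k f) (covC κ ϖ a c m k f'))
    (hQ : ∀ c k f f', Q f f' → Q (covC κ ϖ a c m' k f) (covC κ ϖ a c m' k f'))
    (hmul : ∀ f f' g g', P f f' → Q g g' → R (f * g) (f' * g'))
    (h0 : R 0 0) (hadd : ∀ f f' g g', R f f' → R g g' → R (f + g) (f' + g'))
    (hneg : ∀ f f', R f f' → R (-f) (-f'))
    {x x' y y' : Comp r → HFun} (hx : ∀ c, P (x c) (x' c)) (hy : ∀ c, Q (y c) (y' c))
    (c : Comp r) : R (brc κ ϖ a m m' x y c) (brc κ ϖ a m m' x' y' c) := by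
  have hsum : ∀ {ι : Type} (T : Finset ι) (f f' : ι → HFun), (∀ i, R (f i) (f' i)) →
      R (∑ i ∈ T, f i) (∑ i ∈ T, f' i) := by
    classical
    intro ι T f f' h
    induction T using Finset.induction_on with
    | empty => simpa using h0
    | insert i T hi ih => simpa [Finset.sum_insert hi] using hadd _ _ _ _ (h i) ih
  have hsub : ∀ f f' g g', R f f' → R g g' → R (f - g) (f' - g') := fun f f' g g' hf hg => by
    rw [sub_eq_add_neg, sub_eq_add_neg]
    exact hadd _ _ _ _ hf (hneg _ _ hg)
  refine hadd _ _ _ _ (hsum _ _ _ fun k => hsub _ _ _ _ (hmul _ _ _ _ (hx _) (hQ _ _ _ _ (hy _)))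
    ?_) ?_
  · rw [mul_comm, mul_comm (y' _)]
    exact hmul _ _ _ _ (hP _ _ _ _ (hx _)) (hy _)
  · rcases c with c | c
    · exact hsum _ _ _ fun l => hsub _ _ _ _ (hmul _ _ _ _ (hx _) (hy _))
        (hmul _ _ _ _ (hx _) (hy _))
    · exact h0

/-- Compatibility of a relation between functions with the bracket of sections. -/
lemma br_rel (R : HFun → HFun → Prop) (h0 : R 0 0)
    (hadd : ∀ f f' g g', R f f' → R g g' → R (f + g) (f' + g'))
    (X X' Y Y' : Sec r HFun) (c : Comp r) (s : ℕ) (m : Lam)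
    (h : ∀ s' s'' m' m'', s' + s'' = s → m' + m'' = m →
      R (brc κ ϖ (connFun ϖ ϕ) m' m'' (fun c => cf X c s' m') (fun c => cf Y c s'' m'') c)
        (brc κ ϖ (connFun ϖ ϕ) m' m'' (fun c => cf X' c s' m') (fun c => cf Y' c s'' m'') c)) :
    R (cf (br κ ϖ ϕ X Y) c s m) (cf (br κ ϖ ϕ X' Y') c s m) := by
  classical
  obtain ⟨T, hT⟩ := exists_modes X s
  obtain ⟨T', hT'⟩ := exists_modes X' s
  rw [cf_br κ ϖ ϕ X Y c s m (T ∪ T') fun c s' hs' m' h =>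
      Finset.mem_union_left _ (hT c s' hs' m' h),
    cf_br κ ϖ ϕ X' Y' c s m (T ∪ T') fun c s' hs' m' h =>
      Finset.mem_union_right _ (hT' c s' hs' m' h)]
  have hsum : ∀ {ι : Type} (T : Finset ι) (f f' : ι → HFun), (∀ i ∈ T, R (f i) (f' i)) →
      R (∑ i ∈ T, f i) (∑ i ∈ T, f' i) := by
    intro ι T f f' h
    induction T using Finset.induction_on with
    | empty => simpa using h0
    | insert i T hi ih =>
      rw [Finset.sum_insert hi, Finset.sum_insert hi]
      exact hadd _ _ _ _ (h i (Finset.mem_insert_self _ _))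
        (ih fun j hj => h j (Finset.mem_insert_of_mem hj))
  exact hsum _ _ _ fun p hp => hsum _ _ _ fun m' _ =>
    h _ _ _ _ (Finset.HasAntidiagonal.mem_antidiagonal.mp hp) (by abel)

lemma brc_zero_left (a : Fin 2 → Fin r → Pt → ℂ) (m m' : Lam) (x y : Comp r → HFun)
    (hx : ∀ c, x c = 0) (c : Comp r) : brc κ ϖ a m m' x y c = 0 := by
  have := brc_rel κ ϖ a (fun f _ => f = 0) (fun _ _ => True) (fun f _ => f = 0) m m'
    (by
      rintro c k f f' rfl
      ext ħ p
      rcases c with c | c <;> simp [covC]) (fun _ _ _ _ _ => trivial)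
    (by rintro f f' g g' rfl _; simp) rfl (by rintro f f' g g' rfl rfl; simp)
    (by rintro f f' rfl; simp) (x := x) (x' := x) (y := y) (y' := y) hx (fun _ => trivial) c
  exact this

lemma brc_zero_right (a : Fin 2 → Fin r → Pt → ℂ) (m m' : Lam) (x y : Comp r → HFun)
    (hy : ∀ c, y c = 0) (c : Comp r) : brc κ ϖ a m m' x y c = 0 := by
  have := brc_rel κ ϖ a (fun _ _ => True) (fun f _ => f = 0) (fun f _ => f = 0) m m'
    (fun _ _ _ _ _ => trivial)
    (by
      rintro c k f f' rfl
      ext ħ p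
      rcases c with c | c <;> simp [covC])
    (by rintro f f' g g' _ rfl; simp) rfl (by rintro f f' g g' rfl rfl; simp)
    (by rintro f f' rfl; simp) (x := x) (x' := x) (y := y) (y' := y) (fun _ => trivial) hy c
  exact this

/-- A relation that holds for brackets of coefficients of positive order holds for the bracket. -/
lemma br_rel_pos (R : HFun → HFun → Prop) (h0 : R 0 0)
    (hadd : ∀ f f' g g', R f f' → R g g' → R (f + g) (f' + g'))
    {X X' Y Y' : Sec r HFun} (hX : ∀ c m, cf X c 0 m = 0) (hX' : ∀ c m, cf X' c 0 m = 0)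
    (hY : ∀ c m, cf Y c 0 m = 0) (hY' : ∀ c m, cf Y' c 0 m = 0)
    (c : Comp r) (s : ℕ) (m : Lam)
    (h : ∀ s' < s, ∀ s'' < s, ∀ m' m'', m' + m'' = m →
      R (brc κ ϖ (connFun ϖ ϕ) m' m'' (fun c => cf X c s' m') (fun c => cf Y c s'' m'') c)
        (brc κ ϖ (connFun ϖ ϕ) m' m'' (fun c => cf X' c s' m') (fun c => cf Y' c s'' m'') c)) :
    R (cf (br κ ϖ ϕ X Y) c s m) (cf (br κ ϖ ϕ X' Y') c s m) := by
  refine br_rel κ ϖ ϕ R h0 hadd X X' Y Y' c s m fun s' s'' m' m'' hs hm => ?_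
  rcases Nat.eq_zero_or_pos s' with rfl | hs'
  · rw [brc_zero_left κ ϖ _ _ _ _ _ (fun c => hX c m'),
      brc_zero_left κ ϖ _ _ _ _ _ (fun c => hX' c m')]
    exact h0
  rcases Nat.eq_zero_or_pos s'' with rfl | hs''
  · rw [brc_zero_right κ ϖ _ _ _ _ _ (fun c => hY c m''),
      brc_zero_right κ ϖ _ _ _ _ _ (fun c => hY' c m'')]
    exact h0
  exact h s' (by omega) s'' (by omega) m' m'' hm

lemma cf_br_zero {X : Sec r HFun} (Y : Sec r HFun) (hX : ∀ c m, cf X c 0 m = 0) (c : Comp r)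
    (m : Lam) : cf (br κ ϖ ϕ X Y) c 0 m = 0 := by
  refine br_rel κ ϖ ϕ (fun f _ => f = 0) rfl (by rintro f f' g g' rfl rfl; simp) X X Y Y c 0 m
    fun s' s'' m' m'' hs hm => ?_
  obtain rfl : s' = 0 := by omega
  exact brc_zero_left κ ϖ _ _ _ _ _ (fun c => hX c m') c

lemma cf_dW0 (X : Sec r HFun) (q : Fin 2) (c : Comp r) (s : ℕ) (m : Lam) :
    cf (dW0 κ ϖ ϕ X q) c s m = (fun ħ => pd ϖ q (cf X c s m ħ)) +
      (match c with
      | Sum.inl ij => if ij.1 = ij.2 then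
          fun ħ p => κ * ħ * ∑ k, cf X (Sum.inr k) s m ħ p * pd ϖ q (connFun ϖ ϕ k ij.1) p
        else 0
      | Sum.inr _ => 0) := by
  rcases c with ⟨i, j⟩ | j
  · simp only [cf, dW0, Matrix.add_apply, Matrix.map_apply, Matrix.smul_apply, smul_eq_mul,
      Matrix.sum_apply, Ser.cf_add, kh, Ser.cf_const_mul, Ser.cf_sum, cf_dSer, connMat]
    congr 1
    by_cases h : i = j
    · subst h
      simp only [Matrix.diagonal_apply_eq, if_true, mul_comm ((X.2 _)), dSer]
      rw [Finset.sum_congr rfl fun k _ => by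
        rw [Ser.mapModes_const _ (by intro m; funext ħ; simp), Ser.cf_const_mul]]
      funext ħ p
      simp only [Pi.mul_apply, Finset.sum_apply, mul_comm]
      rfl
    · simp only [Matrix.diagonal_apply_ne _ h, if_neg h]
      have : dSer ϖ q 0 = 0 := Ser.ext fun s m => by rw [cf_dSer]; funext ħ; simp
      simp [this]
  · simp [cf, dW0, cf_dSer]

end Bracket

section Operators

variable {r : ℕ} (κ : ℂ) (ϖ : Pt → Pt) (ϕ : Fin r → Pt → ℝ)

lemma cf_curv1 (ψ : Fin 2 → Fin 2 → Ser HFun) (i j : Fin r) (s : ℕ) (m : Lam) :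
    (curv1 κ ϖ ϕ ψ i j).cf s m = if i = j then fun ħ p => κ * ħ * ∑ k,
      ((ψ 1 k).cf s m ħ p * pd ϖ 0 (connFun ϖ ϕ k i) p -
        (ψ 0 k).cf s m ħ p * pd ϖ 1 (connFun ϖ ϕ k i) p) else 0 := by
  simp only [curv1, Matrix.smul_apply, smul_eq_mul, Matrix.sum_apply, Matrix.sub_apply,
    Matrix.map_apply, kh, Ser.cf_const_mul, Ser.cf_sum, Ser.cf_sub, connMat]
  by_cases h : i = j
  · subst h
    simp only [Matrix.diagonal_apply_eq, if_true, mul_comm ((ψ _ _)), dSer]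
    rw [Finset.sum_congr rfl fun k _ => by
      rw [Ser.mapModes_const _ (by intro m; funext ħ; simp),
        Ser.mapModes_const _ (by intro m; funext ħ; simp), Ser.cf_const_mul, Ser.cf_const_mul]]
    funext ħ p
    simp only [Pi.mul_apply, Finset.sum_apply, Pi.sub_apply, mul_comm]
    rfl
  · simp only [Matrix.diagonal_apply_ne _ h, if_neg h]
    have : ∀ q, dSer ϖ q 0 = 0 := fun q => Ser.ext fun s m => by rw [cf_dSer]; funext ħ; simp
    simp [this]

lemma cf_dW1 (α : Form1 r) (c : Comp r) (s : ℕ) (m : Lam) :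
    cf (dW1 κ ϖ ϕ α) c s m =
      (fun ħ => pd ϖ 0 (cf (α 1) c s m ħ)) - (fun ħ => pd ϖ 1 (cf (α 0) c s m ħ)) +
      (match c with
      | Sum.inl ij => if ij.1 = ij.2 then fun ħ p => κ * ħ * ∑ k,
          (cf (α 1) (Sum.inr k) s m ħ p * pd ϖ 0 (connFun ϖ ϕ k ij.1) p -
            cf (α 0) (Sum.inr k) s m ħ p * pd ϖ 1 (connFun ϖ ϕ k ij.1) p)
        else 0
      | Sum.inr _ => 0) := by
  rcases c with ⟨i, j⟩ | j
  · simp only [cf, dW1, Matrix.add_apply, Matrix.sub_apply, Matrix.map_apply, Ser.cf_add,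
      Ser.cf_sub, cf_dSer, cf_curv1]
  · simp [cf, dW1, cf_dSer]

lemma br01_iterate (X : Sec r HFun) (α : Form1 r) (n : ℕ) (q : Fin 2) :
    (br01 κ ϖ ϕ X)^[n] α q = (br κ ϖ ϕ X)^[n] (α q) := by
  induction n with
  | zero => rfl
  | succ n ih => rw [Function.iterate_succ_apply', Function.iterate_succ_apply', br01, ih]

lemma cf_gaugeZero (n : ℕ) (X : Sec r HFun) (q : Fin 2) (c : Comp r) (s : ℕ) (m : Lam) :
    cf (gaugeZero κ ϖ ϕ n X q) c s m = -∑ k ∈ Finset.range n, (((k + 1).factorial : ℂ)⁻¹) •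
      cf ((br κ ϖ ϕ X)^[k] (dW0 κ ϖ ϕ X q)) c s m := by
  simp only [gaugeZero, Pi.neg_apply, cf_neg, Finset.sum_apply, cf_sum, Pi.smul_apply, cf_smul,
    br01_iterate]

/-- The components of the covector `m_0 dx_1 - m_1 dx_0`, which vanishes on `m`. -/
def conormal (m : Lam) (q : Fin 2) : ℂ := ![-(m 1 : ℂ), (m 0 : ℂ)] q

/-- The determinant of two modes. -/
def detL (m m' : Lam) : ℤ := m 0 * m' 1 - m 1 * m' 0

lemma Setup.cf_homSer (S : Setup r) (q : Fin 2) (f : Ser HFun) (s : ℕ) (m : Lam) :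
    (S.homSer q f).cf s m = fun ħ x => conormal m q * S.flowInt m (f.cf s m) ħ x := by
  rw [Setup.homSer, Ser.cf_mapModes]
  · rfl
  · intro m
    funext ħ x
    simp [Setup.flowInt]

lemma Setup.cf_hom_inr (S : Setup r) (X : Sec r HFun) (q j : Fin 2) (s : ℕ) (m : Lam) :
    cf (S.hom X q) (Sum.inr j) s m =
      fun ħ x => conormal m q * S.flowInt m (cf X (Sum.inr j) s m) ħ x := by
  simp only [cf, Setup.hom, S.cf_homSer]

lemma Setup.cf_hom_inl (S : Setup r) (X : Sec r HFun) (q : Fin 2) (ij : Fin r × Fin r) (s : ℕ)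
    (m : Lam) :
    cf (S.hom X q) (Sum.inl ij) s m = fun ħ x => conormal m q * S.flowInt m
      (cf X (Sum.inl ij) s m - if ij.1 = ij.2 then fun ħ p => S.κ * ħ * ∑ k,
      (conormal m 1 * S.flowInt m (cf X (Sum.inr k) s m) ħ p * pd id 0 (connFun id S.ϕ k ij.1) p -
      conormal m 0 * S.flowInt m (cf X (Sum.inr k) s m) ħ p * pd id 1 (connFun id S.ϕ k ij.1) p)
      else 0) ħ x := by
  simp only [cf, Setup.hom, Matrix.map_apply, S.cf_homSer, Matrix.sub_apply, Ser.cf_sub, cf_curv1]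

lemma pd_smul (q : Fin 2) (z : ℂ) (f : Pt → ℂ) : pd ϖ q (z • f) = z • pd ϖ q f := by
  funext p
  simp only [pd, Pi.smul_apply]
  rw [fderiv_const_smul_field]
  rfl

lemma covC_smul (a : Fin 2 → Fin r → Pt → ℂ) (c : Comp r) (m : Lam) (k : Fin 2) (z : ℂ)
    (f : HFun) : covC κ ϖ a c m k (z • f) = z • covC κ ϖ a c m k f := by
  funext ħ p
  have : (z • f) ħ = z • f ħ := rfl
  rcases c with c | c <;>
  · simp only [covC, this, pd_smul, Pi.smul_apply, smul_eq_mul]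
    ring

lemma brc_smul_smul (a : Fin 2 → Fin r → Pt → ℂ) (m m' : Lam) (z w : ℂ) (x y : Comp r → HFun)
    (c : Comp r) : brc κ ϖ a m m' (fun c => z • x c) (fun c => w • y c) c =
      (z * w) • brc κ ϖ a m m' x y c := by
  simp only [brc, covC_smul, smul_mul_smul_comm, mul_comm w z, ← smul_sub, ← Finset.smul_sum]
  rcases c with c | c
  · rw [smul_add, Finset.smul_sum (s := Finset.univ)]
  · simp only [smul_add, smul_zero]

lemma pd_const (q : Fin 2) (z : ℂ) : pd ϖ q (fun _ => z) = 0 := by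
  funext p
  simp [pd]

lemma connFun_flat : connFun (r := r) ϖ (fun _ _ => 0) = fun _ _ _ => 0 := by
  funext q i p
  simp [connFun, pd_const]

/-- Multiply the coefficients by the components of the conormal covectors of the modes. -/
noncomputable def conormalSec (q : Fin 2) (X : Sec r HFun) : Sec r HFun :=
  mapSec (fun m f => conormal m q • f) X

lemma cf_conormalSec (q : Fin 2) (X : Sec r HFun) (c : Comp r) (s : ℕ) (m : Lam) :
    cf (conormalSec q X) c s m = conormal m q • cf X c s m := by
  rw [conormalSec, cf_mapSec]
  simp

/-- The flat bracket of the `1`-form with density `X` with itself. -/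
noncomputable def detBr (X : Sec r HFun) : Sec r HFun :=
  br11 κ id (fun _ _ => 0) (fun q => conormalSec q X) (fun q => conormalSec q X)

/-- The flat bracket of coefficients. -/
noncomputable def brf (m m' : Lam) (x y : Comp r → HFun) : Comp r → HFun :=
  brc κ ϖ (fun _ _ _ => 0) m m' x y

lemma detBr_rel (R : HFun → HFun → Prop) (h0 : R 0 0)
    (hadd : ∀ f f' g g', R f f' → R g g' → R (f + g) (f' + g'))
    {X X' : Sec r HFun} (hX : ∀ c m, cf X c 0 m = 0) (hX' : ∀ c m, cf X' c 0 m = 0)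
    (c : Comp r) (s : ℕ) (m : Lam)
    (h : ∀ s' < s, ∀ s'' < s, ∀ m' m'', m' + m'' = m →
      R ((detL m' m'' : ℂ) • brf κ id m' m'' (fun c => cf X c s' m') (fun c => cf X c s'' m'') c)
        ((detL m' m'' : ℂ) •
          brf κ id m' m'' (fun c => cf X' c s' m') (fun c => cf X' c s'' m'') c)) :
    R (cf (detBr κ X) c s m) (cf (detBr κ X') c s m) := by
  classical
  obtain ⟨T, hT⟩ := exists_modes X s
  obtain ⟨T', hT'⟩ := exists_modes X' s
  have key : ∀ (Z : Sec r HFun) (hZ : ∀ c, ∀ s' ≤ s, ∀ m', cf Z c s' m' ≠ 0 → m' ∈ T ∪ T'),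
      cf (detBr κ Z) c s m = ∑ p ∈ Finset.HasAntidiagonal.antidiagonal s, ∑ m' ∈ T ∪ T',
        (detL m' (m - m') : ℂ) • brf κ id m' (m - m') (fun c => cf Z c p.1 m')
          (fun c => cf Z c p.2 (m - m')) c := by
    intro Z hZ
    have hZ' : ∀ q c, ∀ s' ≤ s, ∀ m', cf (conormalSec q Z) c s' m' ≠ 0 → m' ∈ T ∪ T' :=
      fun q c s' hs' m' hm' => hZ c s' hs' m' fun h0 => hm' (by rw [cf_conormalSec, h0, smul_zero])
    rw [detBr, br11, cf_sub, cf_br _ _ _ _ _ _ _ _ _ (hZ' 0), cf_br _ _ _ _ _ _ _ _ _ (hZ' 1)]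
    simp only [cf_conormalSec, brc_smul_smul, connFun_flat, ← Finset.sum_sub_distrib, ← sub_smul]
    refine Finset.sum_congr rfl fun p _ => Finset.sum_congr rfl fun m' _ => ?_
    congr 1
    simp [conormal, detL]
    ring
  rw [key X fun c s' hs' m' h => Finset.mem_union_left _ (hT c s' hs' m' h),
    key X' fun c s' hs' m' h => Finset.mem_union_right _ (hT' c s' hs' m' h)]
  have hsum : ∀ {ι : Type} (T : Finset ι) (f f' : ι → HFun), (∀ i ∈ T, R (f i) (f' i)) →
      R (∑ i ∈ T, f i) (∑ i ∈ T, f' i) := by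
    intro ι T f f' h
    induction T using Finset.induction_on with
    | empty => simpa using h0
    | insert i T hi ih =>
      rw [Finset.sum_insert hi, Finset.sum_insert hi]
      exact hadd _ _ _ _ (h i (Finset.mem_insert_self _ _))
        (ih fun j hj => h j (Finset.mem_insert_of_mem hj))
  refine hsum _ _ _ fun p hp => hsum _ _ _ fun m' _ => ?_
  have hp' := Finset.HasAntidiagonal.mem_antidiagonal.mp hp
  rcases Nat.eq_zero_or_pos p.1 with hs' | hs'
  · rw [brf, brf, hs', brc_zero_left κ id _ _ _ _ _ (fun c => hX c m'),
      brc_zero_left κ id _ _ _ _ _ (fun c => hX' c m'), smul_zero]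
    exact h0
  rcases Nat.eq_zero_or_pos p.2 with hs'' | hs''
  · rw [brf, brf, hs'', brc_zero_right κ id _ _ _ _ _ (fun c => hX c (m - m')),
      brc_zero_right κ id _ _ _ _ _ (fun c => hX' c (m - m')), smul_zero]
    exact h0
  exact h _ (by omega) _ (by omega) _ _ (by abel)

end Operators

/-! ## Derivatives in the affine coordinates -/

/-- `ϖ` is a smooth local diffeomorphism on the open set `S`. -/
structure LocDiffeo (ϖ : Pt → Pt) (S : Set Pt) : Prop where
  isOpen : IsOpen S
  smooth : ContDiffOn ℝ ∞ ϖ S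
  inv : ∀ p ∈ S, ∃ e : Pt ≃L[ℝ] Pt, (e : Pt →L[ℝ] Pt) = fderiv ℝ ϖ p

lemma LocDiffeo.mono {ϖ : Pt → Pt} {S S' : Set Pt} (h : LocDiffeo ϖ S) (hS' : IsOpen S')
    (hsub : S' ⊆ S) : LocDiffeo ϖ S' :=
  ⟨hS', h.smooth.mono hsub, fun p hp => h.inv p (hsub hp)⟩

lemma locDiffeo_id {S : Set Pt} (hS : IsOpen S) : LocDiffeo id S :=
  ⟨hS, contDiffOn_id, fun p _ => ⟨ContinuousLinearEquiv.refl ℝ Pt, by rw [fderiv_id]; rfl⟩⟩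

lemma pd_id (q : Fin 2) (f : Pt → ℂ) (p : Pt) : pd id q f p = fderiv ℝ f p (Pi.single q 1) := by
  rw [pd, fderiv_id, ContinuousLinearMap.inverse_id]
  rfl

section Calculus

variable {ϖ : Pt → Pt} {S : Set Pt}

lemma fderiv_eq_sum_pd (hS : LocDiffeo ϖ S) {p : Pt} (hp : p ∈ S) (f : Pt → ℂ) (v : Pt) :
    fderiv ℝ f p v = ∑ q, ((fderiv ℝ ϖ p v q : ℝ) : ℂ) * pd ϖ q f p := by
  obtain ⟨e, he⟩ := hS.inv p hp
  have hv : v = ∑ q, (fderiv ℝ ϖ p v q) • e.symm (Pi.single q 1) := by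
    rw [← he]
    apply e.injective
    rw [map_sum]
    simp only [map_smul, ContinuousLinearEquiv.apply_symm_apply]
    funext i
    fin_cases i <;> simp
  conv_lhs => rw [hv]
  rw [map_sum]
  refine Finset.sum_congr rfl fun q _ => ?_
  rw [map_smul, pd, ← he, ContinuousLinearMap.inverse_equiv, Complex.real_smul]
  rfl

lemma pd_congr (hS : IsOpen S) {f g : Pt → ℂ} (h : Set.EqOn f g S) (q : Fin 2) :
    Set.EqOn (pd ϖ q f) (pd ϖ q g) S := by
  intro p hp
  rw [pd, pd, Filter.EventuallyEq.fderiv_eq (h.eventuallyEq_of_mem (hS.mem_nhds hp))]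

lemma ContDiffOn.pd (hS : LocDiffeo ϖ S) {f : Pt → ℂ} (hf : ContDiffOn ℝ ∞ f S) (q : Fin 2) :
    ContDiffOn ℝ ∞ (pd ϖ q f) S := by
  have h1 : ContDiffOn ℝ ∞ (fderiv ℝ f) S := hf.fderiv_of_isOpen hS.isOpen (by simp)
  have h2 : ContDiffOn ℝ ∞ (fderiv ℝ ϖ) S := hS.smooth.fderiv_of_isOpen hS.isOpen (by simp)
  refine h1.clm_apply ?_
  refine ContDiffOn.clm_apply ?_ contDiffOn_const
  intro p hp
  obtain ⟨e, he⟩ := hS.inv p hp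
  have h3 : ContDiffAt ℝ ∞ ContinuousLinearMap.inverse (fderiv ℝ ϖ p) := by
    rw [← he]
    exact contDiffAt_map_inverse e
  exact h3.comp_contDiffWithinAt p (h2 p hp)

lemma ContDiffOn.differentiableAt_of_isOpen (hS : IsOpen S) {f : Pt → ℂ}
    (hf : ContDiffOn ℝ ∞ f S) {p : Pt} (hp : p ∈ S) : DifferentiableAt ℝ f p :=
  (hf.differentiableOn (by simp)).differentiableAt (hS.mem_nhds hp)

lemma pd_add {f g : Pt → ℂ} {p : Pt} (hf : DifferentiableAt ℝ f p) (hg : DifferentiableAt ℝ g p)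
    (q : Fin 2) : pd ϖ q (f + g) p = pd ϖ q f p + pd ϖ q g p := by
  simp only [pd]
  rw [fderiv_add hf hg]
  rfl

lemma pd_sub {f g : Pt → ℂ} {p : Pt} (hf : DifferentiableAt ℝ f p) (hg : DifferentiableAt ℝ g p)
    (q : Fin 2) : pd ϖ q (f - g) p = pd ϖ q f p - pd ϖ q g p := by
  simp only [pd]
  rw [fderiv_sub hf hg]
  rfl

lemma pd_mul {f g : Pt → ℂ} {p : Pt} (hf : DifferentiableAt ℝ f p) (hg : DifferentiableAt ℝ g p)
    (q : Fin 2) : pd ϖ q (f * g) p = pd ϖ q f p * g p + f p * pd ϖ q g p := by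
  simp only [pd]
  rw [fderiv_mul hf hg]
  simp only [_root_.add_apply, _root_.smul_apply, smul_eq_mul]
  ring

lemma iterPd_append (l : List (Fin 2)) (q : Fin 2) (f : Pt → ℂ) :
    iterPd ϖ (l ++ [q]) f = iterPd ϖ l (pd ϖ q f) := by
  induction l with
  | nil => rfl
  | cons a l ih => simp only [List.cons_append, iterPd, ih]

lemma iterPd_congr (hS : IsOpen S) {f g : Pt → ℂ} (h : Set.EqOn f g S) (l : List (Fin 2)) :
    Set.EqOn (iterPd ϖ l f) (iterPd ϖ l g) S := by
  induction l with
  | nil => exact h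
  | cons a l ih => exact pd_congr hS ih a

lemma ContDiffOn.iterPd (hS : LocDiffeo ϖ S) {f : Pt → ℂ} (hf : ContDiffOn ℝ ∞ f S)
    (l : List (Fin 2)) : ContDiffOn ℝ ∞ (iterPd ϖ l f) S := by
  induction l with
  | nil => exact hf
  | cons a l ih => exact ContDiffOn.pd hS ih a

lemma iterPd_add (hS : LocDiffeo ϖ S) {f g : Pt → ℂ} (hf : ContDiffOn ℝ ∞ f S)
    (hg : ContDiffOn ℝ ∞ g S) (l : List (Fin 2)) :
    Set.EqOn (iterPd ϖ l (f + g)) (iterPd ϖ l f + iterPd ϖ l g) S := by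
  induction l with
  | nil => exact fun _ _ => rfl
  | cons a l ih =>
    intro p hp
    simp only [iterPd]
    rw [pd_congr hS.isOpen ih a hp, pd_add
      (ContDiffOn.differentiableAt_of_isOpen hS.isOpen (ContDiffOn.iterPd hS hf l) hp)
      (ContDiffOn.differentiableAt_of_isOpen hS.isOpen (ContDiffOn.iterPd hS hg l) hp)]
    rfl

lemma iterPd_smul (z : ℂ) (f : Pt → ℂ) (l : List (Fin 2)) :
    iterPd ϖ l (z • f) = z • iterPd ϖ l f := by
  induction l with
  | nil => rfl
  | cons a l ih => simp only [iterPd, ih, pd_smul]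

lemma iterPd_const (z : ℂ) (l : List (Fin 2)) (hl : l ≠ []) :
    iterPd ϖ l (fun _ => z) = 0 := by
  obtain ⟨l', q, rfl⟩ := List.eq_nil_or_concat l |>.resolve_left hl
  rw [List.concat_eq_append, iterPd_append, pd_const]
  clear hl
  induction l' with
  | nil => rfl
  | cons a l ih => simp only [iterPd, ih, pd_zero]

/-- The ways to distribute a list of derivatives over two factors. -/
def splits : List (Fin 2) → List (List (Fin 2) × List (Fin 2))
  | [] => [([], [])]
  | q :: l => (splits l).map (fun ab => (q :: ab.1, ab.2)) ++
      (splits l).map (fun ab => (ab.1, q :: ab.2))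

lemma length_splits (l : List (Fin 2)) :
    ∀ ab ∈ splits l, ab.1.length + ab.2.length = l.length := by
  induction l with
  | nil => simp [splits]
  | cons q l ih =>
    intro ab hab
    simp only [splits, List.mem_append, List.mem_map] at hab
    rcases hab with ⟨ab, h, rfl⟩ | ⟨ab, h, rfl⟩ <;>
    · have := ih ab h
      simp only [List.length_cons]
      omega

lemma pd_listSum (hS : LocDiffeo ϖ S) {ι : Type*} (L : List ι) (F : ι → Pt → ℂ)
    (hF : ∀ i ∈ L, ContDiffOn ℝ ∞ (F i) S) (q : Fin 2) {p : Pt} (hp : p ∈ S) :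
    pd ϖ q (fun x => (L.map fun i => F i x).sum) p = (L.map fun i => pd ϖ q (F i) p).sum := by
  have : ContDiffOn ℝ ∞ (fun x => (L.map fun i => F i x).sum) S ∧
      pd ϖ q (fun x => (L.map fun i => F i x).sum) p = (L.map fun i => pd ϖ q (F i) p).sum := by
    induction L with
    | nil => exact ⟨contDiffOn_const, by simp [pd_const]⟩
    | cons i L ih =>
      obtain ⟨h1, h2⟩ := ih fun j hj => hF j (List.mem_cons_of_mem _ hj)
      have h3 := hF i List.mem_cons_self
      simp only [List.map_cons, List.sum_cons]
      refine ⟨h3.add h1, ?_⟩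
      rw [← h2]
      exact pd_add (ContDiffOn.differentiableAt_of_isOpen hS.isOpen h3 hp)
        (ContDiffOn.differentiableAt_of_isOpen hS.isOpen h1 hp) q
  exact this.2

lemma iterPd_mul (hS : LocDiffeo ϖ S) {f g : Pt → ℂ} (hf : ContDiffOn ℝ ∞ f S)
    (hg : ContDiffOn ℝ ∞ g S) (l : List (Fin 2)) :
    Set.EqOn (iterPd ϖ l (f * g))
      (fun x => ((splits l).map fun ab => iterPd ϖ ab.1 f x * iterPd ϖ ab.2 g x).sum) S := by
  induction l with
  | nil => intro p _; simp [iterPd, splits]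
  | cons q l ih =>
    intro p hp
    simp only [iterPd]
    rw [pd_congr hS.isOpen ih q hp]
    refine (pd_listSum hS (splits l) (fun ab => iterPd ϖ ab.1 f * iterPd ϖ ab.2 g)
      (fun ab _ => (ContDiffOn.iterPd hS hf _).mul (ContDiffOn.iterPd hS hg _)) q hp).trans ?_
    simp only [splits, List.map_append, List.map_map, List.sum_append, Function.comp_def, iterPd]
    rw [← List.sum_map_add]
    congr 1
    refine List.map_congr_left fun ab _ => ?_
    rw [pd_mul (ContDiffOn.differentiableAt_of_isOpen hS.isOpen (ContDiffOn.iterPd hS hf _) hp)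
      (ContDiffOn.differentiableAt_of_isOpen hS.isOpen (ContDiffOn.iterPd hS hg _) hp)]

/-- All derivatives of order `j` are bounded on `V` by multiples of the weight `w j`. -/
def DerivBound (ϖ : Pt → Pt) (F : Filter ℝ) (V : Set Pt) (w : ℕ → ℝ → Pt → ℝ) (f : HFun) : Prop :=
  ∀ l : List (Fin 2), ∃ C : ℝ, 0 ≤ C ∧ ∀ᶠ ħ in F, ∀ x ∈ V,
    ‖iterPd ϖ l (f ħ) x‖ ≤ C * w l.length ħ x

variable {F : Filter ℝ} {V : Set Pt} {w w₁ w₂ : ℕ → ℝ → Pt → ℝ}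

lemma DerivBound.mono {f : HFun} (hf : DerivBound ϖ F V w f) {V' : Set Pt} (h : V' ⊆ V) :
    DerivBound ϖ F V' w f := fun l => by
  obtain ⟨C, hC, h1⟩ := hf l
  exact ⟨C, hC, h1.mono fun ħ h2 x hx => h2 x (h hx)⟩

lemma DerivBound.weaken {f : HFun} (hf : DerivBound ϖ F V w₁ f)
    (h : ∀ j, ∃ C : ℝ, 0 ≤ C ∧ ∀ᶠ ħ in F, ∀ x ∈ V, w₁ j ħ x ≤ C * w j ħ x) :
    DerivBound ϖ F V w f := fun l => by
  obtain ⟨C, hC, h1⟩ := hf l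
  obtain ⟨C', hC', h2⟩ := h l.length
  refine ⟨C * C', mul_nonneg hC hC', ?_⟩
  filter_upwards [h1, h2] with ħ h1 h2 x hx
  calc _ ≤ C * w₁ l.length ħ x := h1 x hx
    _ ≤ C * (C' * w l.length ħ x) := mul_le_mul_of_nonneg_left (h2 x hx) hC
    _ = _ := by ring

lemma DerivBound.pd {f : HFun} (hf : DerivBound ϖ F V w f) (q : Fin 2) :
    DerivBound ϖ F V (fun j => w (j + 1)) (fun ħ => pd ϖ q (f ħ)) := fun l => by
  obtain ⟨C, hC, h1⟩ := hf (l ++ [q])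
  refine ⟨C, hC, ?_⟩
  simpa only [iterPd_append, List.length_append, List.length_singleton] using h1

lemma DerivBound.congr (hS : IsOpen S) (hV : V ⊆ S) {f g : HFun}
    (hf : DerivBound ϖ F V w f) (h : ∀ᶠ ħ in F, Set.EqOn (f ħ) (g ħ) S) :
    DerivBound ϖ F V w g := fun l => by
  obtain ⟨C, hC, h1⟩ := hf l
  refine ⟨C, hC, ?_⟩
  filter_upwards [h1, h] with ħ h1 h2 x hx
  rw [← iterPd_congr hS h2 l (hV hx)]
  exact h1 x hx

lemma DerivBound.smul {f : HFun} (hf : DerivBound ϖ F V w f) (z : ℂ) :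
    DerivBound ϖ F V w (z • f) := fun l => by
  obtain ⟨C, hC, h1⟩ := hf l
  refine ⟨‖z‖ * C, by positivity, ?_⟩
  filter_upwards [h1] with ħ h1 x hx
  rw [Pi.smul_apply, iterPd_smul, Pi.smul_apply, norm_smul, mul_assoc]
  exact mul_le_mul_of_nonneg_left (h1 x hx) (norm_nonneg _)

lemma DerivBound.add (hS : LocDiffeo ϖ S) (hV : V ⊆ S) {f g : HFun}
    (hfs : ∀ᶠ ħ in F, ContDiffOn ℝ ∞ (f ħ) S) (hgs : ∀ᶠ ħ in F, ContDiffOn ℝ ∞ (g ħ) S)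
    (hf : DerivBound ϖ F V w f) (hg : DerivBound ϖ F V w g) :
    DerivBound ϖ F V w (f + g) := fun l => by
  obtain ⟨C, hC, h1⟩ := hf l
  obtain ⟨C', hC', h2⟩ := hg l
  refine ⟨C + C', by positivity, ?_⟩
  filter_upwards [h1, h2, hfs, hgs] with ħ h1 h2 hf hg x hx
  rw [Pi.add_apply, iterPd_add hS hf hg l (hV hx), Pi.add_apply, add_mul]
  exact (norm_add_le _ _).trans (add_le_add (h1 x hx) (h2 x hx))

lemma DerivBound.mul (hS : LocDiffeo ϖ S) (hV : V ⊆ S) {f g : HFun}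
    (hfs : ∀ᶠ ħ in F, ContDiffOn ℝ ∞ (f ħ) S) (hgs : ∀ᶠ ħ in F, ContDiffOn ℝ ∞ (g ħ) S)
    (hf : DerivBound ϖ F V w₁ f) (hg : DerivBound ϖ F V w₂ g)
    (hw : ∀ i j, ∃ C : ℝ, 0 ≤ C ∧ ∀ᶠ ħ in F, ∀ x ∈ V,
      w₁ i ħ x * w₂ j ħ x ≤ C * w (i + j) ħ x) :
    DerivBound ϖ F V w (f * g) := fun l => by
  have key : ∀ L : List (List (Fin 2) × List (Fin 2)),
      (∀ ab ∈ L, ab.1.length + ab.2.length = l.length) →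
      ∃ C : ℝ, 0 ≤ C ∧ ∀ᶠ ħ in F, ∀ x ∈ V,
        ‖(L.map fun ab => iterPd ϖ ab.1 (f ħ) x * iterPd ϖ ab.2 (g ħ) x).sum‖ ≤
          C * w l.length ħ x := by
    intro L
    induction L with
    | nil => intro _; exact ⟨0, le_rfl, Eventually.of_forall fun ħ x _ => by simp⟩
    | cons ab L ih =>
      intro hL
      obtain ⟨C, hC, h⟩ := ih fun i hi => hL i (List.mem_cons_of_mem _ hi)
      obtain ⟨C₁, hC₁, h1⟩ := hf ab.1
      obtain ⟨C₂, hC₂, h2⟩ := hg ab.2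
      obtain ⟨C₃, hC₃, h3⟩ := hw ab.1.length ab.2.length
      rw [hL ab List.mem_cons_self] at h3
      refine ⟨C₁ * C₂ * C₃ + C, by positivity, ?_⟩
      filter_upwards [h, h1, h2, h3] with ħ h h1 h2 h3 x hx
      simp only [List.map_cons, List.sum_cons]
      rw [add_mul]
      refine (norm_add_le _ _).trans (add_le_add ?_ (h x hx))
      rw [norm_mul]
      calc _ ≤ (C₁ * w₁ ab.1.length ħ x) * (C₂ * w₂ ab.2.length ħ x) :=
            mul_le_mul (h1 x hx) (h2 x hx) (norm_nonneg _) ((norm_nonneg _).trans (h1 x hx))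
        _ = C₁ * C₂ * (w₁ ab.1.length ħ x * w₂ ab.2.length ħ x) := by ring
        _ ≤ C₁ * C₂ * (C₃ * w l.length ħ x) :=
            mul_le_mul_of_nonneg_left (h3 x hx) (mul_nonneg hC₁ hC₂)
        _ = _ := by ring
  obtain ⟨C, hC, h⟩ := key (splits l) (length_splits l)
  refine ⟨C, hC, ?_⟩
  filter_upwards [h, hfs, hgs] with ħ h hf hg x hx
  rw [Pi.mul_apply, iterPd_mul hS hf hg l (hV hx)]
  exact h x hx

end Calculus

/-! ## Exponentially small and tempered functions -/

section Growth

variable {ϖ : Pt → Pt} {S : Set Pt}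

lemma derivBound_iff {F : Filter ℝ} {V : Set Pt} {w : ℕ → ℝ → Pt → ℝ} {f : HFun}
    (hw : ∀ j, ∀ᶠ ħ in F, ∀ x ∈ V, 0 ≤ w j ħ x) :
    DerivBound ϖ F V w f ↔ ∀ j : ℕ, ∃ C : ℝ, ∀ᶠ ħ in F, ∀ x ∈ V, ∀ l : List (Fin 2),
      l.length = j → ‖iterPd ϖ l (f ħ) x‖ ≤ C * w j ħ x := by
  constructor
  · intro h j
    choose C hC h using h
    have hfin : {l : List (Fin 2) | l.length = j}.Finite := List.finite_length_eq _ _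
    obtain ⟨M, hM⟩ := (hfin.image C).bddAbove
    refine ⟨M, ?_⟩
    have := (Filter.eventually_all_finite hfin).mpr fun l _ => h l
    filter_upwards [this, hw j] with ħ h1 h2 x hx l hl
    have h3 := h1 l hl x hx
    rw [hl] at h3
    exact h3.trans (mul_le_mul_of_nonneg_right (hM ⟨l, hl, rfl⟩) (h2 x hx))
  · intro h l
    obtain ⟨C, hC⟩ := h l.length
    refine ⟨max C 0, le_max_right _ _, ?_⟩
    filter_upwards [hC, hw l.length] with ħ h1 h2 x hx
    exact (h1 x hx l rfl).trans (mul_le_mul_of_nonneg_right (le_max_left _ _) (h2 x hx))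

/-- The weight of exponentially small functions. -/
noncomputable def wtExp (c : ℝ) : ℕ → ℝ → Pt → ℝ := fun _ ħ _ => Real.exp (-c / ħ)

/-- The weight of tempered functions. -/
noncomputable def wtPow (s : ℤ) : ℕ → ℝ → Pt → ℝ := fun j ħ _ => ħ ^ (-((s : ℝ) + j) / 2)

lemma wExp_iff {f : HFun} : WExp ϖ S f ↔
    ∀ q ∈ S, ∃ V ∈ 𝓝 q, ∃ c : ℝ, 0 < c ∧ DerivBound ϖ (𝓝[>] 0) V (wtExp c) f := by
  refine forall₂_congr fun q _ => ?_
  constructor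
  · rintro ⟨V, hV, c, hc, h⟩
    exact ⟨V, hV, c, hc, (derivBound_iff fun j => Eventually.of_forall fun _ _ _ =>
      (Real.exp_pos _).le).mpr h⟩
  · rintro ⟨V, hV, c, hc, h⟩
    exact ⟨V, hV, c, hc, (derivBound_iff fun j => Eventually.of_forall fun _ _ _ =>
      (Real.exp_pos _).le).mp h⟩

lemma wPow_iff {s : ℤ} {f : HFun} : WPow ϖ s S f ↔
    ∀ q ∈ S, ∃ V ∈ 𝓝 q, DerivBound ϖ (𝓝[>] 0) V (wtPow s) f := by
  refine forall₂_congr fun q _ => ?_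
  have hw : ∀ V : Set Pt, ∀ j, ∀ᶠ ħ in 𝓝[>] (0 : ℝ), ∀ x ∈ V, 0 ≤ wtPow s j ħ x := fun V j => by
    filter_upwards [self_mem_nhdsWithin] with ħ hħ x _
    exact Real.rpow_nonneg (le_of_lt hħ) _
  constructor
  · rintro ⟨V, hV, h⟩
    exact ⟨V, hV, (derivBound_iff (hw V)).mpr h⟩
  · rintro ⟨V, hV, h⟩
    exact ⟨V, hV, (derivBound_iff (hw V)).mp h⟩

/-- Smooth on `S` for each positive `ħ`. -/
def Smooth (S : Set Pt) (f : HFun) : Prop := ∀ ħ : ℝ, 0 < ħ → ContDiffOn ℝ ∞ (f ħ) S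

/-- Smooth and exponentially small on `S`. -/
def WE (ϖ : Pt → Pt) (S : Set Pt) (f : HFun) : Prop := Smooth S f ∧ WExp ϖ S f

/-- Smooth and tempered of order `s` on `S`. -/
def WP (ϖ : Pt → Pt) (s : ℤ) (S : Set Pt) (f : HFun) : Prop := Smooth S f ∧ WPow ϖ s S f

lemma Smooth.eventually {f : HFun} (h : Smooth S f) :
    ∀ᶠ ħ in 𝓝[>] (0 : ℝ), ContDiffOn ℝ ∞ (f ħ) S := by
  filter_upwards [self_mem_nhdsWithin] with ħ hħ
  exact h ħ hħ

lemma Smooth.zero : Smooth S 0 := fun _ _ => contDiffOn_const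
lemma Smooth.add {f g : HFun} (hf : Smooth S f) (hg : Smooth S g) : Smooth S (f + g) :=
  fun ħ h => (hf ħ h).add (hg ħ h)
lemma Smooth.neg {f : HFun} (hf : Smooth S f) : Smooth S (-f) := fun ħ h => (hf ħ h).neg
lemma Smooth.sub {f g : HFun} (hf : Smooth S f) (hg : Smooth S g) : Smooth S (f - g) :=
  fun ħ h => (hf ħ h).sub (hg ħ h)
lemma Smooth.mul {f g : HFun} (hf : Smooth S f) (hg : Smooth S g) : Smooth S (f * g) :=
  fun ħ h => (hf ħ h).mul (hg ħ h)
lemma Smooth.smul {f : HFun} (hf : Smooth S f) (z : ℂ) : Smooth S (z • f) :=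
  fun ħ h => (hf ħ h).const_smul z
lemma Smooth.pd (hS : LocDiffeo ϖ S) {f : HFun} (hf : Smooth S f) (q : Fin 2) :
    Smooth S (fun ħ => pd ϖ q (f ħ)) := fun ħ h => ContDiffOn.pd hS (hf ħ h) q
lemma Smooth.congr {f g : HFun} (hf : Smooth S f)
    (h : ∀ ħ, 0 < ħ → Set.EqOn (f ħ) (g ħ) S) : Smooth S g :=
  fun ħ hħ => (hf ħ hħ).congr fun _ hx => (h ħ hħ hx).symm
lemma Smooth.mono {f : HFun} (hf : Smooth S f) {S' : Set Pt} (h : S' ⊆ S) : Smooth S' f :=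
  fun ħ hħ => (hf ħ hħ).mono h
lemma Smooth.differentiableAt (hS : IsOpen S) {f : HFun} (hf : Smooth S f) {ħ : ℝ} (hħ : 0 < ħ)
    {p : Pt} (hp : p ∈ S) : DifferentiableAt ℝ (f ħ) p :=
  ContDiffOn.differentiableAt_of_isOpen hS (hf ħ hħ) hp

lemma wtExp_mul_wtPow_le {c : ℝ} (hc : 0 < c) (s : ℤ) (V : Set Pt) (i j : ℕ) :
    ∃ C : ℝ, 0 ≤ C ∧ ∀ᶠ ħ in 𝓝[>] (0 : ℝ), ∀ x ∈ V,
      wtExp c i ħ x * wtPow s j ħ x ≤ C * wtExp (c / 2) (i + j) ħ x := by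
  refine ⟨1, zero_le_one, ?_⟩
  have h1 : Tendsto (fun u : ℝ => u ^ (((s : ℝ) + j) / 2) * Real.exp (-(c / 2) * u)) atTop (𝓝 0) :=
    tendsto_rpow_mul_exp_neg_mul_atTop_nhds_zero _ _ (by positivity)
  have h2 := (h1.comp tendsto_inv_nhdsGT_zero).eventually (gt_mem_nhds zero_lt_one)
  filter_upwards [h2, self_mem_nhdsWithin] with ħ h2 hħ x _
  have hħ' : (0 : ℝ) < ħ := hħ
  simp only [Function.comp_apply] at h2
  rw [Real.inv_rpow hħ'.le, ← Real.rpow_neg hħ'.le] at h2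
  simp only [wtExp, wtPow, one_mul]
  have h3 : Real.exp (-c / ħ) = Real.exp (-(c / 2) / ħ) * Real.exp (-(c / 2) * ħ⁻¹) := by
    rw [← Real.exp_add]
    congr 1
    field_simp
    ring
  rw [h3, mul_assoc]
  refine mul_le_of_le_one_right (Real.exp_pos _).le ?_
  rw [mul_comm, neg_div]
  exact h2.le

lemma wtExp_anti {c c' : ℝ} (h : c' ≤ c) (F : Filter ℝ) (hF : F ≤ 𝓝[>] 0) (V : Set Pt) (j : ℕ) :
    ∃ C : ℝ, 0 ≤ C ∧ ∀ᶠ ħ in F, ∀ x ∈ V, wtExp c j ħ x ≤ C * wtExp c' j ħ x := by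
  refine ⟨1, zero_le_one, hF ?_⟩
  filter_upwards [self_mem_nhdsWithin] with ħ hħ x _
  rw [one_mul, wtExp, wtExp, Real.exp_le_exp]
  exact div_le_div_of_nonneg_right (neg_le_neg h) (le_of_lt hħ)

lemma WE.zero : WE ϖ S 0 := ⟨Smooth.zero, wExp_iff.mpr fun q _ => ⟨Set.univ, univ_mem, 1, one_pos,
  fun l => ⟨0, le_rfl, Eventually.of_forall fun _ x _ => by
    have : iterPd ϖ l 0 x = 0 := by
      have := congrFun (iterPd_smul (ϖ := ϖ) 0 0 l) x
      simpa using this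
    simp [this]⟩⟩⟩

lemma WE.add (hS : LocDiffeo ϖ S) {f g : HFun} (hf : WE ϖ S f) (hg : WE ϖ S g) :
    WE ϖ S (f + g) := by
  refine ⟨hf.1.add hg.1, wExp_iff.mpr fun q hq => ?_⟩
  obtain ⟨V, hV, c, hc, h⟩ := wExp_iff.mp hf.2 q hq
  obtain ⟨V', hV', c', hc', h'⟩ := wExp_iff.mp hg.2 q hq
  refine ⟨V ∩ V' ∩ S, inter_mem (inter_mem hV hV') (hS.isOpen.mem_nhds hq), min c c',
    lt_min hc hc', DerivBound.add hS Set.inter_subset_right hf.1.eventually hg.1.eventually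
      ((h.mono fun x hx => hx.1.1).weaken fun j => wtExp_anti (min_le_left _ _) _ le_rfl _ j)
      ((h'.mono fun x hx => hx.1.2).weaken fun j => wtExp_anti (min_le_right _ _) _ le_rfl _ j)⟩

lemma WE.smul {f : HFun} (hf : WE ϖ S f) (z : ℂ) : WE ϖ S (z • f) := by
  refine ⟨hf.1.smul z, wExp_iff.mpr fun q hq => ?_⟩
  obtain ⟨V, hV, c, hc, h⟩ := wExp_iff.mp hf.2 q hq
  exact ⟨V, hV, c, hc, h.smul z⟩

lemma WE.neg {f : HFun} (hf : WE ϖ S f) : WE ϖ S (-f) := by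
  have := hf.smul (-1)
  rwa [neg_one_smul] at this

lemma WE.sub (hS : LocDiffeo ϖ S) {f g : HFun} (hf : WE ϖ S f) (hg : WE ϖ S g) :
    WE ϖ S (f - g) := by
  rw [sub_eq_add_neg]
  exact hf.add hS hg.neg

lemma WE.sum (hS : LocDiffeo ϖ S) {ι : Type*} (T : Finset ι) {f : ι → HFun}
    (h : ∀ i ∈ T, WE ϖ S (f i)) : WE ϖ S (∑ i ∈ T, f i) := by
  classical
  induction T using Finset.induction_on with
  | empty => exact WE.zero
  | insert i T hi ih =>
    rw [Finset.sum_insert hi]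
    exact (h i (Finset.mem_insert_self _ _)).add hS (ih fun j hj => h j (Finset.mem_insert_of_mem hj))

lemma WE.pd (hS : LocDiffeo ϖ S) {f : HFun} (hf : WE ϖ S f) (q : Fin 2) :
    WE ϖ S (fun ħ => pd ϖ q (f ħ)) := by
  refine ⟨hf.1.pd hS q, wExp_iff.mpr fun p hp => ?_⟩
  obtain ⟨V, hV, c, hc, h⟩ := wExp_iff.mp hf.2 p hp
  exact ⟨V, hV, c, hc, h.pd q⟩

lemma WE.congr (hS : IsOpen S) {f g : HFun} (hf : WE ϖ S f)
    (h : ∀ ħ, 0 < ħ → Set.EqOn (f ħ) (g ħ) S) : WE ϖ S g := by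
  refine ⟨hf.1.congr h, wExp_iff.mpr fun p hp => ?_⟩
  obtain ⟨V, hV, c, hc, hb⟩ := wExp_iff.mp hf.2 p hp
  refine ⟨V ∩ S, inter_mem hV (hS.mem_nhds hp), c, hc,
    DerivBound.congr hS Set.inter_subset_right (hb.mono Set.inter_subset_left) ?_⟩
  filter_upwards [self_mem_nhdsWithin] with ħ hħ using h ħ hħ

lemma WE.mono {f : HFun} (hf : WE ϖ S f) {S' : Set Pt} (h : S' ⊆ S) : WE ϖ S' f :=
  ⟨hf.1.mono h, fun q hq => hf.2 q (h hq)⟩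

lemma WE.mul (hS : LocDiffeo ϖ S) {s : ℤ} {f g : HFun} (hf : WE ϖ S f) (hg : WP ϖ s S g) :
    WE ϖ S (f * g) := by
  refine ⟨hf.1.mul hg.1, wExp_iff.mpr fun q hq => ?_⟩
  obtain ⟨V, hV, c, hc, h⟩ := wExp_iff.mp hf.2 q hq
  obtain ⟨V', hV', h'⟩ := wPow_iff.mp hg.2 q hq
  exact ⟨V ∩ V' ∩ S, inter_mem (inter_mem hV hV') (hS.isOpen.mem_nhds hq), c / 2, by positivity,
    DerivBound.mul hS Set.inter_subset_right hf.1.eventually hg.1.eventually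
      (h.mono fun x hx => hx.1.1) (h'.mono fun x hx => hx.1.2)
      fun i j => wtExp_mul_wtPow_le hc s _ i j⟩

lemma WP.mono_order {s s' : ℤ} (hs : s ≤ s') {f : HFun} (hf : WP ϖ s S f) : WP ϖ s' S f := by
  refine ⟨hf.1, wPow_iff.mpr fun q hq => ?_⟩
  obtain ⟨V, hV, h⟩ := wPow_iff.mp hf.2 q hq
  refine ⟨V, hV, h.weaken fun j => ⟨1, zero_le_one, ?_⟩⟩
  filter_upwards [Ioo_mem_nhdsGT (zero_lt_one (α := ℝ))] with ħ hħ x _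
  rw [one_mul]
  refine Real.rpow_le_rpow_of_exponent_ge hħ.1 hħ.2.le ?_
  have : (s : ℝ) ≤ s' := by exact_mod_cast hs
  linarith

lemma WP.zero {s : ℤ} : WP ϖ s S 0 := ⟨Smooth.zero, wPow_iff.mpr fun q _ => ⟨Set.univ, univ_mem,
  fun l => ⟨0, le_rfl, Eventually.of_forall fun _ x _ => by
    have : iterPd ϖ l 0 x = 0 := by
      have := congrFun (iterPd_smul (ϖ := ϖ) 0 0 l) x
      simpa using this
    simp [this]⟩⟩⟩

lemma WP.add (hS : LocDiffeo ϖ S) {s : ℤ} {f g : HFun} (hf : WP ϖ s S f) (hg : WP ϖ s S g) :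
    WP ϖ s S (f + g) := by
  refine ⟨hf.1.add hg.1, wPow_iff.mpr fun q hq => ?_⟩
  obtain ⟨V, hV, h⟩ := wPow_iff.mp hf.2 q hq
  obtain ⟨V', hV', h'⟩ := wPow_iff.mp hg.2 q hq
  exact ⟨V ∩ V' ∩ S, inter_mem (inter_mem hV hV') (hS.isOpen.mem_nhds hq),
    DerivBound.add hS Set.inter_subset_right hf.1.eventually hg.1.eventually
      (h.mono fun x hx => hx.1.1) (h'.mono fun x hx => hx.1.2)⟩

lemma WP.smul {s : ℤ} {f : HFun} (hf : WP ϖ s S f) (z : ℂ) : WP ϖ s S (z • f) := by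
  refine ⟨hf.1.smul z, wPow_iff.mpr fun q hq => ?_⟩
  obtain ⟨V, hV, h⟩ := wPow_iff.mp hf.2 q hq
  exact ⟨V, hV, h.smul z⟩

lemma WP.pd (hS : LocDiffeo ϖ S) {s : ℤ} {f : HFun} (hf : WP ϖ s S f) (q : Fin 2) :
    WP ϖ (s + 1) S (fun ħ => pd ϖ q (f ħ)) := by
  refine ⟨hf.1.pd hS q, wPow_iff.mpr fun p hp => ?_⟩
  obtain ⟨V, hV, h⟩ := wPow_iff.mp hf.2 p hp
  refine ⟨V, hV, (h.pd q).weaken fun j => ⟨1, zero_le_one, Eventually.of_forall fun ħ x _ => ?_⟩⟩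
  simp only [wtPow, one_mul]
  apply le_of_eq
  congr 1
  push_cast
  ring

lemma WP.mul (hS : LocDiffeo ϖ S) {s s' : ℤ} {f g : HFun} (hf : WP ϖ s S f) (hg : WP ϖ s' S g) :
    WP ϖ (s + s') S (f * g) := by
  refine ⟨hf.1.mul hg.1, wPow_iff.mpr fun q hq => ?_⟩
  obtain ⟨V, hV, h⟩ := wPow_iff.mp hf.2 q hq
  obtain ⟨V', hV', h'⟩ := wPow_iff.mp hg.2 q hq
  refine ⟨V ∩ V' ∩ S, inter_mem (inter_mem hV hV') (hS.isOpen.mem_nhds hq),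
    DerivBound.mul hS Set.inter_subset_right hf.1.eventually hg.1.eventually
      (h.mono fun x hx => hx.1.1) (h'.mono fun x hx => hx.1.2)
      fun i j => ⟨1, zero_le_one, ?_⟩⟩
  filter_upwards [self_mem_nhdsWithin] with ħ hħ x _
  simp only [wtPow, one_mul]
  rw [← Real.rpow_add hħ]
  apply le_of_eq
  congr 1
  push_cast
  ring

lemma WP.congr (hS : IsOpen S) {s : ℤ} {f g : HFun} (hf : WP ϖ s S f)
    (h : ∀ ħ, 0 < ħ → Set.EqOn (f ħ) (g ħ) S) : WP ϖ s S g := by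
  refine ⟨hf.1.congr h, wPow_iff.mpr fun p hp => ?_⟩
  obtain ⟨V, hV, hb⟩ := wPow_iff.mp hf.2 p hp
  refine ⟨V ∩ S, inter_mem hV (hS.mem_nhds hp),
    DerivBound.congr hS Set.inter_subset_right (hb.mono Set.inter_subset_left) ?_⟩
  filter_upwards [self_mem_nhdsWithin] with ħ hħ using h ħ hħ

lemma WE.toWP {f : HFun} (hf : WE ϖ S f) (s : ℤ) : WP ϖ s S f := by
  refine ⟨hf.1, wPow_iff.mpr fun q hq => ?_⟩
  obtain ⟨V, hV, c, hc, h⟩ := wExp_iff.mp hf.2 q hq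
  refine ⟨V, hV, h.weaken fun j => ?_⟩
  obtain ⟨C, hC, h1⟩ := wtExp_mul_wtPow_le hc (-s - 2 * j) V j j
  refine ⟨C, hC, ?_⟩
  filter_upwards [h1, self_mem_nhdsWithin] with ħ h1 hħ x hx
  have hħ' : (0 : ℝ) < ħ := hħ
  have h2 := h1 x hx
  have h3 : wtPow (-s - 2 * j) j ħ x = (wtPow s j ħ x)⁻¹ := by
    simp only [wtPow]
    rw [← Real.rpow_neg hħ'.le]
    congr 1
    push_cast
    ring
  have h4 : 0 < wtPow s j ħ x := Real.rpow_pos_of_pos hħ' _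
  rw [h3, mul_inv_le_iff₀ h4] at h2
  refine h2.trans ?_
  rw [mul_assoc]
  refine mul_le_mul_of_nonneg_left ?_ hC
  refine mul_le_of_le_one_left h4.le ?_
  rw [wtExp, Real.exp_le_one_iff]
  exact div_nonpos_of_nonpos_of_nonneg (by linarith) hħ'.le

/-- Smooth functions that do not depend on `ħ` are tempered of order `0`. -/
lemma WP.of_smooth (hS : LocDiffeo ϖ S) {g : Pt → ℂ} (hg : ContDiffOn ℝ ∞ g S) :
    WP ϖ 0 S (fun _ => g) := by
  refine ⟨fun _ _ => hg, wPow_iff.mpr fun q hq => ?_⟩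
  obtain ⟨r, hr, hrS⟩ := Metric.nhds_basis_closedBall.mem_iff.mp (hS.isOpen.mem_nhds hq)
  refine ⟨Metric.closedBall q r, Metric.closedBall_mem_nhds q hr, fun l => ?_⟩
  obtain ⟨C, hC⟩ := (isCompact_closedBall q r).exists_bound_of_continuousOn
    ((ContDiffOn.iterPd hS hg l).continuousOn.mono hrS)
  refine ⟨max C 0, le_max_right _ _, ?_⟩
  filter_upwards [Ioo_mem_nhdsGT (zero_lt_one (α := ℝ))] with ħ hħ x hx
  refine (hC x hx).trans ((le_max_left C 0).trans ?_)
  refine le_mul_of_one_le_right (le_max_right _ _) ?_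
  refine Real.one_le_rpow_of_pos_of_le_one_of_nonpos hħ.1 hħ.2.le ?_
  have : (0 : ℝ) ≤ l.length := Nat.cast_nonneg _
  push_cast
  linarith

/-- A function of `ħ` that is `O(ħ ^ (-s / 2))`. -/
lemma WP.of_const {s : ℤ} {z : ℝ → ℂ} {C : ℝ} (hC : 0 ≤ C)
    (hz : ∀ᶠ ħ in 𝓝[>] (0 : ℝ), ‖z ħ‖ ≤ C * ħ ^ (-(s : ℝ) / 2)) :
    WP ϖ s S (fun ħ _ => z ħ) := by
  refine ⟨fun _ _ => contDiffOn_const, wPow_iff.mpr fun q hq => ⟨Set.univ, univ_mem, fun l => ?_⟩⟩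
  refine ⟨C, hC, ?_⟩
  filter_upwards [hz, self_mem_nhdsWithin] with ħ h hħ x _
  rcases eq_or_ne l [] with rfl | hl
  · simpa [iterPd, wtPow] using h
  · rw [iterPd_const _ _ hl, Pi.zero_apply, norm_zero]
    exact mul_nonneg hC (Real.rpow_nonneg (le_of_lt hħ) _)

lemma WP.hbar_smul (κ : ℂ) : WP ϖ (-2) S (fun ħ _ => κ * ħ) := by
  refine WP.of_const (C := ‖κ‖) (norm_nonneg _) ?_
  filter_upwards [self_mem_nhdsWithin] with ħ hħ
  have hħ' : (0 : ℝ) < ħ := hħ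
  rw [norm_mul, Complex.norm_real, Real.norm_of_nonneg hħ'.le]
  norm_num

lemma WE.of_local {f : HFun} (h : ∀ q ∈ S, ∃ N : Set Pt, IsOpen N ∧ q ∈ N ∧ WE ϖ (N ∩ S) f) :
    WE ϖ S f := by
  refine ⟨fun ħ hħ x hx => ?_, fun q hq => ?_⟩
  · obtain ⟨N, hN, hqN, h1⟩ := h x hx
    exact (contDiffWithinAt_inter' (mem_nhdsWithin_of_mem_nhds (hN.mem_nhds hqN))).mp
      (by rw [Set.inter_comm]; exact h1.1 ħ hħ x ⟨hqN, hx⟩)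
  · obtain ⟨N, hN, hqN, h1⟩ := h q hq
    exact h1.2 q ⟨hqN, hq⟩

end Growth

/-! ## Functions with Gaussian decay and their integrals along rays -/

section Gaussian

/-- Smooth functions all of whose derivatives are `O(e ^ (-c W))` for some `c > 0`. -/
def Gau (W : Pt → ℝ) (g : Pt → ℂ) : Prop :=
  ContDiff ℝ ∞ g ∧ ∃ c : ℝ, 0 < c ∧ ∀ l : List (Fin 2), ∃ C : ℝ, 0 ≤ C ∧ ∀ y,
    ‖iterPd id l g y‖ ≤ C * Real.exp (-c * W y)

variable {W W₁ W₂ W' : Pt → ℝ}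

lemma gau_iff {g : Pt → ℂ} : Gau W g ↔ ContDiff ℝ ∞ g ∧ ∃ c : ℝ, 0 < c ∧
    DerivBound id (pure 0) Set.univ (fun _ _ y => Real.exp (-c * W y)) (fun _ => g) := by
  simp only [Gau, DerivBound, eventually_pure, Set.mem_univ, forall_true_left]

lemma locDiffeo_univ : LocDiffeo id Set.univ := locDiffeo_id isOpen_univ

lemma Gau.zero : Gau W 0 := gau_iff.mpr ⟨contDiff_const, 1, one_pos, fun l => ⟨0, le_rfl, by
  have : iterPd id l (0 : Pt → ℂ) = 0 := by
    simpa using iterPd_smul (ϖ := id) 0 0 l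
  simp [this]⟩⟩

lemma Gau.mul {f g : Pt → ℂ} (hf : Gau W₁ f) (hg : Gau W₂ g) {k : ℝ} (hk : 0 < k)
    (h1 : ∀ y, 0 ≤ W₁ y) (h2 : ∀ y, 0 ≤ W₂ y) (h : ∀ y, k * W y ≤ W₁ y + W₂ y) :
    Gau W (f * g) := by
  obtain ⟨hfs, c, hc, hf⟩ := gau_iff.mp hf
  obtain ⟨hgs, c', hc', hg⟩ := gau_iff.mp hg
  refine gau_iff.mpr ⟨hfs.mul hgs, min c c' * k, by positivity,
    DerivBound.mul locDiffeo_univ (Set.subset_univ _) (Eventually.of_forall fun _ =>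
      hfs.contDiffOn) (Eventually.of_forall fun _ => hgs.contDiffOn) hf hg
      fun i j => ⟨1, zero_le_one, Eventually.of_forall fun _ y _ => ?_⟩⟩
  rw [← Real.exp_add, one_mul, Real.exp_le_exp]
  have e1 := mul_le_mul_of_nonneg_right (min_le_left c c') (h1 y)
  have e2 := mul_le_mul_of_nonneg_right (min_le_right c c') (h2 y)
  have e3 := mul_le_mul_of_nonneg_left (h y) (lt_min hc hc').le
  linarith

lemma Gau.mono {f : Pt → ℂ} (hf : Gau W₁ f) {k : ℝ} (hk : 0 < k)
    (h : ∀ y, k * W y ≤ W₁ y) : Gau W f := by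
  obtain ⟨hfs, c, hc, hf⟩ := hf
  refine ⟨hfs, c * k, by positivity, fun l => ?_⟩
  obtain ⟨C, hC, h1⟩ := hf l
  refine ⟨C, hC, fun y => (h1 y).trans (mul_le_mul_of_nonneg_left ?_ hC)⟩
  rw [Real.exp_le_exp]
  have := mul_le_mul_of_nonneg_left (h y) hc.le
  linarith

lemma Gau.smul {f : Pt → ℂ} (hf : Gau W f) (z : ℂ) : Gau W (z • f) := by
  obtain ⟨hfs, c, hc, hf⟩ := gau_iff.mp hf
  exact gau_iff.mpr ⟨contDiff_const.smul hfs, c, hc, hf.smul z⟩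

lemma Gau.add (hW : ∀ y, 0 ≤ W y) {f g : Pt → ℂ} (hf : Gau W f) (hg : Gau W g) :
    Gau W (f + g) := by
  obtain ⟨hfs, c, hc, hf⟩ := gau_iff.mp hf
  obtain ⟨hgs, c', hc', hg⟩ := gau_iff.mp hg
  refine gau_iff.mpr ⟨hfs.add hgs, min c c', lt_min hc hc', ?_⟩
  refine DerivBound.add locDiffeo_univ (Set.subset_univ _) (Eventually.of_forall fun _ =>
    hfs.contDiffOn) (Eventually.of_forall fun _ => hgs.contDiffOn)
    (hf.weaken fun j => ⟨1, zero_le_one, Eventually.of_forall fun _ y _ => ?_⟩)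
    (hg.weaken fun j => ⟨1, zero_le_one, Eventually.of_forall fun _ y _ => ?_⟩)
  · rw [one_mul, Real.exp_le_exp]
    have e1 := mul_le_mul_of_nonneg_right (min_le_left c c') (hW y)
    linarith
  · rw [one_mul, Real.exp_le_exp]
    have e1 := mul_le_mul_of_nonneg_right (min_le_right c c') (hW y)
    linarith

lemma Gau.pd {f : Pt → ℂ} (hf : Gau W f) (q : Fin 2) : Gau W (pd id q f) := by
  obtain ⟨hfs, c, hc, hf⟩ := gau_iff.mp hf
  exact gau_iff.mpr ⟨contDiffOn_univ.mp (ContDiffOn.pd locDiffeo_univ hfs.contDiffOn q), c, hc,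
    hf.pd q⟩

lemma Gau.differentiableAt {f : Pt → ℂ} (hf : Gau W f) (y : Pt) : DifferentiableAt ℝ f y :=
  (hf.1.differentiable (by simp)).differentiableAt

/-- A family of functions that is closed under derivatives consists of smooth functions. -/
lemma contDiffOn_of_family {S : Set Pt} (hS : IsOpen S) (𝓕 : Set (Pt → ℂ))
    (h : ∀ f ∈ 𝓕, (∀ x ∈ S, DifferentiableAt ℝ f x) ∧
      ∀ q, ∃ g ∈ 𝓕, Set.EqOn (pd id q f) g S) {f : Pt → ℂ} (hf : f ∈ 𝓕) :
    ContDiffOn ℝ ∞ f S := by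
  rw [contDiffOn_infty]
  intro n
  induction n generalizing f with
  | zero =>
    rw [Nat.cast_zero, contDiffOn_zero]
    exact fun x hx => ((h f hf).1 x hx).continuousAt.continuousWithinAt
  | succ n ih =>
    push_cast
    rw [contDiffOn_succ_iff_fderiv_of_isOpen hS]
    refine ⟨fun x hx => ((h f hf).1 x hx).differentiableWithinAt, by simp, ?_⟩
    have key : ∀ x, fderiv ℝ f x = ∑ q : Fin 2,
        (ContinuousLinearMap.proj q : Pt →L[ℝ] ℝ).smulRight (pd id q f x) := by
      intro x
      ext v
      rw [fderiv_eq_sum_pd locDiffeo_univ (Set.mem_univ x)]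
      simp [fderiv_id]
    have h2 : ContDiffOn ℝ n (fun x => ∑ q : Fin 2,
        (ContinuousLinearMap.proj q : Pt →L[ℝ] ℝ).smulRight (pd id q f x)) S := by
      refine ContDiffOn.sum fun q _ => ?_
      obtain ⟨g, hg, hgf⟩ := (h f hf).2 q
      exact contDiffOn_const.smulRight ((ih hg).congr hgf)
    exact h2.congr fun x _ => key x

lemma norm_fderiv_le (f : Pt → ℂ) (y : Pt) :
    ‖fderiv ℝ f y‖ ≤ ‖pd id 0 f y‖ + ‖pd id 1 f y‖ := by
  refine ContinuousLinearMap.opNorm_le_bound _ (by positivity) fun v => ?_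
  rw [fderiv_eq_sum_pd locDiffeo_univ (Set.mem_univ y), Fin.sum_univ_two]
  refine (norm_add_le _ _).trans ?_
  rw [norm_mul, norm_mul, add_mul, mul_comm ‖pd id 0 f y‖, mul_comm ‖pd id 1 f y‖]
  have : ∀ q : Fin 2, ‖((fderiv ℝ id y v q : ℝ) : ℂ)‖ ≤ ‖v‖ := fun q => by
    rw [fderiv_id, Complex.norm_real]
    exact norm_le_pi_norm v q
  exact add_le_add (mul_le_mul_of_nonneg_right (this 0) (norm_nonneg _))
    (mul_le_mul_of_nonneg_right (this 1) (norm_nonneg _))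

/-- Integral along the ray that ends at `y` and has direction `v`. -/
noncomputable def rayInt (v : Pt) (g : Pt → ℂ) : Pt → ℂ := fun y =>
  ∫ σ in Set.Ioi (0 : ℝ), g (y - σ • v)

/-- The weight `W` grows quadratically along all rays `y - ℝ_{≥ 0} v`, and it is bounded below
by `W'` there. -/
def RayDecay (v : Pt) (W W' : Pt → ℝ) : Prop :=
  (∀ y, 0 ≤ W' y) ∧ ∃ k : ℝ, 0 < k ∧ ∃ p : Pt → ℝ, Continuous p ∧
    ∀ y σ, 0 ≤ σ → W' y + k * (σ - p y) ^ 2 ≤ W (y - σ • v)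

variable {v : Pt}

lemma integrable_shifted_gauss {b : ℝ} (hb : 0 < b) (p : ℝ) :
    MeasureTheory.Integrable (fun σ : ℝ => Real.exp (-b * (σ - p) ^ 2)) :=
  (integrable_exp_neg_mul_sq hb).comp_sub_right p

lemma RayDecay.integrableOn {g : Pt → ℂ} (hg : Gau W g) (hv : RayDecay v W W') (y : Pt) :
    MeasureTheory.IntegrableOn (fun σ : ℝ => g (y - σ • v)) (Set.Ioi 0) := by
  obtain ⟨hgs, c, hc, h⟩ := hg
  obtain ⟨hW', k, hk, p, hp, hW⟩ := hv
  obtain ⟨C, hC, hb⟩ := h []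
  refine MeasureTheory.Integrable.mono'
    (g := fun σ => C * Real.exp (-(c * k) * (σ - p y) ^ 2))
    (((integrable_shifted_gauss (by positivity) _).const_mul C).integrableOn)
    (Continuous.aestronglyMeasurable (hgs.continuous.comp (by fun_prop))) ?_
  refine (MeasureTheory.ae_restrict_iff' measurableSet_Ioi).mpr (Eventually.of_forall fun σ hσ => ?_)
  refine (hb (y - σ • v)).trans (mul_le_mul_of_nonneg_left ?_ hC)
  rw [Real.exp_le_exp]
  have h1 := mul_le_mul_of_nonneg_left (hW y σ (le_of_lt hσ)) hc.le
  have h2 := mul_nonneg hc.le (hW' y)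
  nlinarith

lemma RayDecay.norm_rayInt_le {g : Pt → ℂ} {c C k : ℝ} {p : Pt → ℝ} (hc : 0 < c)
    (hC : 0 ≤ C) (hk : 0 < k) (hW : ∀ y σ, 0 ≤ σ → W' y + k * (σ - p y) ^ 2 ≤ W (y - σ • v))
    (hb : ∀ y, ‖g y‖ ≤ C * Real.exp (-c * W y)) (y : Pt) :
    ‖rayInt v g y‖ ≤ C * √(Real.pi / (c * k)) * Real.exp (-c * W' y) := by
  have hint := (integrable_shifted_gauss (show 0 < c * k by positivity) (p y)).const_mul
    (C * Real.exp (-c * W' y))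
  refine (MeasureTheory.norm_integral_le_of_norm_le
    (g := fun σ => C * Real.exp (-c * W' y) * Real.exp (-(c * k) * (σ - p y) ^ 2))
    hint.integrableOn ?_).trans ?_
  · refine (MeasureTheory.ae_restrict_iff' measurableSet_Ioi).mpr
      (Eventually.of_forall fun σ hσ => (hb _).trans ?_)
    rw [mul_assoc]
    refine mul_le_mul_of_nonneg_left ?_ hC
    rw [← Real.exp_add, Real.exp_le_exp]
    have h1 := mul_le_mul_of_nonneg_left (hW y σ (le_of_lt hσ)) hc.le
    nlinarith
  · refine (MeasureTheory.setIntegral_le_integral hint (Eventually.of_forall fun σ => by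
      positivity)).trans (le_of_eq ?_)
    rw [MeasureTheory.integral_const_mul,
      MeasureTheory.integral_sub_right_eq_self (fun σ => Real.exp (-(c * k) * σ ^ 2)) (p y),
      integral_gaussian]
    ring

lemma RayDecay.hasFDerivAt {g : Pt → ℂ} (hg : Gau W g) (hv : RayDecay v W W') (y : Pt) :
    HasFDerivAt (rayInt v g) (∫ σ in Set.Ioi (0 : ℝ), fderiv ℝ g (y - σ • v)) y ∧
      MeasureTheory.IntegrableOn (fun σ : ℝ => fderiv ℝ g (y - σ • v)) (Set.Ioi 0) := by
  have hg' := hg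
  obtain ⟨hgs, c, hc, h⟩ := hg
  have hv' := hv
  obtain ⟨hW', k, hk, p, hp, hW⟩ := hv
  obtain ⟨C₀, hC₀, hb0⟩ := h [0]
  obtain ⟨C₁, hC₁, hb1⟩ := h [1]
  have hcd : Continuous (fderiv ℝ g) := hgs.continuous_fderiv (by simp)
  have hnear : ∀ᶠ y' in 𝓝 y, |p y'| < |p y| + 1 :=
    hp.abs.continuousAt.eventually_lt continuousAt_const (lt_add_one _)
  set M := |p y| + 1
  have hbound : ∀ y' : Pt, |p y'| < M → ∀ σ : ℝ, 0 < σ → ‖fderiv ℝ g (y' - σ • v)‖ ≤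
      (C₀ + C₁) * Real.exp (c * k * M ^ 2) * Real.exp (-(c * k / 2) * σ ^ 2) := by
    intro y' hy' σ hσ
    refine (norm_fderiv_le _ _).trans ((add_le_add (hb0 _) (hb1 _)).trans ?_)
    rw [← add_mul, mul_assoc]
    refine mul_le_mul_of_nonneg_left ?_ (by positivity)
    rw [← Real.exp_add, Real.exp_le_exp]
    have h1 := mul_le_mul_of_nonneg_left (hW y' σ hσ.le) hc.le
    have h2 := mul_nonneg hc.le (hW' y')
    have h3 : p y' ^ 2 ≤ M ^ 2 := by
      rw [← sq_abs (p y')]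
      exact pow_le_pow_left₀ (abs_nonneg _) hy'.le 2
    have h4 : σ ^ 2 / 2 - M ^ 2 ≤ (σ - p y') ^ 2 := by nlinarith [sq_nonneg (σ - 2 * p y')]
    have h5 := mul_le_mul_of_nonneg_left h4 (mul_pos hc hk).le
    nlinarith
  have hbi : MeasureTheory.Integrable (fun σ : ℝ => (C₀ + C₁) * Real.exp (c * k * M ^ 2) *
      Real.exp (-(c * k / 2) * σ ^ 2)) (MeasureTheory.volume.restrict (Set.Ioi 0)) :=
    ((integrable_exp_neg_mul_sq (show 0 < c * k / 2 by positivity)).const_mul _).integrableOn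
  constructor
  · refine hasFDerivAt_integral_of_dominated_of_fderiv_le (𝕜 := ℝ)
      (F := fun y σ => g (y - σ • v)) (F' := fun y σ => fderiv ℝ g (y - σ • v)) hnear
      (Eventually.of_forall fun y' =>
        (hgs.continuous.comp (by fun_prop)).aestronglyMeasurable) (hv'.integrableOn hg' y)
      (hcd.comp (by fun_prop)).aestronglyMeasurable ?_ hbi ?_
    · exact (MeasureTheory.ae_restrict_iff' measurableSet_Ioi).mpr
        (Eventually.of_forall fun σ hσ y' hy' => hbound y' hy' σ hσ)
    · refine Eventually.of_forall fun σ y' _ => ?_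
      have h1 : HasFDerivAt g (fderiv ℝ g (y' - σ • v)) (y' - σ • v) :=
        (hg'.differentiableAt _).hasFDerivAt
      have h2 := h1.comp y' ((hasFDerivAt_id y').sub_const (σ • v))
      rw [ContinuousLinearMap.comp_id] at h2
      exact h2
  · refine MeasureTheory.Integrable.mono' hbi (hcd.comp (by fun_prop)).aestronglyMeasurable ?_
    exact (MeasureTheory.ae_restrict_iff' measurableSet_Ioi).mpr
        (Eventually.of_forall fun σ hσ => hbound y (lt_add_one _) σ hσ)

lemma RayDecay.pd_rayInt {g : Pt → ℂ} (hg : Gau W g) (hv : RayDecay v W W') (q : Fin 2) :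
    pd id q (rayInt v g) = rayInt v (pd id q g) := by
  funext y
  obtain ⟨h1, h2⟩ := hv.hasFDerivAt hg y
  rw [pd_id, h1.fderiv, ContinuousLinearMap.integral_apply h2]
  simp only [rayInt, pd_id]

lemma RayDecay.iterPd_rayInt {g : Pt → ℂ} (hg : Gau W g) (hv : RayDecay v W W')
    (l : List (Fin 2)) : iterPd id l (rayInt v g) = rayInt v (iterPd id l g) ∧
      Gau W (iterPd id l g) := by
  induction l with
  | nil => exact ⟨rfl, hg⟩
  | cons q l ih =>
    refine ⟨?_, ih.2.pd q⟩
    simp only [iterPd]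
    rw [ih.1, hv.pd_rayInt ih.2]

lemma RayDecay.gau {g : Pt → ℂ} (hg : Gau W g) (hv : RayDecay v W W') :
    Gau W' (rayInt v g) := by
  refine ⟨?_, ?_⟩
  · rw [← contDiffOn_univ]
    refine contDiffOn_of_family isOpen_univ {f | ∃ g, Gau W g ∧ f = rayInt v g} ?_ ⟨g, hg, rfl⟩
    rintro f ⟨g, hg, rfl⟩
    exact ⟨fun y _ => (hv.hasFDerivAt hg y).1.differentiableAt, fun q =>
      ⟨_, ⟨_, hg.pd q, rfl⟩, fun y _ => congrFun (hv.pd_rayInt hg q) y⟩⟩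
  · have hg' := hg
    obtain ⟨hgs, c, hc, h⟩ := hg
    have hv' := hv
    obtain ⟨hW', k, hk, p, hp, hW⟩ := hv
    refine ⟨c, hc, fun l => ?_⟩
    obtain ⟨C, hC, hb⟩ := h l
    refine ⟨C * √(Real.pi / (c * k)), by positivity, fun y => ?_⟩
    rw [(hv'.iterPd_rayInt hg' l).1]
    exact RayDecay.norm_rayInt_le hc hC hk hW hb y

lemma RayDecay.rayInt_add {f g : Pt → ℂ} (hf : Gau W f) (hg : Gau W g)
    (hv : RayDecay v W W') : rayInt v (f + g) = rayInt v f + rayInt v g := by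
  funext y
  exact MeasureTheory.integral_add (hv.integrableOn hf y) (hv.integrableOn hg y)

lemma rayInt_smul (z : ℂ) (f : Pt → ℂ) : rayInt v (z • f) = z • rayInt v f := by
  funext y
  exact MeasureTheory.integral_const_mul z _

lemma rayInt_zero : rayInt v 0 = 0 := by
  funext y
  simp [rayInt]

/-- The derivative of the integral along rays in the direction of the rays. -/
lemma RayDecay.sum_pd_rayInt {g : Pt → ℂ} (hg : Gau W g) (hv : RayDecay v W W') (y : Pt) :
    ∑ q, (v q : ℂ) * pd id q (rayInt v g) y = g y := by
  have h1 : ∀ σ : ℝ, HasDerivAt (fun σ : ℝ => g (y - σ • v))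
      (-∑ q, (v q : ℂ) * pd id q g (y - σ • v)) σ := by
    intro σ
    have e1 : HasDerivAt (fun σ : ℝ => y - σ • v) (-v) σ := by
      simpa using ((hasDerivAt_id σ).smul_const v).const_sub y
    have e2 := (hg.differentiableAt (y - σ • v)).hasFDerivAt.comp_hasDerivAt σ e1
    rw [map_neg, fderiv_eq_sum_pd locDiffeo_univ (Set.mem_univ _)] at e2
    simp only [fderiv_id, ContinuousLinearMap.id_apply] at e2
    exact e2
  have h2 : ∀ q, MeasureTheory.IntegrableOn (fun σ : ℝ => (v q : ℂ) * pd id q g (y - σ • v))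
      (Set.Ioi 0) := fun q => (hv.integrableOn (hg.pd q) y).const_mul _
  have h3 : Tendsto (fun σ : ℝ => g (y - σ • v)) atTop (𝓝 0) := by
    obtain ⟨hgs, c, hc, h⟩ := hg
    obtain ⟨hW', k, hk, p, hp, hW⟩ := hv
    obtain ⟨C, hC, hb⟩ := h []
    have e1 : Tendsto (fun σ : ℝ => C * Real.exp (-(c * k * (σ - p y) ^ 2))) atTop (𝓝 (C * 0)) := by
      refine Tendsto.const_mul C (Real.tendsto_exp_neg_atTop_nhds_zero.comp ?_)
      refine Tendsto.const_mul_atTop (by positivity) ?_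
      exact (tendsto_pow_atTop (by norm_num)).comp (tendsto_atTop_add_const_right _ _ tendsto_id)
    rw [mul_zero] at e1
    refine squeeze_zero_norm' ?_ e1
    filter_upwards [eventually_ge_atTop 0] with σ hσ
    refine (hb _).trans (mul_le_mul_of_nonneg_left ?_ hC)
    rw [Real.exp_le_exp]
    have e2 := mul_le_mul_of_nonneg_left (hW y σ hσ) hc.le
    have e3 := mul_nonneg hc.le (hW' y)
    nlinarith
  have h4 := MeasureTheory.integral_Ioi_of_hasDerivAt_of_tendsto
    (a := 0) (m := 0) (h1 0).continuousAt.continuousWithinAt (fun σ _ => h1 σ)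
    (MeasureTheory.Integrable.neg (MeasureTheory.integrable_finsetSum _ fun q _ => h2 q)) h3
  rw [MeasureTheory.integral_neg, MeasureTheory.integral_finsetSum _ (fun q _ => h2 q),
    zero_smul, sub_zero, zero_sub, neg_inj] at h4
  rw [← h4]
  refine Finset.sum_congr rfl fun q _ => ?_
  rw [hv.pd_rayInt hg q, MeasureTheory.integral_const_mul]
  rfl

/-- Invariance under translations along `v`. -/
def InvAlong (v : Pt) (g : Pt → ℂ) : Prop := ∀ y (t : ℝ), g (y + t • v) = g y

lemma InvAlong.rayInt {u : Pt} {g : Pt → ℂ} (hg : InvAlong u g) (v : Pt) :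
    InvAlong u (rayInt v g) := by
  intro y t
  simp only [ExtScattering.rayInt]
  congr 1
  funext σ
  rw [add_sub_right_comm, hg]

lemma InvAlong.pd {u : Pt} {g : Pt → ℂ} (hg : InvAlong u g) (q : Fin 2) :
    InvAlong u (pd id q g) := by
  intro y t
  have : (fun x => g (x + t • u)) = g := funext fun x => hg x t
  rw [pd_id, pd_id, ← fderiv_comp_add_right, this]

lemma InvAlong.sum_pd {u : Pt} {g : Pt → ℂ} (hg : InvAlong u g) {y : Pt}
    (hd : DifferentiableAt ℝ g y) : ∑ q, (u q : ℂ) * ExtScattering.pd id q g y = 0 := by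
  have e1 : HasDerivAt (fun t : ℝ => y + t • u) u 0 := by
    simpa using ((hasDerivAt_id (0 : ℝ)).smul_const u).const_add y
  have hd' : HasFDerivAt g (fderiv ℝ g y) (y + (0 : ℝ) • u) := by simpa using hd.hasFDerivAt
  have e2 := hd'.comp_hasDerivAt (0 : ℝ) e1
  have e3 : (g ∘ fun t : ℝ => y + t • u) = fun _ => g y := funext fun t => hg y t
  rw [e3] at e2
  have e4 := e2.unique (hasDerivAt_const _ _)
  rw [fderiv_eq_sum_pd locDiffeo_univ (Set.mem_univ _)] at e4
  simpa [fderiv_id] using e4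

/-- Integral along the line through `y` with direction `v`. -/
noncomputable def lineInt (v : Pt) (g : Pt → ℂ) : Pt → ℂ := rayInt v g + rayInt (-v) g

lemma lineInt_eq {W'' : Pt → ℝ} {g : Pt → ℂ} (hg : Gau W g) (hv : RayDecay v W W')
    (hv' : RayDecay (-v) W W'') (y : Pt) : lineInt v g y = ∫ σ : ℝ, g (y - σ • v) := by
  have h2 : MeasureTheory.IntegrableOn (fun σ : ℝ => g (y - σ • v)) (Set.Iic 0) := by
    rw [integrableOn_Iic_iff_integrableOn_Iio]
    have h := hv'.integrableOn hg y
    rw [← neg_zero] at h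
    simpa using h.comp_neg_Iio
  rw [← MeasureTheory.setIntegral_univ, ← Set.Iic_union_Ioi (a := (0 : ℝ)),
    MeasureTheory.setIntegral_union (Set.Iic_disjoint_Ioi le_rfl) measurableSet_Ioi h2
      (hv.integrableOn hg y), lineInt, Pi.add_apply, add_comm]
  congr 1
  have := integral_comp_neg_Ioi (0 : ℝ) (fun σ : ℝ => g (y - σ • v))
  rw [neg_zero] at this
  rw [← this]
  simp [rayInt]

lemma invAlong_lineInt {W'' : Pt → ℝ} {g : Pt → ℂ} (hg : Gau W g) (hv : RayDecay v W W')
    (hv' : RayDecay (-v) W W'') : InvAlong v (lineInt v g) := by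
  intro y t
  rw [lineInt_eq hg hv hv', lineInt_eq hg hv hv',
    ← MeasureTheory.integral_sub_right_eq_self (fun σ : ℝ => g (y - σ • v)) t]
  congr 1
  funext σ
  rw [sub_smul]
  congr 1
  abel

end Gaussian

section Weights

/-- The squared Euclidean length. -/
def normSqW (y : Pt) : ℝ := y 0 ^ 2 + y 1 ^ 2

/-- The determinant of two vectors. -/
def detP (v y : Pt) : ℝ := v 0 * y 1 - v 1 * y 0

/-- The inner product. -/
def dotP (v y : Pt) : ℝ := v 0 * y 0 + v 1 * y 1

/-- The weight of functions concentrated along the line spanned by `v`. -/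
def lineW (v y : Pt) : ℝ := detP v y ^ 2

/-- The weight of functions concentrated along the ray spanned by `v`. -/
noncomputable def rayW (v y : Pt) : ℝ := (detP v y ^ 2 + min (dotP v y) 0 ^ 2) / normSqW v

/-- The weight of functions that decay where `η` tends to `-∞`. -/
def negW (η : Pt →L[ℝ] ℝ) (y : Pt) : ℝ := min (η y) 0 ^ 2

/-- The weight of functions concentrated near the kernel of `η`. -/
def sqW (η : Pt →L[ℝ] ℝ) (y : Pt) : ℝ := η y ^ 2

lemma normSqW_pos {v : Pt} (hv : v ≠ 0) : 0 < normSqW v := by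
  by_contra h
  apply hv
  rw [normSqW] at h
  funext i
  fin_cases i <;> simp <;> nlinarith [sq_nonneg (v 0), sq_nonneg (v 1)]

lemma normSqW_nonneg (v : Pt) : 0 ≤ normSqW v := by rw [normSqW]; positivity

lemma rayW_nonneg (v y : Pt) : 0 ≤ rayW v y := div_nonneg (by positivity) (normSqW_nonneg v)

lemma lineW_nonneg (v y : Pt) : 0 ≤ lineW v y := sq_nonneg _

lemma rayDecay_point {v : Pt} (hv : v ≠ 0) : RayDecay v normSqW (rayW v) := by
  refine ⟨rayW_nonneg v, normSqW v, normSqW_pos hv, fun y => max (dotP v y) 0 / normSqW v,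
    by unfold dotP; fun_prop, fun y σ hσ => ?_⟩
  have hN := normSqW_pos hv
  have key : normSqW (y - σ • v) =
      detP v y ^ 2 / normSqW v + (dotP v y - σ * normSqW v) ^ 2 / normSqW v := by
    field_simp
    simp only [normSqW, detP, dotP, Pi.sub_apply, Pi.smul_apply, smul_eq_mul]
    ring
  rw [key, rayW, add_div, add_assoc]
  refine add_le_add le_rfl ?_
  have h2 : normSqW v * (σ - max (dotP v y) 0 / normSqW v) ^ 2 =
      (max (dotP v y) 0 - σ * normSqW v) ^ 2 / normSqW v := by
    field_simp
    ring
  rw [h2, ← add_div]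
  refine div_le_div_of_nonneg_right ?_ hN.le
  rcases le_total (dotP v y) 0 with h | h
  · rw [min_eq_left h, max_eq_right h]
    nlinarith [mul_nonneg hσ hN.le]
  · rw [min_eq_right h, max_eq_left h]
    simp

lemma rayDecay_sqW {v : Pt} {η : Pt →L[ℝ] ℝ} (h : η v = 1) : RayDecay v (sqW η) (negW η) := by
  refine ⟨fun y => sq_nonneg _, 1, one_pos, fun y => max (η y) 0, by fun_prop, fun y σ hσ => ?_⟩
  simp only [negW, sqW, map_sub, map_smul, h, smul_eq_mul, mul_one, one_mul]
  rcases le_total (η y) 0 with h | h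
  · rw [min_eq_left h, max_eq_right h]
    nlinarith
  · rw [min_eq_right h, max_eq_left h]
    nlinarith

lemma sqW_neg (η : Pt →L[ℝ] ℝ) : sqW (-η) = sqW η := by
  funext y
  simp [sqW]

lemma rayDecay_sqW_neg {v : Pt} {η : Pt →L[ℝ] ℝ} (h : η v = 1) :
    RayDecay (-v) (sqW η) (negW (-η)) := by
  rw [← sqW_neg]
  exact rayDecay_sqW (by simp [h])

lemma normSqW_le_lineW {u v : Pt} (h : detP u v ≠ 0) :
    ∃ k : ℝ, 0 < k ∧ ∀ y, k * normSqW y ≤ lineW u y + lineW v y := by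
  have hN : 0 < normSqW u + normSqW v := by
    refine add_pos_of_pos_of_nonneg (normSqW_pos ?_) (normSqW_nonneg v)
    rintro rfl
    simp [detP] at h
  refine ⟨detP u v ^ 2 / (2 * (normSqW u + normSqW v)), by positivity, fun y => ?_⟩
  rw [div_mul_eq_mul_div, div_le_iff₀ (by positivity)]
  have e0 : detP u v * y 0 = v 0 * detP u y - u 0 * detP v y := by simp only [detP]; ring
  have e1 : detP u v * y 1 = v 1 * detP u y - u 1 * detP v y := by simp only [detP]; ring
  have : detP u v ^ 2 * normSqW y = (detP u v * y 0) ^ 2 + (detP u v * y 1) ^ 2 := by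
    rw [normSqW]; ring
  rw [this, e0, e1]
  simp only [lineW, normSqW]
  nlinarith [sq_nonneg (v 0 * detP u y + u 0 * detP v y),
    sq_nonneg (v 1 * detP u y + u 1 * detP v y), sq_nonneg (v 0 * detP v y),
    sq_nonneg (v 1 * detP v y), sq_nonneg (u 0 * detP u y), sq_nonneg (u 1 * detP u y)]

end Weights

/-! ## Polynomials in the parameter -/

section Polynomials

/-- Polynomials in the parameter whose coefficients belong to the class `C`. -/
inductive PolyIn (C : (Pt → ℂ) → Prop) : HFun → Prop
  | of {g : Pt → ℂ} : C g → PolyIn C (fun _ => g)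
  | add {f g : HFun} : PolyIn C f → PolyIn C g → PolyIn C (f + g)
  | eps {f : HFun} : PolyIn C f → PolyIn C (fun ε p => (ε : ℂ) * f ε p)

/-- A class of functions that is a linear space. -/
structure LinClass (C : (Pt → ℂ) → Prop) : Prop where
  zero : C 0
  add : ∀ {f g}, C f → C g → C (f + g)
  smul : ∀ (z : ℂ) {f}, C f → C (z • f)

variable {C C₁ C₂ C₃ : (Pt → ℂ) → Prop}

lemma PolyIn.apply (hC : LinClass C) {f : HFun} (hf : PolyIn C f) (ε : ℝ) : C (f ε) := by
  induction hf with
  | of h => exact h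
  | add _ _ h1 h2 => exact hC.add h1 h2
  | eps _ h => exact hC.smul (ε : ℂ) h

lemma PolyIn.mono (h : ∀ g, C₁ g → C₂ g) {f : HFun} (hf : PolyIn C₁ f) : PolyIn C₂ f := by
  induction hf with
  | of h1 => exact PolyIn.of (h _ h1)
  | add _ _ h1 h2 => exact h1.add h2
  | eps _ h => exact h.eps

lemma PolyIn.zero (hC : LinClass C) : PolyIn C 0 := PolyIn.of hC.zero

lemma PolyIn.smul (hC : LinClass C) {f : HFun} (hf : PolyIn C f) (z : ℂ) : PolyIn C (z • f) := by
  induction hf with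
  | of h => exact PolyIn.of (hC.smul z h)
  | add _ _ h1 h2 => rw [smul_add]; exact h1.add h2
  | @eps f _ h =>
    have : (z • fun (ε : ℝ) (p : Pt) => (ε : ℂ) * f ε p) = fun (ε : ℝ) p => (ε : ℂ) * (z • f) ε p := by
      funext ε p
      simp only [Pi.smul_apply, smul_eq_mul]
      ring
    rw [this]
    exact h.eps

lemma PolyIn.neg (hC : LinClass C) {f : HFun} (hf : PolyIn C f) : PolyIn C (-f) := by
  simpa using hf.smul hC (-1)

lemma PolyIn.mul (h : ∀ f g, C₁ f → C₂ g → C₃ (f * g)) {f g : HFun} (hf : PolyIn C₁ f)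
    (hg : PolyIn C₂ g) : PolyIn C₃ (f * g) := by
  induction hf with
  | @of f h1 =>
    induction hg with
    | of h2 => exact PolyIn.of (h _ _ h1 h2)
    | add _ _ h2 h3 => rw [mul_add]; exact h2.add h3
    | @eps g _ h2 =>
      have : ((fun _ => f : HFun) * fun (ε : ℝ) (p : Pt) => (ε : ℂ) * g ε p) =
          fun (ε : ℝ) p => (ε : ℂ) * ((fun _ => f : HFun) * g) ε p := by
        funext ε p
        simp only [Pi.mul_apply]
        ring
      rw [this]
      exact h2.eps
  | add _ _ h1 h2 => rw [add_mul]; exact h1.add h2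
  | @eps f _ h1 =>
    have : ((fun (ε : ℝ) (p : Pt) => (ε : ℂ) * f ε p) * g) = fun (ε : ℝ) p => (ε : ℂ) * (f * g) ε p := by
      funext ε p
      simp only [Pi.mul_apply]
      ring
    rw [this]
    exact h1.eps

lemma PolyIn.map (hC : LinClass C₁) (D : (Pt → ℂ) → Pt → ℂ) (hD : ∀ f, C₁ f → C₂ (D f))
    (hadd : ∀ f g, C₁ f → C₁ g → D (f + g) = D f + D g) (hsmul : ∀ (z : ℂ) f, D (z • f) = z • D f)
    {f : HFun} (hf : PolyIn C₁ f) : PolyIn C₂ (fun ε => D (f ε)) := by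
  induction hf with
  | of h => exact PolyIn.of (hD _ h)
  | @add f g h1 h2 h3 h4 =>
    have : (fun ε => D ((f + g) ε)) = (fun ε => D (f ε)) + fun ε => D (g ε) :=
      funext fun ε => hadd _ _ (h1.apply hC ε) (h2.apply hC ε)
    rw [this]
    exact h3.add h4
  | @eps f _ h =>
    have : (fun ε => D ((fun (ε : ℝ) (p : Pt) => (ε : ℂ) * f ε p) ε)) =
        fun (ε : ℝ) p => (ε : ℂ) * D (f ε) p := funext fun ε => hsmul (ε : ℂ) (f ε)
    rw [this]
    exact h.eps

/-- Polynomials in the parameter are Lipschitz at `0`. -/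
lemma PolyIn.lipschitz (hC : LinClass C) (Λ : (Pt → ℂ) → ℂ)
    (hadd : ∀ f g, C f → C g → Λ (f + g) = Λ f + Λ g) (hsmul : ∀ (z : ℂ) f, Λ (z • f) = z • Λ f)
    {f : HFun} (hf : PolyIn C f) : ∃ K : ℝ, 0 ≤ K ∧ ∀ ε : ℝ, 0 ≤ ε → ε ≤ 1 →
      ‖Λ (f ε) - Λ (f 0)‖ ≤ K * ε := by
  induction hf with
  | of h => exact ⟨0, le_rfl, fun ε _ _ => by simp⟩
  | @add f g h1 h2 h3 h4 =>
    obtain ⟨K, hK, h3⟩ := h3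
    obtain ⟨K', hK', h4⟩ := h4
    refine ⟨K + K', by positivity, fun ε h0 h5 => ?_⟩
    rw [Pi.add_apply, Pi.add_apply, hadd _ _ (h1.apply hC _) (h2.apply hC _),
      hadd _ _ (h1.apply hC _) (h2.apply hC _), add_sub_add_comm, add_mul]
    exact (norm_add_le _ _).trans (add_le_add (h3 ε h0 h5) (h4 ε h0 h5))
  | @eps f _ h =>
    obtain ⟨K, hK, h⟩ := h
    refine ⟨K + ‖Λ (f 0)‖, by positivity, fun ε h0 h5 => ?_⟩
    have e : ∀ ε : ℝ, Λ (fun p => (ε : ℂ) * f ε p) = (ε : ℂ) * Λ (f ε) := fun ε => hsmul (ε : ℂ) _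
    rw [e, e, Complex.ofReal_zero, zero_mul, sub_zero, norm_mul, Complex.norm_real,
      Real.norm_of_nonneg h0, mul_comm]
    refine mul_le_mul_of_nonneg_right ?_ h0
    calc ‖Λ (f ε)‖ = ‖(Λ (f ε) - Λ (f 0)) + Λ (f 0)‖ := by rw [sub_add_cancel]
      _ ≤ ‖Λ (f ε) - Λ (f 0)‖ + ‖Λ (f 0)‖ := norm_add_le _ _
      _ ≤ K + ‖Λ (f 0)‖ := by
        have := h ε h0 h5
        have h6 : K * ε ≤ K := mul_le_of_le_one_right hK h5
        linarith

variable {W : Pt → ℝ}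

lemma Gau.linClass (hW : ∀ y, 0 ≤ W y) : LinClass (Gau W) :=
  ⟨Gau.zero, fun h1 h2 => h1.add hW h2, fun z _ h => h.smul z⟩

/-- The derivatives of polynomials are bounded uniformly in the parameter. -/
lemma PolyIn.bound (hW : ∀ y, 0 ≤ W y) {f : HFun} (hf : PolyIn (Gau W) f) :
    (∀ ε, ContDiff ℝ ∞ (f ε)) ∧ ∃ c : ℝ, 0 < c ∧ DerivBound id (𝓟 (Set.Icc 0 1)) Set.univ
      (fun _ _ y => Real.exp (-c * W y)) f := by
  refine ⟨fun ε => (hf.apply (Gau.linClass hW) ε).1, ?_⟩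
  induction hf with
  | of h =>
    obtain ⟨_, c, hc, h⟩ := h
    refine ⟨c, hc, fun l => ?_⟩
    obtain ⟨C, hC, h⟩ := h l
    exact ⟨C, hC, Eventually.of_forall fun _ y _ => h y⟩
  | @add f g hf hg h1 h2 =>
    obtain ⟨c, hc, h1⟩ := h1
    obtain ⟨c', hc', h2⟩ := h2
    refine ⟨min c c', lt_min hc hc', DerivBound.add locDiffeo_univ (Set.subset_univ _)
      (Eventually.of_forall fun ε => (hf.apply (Gau.linClass hW) ε).1.contDiffOn)
      (Eventually.of_forall fun ε => (hg.apply (Gau.linClass hW) ε).1.contDiffOn)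
      (h1.weaken fun j => ⟨1, zero_le_one, Eventually.of_forall fun _ y _ => ?_⟩)
      (h2.weaken fun j => ⟨1, zero_le_one, Eventually.of_forall fun _ y _ => ?_⟩)⟩
    · rw [one_mul, Real.exp_le_exp]
      have e1 := mul_le_mul_of_nonneg_right (min_le_left c c') (hW y)
      linarith
    · rw [one_mul, Real.exp_le_exp]
      have e1 := mul_le_mul_of_nonneg_right (min_le_right c c') (hW y)
      linarith
  | @eps f _ h =>
    obtain ⟨c, hc, h⟩ := h
    refine ⟨c, hc, fun l => ?_⟩
    obtain ⟨C, hC, h⟩ := h l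
    refine ⟨C, hC, ?_⟩
    rw [eventually_principal] at h ⊢
    intro ε hε y hy
    change ‖iterPd id l ((ε : ℂ) • f ε) y‖ ≤ _
    rw [iterPd_smul, Pi.smul_apply, norm_smul, Complex.norm_real, Real.norm_of_nonneg hε.1]
    exact (mul_le_of_le_one_left (norm_nonneg _) hε.2).trans (h ε hε y hy)

/-- The flat covariant derivative of a polynomial. -/
lemma PolyIn.covC {r : ℕ} (hC : LinClass C) (hpd : ∀ f q, C f → C (pd id q f))
    (hdiff : ∀ f, C f → Differentiable ℝ f) (κ : ℂ) (c : Comp r) (m : Lam) (k : Fin 2) {f : HFun}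
    (hf : PolyIn C f) : PolyIn C (covC κ id (fun _ _ _ => 0) c m k f) := by
  have e : ExtScattering.covC κ id (fun _ _ _ => 0) c m k f =
      (m k : ℂ) • f + κ • fun (ε : ℝ) p => (ε : ℂ) * (fun ε => ExtScattering.pd id k (f ε)) ε p := by
    funext ε p
    rcases c with c | c <;>
    · simp only [ExtScattering.covC, Pi.add_apply, Pi.smul_apply, smul_eq_mul]
      ring
  rw [e]
  refine (hf.smul hC _).add (PolyIn.smul hC (PolyIn.eps ?_) κ)
  exact hf.map hC _ (fun f h => hpd f k h) (fun f g h1 h2 => funext fun p =>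
    pd_add (hdiff f h1 p) (hdiff g h2 p) k) fun z f => pd_smul _ _ _ _

/-- The flat bracket of polynomials. -/
lemma PolyIn.brf {r : ℕ} (hC₁ : LinClass C₁) (hC₂ : LinClass C₂) (hC₃ : LinClass C₃)
    (hpd₁ : ∀ f q, C₁ f → C₁ (pd id q f)) (hpd₂ : ∀ f q, C₂ f → C₂ (pd id q f))
    (hd₁ : ∀ f, C₁ f → Differentiable ℝ f) (hd₂ : ∀ f, C₂ f → Differentiable ℝ f)
    (hmul : ∀ f g, C₁ f → C₂ g → C₃ (f * g)) (κ : ℂ) (m m' : Lam) {x y : Comp r → HFun}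
    (hx : ∀ c, PolyIn C₁ (x c)) (hy : ∀ c, PolyIn C₂ (y c)) (c : Comp r) :
    PolyIn C₃ (brf κ id m m' x y c) :=
  brc_rel κ id (fun _ _ _ => 0) (fun f _ => PolyIn C₁ f) (fun f _ => PolyIn C₂ f)
    (fun f _ => PolyIn C₃ f) m m' (fun c k _ _ h => h.covC hC₁ hpd₁ hd₁ κ c m k)
    (fun c k _ _ h => h.covC hC₂ hpd₂ hd₂ κ c m' k) (fun _ _ _ _ hf hg => hf.mul hmul hg)
    (PolyIn.zero hC₃) (fun _ _ _ _ h1 h2 => h1.add h2) (fun _ _ h => h.neg hC₃)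
    (x' := x) (y' := y) hx hy c

end Polynomials

/-! ## Rescaling -/

section Rescaling

/-- The function of `ħ` and `x` obtained from a function of `√ħ` and `(x - m0) / √ħ`. -/
noncomputable def rescale (m0 : Pt) (d : ℤ) (f : HFun) : HFun := fun ħ x =>
  ((ħ ^ (-(d : ℝ) / 2) : ℝ) : ℂ) * f (√ħ) ((√ħ)⁻¹ • (x - m0))

variable {m0 : Pt} {d d' : ℤ}

lemma rescale_zero : rescale m0 d 0 = 0 := by
  funext ħ x
  simp [rescale]

lemma rescale_add (f g : HFun) : rescale m0 d (f + g) = rescale m0 d f + rescale m0 d g := by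
  funext ħ x
  simp only [rescale, Pi.add_apply]
  ring

lemma rescale_smul (z : ℂ) (f : HFun) : rescale m0 d (z • f) = z • rescale m0 d f := by
  funext ħ x
  simp only [rescale, Pi.smul_apply, smul_eq_mul]
  ring

lemma rescale_mul (f g : HFun) {ħ : ℝ} (hħ : 0 < ħ) :
    (rescale m0 d f * rescale m0 d' g) ħ = rescale m0 (d + d') (f * g) ħ := by
  funext x
  have : ħ ^ (-((d + d' : ℤ) : ℝ) / 2) = ħ ^ (-(d : ℝ) / 2) * ħ ^ (-(d' : ℝ) / 2) := by
    rw [← Real.rpow_add hħ]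
    congr 1
    push_cast
    ring
  simp only [rescale, Pi.mul_apply, this]
  push_cast
  ring

lemma pd_rescale (f : HFun) {ħ : ℝ} (hħ : 0 < ħ) (q : Fin 2) :
    pd id q (rescale m0 d f ħ) = rescale m0 (d + 1) (fun ε => pd id q (f ε)) ħ := by
  funext x
  have e1 : rescale m0 d f ħ = ((ħ ^ (-(d : ℝ) / 2) : ℝ) : ℂ) •
      fun x => (fun y => f (√ħ) ((√ħ)⁻¹ • y)) (x - m0) := rfl
  have e2 : ħ ^ (-((d + 1 : ℤ) : ℝ) / 2) = ħ ^ (-(d : ℝ) / 2) * (√ħ)⁻¹ := by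
    rw [Real.sqrt_eq_rpow, ← Real.rpow_neg hħ.le, ← Real.rpow_add hħ]
    congr 1
    push_cast
    ring
  have e3 : fderiv ℝ (fun x => (fun y => f (√ħ) ((√ħ)⁻¹ • y)) (x - m0)) x =
      (√ħ)⁻¹ • fderiv ℝ (f (√ħ)) ((√ħ)⁻¹ • (x - m0)) := by
    rw [← fderiv_comp_smul]
    exact fderiv_comp_sub (𝕜 := ℝ) (f := fun y : Pt => f (√ħ) ((√ħ)⁻¹ • y)) (x := x) m0
  rw [e1, pd_smul, Pi.smul_apply, pd_id, e3]
  simp only [rescale, e2, pd_id, _root_.smul_apply, smul_eq_mul, Complex.real_smul]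
  push_cast
  ring

lemma iterPd_rescale (f : HFun) {ħ : ℝ} (hħ : 0 < ħ) (l : List (Fin 2)) :
    iterPd id l (rescale m0 d f ħ) =
      rescale m0 (d + l.length) (fun ε => iterPd id l (f ε)) ħ := by
  induction l with
  | nil => simp [iterPd]
  | cons q l ih =>
    simp only [iterPd]
    rw [ih, pd_rescale _ hħ]
    simp [add_assoc]

lemma norm_rescale (f : HFun) {ħ : ℝ} (hħ : 0 < ħ) (x : Pt) :
    ‖rescale m0 d f ħ x‖ = ħ ^ (-(d : ℝ) / 2) * ‖f (√ħ) ((√ħ)⁻¹ • (x - m0))‖ := by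
  rw [rescale, norm_mul, Complex.norm_real, Real.norm_of_nonneg (Real.rpow_nonneg hħ.le _)]

variable {W : Pt → ℝ}

lemma PolyIn.smooth_rescale (hW : ∀ y, 0 ≤ W y) {f : HFun} (hf : PolyIn (Gau W) f) (S : Set Pt) :
    Smooth S (rescale m0 d f) := fun ħ _ => by
  refine ContDiff.contDiffOn (contDiff_const.mul ((hf.bound hW).1 (√ħ) |>.comp ?_))
  fun_prop

lemma sqrt_mem_Icc {ħ : ℝ} (h : ħ ∈ Set.Ioo (0 : ℝ) 1) : √ħ ∈ Set.Icc (0 : ℝ) 1 :=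
  ⟨Real.sqrt_nonneg _, Real.sqrt_le_one.mpr h.2.le⟩

/-- Rescaled functions are tempered. -/
lemma PolyIn.wP_rescale (hW : ∀ y, 0 ≤ W y) {f : HFun} (hf : PolyIn (Gau W) f) (S : Set Pt) :
    WP id d S (rescale m0 d f) := by
  refine ⟨hf.smooth_rescale hW S, wPow_iff.mpr fun q _ => ⟨Set.univ, univ_mem, fun l => ?_⟩⟩
  obtain ⟨c, hc, hb⟩ := (hf.bound hW).2
  obtain ⟨C, hC, hb⟩ := hb l
  rw [eventually_principal] at hb
  refine ⟨C, hC, ?_⟩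
  filter_upwards [Ioo_mem_nhdsGT (zero_lt_one (α := ℝ))] with ħ hħ x _
  rw [iterPd_rescale _ hħ.1, norm_rescale _ hħ.1, mul_comm, wtPow]
  push_cast
  refine mul_le_mul_of_nonneg_right ?_ (Real.rpow_nonneg hħ.1.le _)
  refine (hb _ (sqrt_mem_Icc hħ) _ (Set.mem_univ _)).trans (mul_le_of_le_one_right hC ?_)
  rw [Real.exp_le_one_iff]
  nlinarith [hW ((√ħ)⁻¹ • (x - m0))]

/-- Rescaled functions are exponentially small where the weight is positive. -/
lemma PolyIn.wE_rescale (hW : ∀ y, 0 ≤ W y) (hWc : Continuous W)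
    (hWh : ∀ t : ℝ, 0 ≤ t → ∀ y, W (t • y) = t ^ 2 * W y) {f : HFun} (hf : PolyIn (Gau W) f)
    {S : Set Pt} (hS : ∀ x ∈ S, 0 < W (x - m0)) : WE id S (rescale m0 d f) := by
  refine ⟨hf.smooth_rescale hW S, wExp_iff.mpr fun q hq => ?_⟩
  have hq' := hS q hq
  obtain ⟨c, hc, hb⟩ := (hf.bound hW).2
  have hV : ∀ᶠ x in 𝓝 q, W (q - m0) / 2 < W (x - m0) :=
    ContinuousAt.eventually_lt continuousAt_const (by fun_prop) (by linarith)
  set δ := W (q - m0) / 2 with hδ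
  have hδ0 : 0 < δ := by positivity
  refine ⟨{x | δ < W (x - m0)}, hV, c * δ / 2, by positivity, fun l => ?_⟩
  obtain ⟨C, hC, hb⟩ := hb l
  rw [eventually_principal] at hb
  obtain ⟨C', hC', hw⟩ := wtExp_mul_wtPow_le (show 0 < c * δ by positivity) d Set.univ 0 l.length
  refine ⟨C * C', by positivity, ?_⟩
  filter_upwards [Ioo_mem_nhdsGT (zero_lt_one (α := ℝ)), hw] with ħ hħ hw x hx
  rw [iterPd_rescale _ hħ.1, norm_rescale _ hħ.1]
  have h1 := hb _ (sqrt_mem_Icc hħ) ((√ħ)⁻¹ • (x - m0)) (Set.mem_univ _)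
  have h2 : Real.exp (-c * W ((√ħ)⁻¹ • (x - m0))) ≤ Real.exp (-(c * δ) / ħ) := by
    rw [Real.exp_le_exp, hWh _ (by positivity), inv_pow, Real.sq_sqrt hħ.1.le, neg_mul, neg_div, neg_le_neg_iff,
      div_le_iff₀ hħ.1]
    have : c * (ħ⁻¹ * W (x - m0)) * ħ = c * W (x - m0) := by
      have := hħ.1.ne'
      field_simp
    rw [this]
    exact mul_le_mul_of_nonneg_left (le_of_lt hx) hc.le
  have h3 := hw x (Set.mem_univ _)
  simp only [wtExp, wtPow] at h3 ⊢
  push_cast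
  have h4 : 0 ≤ ħ ^ (-((d : ℝ) + l.length) / 2) := Real.rpow_nonneg hħ.1.le _
  calc _ ≤ ħ ^ (-((d : ℝ) + l.length) / 2) * (C * Real.exp (-(c * δ) / ħ)) :=
        mul_le_mul_of_nonneg_left (h1.trans (mul_le_mul_of_nonneg_left h2 hC)) h4
    _ = C * (Real.exp (-(c * δ) / ħ) * ħ ^ (-((d : ℝ) + l.length) / 2)) := by ring
    _ ≤ C * (C' * Real.exp (-(c * δ / 2) / ħ)) := mul_le_mul_of_nonneg_left h3 hC
    _ = _ := by ring

/-- The flat bracket commutes with rescaling. -/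
lemma brf_rescale {r : ℕ} (κ : ℂ) (m m' : Lam) (x y : Comp r → HFun) (c : Comp r) {ħ : ℝ}
    (hħ : 0 < ħ) : brf κ id m m' (fun c => rescale m0 d (x c)) (fun c => rescale m0 d' (y c)) c ħ =
      rescale m0 (d + d') (brf κ id m m' x y c) ħ := by
  have hcov : ∀ (d : ℤ) (c : Comp r) m k (f : HFun),
      covC κ id (fun _ _ _ => 0) c m k (rescale m0 d f) ħ =
        rescale m0 d (covC κ id (fun _ _ _ => 0) c m k f) ħ := by
    intro d c m k f
    funext p
    have e2 : ħ ^ (-((d + 1 : ℤ) : ℝ) / 2) * ħ = ħ ^ (-(d : ℝ) / 2) * √ħ := by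
      rw [Real.sqrt_eq_rpow, ← Real.rpow_add hħ, ← Real.rpow_add_one hħ.ne']
      congr 1
      push_cast
      ring
    have e3 : κ * ħ * pd id k (rescale m0 d f ħ) p =
        ((ħ ^ (-(d : ℝ) / 2) : ℝ) : ℂ) * (κ * (√ħ : ℝ) * pd id k (f (√ħ)) ((√ħ)⁻¹ • (p - m0))) := by
      rw [pd_rescale _ hħ, rescale]
      calc _ = κ * (((ħ ^ (-((d + 1 : ℤ) : ℝ) / 2) * ħ : ℝ) : ℂ)) *
            pd id k (f (√ħ)) ((√ħ)⁻¹ • (p - m0)) := by push_cast; ring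
        _ = _ := by rw [e2]; push_cast; ring
    rcases c with c | c <;>
    · simp only [covC]
      rw [e3]
      simp only [rescale, covC]
      ring
  have hmul : ∀ f g : HFun, rescale m0 d f ħ * rescale m0 d' g ħ =
      rescale m0 (d + d') (f * g) ħ := fun f g => rescale_mul f g hħ
  have hmul' : ∀ f g : HFun, rescale m0 d' g ħ * rescale m0 d f ħ =
      rescale m0 (d + d') (g * f) ħ := fun f g => by rw [mul_comm, hmul, mul_comm]
  have hsub : ∀ f g : HFun, rescale m0 (d + d') f ħ - rescale m0 (d + d') g ħ =
      rescale m0 (d + d') (f - g) ħ := fun f g => by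
    rw [sub_eq_add_neg f, ← neg_one_smul ℂ g, rescale_add, rescale_smul]
    simp [sub_eq_add_neg]
  have hsum : ∀ {ι : Type} (T : Finset ι) (f : ι → HFun), ∑ i ∈ T, rescale m0 (d + d') (f i) ħ =
      rescale m0 (d + d') (∑ i ∈ T, f i) ħ := by
    classical
    intro ι T f
    induction T using Finset.induction_on with
    | empty => simp [rescale_zero]
    | insert i T hi ih => rw [Finset.sum_insert hi, Finset.sum_insert hi, ih, rescale_add]; rfl
  rcases c with c | c
  · simp only [brf, brc, Pi.add_apply, Finset.sum_apply, Pi.sub_apply, Pi.mul_apply, hcov, hmul,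
      hmul', hsub, hsum, rescale_add]
  · simp only [brf, brc, Pi.add_apply, Finset.sum_apply, Pi.sub_apply, Pi.mul_apply, hcov, hmul,
      hmul', hsub, hsum, rescale_add, rescale_zero, Pi.zero_apply]

end Rescaling

/-! ## Smooth averages over segments -/

section Averages

open MeasureTheory

variable {U : Set Pt} {Ω : Set (ℝ × Pt)}

/-- The partial derivative of a function that depends smoothly on a parameter. -/
lemma pd_slice (hΩ : IsOpen Ω) {h : ℝ → Pt → ℂ} (hh : ContDiffOn ℝ ∞ (Function.uncurry h) Ω)
    {s : ℝ} {x : Pt} (hx : (s, x) ∈ Ω) (q : Fin 2) :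
    pd id q (h s) x = fderiv ℝ (Function.uncurry h) (s, x) (0, Pi.single q 1) ∧
      HasFDerivAt (h s) ((fderiv ℝ (Function.uncurry h) (s, x)).comp
        (ContinuousLinearMap.inr ℝ ℝ Pt)) x := by
  have h1 : HasFDerivAt (Function.uncurry h) (fderiv ℝ (Function.uncurry h) (s, x)) (s, x) :=
    ((hh.differentiableOn (by simp)).differentiableAt (hΩ.mem_nhds hx)).hasFDerivAt
  have h2 : HasFDerivAt (fun x : Pt => (s, x)) (ContinuousLinearMap.inr ℝ ℝ Pt) x :=
    hasFDerivAt_prodMk_right s x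
  have h3 : HasFDerivAt (h s) _ x := HasFDerivAt.comp x (g := Function.uncurry h) h1 h2
  refine ⟨?_, h3⟩
  rw [pd_id, h3.fderiv]
  simp

lemma contDiffOn_pd_slice (hΩ : IsOpen Ω) {h : ℝ → Pt → ℂ}
    (hh : ContDiffOn ℝ ∞ (Function.uncurry h) Ω) (q : Fin 2) :
    ContDiffOn ℝ ∞ (Function.uncurry fun s => pd id q (h s)) Ω := by
  have h1 : ContDiffOn ℝ ∞ (fderiv ℝ (Function.uncurry h)) Ω := hh.fderiv_of_isOpen hΩ (by simp)
  refine (h1.clm_apply (contDiffOn_const (c := ((0 : ℝ), (Pi.single q 1 : Pt))))).congr ?_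
  rintro ⟨s, x⟩ hx
  exact (pd_slice hΩ hh hx q).1

lemma hasFDerivAt_average (hΩ : IsOpen Ω) (hU : IsOpen U) (hsub : Set.Icc (0 : ℝ) 1 ×ˢ U ⊆ Ω)
    {h : ℝ → Pt → ℂ} (hh : ContDiffOn ℝ ∞ (Function.uncurry h) Ω) {x : Pt} (hx : x ∈ U) :
    DifferentiableAt ℝ (fun x => ∫ s in Set.Icc (0 : ℝ) 1, h s x) x ∧ ∀ q,
      pd id q (fun x => ∫ s in Set.Icc (0 : ℝ) 1, h s x) x =
        ∫ s in Set.Icc (0 : ℝ) 1, pd id q (h s) x := by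
  obtain ⟨ρ, hρ, hball⟩ := Metric.nhds_basis_closedBall.mem_iff.mp (hU.mem_nhds hx)
  have hK : IsCompact (Set.Icc (0 : ℝ) 1 ×ˢ Metric.closedBall x ρ) :=
    isCompact_Icc.prod (isCompact_closedBall x ρ)
  have hKΩ : Set.Icc (0 : ℝ) 1 ×ˢ Metric.closedBall x ρ ⊆ Ω :=
    (Set.prod_mono le_rfl hball).trans hsub
  set D : ℝ × Pt → Pt →L[ℝ] ℂ := fun z => (fderiv ℝ (Function.uncurry h) z).comp
    (ContinuousLinearMap.inr ℝ ℝ Pt)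
  have hD : ContinuousOn D Ω := by
    have h1 : ContinuousOn (fderiv ℝ (Function.uncurry h)) Ω :=
      (hh.fderiv_of_isOpen hΩ (m := ∞) (by simp)).continuousOn
    exact h1.clm_comp continuousOn_const
  obtain ⟨M, hM⟩ := hK.exists_bound_of_continuousOn (hD.mono hKΩ)
  have hslice : ∀ y ∈ U, ContinuousOn (fun s : ℝ => ((s, y) : ℝ × Pt)) (Set.Icc 0 1) ∧
      Set.MapsTo (fun s : ℝ => ((s, y) : ℝ × Pt)) (Set.Icc 0 1) Ω := fun y hy =>
    ⟨by fun_prop, fun s hs => hsub ⟨hs, hy⟩⟩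
  have hmeas : ∀ y ∈ U, ContinuousOn (fun s => h s y) (Set.Icc 0 1) := fun y hy =>
    hh.continuousOn.comp (hslice y hy).1 (hslice y hy).2
  have hDs : ∀ y ∈ U, ContinuousOn (fun s => D (s, y)) (Set.Icc 0 1) := fun y hy =>
    hD.comp (hslice y hy).1 (hslice y hy).2
  have key : HasFDerivAt (fun x => ∫ s in Set.Icc (0 : ℝ) 1, h s x)
      (∫ s in Set.Icc (0 : ℝ) 1, D (s, x)) x := by
    refine hasFDerivAt_integral_of_dominated_of_fderiv_le (𝕜 := ℝ) (F := fun x s => h s x)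
      (F' := fun x s => D (s, x)) (bound := fun _ => M) (Metric.ball_mem_nhds x hρ) ?_
      ((hmeas x hx).integrableOn_compact isCompact_Icc)
      ((hDs x hx).aestronglyMeasurable measurableSet_Icc) ?_ ?_ ?_
    · filter_upwards [hU.mem_nhds hx] with y hy
      exact (hmeas y hy).aestronglyMeasurable measurableSet_Icc
    · refine (ae_restrict_iff' measurableSet_Icc).mpr (Eventually.of_forall fun s hs y hy => ?_)
      exact hM (s, y) ⟨hs, Metric.ball_subset_closedBall hy⟩
    · exact integrable_const M
    · refine (ae_restrict_iff' measurableSet_Icc).mpr (Eventually.of_forall fun s hs y hy => ?_)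
      exact (pd_slice hΩ hh (hKΩ ⟨hs, Metric.ball_subset_closedBall hy⟩) 0).2
  refine ⟨key.differentiableAt, fun q => ?_⟩
  rw [pd_id, key.fderiv, ContinuousLinearMap.integral_apply
    ((hDs x hx).integrableOn_compact isCompact_Icc)]
  refine setIntegral_congr_fun measurableSet_Icc fun s hs => ?_
  simp only [D, (pd_slice hΩ hh (hsub ⟨hs, hx⟩) q).1]
  simp

lemma contDiffOn_average (hΩ : IsOpen Ω) (hU : IsOpen U) (hsub : Set.Icc (0 : ℝ) 1 ×ˢ U ⊆ Ω)
    {h : ℝ → Pt → ℂ} (hh : ContDiffOn ℝ ∞ (Function.uncurry h) Ω) :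
    ContDiffOn ℝ ∞ (fun x => ∫ s in Set.Icc (0 : ℝ) 1, h s x) U := by
  refine contDiffOn_of_family hU {f | ∃ h : ℝ → Pt → ℂ, ContDiffOn ℝ ∞ (Function.uncurry h) Ω ∧
    f = fun x => ∫ s in Set.Icc (0 : ℝ) 1, h s x} ?_ ⟨h, hh, rfl⟩
  rintro f ⟨h, hh, rfl⟩
  exact ⟨fun x hx => (hasFDerivAt_average hΩ hU hsub hh hx).1, fun q =>
    ⟨_, ⟨_, contDiffOn_pd_slice hΩ hh q, rfl⟩, fun x hx =>
      (hasFDerivAt_average hΩ hU hsub hh hx).2 q⟩⟩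

lemma iterPd_average (hΩ : IsOpen Ω) (hU : IsOpen U) (hsub : Set.Icc (0 : ℝ) 1 ×ˢ U ⊆ Ω)
    {h : ℝ → Pt → ℂ} (hh : ContDiffOn ℝ ∞ (Function.uncurry h) Ω) (l : List (Fin 2)) :
    Set.EqOn (iterPd id l (fun x => ∫ s in Set.Icc (0 : ℝ) 1, h s x))
      (fun x => ∫ s in Set.Icc (0 : ℝ) 1, iterPd id l (h s) x) U ∧
      ContDiffOn ℝ ∞ (Function.uncurry fun s => iterPd id l (h s)) Ω := by
  induction l with
  | nil => exact ⟨fun _ _ => rfl, hh⟩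
  | cons q l ih =>
    refine ⟨fun x hx => ?_, contDiffOn_pd_slice hΩ ih.2 q⟩
    simp only [iterPd]
    rw [pd_congr hU ih.1 q hx]
    exact (hasFDerivAt_average hΩ hU hsub ih.2 hx).2 q

/-- Derivatives of the composition with an affine map. -/
lemma norm_iterPd_comp_le (hU : IsOpen U) (A : Pt →L[ℝ] Pt) (b : Pt) {M : ℝ}
    (hM : ∀ q k, |A (Pi.single q 1) k| ≤ M) (l : List (Fin 2)) {f : Pt → ℂ}
    (hf : ContDiffOn ℝ ∞ f U) {B : ℝ} {x : Pt} (hx : A x + b ∈ U)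
    (hB : ∀ l' : List (Fin 2), l'.length = l.length → ‖iterPd id l' f (A x + b)‖ ≤ B) :
    ‖iterPd id l (fun x => f (A x + b)) x‖ ≤ (2 * M) ^ l.length * B := by
  have hM0 : 0 ≤ M := (abs_nonneg _).trans (hM 0 0)
  have hV : IsOpen {x | A x + b ∈ U} := hU.preimage (by fun_prop)
  have hcomp : ∀ {f : Pt → ℂ}, ContDiffOn ℝ ∞ f U →
      ContDiffOn ℝ ∞ (fun x => f (A x + b)) {x | A x + b ∈ U} := fun hf =>
    hf.comp (by fun_prop) fun _ h => h
  induction l using List.reverseRecOn generalizing f B with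
  | nil => simpa [iterPd] using hB [] rfl
  | append_singleton l q ih =>
    have key : Set.EqOn (pd id q (fun x => f (A x + b)))
        ((fun x => ((A (Pi.single q 1) 0 : ℝ) : ℂ) • pd id 0 f (A x + b)) +
          (fun x => ((A (Pi.single q 1) 1 : ℝ) : ℂ) • pd id 1 f (A x + b)))
        {x | A x + b ∈ U} := by
      intro y hy
      have h1 := (ContDiffOn.differentiableAt_of_isOpen hU hf hy).hasFDerivAt
      have h2 : HasFDerivAt (fun x => A x + b) A y := A.hasFDerivAt.add_const b
      have h3 : HasFDerivAt (fun x => f (A x + b)) _ y := HasFDerivAt.comp y (g := f) h1 h2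
      rw [pd_id, h3.fderiv, ContinuousLinearMap.comp_apply,
        fderiv_eq_sum_pd locDiffeo_univ (Set.mem_univ _), Fin.sum_univ_two]
      simp [fderiv_id]
    have hL : LocDiffeo id {x | A x + b ∈ U} := locDiffeo_id hV
    have hs : ∀ k, ContDiffOn ℝ ∞ (fun x => pd id k f (A x + b)) {x | A x + b ∈ U} := fun k =>
      hcomp (ContDiffOn.pd (locDiffeo_id hU) hf k)
    have hs' : ∀ (z : ℂ) k, ContDiffOn ℝ ∞ (z • fun x => pd id k f (A x + b))
        {x | A x + b ∈ U} := fun z k => contDiffOn_const.smul (hs k)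
    have hb : ∀ k, ‖iterPd id l (fun x => pd id k f (A x + b)) x‖ ≤ (2 * M) ^ l.length * B :=
      fun k => ih (ContDiffOn.pd (locDiffeo_id hU) hf k) fun l' hl' => by
        rw [← iterPd_append]
        exact hB _ (by simp [hl'])
    rw [iterPd_append, iterPd_congr hV key l hx]
    have e := iterPd_add hL (hs' ((A (Pi.single q 1) 0 : ℝ) : ℂ) 0)
      (hs' ((A (Pi.single q 1) 1 : ℝ) : ℂ) 1) l hx
    rw [iterPd_smul, iterPd_smul] at e
    refine (le_of_eq (congrArg _ e)).trans ((norm_add_le _ _).trans ?_)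
    simp only [Pi.smul_apply, norm_smul, Complex.norm_real, Real.norm_eq_abs]
    have hB0 : 0 ≤ (2 * M) ^ l.length * B := (norm_nonneg _).trans (hb 0)
    have e0 := mul_le_mul (hM q 0) (hb 0) (norm_nonneg _) hM0
    have e1 := mul_le_mul (hM q 1) (hb 1) (norm_nonneg _) hM0
    refine (add_le_add e0 e1).trans (le_of_eq ?_)
    rw [List.length_append, List.length_singleton, pow_succ]
    ring

/-- Exponentially small functions are uniformly exponentially small near compact sets. -/
lemma WE.compact {f : HFun} (hf : WE id U f) {K : Set Pt} (hK : IsCompact K) (hKU : K ⊆ U) :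
    ∃ V : Set Pt, IsOpen V ∧ K ⊆ V ∧ ∃ c : ℝ, 0 < c ∧
      DerivBound id (𝓝[>] 0) V (wtExp c) f := by
  refine hK.induction_on (p := fun K => ∃ V : Set Pt, IsOpen V ∧ K ⊆ V ∧ ∃ c : ℝ, 0 < c ∧
      DerivBound id (𝓝[>] 0) V (wtExp c) f) ?_ ?_ ?_ ?_
  · exact ⟨∅, isOpen_empty, le_rfl, 1, one_pos, fun l => ⟨0, le_rfl,
      Eventually.of_forall fun _ _ h => h.elim⟩⟩
  · rintro s t hst ⟨V, h1, h2, h3⟩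
    exact ⟨V, h1, hst.trans h2, h3⟩
  · rintro s t ⟨V, hV, hsV, c, hc, h⟩ ⟨V', hV', htV', c', hc', h'⟩
    refine ⟨V ∪ V', hV.union hV', Set.union_subset_union hsV htV', min c c', lt_min hc hc',
      fun l => ?_⟩
    obtain ⟨C, hC, h⟩ :=
      (h.weaken fun j => wtExp_anti (min_le_left c c') _ le_rfl _ j) l
    obtain ⟨C', hC', h'⟩ :=
      (h'.weaken fun j => wtExp_anti (min_le_right c c') _ le_rfl _ j) l
    refine ⟨max C C', le_max_of_le_left hC, ?_⟩
    filter_upwards [h, h'] with ħ h h' x hx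
    have hw : 0 ≤ wtExp (min c c') l.length ħ x := (Real.exp_pos _).le
    rcases hx with hx | hx
    · exact (h x hx).trans (mul_le_mul_of_nonneg_right (le_max_left _ _) hw)
    · exact (h' x hx).trans (mul_le_mul_of_nonneg_right (le_max_right _ _) hw)
  · intro x hx
    obtain ⟨V, hV, c, hc, h⟩ := wExp_iff.mp hf.2 x (hKU hx)
    exact ⟨interior V, mem_nhdsWithin_of_mem_nhds (interior_mem_nhds.mpr hV), interior V,
      isOpen_interior, le_rfl, c, hc, h.mono interior_subset⟩

end Averages

/-! ## Integration along a flow -/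

section Flow

variable {U : Set Pt} (τ : Pt →L[ℝ] ℝ) (v q0 : Pt)

/-- The point at time `s`, as a fraction of the flow time, on the way back along `v`. -/
def pathPt (s : ℝ) (x : Pt) : Pt := x - (s * τ (x - q0)) • v

/-- Integration along the flow of `v`, from the line through `q0` where `τ` is constant. -/
noncomputable def flowInt' (f : Pt → ℂ) (x : Pt) : ℂ :=
  ∫ σ in (0 : ℝ)..τ (x - q0), f (x - σ • v)

/-- The chart is adapted to the flow. -/
structure Adapted (U : Set Pt) (τ : Pt →L[ℝ] ℝ) (v q0 : Pt) : Prop where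
  isOpen : IsOpen U
  convex : Convex ℝ U
  foot : ∀ x ∈ U, x - τ (x - q0) • v ∈ U
  one : τ v = 1

variable {τ v q0}

lemma Adapted.path_mem (h : Adapted U τ v q0) {s : ℝ} (hs : s ∈ Set.Icc (0 : ℝ) 1) {x : Pt}
    (hx : x ∈ U) : pathPt τ v q0 s x ∈ U := by
  have := h.convex hx (h.foot x hx) (sub_nonneg.mpr hs.2) hs.1 (sub_add_cancel 1 s)
  convert this using 1
  rw [pathPt, smul_sub, smul_smul, sub_smul, one_smul]
  abel

lemma Adapted.path_mem' (h : Adapted U τ v q0) {x : Pt} (hx : x ∈ U) {σ : ℝ}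
    (hσ : σ ∈ Set.uIcc 0 (τ (x - q0))) : x - σ • v ∈ U := by
  rw [← segment_eq_uIcc] at hσ
  obtain ⟨a, b, ha, hb, hab, rfl⟩ := hσ
  have := h.path_mem (s := b) ⟨hb, by linarith⟩ hx
  simpa [pathPt] using this

lemma flowInt'_eq (f : Pt → ℂ) (x : Pt) :
    flowInt' τ v q0 f x =
      (τ (x - q0) : ℂ) * ∫ s in Set.Icc (0 : ℝ) 1, f (pathPt τ v q0 s x) := by
  rw [flowInt', MeasureTheory.integral_Icc_eq_integral_Ioc,
    ← intervalIntegral.integral_of_le zero_le_one]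
  have := intervalIntegral.smul_integral_comp_mul_right (a := 0) (b := 1)
    (fun σ => f (x - σ • v)) (τ (x - q0))
  rw [zero_mul, one_mul] at this
  rw [← this, Complex.real_smul]
  rfl

lemma path_isOpen (hU : IsOpen U) :
    IsOpen {z : ℝ × Pt | pathPt τ v q0 z.1 z.2 ∈ U} := by
  refine hU.preimage ?_
  unfold pathPt
  fun_prop

lemma path_contDiffOn {f : Pt → ℂ} (hf : ContDiffOn ℝ ∞ f U) :
    ContDiffOn ℝ ∞ (Function.uncurry fun s x => f (pathPt τ v q0 s x))
      {z : ℝ × Pt | pathPt τ v q0 z.1 z.2 ∈ U} := by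
  refine hf.comp (ContDiff.contDiffOn ?_) fun _ h => h
  unfold pathPt
  fun_prop

lemma Adapted.contDiffOn_flowInt' (h : Adapted U τ v q0) {f : Pt → ℂ}
    (hf : ContDiffOn ℝ ∞ f U) : ContDiffOn ℝ ∞ (flowInt' τ v q0 f) U := by
  have h1 := contDiffOn_average (path_isOpen h.isOpen) h.isOpen
    (fun z hz => h.path_mem hz.1 hz.2) (path_contDiffOn (τ := τ) (v := v) (q0 := q0) hf)
  have h2 : ContDiffOn ℝ ∞ (fun x : Pt => (τ (x - q0) : ℂ)) U :=
    (Complex.ofRealCLM.contDiff.comp (τ.contDiff.comp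
      (contDiff_id.sub contDiff_const))).contDiffOn
  exact (h2.mul h1).congr fun x _ => flowInt'_eq f x

/-- The linear part of the path maps. -/
def pathLin (τ : Pt →L[ℝ] ℝ) (v : Pt) (s : ℝ) : Pt →L[ℝ] Pt :=
  ContinuousLinearMap.id ℝ Pt - s • τ.smulRight v

lemma pathPt_eq (s : ℝ) (x : Pt) :
    pathPt τ v q0 s x = pathLin τ v s x + (s * τ q0) • v := by
  simp only [pathPt, pathLin, map_sub, mul_sub, sub_smul, _root_.sub_apply,
    ContinuousLinearMap.id_apply, _root_.smul_apply, ContinuousLinearMap.smulRight_apply, smul_smul]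
  abel

lemma exists_pathLin_bound (τ : Pt →L[ℝ] ℝ) (v : Pt) :
    ∃ M : ℝ, ∀ s ∈ Set.Icc (0 : ℝ) 1, ∀ q k, |pathLin τ v s (Pi.single q 1) k| ≤ M := by
  refine ⟨1 + ‖τ‖ * ‖v‖, fun s hs q k => ?_⟩
  have e1 : ‖(Pi.single q 1 : Pt)‖ = 1 := by
    rw [Pi.norm_single]
    simp
  have e2 : |τ (Pi.single q 1)| ≤ ‖τ‖ := by
    have := τ.le_opNorm (Pi.single q 1)
    rwa [e1, mul_one] at this
  have e3 : |v k| ≤ ‖v‖ := norm_le_pi_norm v k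
  have e4 : |(Pi.single q 1 : Pt) k| ≤ 1 := by
    have := norm_le_pi_norm (Pi.single q 1 : Pt) k
    rwa [e1, Real.norm_eq_abs] at this
  simp only [pathLin, _root_.sub_apply, ContinuousLinearMap.id_apply, _root_.smul_apply,
    ContinuousLinearMap.smulRight_apply, Pi.sub_apply, Pi.smul_apply, smul_eq_mul]
  refine (abs_sub _ _).trans (add_le_add e4 ?_)
  rw [abs_mul, abs_mul, abs_of_nonneg hs.1]
  refine mul_le_of_le_one_left (by positivity) hs.2 |>.trans ?_
  exact mul_le_mul e2 e3 (abs_nonneg _) (norm_nonneg _)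

/-- A uniform bound along the paths that start near a point of the chart. -/
lemma Adapted.exists_path_bound (h : Adapted U τ v q0) {f : HFun} (hf : WE id U f) {x : Pt}
    (hx : x ∈ U) : ∃ V ∈ 𝓝 x, ∃ c : ℝ, 0 < c ∧ ∀ l : List (Fin 2), ∃ C : ℝ, 0 ≤ C ∧
      ∀ᶠ ħ in 𝓝[>] (0 : ℝ), ∀ y ∈ V, ∀ s ∈ Set.Icc (0 : ℝ) 1,
        ‖iterPd id l (fun y => f ħ (pathPt τ v q0 s y)) y‖ ≤ C * Real.exp (-c / ħ) := by
  have hcont : Continuous fun z : ℝ × Pt => pathPt τ v q0 z.1 z.2 := by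
    unfold pathPt
    fun_prop
  have hK : IsCompact ((fun s => pathPt τ v q0 s x) '' Set.Icc (0 : ℝ) 1) :=
    isCompact_Icc.image (hcont.comp (by fun_prop : Continuous fun s : ℝ => (s, x)))
  obtain ⟨N, hN, hKN, c, hc, hb⟩ := hf.compact hK (by
    rintro _ ⟨s, hs, rfl⟩
    exact h.path_mem hs hx)
  obtain ⟨u, w, hu, hw, hIu, hxw, huw⟩ := generalized_tube_lemma isCompact_Icc isCompact_singleton
    ((hN.inter h.isOpen).preimage hcont) (s := Set.Icc (0 : ℝ) 1) (t := {x}) (by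
      rintro ⟨s, y⟩ ⟨hs, rfl⟩
      exact ⟨hKN ⟨s, hs, rfl⟩, h.path_mem hs hx⟩)
  obtain ⟨M, hM⟩ := exists_pathLin_bound τ v
  refine ⟨w, hw.mem_nhds (hxw rfl), c, hc, fun l => ?_⟩
  have hw : ∀ j, ∀ᶠ ħ in 𝓝[>] (0 : ℝ), ∀ x ∈ N, 0 ≤ wtExp c j ħ x := fun j =>
    Eventually.of_forall fun _ _ _ => (Real.exp_pos _).le
  obtain ⟨C, hC⟩ := (derivBound_iff hw).mp hb l.length
  have hM0 : 0 ≤ M := (abs_nonneg _).trans (hM 0 ⟨le_rfl, zero_le_one⟩ 0 0)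
  refine ⟨(2 * M) ^ l.length * max C 0, by positivity, ?_⟩
  filter_upwards [hC, self_mem_nhdsWithin] with ħ h1 hħ y hy s hs
  have hmem := huw (show ((s, y) : ℝ × Pt) ∈ u ×ˢ w from ⟨hIu hs, hy⟩)
  have e : (fun y => f ħ (pathPt τ v q0 s y)) =
      fun y => f ħ (pathLin τ v s y + (s * τ q0) • v) := funext fun y => by rw [pathPt_eq]
  rw [e, mul_assoc]
  refine norm_iterPd_comp_le h.isOpen _ _ (hM s hs) l (hf.1 ħ hħ) ?_ fun l' hl' => ?_
  · rw [← pathPt_eq]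
    exact hmem.2
  · rw [← pathPt_eq]
    refine (h1 _ hmem.1 l' hl').trans ?_
    exact mul_le_mul_of_nonneg_right (le_max_left _ _) (Real.exp_pos _).le

/-- Integration along the flow preserves exponential smallness. -/
lemma Adapted.wE_flowInt' (h : Adapted U τ v q0) {f : HFun} (hf : WE id U f) :
    WE id U (fun ħ => flowInt' τ v q0 (f ħ)) := by
  have hL := locDiffeo_id h.isOpen
  have hsub : Set.Icc (0 : ℝ) 1 ×ˢ U ⊆ {z : ℝ × Pt | pathPt τ v q0 z.1 z.2 ∈ U} :=
    fun z hz => h.path_mem hz.1 hz.2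
  have h1 : WE id U (fun ħ x => ∫ s in Set.Icc (0 : ℝ) 1, f ħ (pathPt τ v q0 s x)) := by
    refine ⟨fun ħ hħ => contDiffOn_average (path_isOpen h.isOpen) h.isOpen hsub
      (path_contDiffOn (hf.1 ħ hħ)), wExp_iff.mpr fun x hx => ?_⟩
    obtain ⟨V, hV, c, hc, hb⟩ := h.exists_path_bound hf hx
    refine ⟨V ∩ U, inter_mem hV (h.isOpen.mem_nhds hx), c, hc, fun l => ?_⟩
    obtain ⟨C, hC, hb⟩ := hb l
    refine ⟨C, hC, ?_⟩
    filter_upwards [hb, self_mem_nhdsWithin] with ħ hb hħ y hy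
    rw [(iterPd_average (path_isOpen h.isOpen) h.isOpen hsub
      (path_contDiffOn (hf.1 ħ hħ)) l).1 hy.2]
    refine (MeasureTheory.norm_setIntegral_le_of_norm_le_const (C := C * Real.exp (-c / ħ))
      (by simp) fun s hs => hb y hy.1 s hs).trans ?_
    simp [wtExp]
  have h2 : WP id 0 U (fun _ x => (τ (x - q0) : ℂ)) := WP.of_smooth hL
    (Complex.ofRealCLM.contDiff.comp (τ.contDiff.comp
      (contDiff_id.sub contDiff_const))).contDiffOn
  refine (h1.mul hL h2).congr h.isOpen fun ħ _ x _ => ?_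
  simp only [Pi.mul_apply, flowInt'_eq]
  ring

/-- The fundamental theorem of calculus along the flow. -/
lemma Adapted.flowInt'_deriv (h : Adapted U τ v q0) {f : Pt → ℂ} (hf : ContDiffOn ℝ ∞ f U)
    {x : Pt} (hx : x ∈ U) :
    flowInt' τ v q0 (fun y => ∑ q, (v q : ℂ) * pd id q f y) x =
      f x - f (x - τ (x - q0) • v) := by
  have h1 : ∀ σ ∈ Set.uIcc 0 (τ (x - q0)), HasDerivAt (fun σ : ℝ => f (x - σ • v))
      (-∑ q, (v q : ℂ) * pd id q f (x - σ • v)) σ := by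
    intro σ hσ
    have e1 : HasDerivAt (fun σ : ℝ => x - σ • v) (-v) σ := by
      simpa using ((hasDerivAt_id σ).smul_const v).const_sub x
    have e2 := (ContDiffOn.differentiableAt_of_isOpen h.isOpen hf
      (h.path_mem' hx hσ)).hasFDerivAt.comp_hasDerivAt σ e1
    rw [map_neg, fderiv_eq_sum_pd locDiffeo_univ (Set.mem_univ _)] at e2
    simp only [fderiv_id, ContinuousLinearMap.id_apply] at e2
    exact e2
  have h2 : ContinuousOn (fun σ : ℝ => ∑ q, (v q : ℂ) * pd id q f (x - σ • v))
      (Set.uIcc 0 (τ (x - q0))) := by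
    refine continuousOn_finsetSum _ fun q _ => continuousOn_const.mul ?_
    exact (ContDiffOn.pd (locDiffeo_id h.isOpen) hf q).continuousOn.comp (by fun_prop)
      fun σ hσ => h.path_mem' hx hσ
  have h3 := intervalIntegral.integral_eq_sub_of_hasDerivAt h1 h2.neg.intervalIntegrable
  rw [intervalIntegral.integral_neg, zero_smul, sub_zero] at h3
  rw [flowInt']
  linear_combination -h3

lemma Adapted.intervalIntegrable (h : Adapted U τ v q0) {f : Pt → ℂ} (hf : ContDiffOn ℝ ∞ f U)
    {x : Pt} (hx : x ∈ U) : IntervalIntegrable (fun σ : ℝ => f (x - σ • v))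
      MeasureTheory.volume 0 (τ (x - q0)) :=
  (hf.continuousOn.comp (by fun_prop) fun _ hσ => h.path_mem' hx hσ).intervalIntegrable

lemma Adapted.flowInt'_add (h : Adapted U τ v q0) {f g : Pt → ℂ} (hf : ContDiffOn ℝ ∞ f U)
    (hg : ContDiffOn ℝ ∞ g U) {x : Pt} (hx : x ∈ U) :
    flowInt' τ v q0 (f + g) x = flowInt' τ v q0 f x + flowInt' τ v q0 g x :=
  intervalIntegral.integral_add (h.intervalIntegrable hf hx) (h.intervalIntegrable hg hx)

lemma Adapted.flowInt'_congr (h : Adapted U τ v q0) {f g : Pt → ℂ} (hfg : Set.EqOn f g U)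
    {x : Pt} (hx : x ∈ U) : flowInt' τ v q0 f x = flowInt' τ v q0 g x :=
  intervalIntegral.integral_congr fun _ hσ => hfg (h.path_mem' hx hσ)

lemma Adapted.foot_idem (h : Adapted U τ v q0) (x : Pt) :
    τ (x - τ (x - q0) • v - q0) = 0 := by
  rw [sub_right_comm, map_sub, map_smul, h.one]
  simp

lemma Adapted.flowInt'_foot (h : Adapted U τ v q0) (f : Pt → ℂ) (x : Pt) :
    flowInt' τ v q0 f (x - τ (x - q0) • v) = 0 := by
  rw [flowInt', h.foot_idem, intervalIntegral.integral_same]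

/-- Integration along the flow inverts the derivative along the flow. -/
lemma Adapted.sum_pd_flowInt' (h : Adapted U τ v q0) {f : Pt → ℂ} (hf : ContDiffOn ℝ ∞ f U)
    {x : Pt} (hx : x ∈ U) :
    ∑ q, (v q : ℂ) * pd id q (flowInt' τ v q0 f) x = f x := by
  have hd := (ContDiffOn.differentiableAt_of_isOpen h.isOpen (h.contDiffOn_flowInt' hf) hx)
  have e1 : HasDerivAt (fun t : ℝ => x + t • v) v 0 := by
    simpa using ((hasDerivAt_id (0 : ℝ)).smul_const v).const_add x
  have hd' : HasFDerivAt (flowInt' τ v q0 f) (fderiv ℝ (flowInt' τ v q0 f) x)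
      (x + (0 : ℝ) • v) := by simpa using hd.hasFDerivAt
  have e2 := hd'.comp_hasDerivAt (0 : ℝ) e1
  rw [fderiv_eq_sum_pd locDiffeo_univ (Set.mem_univ _)] at e2
  simp only [fderiv_id, ContinuousLinearMap.id_apply] at e2
  have hshift : ∀ t : ℝ, flowInt' τ v q0 f (x + t • v) =
      ∫ σ in (-t)..τ (x - q0), f (x - σ • v) := by
    intro t
    have e3 : τ (x + t • v - q0) = τ (x - q0) + t := by
      rw [add_sub_right_comm, map_add, map_smul, h.one, smul_eq_mul, mul_one]
    have e4 := intervalIntegral.integral_comp_sub_right (a := 0) (b := τ (x - q0) + t)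
      (fun σ : ℝ => f (x - σ • v)) t
    rw [zero_sub, add_sub_cancel_right] at e4
    rw [flowInt', e3, ← e4]
    congr 1
    funext σ
    rw [sub_smul]
    congr 1
    abel
  have hc : ContinuousAt (fun σ : ℝ => f (x - σ • v)) 0 := by
    have : ContinuousAt f (x - (0 : ℝ) • v) := by
      simpa using (ContDiffOn.differentiableAt_of_isOpen h.isOpen hf hx).continuousAt
    exact ContinuousAt.comp (f := fun σ : ℝ => x - σ • v) this (by fun_prop)
  have hnear : ∀ᶠ σ : ℝ in 𝓝 0, x - σ • v ∈ U := by
    have : ContinuousAt (fun σ : ℝ => x - σ • v) 0 := by fun_prop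
    exact this (h.isOpen.mem_nhds (by simpa using hx))
  have hmeas : StronglyMeasurableAtFilter (fun σ : ℝ => f (x - σ • v)) (𝓝 0) := by
    obtain ⟨O, hO, hOo, h0⟩ := eventually_nhds_iff.mp hnear
    exact ContinuousOn.stronglyMeasurableAtFilter_nhdsWithin
      (s := O) (hf.continuousOn.comp (by fun_prop) fun σ hσ => hO σ hσ)
      hOo.measurableSet 0 |>.filter_mono (by rw [hOo.nhdsWithin_eq h0])
  have e5 : HasDerivAt (fun u : ℝ => ∫ σ in u..τ (x - q0), f (x - σ • v)) (-f x) (-0) := by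
    rw [neg_zero]
    have := intervalIntegral.integral_hasDerivAt_left (h.intervalIntegrable hf hx) hmeas hc
    simpa using this
  have e6 := e5.scomp (0 : ℝ) (hasDerivAt_neg (0 : ℝ))
  have e7 : (flowInt' τ v q0 f ∘ fun t : ℝ => x + t • v) =
      ((fun u : ℝ => ∫ σ in u..τ (x - q0), f (x - σ • v)) ∘ Neg.neg) := funext hshift
  rw [e7] at e2
  have := e2.unique e6
  simpa using this

end Flow

/-! ## Gaussian functions -/

section GaussianFunctions

lemma exists_bound_pow_mul_exp (n : ℕ) :
    ∃ C : ℝ, 0 ≤ C ∧ ∀ u : ℝ, |u| ^ n * Real.exp (-u ^ 2) ≤ C * Real.exp (-(1 / 2) * u ^ 2) := by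
  refine ⟨n.factorial * Real.exp (1 / 2), by positivity, fun u => ?_⟩
  have h1 : |u| ^ n ≤ n.factorial * Real.exp |u| := by
    have := Real.pow_div_factorial_le_exp |u| (abs_nonneg u) n
    rwa [div_le_iff₀' (by positivity)] at this
  calc |u| ^ n * Real.exp (-u ^ 2)
      ≤ n.factorial * Real.exp |u| * Real.exp (-u ^ 2) :=
        mul_le_mul_of_nonneg_right h1 (Real.exp_pos _).le
    _ ≤ n.factorial * Real.exp (1 / 2) * Real.exp (-(1 / 2) * u ^ 2) := by
        rw [mul_assoc, mul_assoc, ← Real.exp_add, ← Real.exp_add]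
        refine mul_le_mul_of_nonneg_left (Real.exp_le_exp.mpr ?_) (by positivity)
        nlinarith [sq_nonneg (|u| - 1), sq_abs u]

lemma exists_bound_eval_mul_exp (P : Polynomial ℝ) :
    ∃ C : ℝ, 0 ≤ C ∧ ∀ u : ℝ, |P.eval u| * Real.exp (-u ^ 2) ≤
      C * Real.exp (-(1 / 2) * u ^ 2) := by
  induction P using Polynomial.induction_on' with
  | add P Q hP hQ =>
    obtain ⟨C, hC, hP⟩ := hP
    obtain ⟨C', hC', hQ⟩ := hQ
    refine ⟨C + C', by positivity, fun u => ?_⟩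
    rw [Polynomial.eval_add, add_mul]
    refine (mul_le_mul_of_nonneg_right (abs_add_le _ _) (Real.exp_pos _).le).trans ?_
    rw [add_mul]
    exact add_le_add (hP u) (hQ u)
  | monomial n a =>
    obtain ⟨C, hC, h⟩ := exists_bound_pow_mul_exp n
    refine ⟨|a| * C, by positivity, fun u => ?_⟩
    rw [Polynomial.eval_monomial, abs_mul, abs_pow, mul_assoc, mul_assoc]
    exact mul_le_mul_of_nonneg_left (h u) (abs_nonneg a)

/-- Gaussian functions decay away from the kernel of the linear form. -/
lemma gau_gauss (η : Pt →L[ℝ] ℝ) :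
    Gau (sqW η) (fun y => ((Real.exp (-(η y) ^ 2) : ℝ) : ℂ)) := by
  set f : Polynomial ℝ → Pt → ℂ := fun P y =>
    ((P.eval (η y) * Real.exp (-(η y) ^ 2) : ℝ) : ℂ) with hf
  have hpd : ∀ P q, ∃ Q, pd id q (f P) = f Q := by
    intro P q
    refine ⟨Polynomial.C (η (Pi.single q 1)) *
      (P.derivative - Polynomial.C 2 * Polynomial.X * P), funext fun y => ?_⟩
    have h1 : HasDerivAt (fun u : ℝ => P.eval u * Real.exp (-u ^ 2))
        (P.derivative.eval (η y) * Real.exp (-(η y) ^ 2) +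
          P.eval (η y) * (Real.exp (-(η y) ^ 2) * -(2 * η y))) (η y) := by
      refine (P.hasDerivAt (η y)).mul (HasDerivAt.exp ?_)
      exact HasDerivAt.congr_deriv (hasDerivAt_pow 2 (η y)).neg (by simp)
    have h2 : HasFDerivAt (fun y => P.eval (η y) * Real.exp (-(η y) ^ 2)) _ y :=
      h1.comp_hasFDerivAt y η.hasFDerivAt
    have h3 : HasFDerivAt (f P) _ y := Complex.ofRealCLM.hasFDerivAt.comp y h2
    rw [pd_id, h3.fderiv]
    simp [hf]
    ring
  have hiter : ∀ (l : List (Fin 2)) P, ∃ Q, iterPd id l (f P) = f Q := by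
    intro l
    induction l with
    | nil => exact fun P => ⟨P, rfl⟩
    | cons q l ih =>
      intro P
      obtain ⟨Q, hQ⟩ := ih P
      rw [iterPd, hQ]
      exact hpd Q q
  have e1 : (fun y => ((Real.exp (-(η y) ^ 2) : ℝ) : ℂ)) = f 1 := by
    funext y
    simp [hf]
  rw [e1]
  refine ⟨?_, 1 / 2, by norm_num, fun l => ?_⟩
  · refine Complex.ofRealCLM.contDiff.comp (ContDiff.mul ?_ ?_)
    · exact (Polynomial.contDiff_aeval (𝕜 := ℝ) (1 : Polynomial ℝ) ∞).comp η.contDiff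
    · exact Real.contDiff_exp.comp ((η.contDiff.pow 2).neg)
  · obtain ⟨Q, hQ⟩ := hiter l 1
    obtain ⟨C, hC, h⟩ := exists_bound_eval_mul_exp Q
    refine ⟨C, hC, fun y => ?_⟩
    rw [hQ, hf]
    simp only [Complex.norm_real, norm_mul, Real.norm_eq_abs, Real.abs_exp]
    exact h _

end GaussianFunctions

/-! ## The bracket of densities -/

section DetBr

variable {r : ℕ} (κ : ℂ)

lemma cf_detBr (X : Sec r HFun) (s : ℕ) (m : Lam) : ∃ T : Finset Lam, ∀ c,
    cf (detBr κ X) c s m = ∑ p ∈ Finset.HasAntidiagonal.antidiagonal s, ∑ m' ∈ T,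
      (detL m' (m - m') : ℂ) • brf κ id m' (m - m') (fun c => cf X c p.1 m')
        (fun c => cf X c p.2 (m - m')) c := by
  obtain ⟨T, hT⟩ := exists_modes X s
  refine ⟨T, fun c => ?_⟩
  have hT' : ∀ q c, ∀ s' ≤ s, ∀ m', cf (conormalSec q X) c s' m' ≠ 0 → m' ∈ T :=
    fun q c s' hs' m' hm' => hT c s' hs' m' fun h0 => hm' (by rw [cf_conormalSec, h0, smul_zero])
  rw [detBr, br11, cf_sub, cf_br _ _ _ _ _ _ _ _ _ (hT' 0), cf_br _ _ _ _ _ _ _ _ _ (hT' 1)]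
  simp only [cf_conormalSec, brc_smul_smul, connFun_flat, ← Finset.sum_sub_distrib, ← sub_smul]
  refine Finset.sum_congr rfl fun p _ => Finset.sum_congr rfl fun m' _ => ?_
  congr 1
  simp [conormal, detL]
  ring

lemma detBr_eqBelow {X Y : Sec r HFun} (hX : ∀ c m, cf X c 0 m = 0) (hY : ∀ c m, cf Y c 0 m = 0)
    {n : ℕ} (h : EqBelow n X Y) : EqBelow (n + 1) (detBr κ X) (detBr κ Y) := by
  intro c s hs m
  refine detBr_rel κ Eq rfl (by rintro f _ g _ rfl rfl; rfl) hX hY c s m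
    fun s' hs' s'' hs'' m' m'' _ => ?_
  have e1 : (fun c => cf X c s' m') = fun c => cf Y c s' m' :=
    funext fun c => h c s' (by omega) m'
  have e2 : (fun c => cf X c s'' m'') = fun c => cf Y c s'' m'' :=
    funext fun c => h c s'' (by omega) m''
  rw [e1, e2]

lemma cf_detBr_zero {X : Sec r HFun} (hX : ∀ c m, cf X c 0 m = 0) (c : Comp r) (m : Lam) :
    cf (detBr κ X) c 0 m = 0 :=
  detBr_rel κ (fun f _ => f = 0) rfl (by rintro f _ g _ rfl rfl; simp) hX hX c 0 m
    fun s' hs' => absurd hs' (Nat.not_lt_zero s')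

lemma brf_zero_left (m m' : Lam) (x y : Comp r → HFun) (hx : ∀ c, x c = 0) (c : Comp r) :
    brf κ id m m' x y c = 0 := brc_zero_left κ id _ m m' x y hx c

lemma brf_zero_right (m m' : Lam) (x y : Comp r → HFun) (hy : ∀ c, y c = 0) (c : Comp r) :
    brf κ id m m' x y c = 0 := brc_zero_right κ id _ m m' x y hy c

/-- The vector part of the flat bracket at parameter `0`. -/
lemma brf_inr_zero (m m' : Lam) (x y : Comp r → HFun) (k : Fin 2) (p : Pt) :
    brf κ id m m' x y (Sum.inr k) 0 p =
      (∑ j, (m' j : ℂ) * x (Sum.inr j) 0 p) * y (Sum.inr k) 0 p -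
        (∑ j, (m j : ℂ) * y (Sum.inr j) 0 p) * x (Sum.inr k) 0 p := by
  simp only [brf, brc, covC, Pi.add_apply, Pi.sub_apply, Pi.mul_apply,
    Complex.ofReal_zero, Fin.sum_univ_two, Pi.zero_apply]
  ring

/-- If the vector parts annihilate their modes at parameter `0`, then so does the bracket. -/
lemma sum_brf_inr_zero (m m' : Lam) (x y : Comp r → HFun) (p : Pt)
    (hx : ∑ j, (m j : ℂ) * x (Sum.inr j) 0 p = 0) (hy : ∑ j, (m' j : ℂ) * y (Sum.inr j) 0 p = 0) :
    ∑ k, ((m + m') k : ℂ) * brf κ id m m' x y (Sum.inr k) 0 p = 0 := by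
  simp only [brf_inr_zero, Pi.add_apply, Int.cast_add, Fin.sum_univ_two] at hx hy ⊢
  linear_combination ((m' 0 : ℂ) * x (Sum.inr 0) 0 p + (m' 1 : ℂ) * x (Sum.inr 1) 0 p) * hy -
    ((m 0 : ℂ) * y (Sum.inr 0) 0 p + (m 1 : ℂ) * y (Sum.inr 1) 0 p) * hx

end DetBr

/-! ## Modes -/

section Modes

lemma toPt_nsmul (n : ℕ) (m : Lam) : toPt (n • m) = (n : ℝ) • toPt m := by
  funext q
  simp [toPt]

lemma toPt_ne_zero {m : Lam} (h : m ≠ 0) : toPt m ≠ 0 := fun h0 => h <| funext fun q => by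
  have := congrFun h0 q
  simpa [toPt] using this

lemma detP_toPt (m m' : Lam) : detP (toPt m) (toPt m') = (detL m m' : ℝ) := by
  simp [detP, toPt, detL]

lemma detP_smul (t : ℝ) (u v : Pt) : detP (t • u) v = t * detP u v := by
  simp only [detP, Pi.smul_apply, smul_eq_mul]
  ring

lemma nsmul_apply' (n : ℕ) (m : Lam) (q : Fin 2) : (n • m) q = n * m q := by simp

lemma detL_nsmul_nsmul (n n' : ℕ) (m : Lam) : detL (n • m) (n' • m) = 0 := by
  simp only [detL, Pi.smul_apply, nsmul_eq_mul]
  ring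

namespace Setup

variable {r : ℕ} (S : Setup r)

/-- The determinant of the directions of the initial walls. -/
def D : ℤ := detL S.w1.m S.w2.m

lemma D_ne : S.D ≠ 0 := S.nonparallel

/-- The non-zero elements of the monoid generated by the directions of the initial walls. -/
def Cone (m : Lam) : Prop := ∃ b : ℕ × ℕ, b ≠ 0 ∧ m = b.1 • S.w1.m + b.2 • S.w2.m

variable {S}

lemma detL_left (b : ℕ × ℕ) : detL (b.1 • S.w1.m + b.2 • S.w2.m) S.w2.m = b.1 * S.D := by
  simp only [detL, D, Pi.add_apply, nsmul_apply']
  ring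

lemma detL_right (b : ℕ × ℕ) : detL S.w1.m (b.1 • S.w1.m + b.2 • S.w2.m) = b.2 * S.D := by
  simp only [detL, D, Pi.add_apply, nsmul_apply']
  ring

lemma comb_injective {b b' : ℕ × ℕ}
    (h : b.1 • S.w1.m + b.2 • S.w2.m = b'.1 • S.w1.m + b'.2 • S.w2.m) : b = b' := by
  have h1 := detL_left (S := S) b
  have h2 := detL_right (S := S) b
  rw [h, detL_left] at h1
  rw [h, detL_right] at h2
  have e1 := mul_right_cancel₀ S.D_ne h1
  have e2 := mul_right_cancel₀ S.D_ne h2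
  exact Prod.ext (by exact_mod_cast e1.symm) (by exact_mod_cast e2.symm)

lemma Cone.ne_zero {m : Lam} (h : S.Cone m) : m ≠ 0 := by
  obtain ⟨b, hb, rfl⟩ := h
  intro h0
  exact hb (comb_injective (S := S) (b' := 0) (by simpa using h0))

lemma Cone.add {m m' : Lam} (h : S.Cone m) (h' : S.Cone m') : S.Cone (m + m') := by
  obtain ⟨b, hb, rfl⟩ := h
  obtain ⟨b', hb', rfl⟩ := h'
  refine ⟨b + b', ?_, ?_⟩
  · intro h0
    refine hb (Prod.ext ?_ ?_)
    · have := congrArg Prod.fst h0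
      simp at this
      simpa using this.1
    · have := congrArg Prod.snd h0
      simp at this
      simpa using this.1
  · simp only [Prod.fst_add, Prod.snd_add, add_smul]
    abel

lemma mA_cone (a : Prim) {l : ℕ} (hl : 1 ≤ l) : S.Cone (l • S.mA a) := by
  refine ⟨(l * a.1.1, l * a.1.2), ?_, ?_⟩
  · intro h0
    have h1 := congrArg Prod.fst h0
    have h2 := congrArg Prod.snd h0
    simp only [Prod.fst_zero, Prod.snd_zero, mul_eq_zero] at h1 h2
    have h3 := a.2
    rw [h1.resolve_left (by omega), h2.resolve_left (by omega)] at h3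
    simp at h3
  · simp only [mA, smul_add, smul_smul]

lemma mA_ne_zero (a : Prim) : S.mA a ≠ 0 := by
  simpa using (mA_cone (S := S) a le_rfl).ne_zero

lemma Cone.exists_prim {m : Lam} (h : S.Cone m) : ∃ a : Prim, ∃ l : ℕ, 1 ≤ l ∧ m = l • S.mA a := by
  obtain ⟨b, hb, rfl⟩ := h
  have hg : 0 < Nat.gcd b.1 b.2 := by
    rw [Nat.pos_iff_ne_zero, Ne, Nat.gcd_eq_zero_iff]
    rintro ⟨h1, h2⟩
    exact hb (Prod.ext h1 h2)
  refine ⟨⟨(b.1 / Nat.gcd b.1 b.2, b.2 / Nat.gcd b.1 b.2), Nat.coprime_div_gcd_div_gcd hg⟩,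
    Nat.gcd b.1 b.2, hg, ?_⟩
  simp only [mA, smul_add, smul_smul]
  rw [Nat.mul_div_cancel' (Nat.gcd_dvd_left _ _), Nat.mul_div_cancel' (Nat.gcd_dvd_right _ _)]

lemma prim_unique {a a' : Prim} {l l' : ℕ} (hl : 1 ≤ l) (hl' : 1 ≤ l')
    (h : l • S.mA a = l' • S.mA a') : a = a' := by
  simp only [mA, smul_add, smul_smul] at h
  have h1 := comb_injective (S := S) (b := (l * a.1.1, l * a.1.2))
    (b' := (l' * a'.1.1, l' * a'.1.2)) h
  have e1 : l * a.1.1 = l' * a'.1.1 := congrArg Prod.fst h1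
  have e2 : l * a.1.2 = l' * a'.1.2 := congrArg Prod.snd h1
  have e3 : l = l' := by
    have h3 : Nat.gcd (l * a.1.1) (l * a.1.2) = l := by
      rw [Nat.gcd_mul_left, a.2, mul_one]
    have h4 : Nat.gcd (l' * a'.1.1) (l' * a'.1.2) = l' := by
      rw [Nat.gcd_mul_left, a'.2, mul_one]
    rw [← h3, ← h4, e1, e2]
  subst e3
  exact Subtype.ext (Prod.ext (Nat.eq_of_mul_eq_mul_left hl e1) (Nat.eq_of_mul_eq_mul_left hl e2))

lemma mA_e1 : S.mA e1 = S.w1.m := by simp [mA, e1]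

lemma mA_e2 : S.mA e2 = S.w2.m := by simp [mA, e2]

lemma cone_w1 {l : ℕ} (hl : 1 ≤ l) : S.Cone (l • S.w1.m) := by
  rw [← mA_e1]
  exact mA_cone e1 hl

lemma cone_w2 {l : ℕ} (hl : 1 ≤ l) : S.Cone (l • S.w2.m) := by
  rw [← mA_e2]
  exact mA_cone e2 hl

/-- The two initial walls are extremal. -/
lemma detL_eq_zero_of_add_w1 {m m' : Lam} {l : ℕ} (h : S.Cone m) (h' : S.Cone m')
    (e : m + m' = l • S.w1.m) : detL m m' = 0 := by
  obtain ⟨b, hb, rfl⟩ := h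
  obtain ⟨b', hb', rfl⟩ := h'
  have h1 := comb_injective (S := S) (b := b + b') (b' := (l, 0)) (by
    simp only [Prod.fst_add, Prod.snd_add, add_smul, zero_smul, add_zero]
    rw [← e]
    abel)
  have h2 : b.2 + b'.2 = 0 := congrArg Prod.snd h1
  have h3 : b.2 = 0 := by omega
  have h4 : b'.2 = 0 := by omega
  rw [h3, h4, zero_smul, add_zero, add_zero, detL_nsmul_nsmul]

lemma detL_eq_zero_of_add_w2 {m m' : Lam} {l : ℕ} (h : S.Cone m) (h' : S.Cone m')
    (e : m + m' = l • S.w2.m) : detL m m' = 0 := by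
  obtain ⟨b, hb, rfl⟩ := h
  obtain ⟨b', hb', rfl⟩ := h'
  have h1 := comb_injective (S := S) (b := b + b') (b' := (0, l)) (by
    simp only [Prod.fst_add, Prod.snd_add, add_smul, zero_smul, zero_add]
    rw [← e]
    abel)
  have h2 : b.1 + b'.1 = 0 := congrArg Prod.fst h1
  have h3 : b.1 = 0 := by omega
  have h4 : b'.1 = 0 := by omega
  rw [h3, h4, zero_smul, zero_add, zero_add, detL_nsmul_nsmul]

lemma logθ1_mode {c : Comp r} {s : ℕ} {m : Lam} (h : cf S.w1.logθ c s m ≠ 0) :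
    ∃ l : ℕ, 1 ≤ l ∧ m = l • S.w1.m := S.isWall1.2.2.2 c s m h

lemma logθ2_mode {c : Comp r} {s : ℕ} {m : Lam} (h : cf S.w2.logθ c s m ≠ 0) :
    ∃ l : ℕ, 1 ≤ l ∧ m = l • S.w2.m := S.isWall2.2.2.2 c s m h

end Setup
end Modes

/-! ## Densities -/

section Densities

namespace Setup

variable {r : ℕ} (S : Setup r)

/-- The density of the sum of the wall forms with profiles `u 1` and `u 0`. -/
noncomputable def initSec (u : Fin 2 → HFun) : Sec r HFun :=
  mapSec (fun m z => (-z / (detL m S.w2.m : ℂ)) • u 1) S.w1.logθ +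
    mapSec (fun m z => (z / (detL S.w1.m m : ℂ)) • u 0) S.w2.logθ

lemma cf_initSec (u : Fin 2 → HFun) (c : Comp r) (s : ℕ) (m : Lam) :
    cf (S.initSec u) c s m = (-cf S.w1.logθ c s m / (detL m S.w2.m : ℂ)) • u 1 +
      (cf S.w2.logθ c s m / (detL S.w1.m m : ℂ)) • u 0 := by
  rw [initSec, cf_add, cf_mapSec _ (by simp), cf_mapSec _ (by simp)]

/-- `X` solves the flat Kuranishi equation, in terms of densities, with the homotopy operator
`I`. -/
def IsDensity (u : Fin 2 → HFun) (I : Lam → HFun → HFun) (X : Sec r HFun) : Prop :=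
  (∀ c m, cf X c 0 m = 0) ∧ ∀ c s m,
    cf X c s m = cf (S.initSec u) c s m - (2⁻¹ : ℂ) • I m (cf (detBr S.κ X) c s m)

variable {S}

lemma logθ1_zero (c : Comp r) (m : Lam) : cf S.w1.logθ c 0 m = 0 :=
  S.isWall1.2.2.1.1 c 0 m (Or.inl rfl)

lemma logθ2_zero (c : Comp r) (m : Lam) : cf S.w2.logθ c 0 m = 0 :=
  S.isWall2.2.2.1.1 c 0 m (Or.inl rfl)

lemma exists_isDensity (u : Fin 2 → HFun) (I : Lam → HFun → HFun) (hI : ∀ m, I m 0 = 0) :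
    ∃ X, S.IsDensity u I X := by
  obtain ⟨T, hT'⟩ : ∃ T : Lam → HFun → HFun, ∀ m f, T m f = (2⁻¹ : ℂ) • I m f :=
    ⟨fun m f => (2⁻¹ : ℂ) • I m f, fun _ _ => rfl⟩
  have hT : ∀ m, T m 0 = 0 := fun m => by rw [hT', hI, smul_zero]
  obtain ⟨X, h1, h2⟩ := exists_fixedPoint (fun X : Sec r HFun => S.initSec u - mapSec T
      (diagSec fun s => if s = 0 then 0 else detBr S.κ X))
    (fun X c m => by
      rw [cf_sub, cf_mapSec _ hT, cf_diagSec, if_pos rfl, cf_initSec, logθ1_zero,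
        logθ2_zero]
      simp [hT, cf_zero])
    (fun n X Y hX hY h c s hs m => by
      simp only [cf_sub, cf_mapSec _ hT, cf_diagSec]
      split_ifs
      · rfl
      · rw [detBr_eqBelow S.κ hX hY h c s hs m])
  refine ⟨X, h2, fun c s m => ?_⟩
  conv_lhs => rw [← h1]
  simp only [cf_sub, cf_mapSec _ hT, cf_diagSec]
  split_ifs with hs
  · subst hs
    rw [cf_detBr_zero S.κ h2, cf_zero, hT']
  · rw [hT']

lemma cf_initSec_cone {u : Fin 2 → HFun} {c : Comp r} {s : ℕ} {m : Lam}
    (h : cf (S.initSec u) c s m ≠ 0) : S.Cone m := by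
  rw [cf_initSec] at h
  by_cases h1 : cf S.w1.logθ c s m = 0
  · by_cases h2 : cf S.w2.logθ c s m = 0
    · simp [h1, h2] at h
    · obtain ⟨l, hl, rfl⟩ := logθ2_mode h2
      exact cone_w2 hl
  · obtain ⟨l, hl, rfl⟩ := logθ1_mode h1
    exact cone_w1 hl

lemma detBr_cone_of_lt {X : Sec r HFun} (hX : ∀ c m, cf X c 0 m = 0) {s : ℕ}
    (h : ∀ c, ∀ s' < s, ∀ m, cf X c s' m ≠ 0 → S.Cone m) {c : Comp r} {m : Lam}
    (hm : cf (detBr S.κ X) c s m ≠ 0) : S.Cone m := by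
  by_contra hc
  refine hm (detBr_rel S.κ (fun f _ => f = 0) rfl (by rintro f _ g _ rfl rfl; simp) hX hX c s m
    fun s' hs' s'' hs'' m' m'' e => ?_)
  by_cases h1 : S.Cone m'
  · by_cases h2 : S.Cone m''
    · exact absurd (e ▸ h1.add h2) hc
    · rw [brf_zero_right, smul_zero]
      exact fun c => by_contra fun h0 => h2 (h c s'' hs'' m'' h0)
  · rw [brf_zero_left, smul_zero]
    exact fun c => by_contra fun h0 => h1 (h c s' hs' m' h0)

namespace IsDensity

variable {u : Fin 2 → HFun} {I : Lam → HFun → HFun} {X : Sec r HFun}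

lemma cone (hI : ∀ m, I m 0 = 0) (h : S.IsDensity u I X) {c : Comp r} {s : ℕ} {m : Lam}
    (hm : cf X c s m ≠ 0) : S.Cone m := by
  induction s using Nat.strong_induction_on generalizing c m with
  | _ s ih =>
    by_contra hc
    apply hm
    have h1 : cf (S.initSec u) c s m = 0 := by_contra fun h0 => hc (cf_initSec_cone h0)
    have h2 : cf (detBr S.κ X) c s m = 0 := by_contra fun h0 =>
      hc (detBr_cone_of_lt h.1 (fun c s' hs' m h => ih s' hs' h) h0)
    rw [h.2, h1, h2, hI]
    simp

lemma detBr_cone (hI : ∀ m, I m 0 = 0) (h : S.IsDensity u I X) {c : Comp r} {s : ℕ} {m : Lam}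
    (hm : cf (detBr S.κ X) c s m ≠ 0) : S.Cone m :=
  detBr_cone_of_lt h.1 (fun _ _ _ _ h0 => h.cone hI h0) hm

lemma detBr_eq_zero (hI : ∀ m, I m 0 = 0) (h : S.IsDensity u I X) {m : Lam}
    (hm : ∀ m' m'', S.Cone m' → S.Cone m'' → m' + m'' = m → detL m' m'' = 0)
    (c : Comp r) (s : ℕ) : cf (detBr S.κ X) c s m = 0 := by
  refine detBr_rel S.κ (fun f _ => f = 0) rfl (by rintro f _ g _ rfl rfl; simp) h.1 h.1 c s m
    fun s' hs' s'' hs'' m' m'' e => ?_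
  by_cases h1 : S.Cone m'
  · by_cases h2 : S.Cone m''
    · rw [hm m' m'' h1 h2 e]
      simp
    · rw [brf_zero_right, smul_zero]
      exact fun c => by_contra fun h0 => h2 (h.cone hI h0)
  · rw [brf_zero_left, smul_zero]
    exact fun c => by_contra fun h0 => h1 (h.cone hI h0)

lemma detBr_w1 (hI : ∀ m, I m 0 = 0) (h : S.IsDensity u I X) (l : ℕ) (c : Comp r) (s : ℕ) :
    cf (detBr S.κ X) c s (l • S.w1.m) = 0 :=
  h.detBr_eq_zero hI (fun _ _ h1 h2 e => detL_eq_zero_of_add_w1 h1 h2 e) c s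

lemma detBr_w2 (hI : ∀ m, I m 0 = 0) (h : S.IsDensity u I X) (l : ℕ) (c : Comp r) (s : ℕ) :
    cf (detBr S.κ X) c s (l • S.w2.m) = 0 :=
  h.detBr_eq_zero hI (fun _ _ h1 h2 e => detL_eq_zero_of_add_w2 h1 h2 e) c s

end IsDensity

/-- The initial density has modes along the two walls only. -/
lemma cf_initSec_eq_zero (u : Fin 2 → HFun) {a : Prim} (h1 : a ≠ e1) (h2 : a ≠ e2) {l : ℕ}
    (hl : 1 ≤ l) (c : Comp r) (s : ℕ) : cf (S.initSec u) c s (l • S.mA a) = 0 := by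
  have e1' : cf S.w1.logθ c s (l • S.mA a) = 0 := by
    by_contra h
    obtain ⟨l', hl', e⟩ := logθ1_mode h
    rw [← mA_e1] at e
    exact h1 (prim_unique hl hl' e)
  have e2' : cf S.w2.logθ c s (l • S.mA a) = 0 := by
    by_contra h
    obtain ⟨l', hl', e⟩ := logθ2_mode h
    rw [← mA_e2] at e
    exact h2 (prim_unique hl hl' e)
  rw [cf_initSec, e1', e2']
  simp

lemma logθ2_w1 {l : ℕ} (hl : 1 ≤ l) (c : Comp r) (s : ℕ) :
    cf S.w2.logθ c s (l • S.w1.m) = 0 := by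
  by_contra h
  obtain ⟨l', hl', e⟩ := logθ2_mode h
  rw [← mA_e2, ← mA_e1] at e
  have := prim_unique hl hl' e
  simp [e1, e2] at this

lemma logθ1_w2 {l : ℕ} (hl : 1 ≤ l) (c : Comp r) (s : ℕ) :
    cf S.w1.logθ c s (l • S.w2.m) = 0 := by
  by_contra h
  obtain ⟨l', hl', e⟩ := logθ1_mode h
  rw [← mA_e2, ← mA_e1] at e
  have := prim_unique hl hl' e
  simp [e1, e2] at this

end Setup
end Densities

/-! ## The model -/

section Model

/-- The determinant with a fixed vector, as a linear form. -/
noncomputable def detCLM (u : Pt) : Pt →L[ℝ] ℝ :=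
  u 0 • ContinuousLinearMap.proj 1 - u 1 • ContinuousLinearMap.proj 0

lemma detCLM_apply (u y : Pt) : detCLM u y = detP u y := by
  simp [detCLM, detP]

/-- Functions concentrated along the line spanned by `v` and invariant along this line. -/
def GauInv (v : Pt) (g : Pt → ℂ) : Prop := Gau (lineW v) g ∧ InvAlong v g

lemma InvAlong.add {v : Pt} {f g : Pt → ℂ} (hf : InvAlong v f) (hg : InvAlong v g) :
    InvAlong v (f + g) := fun y t => by rw [Pi.add_apply, hf, hg, Pi.add_apply]

lemma InvAlong.smul {v : Pt} {f : Pt → ℂ} (hf : InvAlong v f) (z : ℂ) :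
    InvAlong v (z • f) := fun y t => by rw [Pi.smul_apply, hf, Pi.smul_apply]

lemma InvAlong.zero (v : Pt) : InvAlong v 0 := fun _ _ => rfl

lemma GauInv.linClass (v : Pt) : LinClass (GauInv v) :=
  ⟨⟨Gau.zero, InvAlong.zero v⟩, fun h1 h2 => ⟨h1.1.add (lineW_nonneg v) h2.1, h1.2.add h2.2⟩,
    fun z _ h => ⟨h.1.smul z, h.2.smul z⟩⟩

lemma lineW_neg (v y : Pt) : lineW (-v) y = lineW v y := by
  simp only [lineW, detP, Pi.neg_apply]
  ring

lemma Gau.line_of_ray {v : Pt} (hv : v ≠ 0) {g : Pt → ℂ} (hg : Gau (rayW v) g) :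
    Gau (lineW v) g := by
  refine hg.mono (k := (normSqW v)⁻¹) (inv_pos.mpr (normSqW_pos hv)) fun y => ?_
  rw [rayW, lineW, ← div_eq_inv_mul]
  exact div_le_div_of_nonneg_right (le_add_of_nonneg_right (sq_nonneg _)) (normSqW_nonneg v)

lemma Gau.line_of_ray_neg {v : Pt} (hv : v ≠ 0) {g : Pt → ℂ} (hg : Gau (rayW (-v)) g) :
    Gau (lineW v) g :=
  (Gau.line_of_ray (neg_ne_zero.mpr hv) hg).mono one_pos fun y => by rw [lineW_neg, one_mul]

lemma gau_lineInt {v : Pt} (hv : v ≠ 0) {g : Pt → ℂ} (hg : Gau normSqW g) :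
    GauInv v (lineInt v g) :=
  ⟨Gau.add (lineW_nonneg v) (((rayDecay_point hv).gau hg).line_of_ray hv)
    (((rayDecay_point (neg_ne_zero.mpr hv)).gau hg).line_of_ray_neg hv),
    invAlong_lineInt hg (rayDecay_point hv) (rayDecay_point (neg_ne_zero.mpr hv))⟩

namespace Setup

variable {r : ℕ} (S : Setup r)

/-- The coordinates in the basis of the directions of the walls, as linear forms. -/
noncomputable def coordL (i : Fin 2) : Pt →L[ℝ] ℝ :=
  ![-(S.D : ℝ)⁻¹ • detCLM (toPt S.w2.m), (S.D : ℝ)⁻¹ • detCLM (toPt S.w1.m)] i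

lemma coordL_apply (i : Fin 2) (v : Pt) : S.coordL i v = coords S.w1.m S.w2.m v i := by
  fin_cases i <;> simp [coordL, coords, detCLM_apply, detP, toPt, D, detL] <;> ring

/-- The Gaussian profiles of the model. -/
noncomputable def gaussS (i : Fin 2) : HFun := fun _ y =>
  (((√Real.pi)⁻¹ : ℝ) : ℂ) * ((Real.exp (-(S.coordL i y) ^ 2) : ℝ) : ℂ)

variable {S}

lemma gauInv_gauss {η : Pt →L[ℝ] ℝ} {v : Pt} {k : ℝ} (hk : k ≠ 0) (h : η = k • detCLM v) :
    GauInv v (fun y => (((√Real.pi)⁻¹ : ℝ) : ℂ) * ((Real.exp (-(η y) ^ 2) : ℝ) : ℂ)) := by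
  constructor
  · refine ((gau_gauss η).smul (((√Real.pi)⁻¹ : ℝ) : ℂ)).mono (k := k ^ 2) (by positivity) fun y => ?_
    rw [sqW, h, lineW, _root_.smul_apply, detCLM_apply, smul_eq_mul, mul_pow]
  · intro y t
    have : η (y + t • v) = η y := by
      rw [map_add, map_smul, h, _root_.smul_apply _ _ v, detCLM_apply]
      simp [detP]
      ring_nf
      simp
    simp only [this]

lemma GauInv_nsmul {v : Pt} {l : ℕ} (hl : 1 ≤ l) {g : Pt → ℂ} (h : GauInv v g) :
    GauInv ((l : ℝ) • v) g := by
  have hl' : (l : ℝ) ≠ 0 := by positivity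
  constructor
  · refine h.1.mono (k := ((l : ℝ) ^ 2)⁻¹) (by positivity) fun y => ?_
    rw [lineW, lineW, detP_smul, mul_pow]
    field_simp
    exact le_rfl
  · intro y t
    rw [smul_smul]
    exact h.2 y _

lemma gaussS_one (ε : ℝ) : GauInv (toPt S.w1.m) (S.gaussS 1 ε) :=
  gauInv_gauss (k := (S.D : ℝ)⁻¹) (inv_ne_zero (Int.cast_ne_zero.mpr S.D_ne)) rfl

lemma gaussS_zero (ε : ℝ) : GauInv (toPt S.w2.m) (S.gaussS 0 ε) :=
  gauInv_gauss (k := -(S.D : ℝ)⁻¹) (neg_ne_zero.mpr (inv_ne_zero (Int.cast_ne_zero.mpr S.D_ne))) rfl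

lemma polyIn_initSec (c : Comp r) (s : ℕ) (m : Lam) :
    PolyIn (GauInv (toPt m)) (cf (S.initSec S.gaussS) c s m) := by
  have hC := GauInv.linClass (toPt m)
  rw [cf_initSec]
  refine PolyIn.add ?_ ?_
  · by_cases h : cf S.w1.logθ c s m = 0
    · rw [h, neg_zero, zero_div, zero_smul]
      exact PolyIn.zero hC
    · obtain ⟨l, hl, rfl⟩ := logθ1_mode h
      refine PolyIn.smul hC (PolyIn.of ?_) _
      rw [toPt_nsmul]
      exact GauInv_nsmul hl (gaussS_one 0)
  · by_cases h : cf S.w2.logθ c s m = 0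
    · rw [h, zero_div, zero_smul]
      exact PolyIn.zero hC
    · obtain ⟨l, hl, rfl⟩ := logθ2_mode h
      refine PolyIn.smul hC (PolyIn.of ?_) _
      rw [toPt_nsmul]
      exact GauInv_nsmul hl (gaussS_zero 0)

/-- The homotopy operator of the model. -/
noncomputable def rayOp (m : Lam) (f : HFun) : HFun := fun ε => rayInt (toPt m) (f ε)

lemma rayOp_zero (m : Lam) : rayOp m 0 = 0 := funext fun _ => rayInt_zero

variable (S) in
/-- The solution of the Kuranishi equation in the model. -/
noncomputable def model : Sec r HFun :=
  (exists_isDensity (S := S) S.gaussS rayOp rayOp_zero).choose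

lemma model_isDensity : S.IsDensity S.gaussS rayOp S.model :=
  (exists_isDensity (S := S) S.gaussS rayOp rayOp_zero).choose_spec

lemma polyIn_rayOp {m : Lam} (hm : m ≠ 0) {f : HFun} (hf : PolyIn (Gau normSqW) f) :
    PolyIn (Gau (rayW (toPt m))) (rayOp m f) :=
  hf.map (Gau.linClass normSqW_nonneg) _
    (fun _ h => (rayDecay_point (toPt_ne_zero hm)).gau h)
    (fun _ _ h1 h2 => (rayDecay_point (toPt_ne_zero hm)).rayInt_add h1 h2)
    fun z f => rayInt_smul z f

lemma polyIn_detBr_of_lt {X : Sec r HFun} (hX : ∀ c m, cf X c 0 m = 0) {s : ℕ}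
    (h : ∀ c, ∀ s' < s, ∀ m, PolyIn (Gau (lineW (toPt m))) (cf X c s' m)) (c : Comp r) (m : Lam) :
    PolyIn (Gau normSqW) (cf (detBr S.κ X) c s m) := by
  have hC := Gau.linClass normSqW_nonneg
  refine detBr_rel S.κ (fun f _ => PolyIn (Gau normSqW) f) (PolyIn.zero hC)
    (fun _ _ _ _ h1 h2 => h1.add h2) hX hX c s m fun s' hs' s'' hs'' m' m'' e => ?_
  by_cases hd : detL m' m'' = 0
  · rw [hd, Int.cast_zero, zero_smul]
    exact PolyIn.zero hC
  · obtain ⟨k, hk, hk'⟩ := normSqW_le_lineW (u := toPt m') (v := toPt m'')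
      (by rw [detP_toPt]; exact_mod_cast hd)
    refine PolyIn.smul hC (PolyIn.brf (Gau.linClass (lineW_nonneg (toPt m')))
      (Gau.linClass (lineW_nonneg (toPt m''))) hC (fun f q h => h.pd q) (fun f q h => h.pd q)
      (fun f h p => h.differentiableAt p) (fun f h p => h.differentiableAt p)
      (fun f g h1 h2 => h1.mul h2 hk (lineW_nonneg _) (lineW_nonneg _) hk') S.κ m' m''
      (fun c => h c s' hs' m') (fun c => h c s'' hs'' m'') c) _

lemma polyIn_model (c : Comp r) (s : ℕ) (m : Lam) :
    PolyIn (Gau (lineW (toPt m))) (cf S.model c s m) := by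
  induction s using Nat.strong_induction_on generalizing c m with
  | _ s ih =>
    have hC := Gau.linClass (lineW_nonneg (toPt m))
    by_cases h0 : cf S.model c s m = 0
    · rw [h0]
      exact PolyIn.zero hC
    have hm : m ≠ 0 := (model_isDensity.cone rayOp_zero h0).ne_zero
    rw [model_isDensity.2, sub_eq_add_neg, ← smul_neg]
    refine PolyIn.add ((polyIn_initSec c s m).mono fun g h => h.1) (PolyIn.smul hC (PolyIn.neg hC
      ((polyIn_rayOp hm ?_).mono fun g h => h.line_of_ray (toPt_ne_zero hm))) _)
    exact polyIn_detBr_of_lt model_isDensity.1 (fun c s' hs' m => ih s' hs' c m) c m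

lemma polyIn_detBr (c : Comp r) (s : ℕ) (m : Lam) :
    PolyIn (Gau normSqW) (cf (detBr S.κ S.model) c s m) :=
  polyIn_detBr_of_lt model_isDensity.1 (fun c s' _ m => polyIn_model c s' m) c m

variable (S) in
/-- The total flux of the model along lines. -/
noncomputable def flux (c : Comp r) (s : ℕ) (m : Lam) : HFun := fun ε =>
  cf (S.initSec S.gaussS) c s m ε -
    (2⁻¹ : ℂ) • lineInt (toPt m) (cf (detBr S.κ S.model) c s m ε)

lemma polyIn_flux {m : Lam} (hm : m ≠ 0) (c : Comp r) (s : ℕ) :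
    PolyIn (GauInv (toPt m)) (S.flux c s m) := by
  have hC := GauInv.linClass (toPt m)
  have e : S.flux c s m = cf (S.initSec S.gaussS) c s m +
      (-(2⁻¹ : ℂ)) • fun ε => lineInt (toPt m) (cf (detBr S.κ S.model) c s m ε) := by
    funext ε
    rw [flux, sub_eq_add_neg, ← neg_smul]
    rfl
  rw [e]
  refine (polyIn_initSec c s m).add (PolyIn.smul hC ?_ _)
  refine (polyIn_detBr c s m).map (Gau.linClass normSqW_nonneg) _
    (fun _ h => gau_lineInt (toPt_ne_zero hm) h) (fun f g h1 h2 => ?_) fun z f => ?_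
  · simp only [lineInt]
    rw [(rayDecay_point (toPt_ne_zero hm)).rayInt_add h1 h2,
      (rayDecay_point (neg_ne_zero.mpr (toPt_ne_zero hm))).rayInt_add h1 h2]
    abel
  · simp only [lineInt, rayInt_smul, smul_add]

/-- The difference of the flux and the density of the model. -/
lemma polyIn_flux_sub {m : Lam} (hm : m ≠ 0) (c : Comp r) (s : ℕ) :
    PolyIn (Gau (rayW (-toPt m))) (S.flux c s m - cf S.model c s m) := by
  have hC := Gau.linClass (rayW_nonneg (-toPt m))
  have hn := neg_ne_zero.mpr (toPt_ne_zero hm)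
  have e : S.flux c s m - cf S.model c s m =
      (-(2⁻¹ : ℂ)) • fun ε => rayInt (-toPt m) (cf (detBr S.κ S.model) c s m ε) := by
    funext ε
    rw [model_isDensity.2]
    simp only [flux, lineInt, rayOp, Pi.sub_apply, Pi.smul_apply, smul_add, neg_smul]
    abel
  rw [e]
  exact PolyIn.smul hC ((polyIn_detBr c s m).map (Gau.linClass normSqW_nonneg) _
    (fun _ h => (rayDecay_point hn).gau h) (fun f g h1 h2 => (rayDecay_point hn).rayInt_add h1 h2)
    fun z f => rayInt_smul z f) _

/-- Away from the initial walls the density is concentrated along rays. -/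
lemma polyIn_model_ray {a : Prim} (h1 : a ≠ e1) (h2 : a ≠ e2) {l : ℕ} (hl : 1 ≤ l) (c : Comp r)
    (s : ℕ) : PolyIn (Gau (rayW (toPt (l • S.mA a)))) (cf S.model c s (l • S.mA a)) := by
  have hC := Gau.linClass (rayW_nonneg (toPt (l • S.mA a)))
  rw [model_isDensity.2, cf_initSec_eq_zero _ h1 h2 hl, zero_sub]
  exact PolyIn.neg hC (PolyIn.smul hC (polyIn_rayOp (mA_cone a hl).ne_zero (polyIn_detBr c s _)) _)

lemma flux_w1 {l : ℕ} (hl : 1 ≤ l) (c : Comp r) (s : ℕ) : S.flux c s (l • S.w1.m) =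
    (-cf S.w1.logθ c s (l • S.w1.m) / (detL (l • S.w1.m) S.w2.m : ℂ)) • S.gaussS 1 := by
  funext ε
  rw [flux, model_isDensity.detBr_w1 rayOp_zero, cf_initSec, logθ2_w1 hl]
  simp [lineInt, rayInt_zero]

lemma flux_w2 {l : ℕ} (hl : 1 ≤ l) (c : Comp r) (s : ℕ) : S.flux c s (l • S.w2.m) =
    (cf S.w2.logθ c s (l • S.w2.m) / (detL S.w1.m (l • S.w2.m) : ℂ)) • S.gaussS 0 := by
  funext ε
  rw [flux, model_isDensity.detBr_w2 rayOp_zero, cf_initSec, logθ1_w2 hl]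
  simp [lineInt, rayInt_zero]

lemma sum_initSec_inr (u : Fin 2 → HFun) (s : ℕ) (m : Lam) (ε : ℝ) (p : Pt) :
    ∑ q, (m q : ℂ) * cf (S.initSec u) (Sum.inr q) s m ε p = 0 := by
  have h1 := S.isWall1.2.2.1.2 s m
  have h2 := S.isWall2.2.2.1.2 s m
  simp only [cf_initSec, Pi.add_apply, Pi.smul_apply, smul_eq_mul, Fin.sum_univ_two] at h1 h2 ⊢
  linear_combination (-(1 / (detL m S.w2.m : ℂ)) * u 1 ε p) * h1 +
    (1 / (detL S.w1.m m : ℂ) * u 0 ε p) * h2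

lemma sum_detBr_inr {X : Sec r HFun} (hX : ∀ c m, cf X c 0 m = 0) {s : ℕ}
    (h : ∀ s' < s, ∀ m p, ∑ q, (m q : ℂ) * cf X (Sum.inr q) s' m 0 p = 0) (m : Lam) (p : Pt) :
    ∑ q, (m q : ℂ) * cf (detBr S.κ X) (Sum.inr q) s m 0 p = 0 := by
  obtain ⟨T, hT⟩ := cf_detBr S.κ X s m
  simp only [hT, Finset.sum_apply, Pi.smul_apply, smul_eq_mul, Finset.mul_sum]
  rw [Finset.sum_comm]
  refine Finset.sum_eq_zero fun i hi => ?_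
  rw [Finset.sum_comm]
  refine Finset.sum_eq_zero fun m' _ => ?_
  have hi' := Finset.HasAntidiagonal.mem_antidiagonal.mp hi
  rcases Nat.eq_zero_or_pos i.1 with hs' | hs'
  · simp [hs', brf_zero_left S.κ m' (m - m') (fun c => cf X c 0 m') _ (fun c => hX c m')]
  rcases Nat.eq_zero_or_pos i.2 with hs'' | hs''
  · simp [hs'', brf_zero_right S.κ m' (m - m') _ (fun c => cf X c 0 (m - m'))
      (fun c => hX c (m - m'))]
  have := sum_brf_inr_zero S.κ m' (m - m') (fun c => cf X c i.1 m')
    (fun c => cf X c i.2 (m - m')) p (h i.1 (by omega) m' p) (h i.2 (by omega) (m - m') p)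
  rw [add_sub_cancel] at this
  simp only [mul_left_comm _ (detL m' (m - m') : ℂ), ← Finset.mul_sum, this, mul_zero]

lemma sum_rayInt {m : Lam} {v : Pt} {W W' : Pt → ℝ} (hv : RayDecay v W W') {g : Fin 2 → Pt → ℂ}
    (hg : ∀ q, Gau W (g q)) (h : ∀ p, ∑ q, (m q : ℂ) * g q p = 0) (p : Pt) :
    ∑ q, (m q : ℂ) * rayInt v (g q) p = 0 := by
  have e : (m 0 : ℂ) • g 0 + (m 1 : ℂ) • g 1 = 0 := funext fun p => by
    simpa [Fin.sum_univ_two] using h p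
  have := hv.rayInt_add ((hg 0).smul (m 0 : ℂ)) ((hg 1).smul (m 1 : ℂ))
  rw [e, rayInt_zero, rayInt_smul, rayInt_smul] at this
  simpa [Fin.sum_univ_two] using (congrFun this p).symm

/-- At parameter `0` the vector part of the model annihilates the modes. -/
lemma sum_model_inr (s : ℕ) (m : Lam) (p : Pt) :
    ∑ q, (m q : ℂ) * cf S.model (Sum.inr q) s m 0 p = 0 := by
  induction s using Nat.strong_induction_on generalizing m p with
  | _ s ih =>
    by_cases hm : m = 0
    · simp [hm]
    have h1 := sum_initSec_inr (S := S) S.gaussS s m 0 p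
    have h2 := sum_rayInt (m := m) (rayDecay_point (toPt_ne_zero hm))
      (fun q => (polyIn_detBr (S := S) (Sum.inr q) s m).apply (Gau.linClass normSqW_nonneg) 0)
      (fun p => sum_detBr_inr (S := S) model_isDensity.1 ih m p) p
    simp only [fun q => model_isDensity (S := S) |>.2 (Sum.inr q) s m, Pi.sub_apply, Pi.smul_apply,
      smul_eq_mul, Fin.sum_univ_two, rayOp] at h1 h2 ⊢
    linear_combination h1 - 2⁻¹ * h2

lemma sum_flux_inr {m : Lam} (hm : m ≠ 0) (s : ℕ) (p : Pt) :
    ∑ q, (m q : ℂ) * S.flux (Sum.inr q) s m 0 p = 0 := by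
  have h0 : ∀ p, ∑ q, (m q : ℂ) * cf (detBr S.κ S.model) (Sum.inr q) s m 0 p = 0 := fun p =>
    sum_detBr_inr (S := S) model_isDensity.1 (fun s' _ m p => sum_model_inr s' m p) m p
  have hg : ∀ q, Gau normSqW (cf (detBr S.κ S.model) (Sum.inr q) s m 0) := fun q =>
    (polyIn_detBr (S := S) (Sum.inr q) s m).apply (Gau.linClass normSqW_nonneg) 0
  have h1 := sum_initSec_inr (S := S) S.gaussS s m 0 p
  have h2 := sum_rayInt (m := m) (rayDecay_point (toPt_ne_zero hm)) hg h0 p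
  have h3 := sum_rayInt (m := m) (rayDecay_point (neg_ne_zero.mpr (toPt_ne_zero hm))) hg h0 p
  simp only [flux, lineInt, Pi.sub_apply, Pi.smul_apply, Pi.add_apply, smul_eq_mul,
    Fin.sum_univ_two] at h1 h2 h3 ⊢
  linear_combination h1 - 2⁻¹ * h2 - 2⁻¹ * h3

end Setup
end Model

/-! ## Equality up to exponentially small functions -/

section AsymEq

/-- Tempered functions. -/
def Tempered (ϖ : Pt → Pt) (S : Set Pt) (g : HFun) : Prop := ∃ d : ℤ, WP ϖ d S g

/-- The function `f` equals the tempered function `g` up to an exponentially small function. -/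
def AsymEq (ϖ : Pt → Pt) (S : Set Pt) (f g : HFun) : Prop := WE ϖ S (f - g) ∧ Tempered ϖ S g

variable {ϖ : Pt → Pt} {S : Set Pt}

lemma Tempered.zero : Tempered ϖ S 0 := ⟨0, WP.zero⟩

lemma Tempered.add (hS : LocDiffeo ϖ S) {f g : HFun} (hf : Tempered ϖ S f)
    (hg : Tempered ϖ S g) : Tempered ϖ S (f + g) := by
  obtain ⟨d, hf⟩ := hf
  obtain ⟨d', hg⟩ := hg
  exact ⟨max d d', (hf.mono_order (le_max_left _ _)).add hS (hg.mono_order (le_max_right _ _))⟩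

lemma Tempered.smul {f : HFun} (hf : Tempered ϖ S f) (z : ℂ) : Tempered ϖ S (z • f) :=
  hf.imp fun _ h => h.smul z

lemma Tempered.mul (hS : LocDiffeo ϖ S) {f g : HFun} (hf : Tempered ϖ S f)
    (hg : Tempered ϖ S g) : Tempered ϖ S (f * g) := by
  obtain ⟨d, hf⟩ := hf
  obtain ⟨d', hg⟩ := hg
  exact ⟨_, hf.mul hS hg⟩

lemma Tempered.pd (hS : LocDiffeo ϖ S) {f : HFun} (hf : Tempered ϖ S f) (q : Fin 2) :
    Tempered ϖ S (fun ħ => pd ϖ q (f ħ)) := by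
  obtain ⟨d, hf⟩ := hf
  exact ⟨_, hf.pd hS q⟩

lemma WE.mul_tempered (hS : LocDiffeo ϖ S) {f g : HFun} (hf : WE ϖ S f) (hg : Tempered ϖ S g) :
    WE ϖ S (f * g) := by
  obtain ⟨d, hg⟩ := hg
  exact hf.mul hS hg

lemma AsymEq.zero : AsymEq ϖ S 0 0 := ⟨by rw [sub_zero]; exact WE.zero, Tempered.zero⟩

lemma AsymEq.refl {f : HFun} (hf : Tempered ϖ S f) : AsymEq ϖ S f f :=
  ⟨by rw [sub_self]; exact WE.zero, hf⟩

lemma AsymEq.add (hS : LocDiffeo ϖ S) {f f' g g' : HFun} (h : AsymEq ϖ S f f')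
    (h' : AsymEq ϖ S g g') : AsymEq ϖ S (f + g) (f' + g') :=
  ⟨by rw [add_sub_add_comm]; exact h.1.add hS h'.1, h.2.add hS h'.2⟩

lemma AsymEq.smul {f f' : HFun} (h : AsymEq ϖ S f f') (z : ℂ) : AsymEq ϖ S (z • f) (z • f') :=
  ⟨by rw [← smul_sub]; exact h.1.smul z, h.2.smul z⟩

lemma AsymEq.neg {f f' : HFun} (h : AsymEq ϖ S f f') : AsymEq ϖ S (-f) (-f') := by
  simpa using h.smul (-1)

lemma AsymEq.left (hS : LocDiffeo ϖ S) {f f' : HFun} (h : AsymEq ϖ S f f') : Tempered ϖ S f := by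
  have := Tempered.add hS (f := f - f') ⟨0, h.1.toWP 0⟩ h.2
  rwa [sub_add_cancel] at this

lemma AsymEq.mul (hS : LocDiffeo ϖ S) {f f' g g' : HFun} (h : AsymEq ϖ S f f')
    (h' : AsymEq ϖ S g g') : AsymEq ϖ S (f * g) (f' * g') := by
  refine ⟨?_, h.2.mul hS h'.2⟩
  have : f * g - f' * g' = (f - f') * g + (g - g') * f' := by ring
  rw [this]
  exact (h.1.mul_tempered hS (h'.left hS)).add hS (h'.1.mul_tempered hS h.2)

lemma covC_flat {r : ℕ} (κ : ℂ) (c : Comp r) (m : Lam) (k : Fin 2) (f : HFun) :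
    covC κ ϖ (fun _ _ _ => 0) c m k f =
      (m k : ℂ) • f + (fun ħ _ => κ * ħ : HFun) * (fun ħ => pd ϖ k (f ħ) : HFun) := by
  funext ħ p
  rcases c with c | c <;> simp [covC]

lemma Smooth.pd_sub (hS : LocDiffeo ϖ S) {f g : HFun} (hf : Smooth S f) (hg : Smooth S g)
    (k : Fin 2) {ħ : ℝ} (hħ : 0 < ħ) : Set.EqOn (ExtScattering.pd ϖ k ((f - g) ħ))
      (ExtScattering.pd ϖ k (f ħ) - ExtScattering.pd ϖ k (g ħ)) S := fun _ hp =>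
  ExtScattering.pd_sub (hf.differentiableAt hS.isOpen hħ hp) (hg.differentiableAt hS.isOpen hħ hp) k

lemma AsymEq.smooth_left (hS : LocDiffeo ϖ S) {f f' : HFun} (h : AsymEq ϖ S f f') :
    Smooth S f := by
  obtain ⟨_, h⟩ := h.left hS
  exact h.1

lemma AsymEq.smooth_right {f f' : HFun} (h : AsymEq ϖ S f f') : Smooth S f' := by
  obtain ⟨_, h⟩ := h.2
  exact h.1

lemma AsymEq.pd (hS : LocDiffeo ϖ S) {f f' : HFun} (h : AsymEq ϖ S f f') (k : Fin 2) :
    AsymEq ϖ S (fun ħ => pd ϖ k (f ħ)) (fun ħ => pd ϖ k (f' ħ)) :=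
  ⟨(h.1.pd hS k).congr hS.isOpen fun _ hħ =>
    Smooth.pd_sub hS (h.smooth_left hS) h.smooth_right k hħ, h.2.pd hS k⟩

lemma AsymEq.covC (hS : LocDiffeo ϖ S) {r : ℕ} (κ : ℂ) (c : Comp r) (m : Lam) (k : Fin 2)
    {f f' : HFun} (h : AsymEq ϖ S f f') :
    AsymEq ϖ S (covC κ ϖ (fun _ _ _ => 0) c m k f) (covC κ ϖ (fun _ _ _ => 0) c m k f') := by
  rw [covC_flat, covC_flat]
  exact (h.smul _).add hS ((AsymEq.refl ⟨_, WP.hbar_smul κ⟩).mul hS (h.pd hS k))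

lemma AsymEq.congr (hS : IsOpen S) {f f' g g' : HFun} (h : AsymEq ϖ S f f')
    (hf : ∀ ħ, 0 < ħ → Set.EqOn (f ħ) (g ħ) S) (hf' : ∀ ħ, 0 < ħ → Set.EqOn (f' ħ) (g' ħ) S) :
    AsymEq ϖ S g g' :=
  ⟨h.1.congr hS fun ħ hħ p hp => by simp only [Pi.sub_apply, hf ħ hħ hp, hf' ħ hħ hp],
    h.2.imp fun _ h => h.congr hS hf'⟩

/-- Brackets of coefficients preserve equality up to exponentially small functions. -/
lemma AsymEq.brc (hS : LocDiffeo ϖ S) {r : ℕ} (κ : ℂ) (m m' : Lam) {x x' y y' : Comp r → HFun}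
    (hx : ∀ c, AsymEq ϖ S (x c) (x' c)) (hy : ∀ c, AsymEq ϖ S (y c) (y' c)) (c : Comp r) :
    AsymEq ϖ S (brc κ ϖ (fun _ _ _ => 0) m m' x y c) (brc κ ϖ (fun _ _ _ => 0) m m' x' y' c) :=
  brc_rel κ ϖ _ (AsymEq ϖ S) (AsymEq ϖ S) (AsymEq ϖ S) m m'
    (fun c k _ _ h => h.covC hS κ c m k) (fun c k _ _ h => h.covC hS κ c m' k)
    (fun _ _ _ _ h h' => h.mul hS h') AsymEq.zero (fun _ _ _ _ h h' => h.add hS h')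
    (fun _ _ h => h.neg) hx hy c

/-- Exponential smallness is preserved by affine maps. -/
lemma WE.comp_affine {U V : Set Pt} (hU : IsOpen U) (hV : IsOpen V) (A : Pt →L[ℝ] Pt) (b : Pt)
    (h : ∀ x ∈ U, A x + b ∈ V) {f : HFun} (hf : WE id V f) :
    WE id U (fun ħ x => f ħ (A x + b)) := by
  refine ⟨fun ħ hħ => (hf.1 ħ hħ).comp (by fun_prop) h, wExp_iff.mpr fun x hx => ?_⟩
  obtain ⟨N, hN, c, hc, hb⟩ := wExp_iff.mp hf.2 _ (h x hx)
  have hcont : Continuous fun x => A x + b := by fun_prop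
  obtain ⟨M, hM⟩ : ∃ M : ℝ, ∀ q k, |A (Pi.single q 1) k| ≤ M := by
    refine ⟨∑ q, ∑ k, |A (Pi.single q 1) k|, fun q k => ?_⟩
    exact (Finset.single_le_sum (f := fun k => |A (Pi.single q 1) k|) (fun _ _ => abs_nonneg _)
      (Finset.mem_univ k)).trans (Finset.single_le_sum (f := fun q => ∑ k, |A (Pi.single q 1) k|)
      (fun _ _ => Finset.sum_nonneg fun _ _ => abs_nonneg _) (Finset.mem_univ q))
  have hw : ∀ j, ∀ᶠ ħ in 𝓝[>] (0 : ℝ), ∀ x ∈ N, 0 ≤ wtExp c j ħ x := fun j =>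
    Eventually.of_forall fun _ _ _ => (Real.exp_pos _).le
  refine ⟨(fun x => A x + b) ⁻¹' N ∩ U, inter_mem (hcont.continuousAt hN) (hU.mem_nhds hx), c, hc,
    fun l => ?_⟩
  obtain ⟨C, hC⟩ := (derivBound_iff hw).mp hb l.length
  have hM0 : 0 ≤ M := (abs_nonneg _).trans (hM 0 0)
  refine ⟨(2 * M) ^ l.length * max C 0, by positivity, ?_⟩
  filter_upwards [hC, self_mem_nhdsWithin] with ħ h1 hħ y hy
  rw [mul_assoc]
  refine norm_iterPd_comp_le hV A b hM l (hf.1 ħ hħ) (h y hy.2) fun l' hl' => ?_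
  refine (h1 _ hy.1 l' hl').trans ?_
  exact mul_le_mul_of_nonneg_right (le_max_left _ _) (Real.exp_pos _).le

end AsymEq

/-! ## The flat Kuranishi equation on the chart -/

section Flat

namespace Setup

variable {r : ℕ} (S : Setup r)

/-- The flow time along `m`, as a linear form. -/
noncomputable def timeL (m : Lam) : Pt →L[ℝ] ℝ :=
  (coords S.w1.m S.w2.m (toPt m) ⬝ᵥ coords S.w1.m S.w2.m (toPt m))⁻¹ •
    ∑ i, coords S.w1.m S.w2.m (toPt m) i • S.coordL i

variable {S}

lemma flowTime_eq (m : Lam) (q x : Pt) :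
    flowTime S.w1.m S.w2.m q m x = S.timeL m (x - q) := by
  simp only [flowTime, timeL, dotProduct, Fin.sum_univ_two, _root_.smul_apply, _root_.add_apply,
    smul_eq_mul, coordL_apply]
  rw [div_eq_inv_mul]

lemma coords_ne_zero {m : Lam} (hm : m ≠ 0) :
    coords S.w1.m S.w2.m (toPt m) ⬝ᵥ coords S.w1.m S.w2.m (toPt m) ≠ 0 := by
  intro h
  rw [dotProduct_self_eq_zero] at h
  have h0 := congrFun h 0
  have h1 := congrFun h 1
  have hD : (S.D : ℝ) ≠ 0 := Int.cast_ne_zero.mpr S.D_ne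
  simp only [D, detL, Int.cast_sub, Int.cast_mul] at hD
  simp only [coords, Matrix.cons_val_zero, Matrix.cons_val_one, Pi.zero_apply,
    div_eq_zero_iff, hD, or_false] at h0 h1
  apply toPt_ne_zero hm
  have e0 : ((S.w1.m 0 : ℝ) * S.w2.m 1 - S.w1.m 1 * S.w2.m 0) * toPt m 0 = 0 := by
    linear_combination (S.w1.m 0 : ℝ) * h0 + (S.w2.m 0 : ℝ) * h1
  have e1 : ((S.w1.m 0 : ℝ) * S.w2.m 1 - S.w1.m 1 * S.w2.m 0) * toPt m 1 = 0 := by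
    linear_combination (S.w1.m 1 : ℝ) * h0 + (S.w2.m 1 : ℝ) * h1
  funext i
  fin_cases i
  · exact (mul_eq_zero.mp e0).resolve_left hD
  · exact (mul_eq_zero.mp e1).resolve_left hD

lemma timeL_self {m : Lam} (hm : m ≠ 0) : S.timeL m (toPt m) = 1 := by
  have h := coords_ne_zero (S := S) hm
  simp only [timeL, _root_.smul_apply, smul_eq_mul, Fin.sum_univ_two, _root_.add_apply,
    coordL_apply]
  rw [dotProduct, Fin.sum_univ_two] at h ⊢
  exact inv_mul_cancel₀ h

lemma adapted {m : Lam} (hm : m ≠ 0) : Adapted S.U (S.timeL m) (toPt m) S.q0 := by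
  refine ⟨S.isOpen_U, S.convex_U, fun x hx => ?_, timeL_self hm⟩
  have := S.foot_mem m x hx
  rwa [flowTime_eq] at this

lemma flowInt_eq (m : Lam) (f : HFun) :
    S.flowInt m f = fun ħ => flowInt' (S.timeL m) (toPt m) S.q0 (f ħ) := by
  funext ħ x
  simp only [flowInt, flowInt', flowTime_eq]

lemma flowInt_zero (m : Lam) : S.flowInt m 0 = 0 := by
  funext ħ x
  simp [flowInt]

lemma coordL_toPt (i : Fin 2) (b : ℕ × ℕ) :
    S.coordL i (toPt (b.1 • S.w1.m + b.2 • S.w2.m)) = ![(b.1 : ℝ), b.2] i := by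
  have hD : (S.D : ℝ) ≠ 0 := Int.cast_ne_zero.mpr S.D_ne
  fin_cases i
  · have := detL_left (S := S) b
    simp only [coordL, Fin.zero_eta, Matrix.cons_val_zero, _root_.smul_apply, detCLM_apply,
      detP_toPt, smul_eq_mul]
    have e : detL S.w2.m (b.1 • S.w1.m + b.2 • S.w2.m) = -(b.1 * S.D) := by
      rw [← this]
      simp only [detL]
      ring
    rw [e]
    push_cast
    field_simp
  · change ((S.D : ℝ)⁻¹ • detCLM (toPt S.w1.m)) _ = (b.2 : ℝ)
    rw [_root_.smul_apply, detCLM_apply, detP_toPt, smul_eq_mul, detL_right]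
    push_cast
    field_simp

lemma coordL_w1 (i : Fin 2) : S.coordL i (toPt S.w1.m) = ![1, 0] i := by
  have := coordL_toPt (S := S) i (1, 0)
  simpa using this

lemma coordL_w2 (i : Fin 2) : S.coordL i (toPt S.w2.m) = ![0, 1] i := by
  have := coordL_toPt (S := S) i (0, 1)
  simpa using this

lemma coordL_pol (i : Fin 2) (p : Pt) :
    S.coordL i (S.pol p - S.m0) = ![p 0 * Real.cos (p 1), p 0 * Real.sin (p 1)] i := by
  have : S.pol p - S.m0 = (p 0 * Real.cos (p 1)) • toPt S.w1.m +
      (p 0 * Real.sin (p 1)) • toPt S.w2.m := by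
    rw [pol, polar]
    abel
  rw [this, map_add, map_smul, map_smul, coordL_w1, coordL_w2]
  fin_cases i <;> simp

lemma cos_ϑ0_neg : Real.cos S.ϑ0 < 0 :=
  Real.cos_neg_of_pi_div_two_lt_of_lt (by linarith [S.lt_ϑ0, Real.pi_pos])
    (by linarith [S.ϑ0_lt])

lemma sin_ϑ0_neg : Real.sin S.ϑ0 < 0 := by
  have h := Real.sin_pos_of_pos_of_lt_pi (x := S.ϑ0 - Real.pi) (by linarith [S.lt_ϑ0])
    (by linarith [S.ϑ0_lt, Real.pi_pos])
  rw [Real.sin_sub_pi] at h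
  linarith

/-- The base point lies before the origin with respect to all flows. -/
lemma timeL_pos {m : Lam} (hm : S.Cone m) : 0 < S.timeL m (S.m0 - S.q0) := by
  have hN := coords_ne_zero (S := S) hm.ne_zero
  obtain ⟨b, hb, rfl⟩ := hm
  have hN' : 0 < coords S.w1.m S.w2.m (toPt (b.1 • S.w1.m + b.2 • S.w2.m)) ⬝ᵥ
      coords S.w1.m S.w2.m (toPt (b.1 • S.w1.m + b.2 • S.w2.m)) :=
    lt_of_le_of_ne (by rw [dotProduct]; exact Finset.sum_nonneg fun i _ => mul_self_nonneg _)
      (Ne.symm hN)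
  have e : S.m0 - S.q0 = -(S.pol S.p0 - S.m0) := by
    rw [q0]
    abel
  rw [e, map_neg]
  simp only [timeL, _root_.smul_apply, smul_eq_mul, Fin.sum_univ_two, _root_.add_apply,
    coordL_pol, ← coordL_apply, coordL_toPt, p0, Matrix.cons_val_zero, Matrix.cons_val_one]
  simp only [dotProduct, Fin.sum_univ_two, ← coordL_apply, coordL_toPt, Matrix.cons_val_zero,
    Matrix.cons_val_one] at hN'
  rw [neg_pos, dotProduct, Fin.sum_univ_two]
  simp only [← coordL_apply, coordL_toPt, Matrix.cons_val_zero, Matrix.cons_val_one]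
  refine mul_neg_of_pos_of_neg (inv_pos.mpr hN') ?_
  have hc := mul_neg_of_pos_of_neg S.ρ0_pos S.cos_ϑ0_neg
  have hs := mul_neg_of_pos_of_neg S.ρ0_pos S.sin_ϑ0_neg
  rcases Nat.eq_zero_or_pos b.1 with h1 | h1
  · have h2 : 0 < b.2 := Nat.pos_of_ne_zero fun h2 => hb (Prod.ext h1 h2)
    have h2' : (0 : ℝ) < b.2 := by exact_mod_cast h2
    rw [h1, Nat.cast_zero, zero_mul, zero_add]
    exact mul_neg_of_pos_of_neg h2' hs
  · have h1' : (0 : ℝ) < b.1 := by exact_mod_cast h1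
    have h2' : (0 : ℝ) ≤ b.2 := Nat.cast_nonneg _
    nlinarith [mul_neg_of_pos_of_neg h1' hc, mul_nonneg h2' (neg_nonneg.mpr hs.le)]

variable (S) in
/-- The density of the solution of the flat Kuranishi equation. -/
noncomputable def dens : Sec r HFun :=
  (exists_isDensity (S := S) (fun i => gauss (S.coord i)) S.flowInt flowInt_zero).choose

lemma dens_isDensity : S.IsDensity (fun i => gauss (S.coord i)) S.flowInt S.dens :=
  (exists_isDensity (S := S) (fun i => gauss (S.coord i)) S.flowInt flowInt_zero).choose_spec

lemma gauss_eq_rescale (i : Fin 2) {ħ : ℝ} (hħ : 0 < ħ) :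
    gauss (S.coord i) ħ = rescale S.m0 1 (S.gaussS i) ħ := by
  funext x
  have e1 : ħ ^ (-((1 : ℤ) : ℝ) / 2) = (√ħ)⁻¹ := by
    rw [Real.sqrt_eq_rpow, ← Real.rpow_neg hħ.le]
    norm_num
  have e2 : -(S.coordL i ((√ħ)⁻¹ • (x - S.m0))) ^ 2 = -(S.coord i x) ^ 2 / ħ := by
    rw [map_smul, smul_eq_mul, mul_pow, inv_pow, Real.sq_sqrt hħ.le, coord, coordL_apply]
    ring
  rw [rescale, gaussS, e1, e2, gauss, Real.sqrt_mul Real.pi_pos.le]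
  push_cast
  rw [div_eq_mul_inv, mul_inv]
  ring

/-- The bracket of the rescaled model. -/
lemma detBr_rescale (c : Comp r) (s : ℕ) (m : Lam) {ħ : ℝ} (hħ : 0 < ħ) :
    cf (detBr S.κ (mapSec (fun _ f => rescale S.m0 1 f) S.model)) c s m ħ =
      rescale S.m0 2 (cf (detBr S.κ S.model) c s m) ħ := by
  have hcf : ∀ c s m, cf (mapSec (fun _ f => rescale S.m0 1 f) S.model) c s m =
      rescale S.m0 1 (cf S.model c s m) := fun c s m =>
    cf_mapSec (fun _ f => rescale S.m0 1 f) (fun _ => rescale_zero) _ _ _ _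
  refine detBr_rel S.κ (fun f g => f ħ = rescale S.m0 2 g ħ) (by rw [rescale_zero]) ?_ ?_
    model_isDensity.1 c s m fun s' _ s'' _ m' m'' _ => ?_
  · intro f f' g g' h h'
    rw [rescale_add, Pi.add_apply, Pi.add_apply, h, h']
  · intro c m
    rw [hcf, model_isDensity.1, rescale_zero]
  · rw [rescale_smul, Pi.smul_apply, Pi.smul_apply]
    simp only [hcf]
    rw [brf_rescale S.κ m' m'' _ _ c hħ]
    rfl

lemma cont_rayW (v : Pt) : Continuous (rayW v) := by
  unfold rayW detP dotP normSqW
  fun_prop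

lemma rayW_smul {v : Pt} {t : ℝ} (ht : 0 ≤ t) (y : Pt) : rayW v (t • y) = t ^ 2 * rayW v y := by
  have e1 : detP v (t • y) = t * detP v y := by
    simp only [detP, Pi.smul_apply, smul_eq_mul]
    ring
  have e2 : dotP v (t • y) = t * dotP v y := by
    simp only [dotP, Pi.smul_apply, smul_eq_mul]
    ring
  have e3 : min (t * dotP v y) 0 = t * min (dotP v y) 0 := by
    rw [mul_min_of_nonneg _ _ ht, mul_zero]
  rw [rayW, rayW, e1, e2, e3]
  ring

lemma exists_of_rayW_eq_zero {v y : Pt} (hv : v ≠ 0) (h : rayW v y = 0) :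
    ∃ t : ℝ, 0 ≤ t ∧ y = t • v := by
  have hN := normSqW_pos hv
  rw [rayW, div_eq_zero_iff, or_iff_left hN.ne'] at h
  have h1 : detP v y = 0 := by nlinarith [sq_nonneg (detP v y), sq_nonneg (min (dotP v y) 0)]
  have h2 : min (dotP v y) 0 = 0 := by
    nlinarith [sq_nonneg (detP v y), sq_nonneg (min (dotP v y) 0)]
  refine ⟨dotP v y / normSqW v, div_nonneg (min_eq_right_iff.mp h2) hN.le, ?_⟩
  have e : ∀ i, normSqW v * y i = dotP v y * v i := by
    intro i
    fin_cases i
    · simp only [normSqW, dotP, detP, Fin.zero_eta] at h1 ⊢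
      linear_combination -(v 1) * h1
    · simp only [normSqW, dotP, detP, Fin.mk_one] at h1 ⊢
      linear_combination (v 0) * h1
  funext i
  rw [Pi.smul_apply, smul_eq_mul, div_mul_eq_mul_div, eq_div_iff hN.ne', mul_comm, e i]

end Setup
end Flat

section Comparison

namespace Setup

variable {r : ℕ} {S : Setup r}

/-- The composition with the projection to the initial line is exponentially small. -/
lemma wE_foot_rescale {m : Lam} (hm : S.Cone m) {g : HFun}
    (hg : PolyIn (Gau (rayW (toPt m))) g) :
    WE id S.U (fun ħ x => rescale S.m0 1 g ħ (x - S.timeL m (x - S.q0) • toPt m)) := by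
  have had := adapted (S := S) hm.ne_zero
  have hmne := toPt_ne_zero hm.ne_zero
  have hc : Continuous fun y => rayW (toPt m) (y - S.m0) :=
    (cont_rayW _).comp (continuous_id.sub continuous_const)
  have hV : IsOpen {y | 0 < rayW (toPt m) (y - S.m0)} := isOpen_lt continuous_const hc
  have h1 : WE id {y | 0 < rayW (toPt m) (y - S.m0)} (rescale S.m0 1 g) :=
    hg.wE_rescale (rayW_nonneg _) (cont_rayW _) (fun t ht y => rayW_smul ht y) fun x hx => hx
  have e : ∀ x, x - S.timeL m (x - S.q0) • toPt m =
      pathLin (S.timeL m) (toPt m) 1 x + (1 * S.timeL m S.q0) • toPt m := fun x => by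
    rw [← pathPt_eq, pathPt, one_mul]
  simp only [e]
  refine WE.comp_affine S.isOpen_U hV _ _ (fun x _ => ?_) h1
  rw [← e]
  refine lt_of_le_of_ne (rayW_nonneg _ _) fun h0 => ?_
  obtain ⟨t, ht, e1⟩ := exists_of_rayW_eq_zero hmne h0.symm
  have e2 := had.foot_idem x
  have e3 : x - S.timeL m (x - S.q0) • toPt m - S.q0 = t • toPt m + (S.m0 - S.q0) := by
    rw [← e1]
    abel
  rw [e3, map_add, map_smul, had.one, smul_eq_mul, mul_one] at e2
  linarith [timeL_pos hm]

lemma sum_pd_rescale {m : Lam} {g : HFun} {d : ℤ} {ħ : ℝ} (hħ : 0 < ħ) (x : Pt) :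
    ∑ q, (toPt m q : ℂ) * pd id q (rescale S.m0 d g ħ) x = rescale S.m0 (d + 1)
      (fun ε y => ∑ q, (toPt m q : ℂ) * pd id q (g ε) y) ħ x := by
  simp only [pd_rescale _ hħ]
  simp only [rescale, Finset.mul_sum]
  exact Finset.sum_congr rfl fun q _ => by ring

/-- Integration along the flow of a rescaled function. -/
lemma flowInt_rescale {m : Lam} (hm : m ≠ 0) {g : HFun} (hg : PolyIn (Gau normSqW) g) {ħ : ℝ}
    (hħ : 0 < ħ) {x : Pt} (hx : x ∈ S.U) :
    S.flowInt m (rescale S.m0 2 g) ħ x = rescale S.m0 1 (rayOp m g) ħ x -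
      rescale S.m0 1 (rayOp m g) ħ (x - S.timeL m (x - S.q0) • toPt m) := by
  have had := adapted (S := S) hm
  have h1 := (polyIn_rayOp hm hg).smooth_rescale (m0 := S.m0) (d := 1) (rayW_nonneg _) S.U
  rw [← had.flowInt'_deriv (h1 ħ hħ) hx, flowInt_eq]
  refine congrArg (fun h => flowInt' (S.timeL m) (toPt m) S.q0 h x) (funext fun y => ?_)
  rw [sum_pd_rescale hħ]
  simp only [rescale, rayOp]
  rw [(rayDecay_point (toPt_ne_zero hm)).sum_pd_rayInt (hg.apply (Gau.linClass normSqW_nonneg) _)]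
  norm_num

lemma asymEq_flowInt {m : Lam} (hm : S.Cone m) {f g : HFun} (hg : PolyIn (Gau normSqW) g)
    (h : AsymEq id S.U f (rescale S.m0 2 g)) :
    AsymEq id S.U (S.flowInt m f) (rescale S.m0 1 (rayOp m g)) := by
  have had := adapted (S := S) hm.ne_zero
  have hS := locDiffeo_id S.isOpen_U
  have hr := polyIn_rayOp hm.ne_zero hg
  refine ⟨?_, 1, hr.wP_rescale (rayW_nonneg _) _⟩
  refine ((had.wE_flowInt' h.1).sub hS (wE_foot_rescale hm hr)).congr S.isOpen_U
    fun ħ hħ x hx => ?_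
  have e1 := flowInt_rescale hm.ne_zero hg hħ hx
  have e2 := had.flowInt'_add (h.1.1 ħ hħ) (h.smooth_right ħ hħ) hx
  have e3 : (f - rescale S.m0 2 g) ħ + rescale S.m0 2 g ħ = f ħ := sub_add_cancel (f ħ) _
  rw [e3] at e2
  rw [flowInt_eq] at e1
  change flowInt' _ _ _ _ x = _ at e1
  simp only [Pi.sub_apply, flowInt_eq] at e2 ⊢
  rw [e2, e1]
  ring

lemma initSec_rescale (c : Comp r) (s : ℕ) (m : Lam) {ħ : ℝ} (hħ : 0 < ħ) :
    cf (S.initSec fun i => gauss (S.coord i)) c s m ħ =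
      rescale S.m0 1 (cf (S.initSec S.gaussS) c s m) ħ := by
  simp only [cf_initSec, rescale_add, rescale_smul, Pi.add_apply, Pi.smul_apply,
    gauss_eq_rescale _ hħ]

lemma asymEq_detBr_of_lt {s : ℕ} (ih : ∀ s' < s, ∀ c m,
    AsymEq id S.U (cf S.dens c s' m) (rescale S.m0 1 (cf S.model c s' m))) (c : Comp r) (m : Lam) :
    AsymEq id S.U (cf (detBr S.κ S.dens) c s m)
      (rescale S.m0 2 (cf (detBr S.κ S.model) c s m)) := by
  have hS := locDiffeo_id S.isOpen_U
  have hcf : ∀ c s m, cf (mapSec (fun _ f => rescale S.m0 1 f) S.model) c s m =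
      rescale S.m0 1 (cf S.model c s m) := fun c s m =>
    cf_mapSec (fun _ f => rescale S.m0 1 f) (fun _ => rescale_zero) _ _ _ _
  refine AsymEq.congr S.isOpen_U (f := cf (detBr S.κ S.dens) c s m)
    (f' := cf (detBr S.κ (mapSec (fun _ f => rescale S.m0 1 f) S.model)) c s m) ?_
    (fun _ _ _ _ => rfl) fun ħ hħ x _ => by rw [detBr_rescale c s m hħ]
  refine detBr_rel S.κ (AsymEq id S.U) AsymEq.zero (fun _ _ _ _ h h' => h.add hS h')
    dens_isDensity.1 (fun c m => by rw [hcf, model_isDensity.1, rescale_zero]) c s m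
    fun s' hs' s'' hs'' m' m'' _ => AsymEq.smul (AsymEq.brc hS S.κ m' m'' (fun c => ?_)
      (fun c => ?_) c) _
  · rw [hcf]
    exact ih s' hs' c m'
  · rw [hcf]
    exact ih s'' hs'' c m''

/-- The density equals the rescaled model up to exponentially small functions. -/
lemma dens_asymEq (c : Comp r) (s : ℕ) (m : Lam) :
    AsymEq id S.U (cf S.dens c s m) (rescale S.m0 1 (cf S.model c s m)) := by
  have hS := locDiffeo_id S.isOpen_U
  induction s using Nat.strong_induction_on generalizing c m with
  | _ s ih =>
    by_cases hm : S.Cone m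
    · have h1 := asymEq_detBr_of_lt ih c m
      have h2 := (asymEq_flowInt hm (polyIn_detBr c s m) h1).smul (2⁻¹ : ℂ)
      have h3 : AsymEq id S.U (cf (S.initSec fun i => gauss (S.coord i)) c s m)
          (rescale S.m0 1 (cf (S.initSec S.gaussS) c s m)) := by
        refine (AsymEq.refl ⟨1, ((polyIn_initSec c s m).mono fun g h => h.1).wP_rescale
          (lineW_nonneg _) S.U⟩).congr S.isOpen_U (fun ħ hħ x _ => ?_) fun _ _ _ _ => rfl
        rw [initSec_rescale c s m hħ]
      rw [dens_isDensity.2, model_isDensity.2, sub_eq_add_neg, sub_eq_add_neg, rescale_add,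
        ← neg_one_smul ℂ ((2⁻¹ : ℂ) • rayOp _ _), rescale_smul, rescale_smul, neg_one_smul]
      exact h3.add hS h2.neg
    · rw [by_contra fun h => hm (dens_isDensity.cone flowInt_zero h),
        by_contra fun h => hm (model_isDensity.cone rayOp_zero h), rescale_zero]
      exact AsymEq.zero

lemma detBr_asymEq (c : Comp r) (s : ℕ) (m : Lam) :
    AsymEq id S.U (cf (detBr S.κ S.dens) c s m)
      (rescale S.m0 2 (cf (detBr S.κ S.model) c s m)) :=
  asymEq_detBr_of_lt (fun s' _ c m => dens_asymEq c s' m) c m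

lemma dens_smooth (c : Comp r) (s : ℕ) (m : Lam) : Smooth S.U (cf S.dens c s m) :=
  (dens_asymEq c s m).smooth_left (locDiffeo_id S.isOpen_U)

lemma detBr_smooth (c : Comp r) (s : ℕ) (m : Lam) : Smooth S.U (cf (detBr S.κ S.dens) c s m) :=
  (detBr_asymEq c s m).smooth_left (locDiffeo_id S.isOpen_U)

/-- The Maurer-Cartan equation, in terms of the density. -/
lemma sum_pd_dens (c : Comp r) (s : ℕ) (m : Lam) {ħ : ℝ} (hħ : 0 < ħ) {x : Pt} (hx : x ∈ S.U) :
    ∑ q, (m q : ℂ) * pd id q (cf S.dens c s m ħ) x +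
      2⁻¹ * cf (detBr S.κ S.dens) c s m ħ x = 0 := by
  have hC := GauInv.linClass (toPt m)
  by_cases hm : m = 0
  · have h0 : cf (detBr S.κ S.dens) c s m = 0 := by_contra fun h =>
      (dens_isDensity.detBr_cone flowInt_zero h).ne_zero hm
    rw [h0]
    simp [hm]
  have had := adapted (S := S) hm
  have e0 : cf S.dens c s m ħ = rescale S.m0 1 (cf (S.initSec S.gaussS) c s m) ħ -
      (2⁻¹ : ℂ) • flowInt' (S.timeL m) (toPt m) S.q0 (cf (detBr S.κ S.dens) c s m ħ) := by
    rw [dens_isDensity.2, flowInt_eq, ← initSec_rescale c s m hħ]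
    rfl
  have hi := (polyIn_initSec (S := S) c s m)
  have h1 : ContDiffOn ℝ ∞ (rescale S.m0 1 (cf (S.initSec S.gaussS) c s m) ħ) S.U :=
    (hi.mono fun g h => h.1).smooth_rescale (lineW_nonneg _) S.U ħ hħ
  have h2 := had.contDiffOn_flowInt' (detBr_smooth c s m ħ hħ)
  have h3 : ContDiffOn ℝ ∞ ((2⁻¹ : ℂ) • flowInt' (S.timeL m) (toPt m) S.q0
      (cf (detBr S.κ S.dens) c s m ħ)) S.U := h2.const_smul (2⁻¹ : ℂ)
  have e1 := had.sum_pd_flowInt' (detBr_smooth c s m ħ hħ) hx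
  have e2 := sum_pd_rescale (S := S) (m := m) (g := cf (S.initSec S.gaussS) c s m) (d := 1) hħ x
  have e3 : (fun (ε : ℝ) y => ∑ q, (toPt m q : ℂ) * pd id q (cf (S.initSec S.gaussS) c s m ε) y) =
      0 := funext fun ε => funext fun y => (hi.apply hC ε).2.sum_pd
    ((hi.apply hC ε).1.differentiableAt y)
  rw [e3, rescale_zero] at e2
  have e4 : ∀ q, pd id q (cf S.dens c s m ħ) x =
      pd id q (rescale S.m0 1 (cf (S.initSec S.gaussS) c s m) ħ) x -
      2⁻¹ * pd id q (flowInt' (S.timeL m) (toPt m) S.q0 (cf (detBr S.κ S.dens) c s m ħ)) x := by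
    intro q
    rw [e0, pd_sub (ContDiffOn.differentiableAt_of_isOpen S.isOpen_U h1 hx)
      (ContDiffOn.differentiableAt_of_isOpen S.isOpen_U h3 hx), pd_smul]
    rfl
  simp only [e4, Fin.sum_univ_two, toPt, Complex.ofReal_intCast, Pi.zero_apply] at e1 e2 ⊢
  linear_combination e2 - 2⁻¹ * e1

end Setup
end Comparison

/-! ## Relations between brackets of sections -/

section Relations

variable {r : ℕ} {κ κ' : ℂ} {ϖ ϖ' : Pt → Pt} {ϕ ϕ' : Fin r → Pt → ℝ}

/-- Compatibility of a relation between families of functions with the bracket of sections. -/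
lemma br_relF (R : (Comp r → HFun) → (Comp r → HFun) → Prop) (h0 : R 0 0)
    (hadd : ∀ x x' y y', R x x' → R y y' → R (x + y) (x' + y')) {X X' Y Y' : Sec r HFun}
    (hX : ∀ c m, cf X c 0 m = 0) (hX' : ∀ c m, cf X' c 0 m = 0)
    (hY : ∀ c m, cf Y c 0 m = 0) (hY' : ∀ c m, cf Y' c 0 m = 0) (s : ℕ) (m : Lam)
    (h : ∀ s' < s, ∀ s'' < s, ∀ m' m'', m' + m'' = m →
      R (brc κ ϖ (connFun ϖ ϕ) m' m'' (fun c => cf X c s' m') (fun c => cf Y c s'' m''))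
        (brc κ' ϖ' (connFun ϖ' ϕ') m' m'' (fun c => cf X' c s' m') (fun c => cf Y' c s'' m''))) :
    R (fun c => cf (br κ ϖ ϕ X Y) c s m) (fun c => cf (br κ' ϖ' ϕ' X' Y') c s m) := by
  classical
  obtain ⟨T, hT⟩ := exists_modes X s
  obtain ⟨T', hT'⟩ := exists_modes X' s
  have e1 : (fun c => cf (br κ ϖ ϕ X Y) c s m) = ∑ p ∈ Finset.HasAntidiagonal.antidiagonal s,
      ∑ m' ∈ T ∪ T', brc κ ϖ (connFun ϖ ϕ) m' (m - m') (fun c => cf X c p.1 m')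
        (fun c => cf Y c p.2 (m - m')) := by
    funext c
    rw [cf_br κ ϖ ϕ X Y c s m (T ∪ T') fun c s' hs' m' h =>
      Finset.mem_union_left _ (hT c s' hs' m' h)]
    simp only [Finset.sum_apply]
  have e2 : (fun c => cf (br κ' ϖ' ϕ' X' Y') c s m) =
      ∑ p ∈ Finset.HasAntidiagonal.antidiagonal s, ∑ m' ∈ T ∪ T',
        brc κ' ϖ' (connFun ϖ' ϕ') m' (m - m') (fun c => cf X' c p.1 m')
        (fun c => cf Y' c p.2 (m - m')) := by
    funext c
    rw [cf_br κ' ϖ' ϕ' X' Y' c s m (T ∪ T') fun c s' hs' m' h =>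
      Finset.mem_union_right _ (hT' c s' hs' m' h)]
    simp only [Finset.sum_apply]
  have hsum : ∀ {ι : Type} (T : Finset ι) (f f' : ι → Comp r → HFun),
      (∀ i ∈ T, R (f i) (f' i)) → R (∑ i ∈ T, f i) (∑ i ∈ T, f' i) := by
    intro ι T f f' h
    induction T using Finset.induction_on with
    | empty => simpa using h0
    | insert i T hi ih =>
      rw [Finset.sum_insert hi, Finset.sum_insert hi]
      exact hadd _ _ _ _ (h i (Finset.mem_insert_self _ _))
        (ih fun j hj => h j (Finset.mem_insert_of_mem hj))
  rw [e1, e2]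
  refine hsum _ _ _ fun p hp => hsum _ _ _ fun m' _ => ?_
  have hp' := Finset.HasAntidiagonal.mem_antidiagonal.mp hp
  have hl : ∀ (κ : ℂ) (ϖ : Pt → Pt) (ϕ : Fin r → Pt → ℝ) (X Y : Sec r HFun),
      (∀ c m, cf X c 0 m = 0) → p.1 = 0 → brc κ ϖ (connFun ϖ ϕ) m' (m - m')
        (fun c => cf X c p.1 m') (fun c => cf Y c p.2 (m - m')) = 0 := fun κ ϖ ϕ X Y hX hs =>
    funext fun c => brc_zero_left κ ϖ _ _ _ _ _ (fun c => by rw [hs]; exact hX c m') c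
  have hr : ∀ (κ : ℂ) (ϖ : Pt → Pt) (ϕ : Fin r → Pt → ℝ) (X Y : Sec r HFun),
      (∀ c m, cf Y c 0 m = 0) → p.2 = 0 → brc κ ϖ (connFun ϖ ϕ) m' (m - m')
        (fun c => cf X c p.1 m') (fun c => cf Y c p.2 (m - m')) = 0 := fun κ ϖ ϕ X Y hX hs =>
    funext fun c => brc_zero_right κ ϖ _ _ _ _ _ (fun c => by rw [hs]; exact hX c _) c
  rcases Nat.eq_zero_or_pos p.1 with hs' | hs'
  · rw [hl _ _ _ X Y hX hs', hl _ _ _ X' Y' hX' hs']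
    exact h0
  rcases Nat.eq_zero_or_pos p.2 with hs'' | hs''
  · rw [hr _ _ _ X Y hY hs'', hr _ _ _ X' Y' hY' hs'']
    exact h0
  exact h _ (by omega) _ (by omega) _ _ (by abel)

lemma cf_iterate_zero {X Y : Sec r HFun} (hX : ∀ c m, cf X c 0 m = 0)
    (hY : ∀ c m, cf Y c 0 m = 0) (k : ℕ) (c : Comp r) (m : Lam) :
    cf ((br κ ϖ ϕ X)^[k] Y) c 0 m = 0 := by
  cases k with
  | zero => exact hY c m
  | succ k =>
    rw [Function.iterate_succ_apply']
    exact cf_br_zero κ ϖ ϕ _ hX c m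

/-- Compatibility of relations between families of functions with iterated brackets. -/
lemma iterate_relF (P R : Lam → (Comp r → HFun) → (Comp r → HFun) → Prop) (h0 : ∀ m, R m 0 0)
    (hadd : ∀ m x x' y y', R m x x' → R m y y' → R m (x + y) (x' + y'))
    (hbr : ∀ m' m'' x x' y y', P m' x x' → R m'' y y' →
      R (m' + m'') (brc κ ϖ (connFun ϖ ϕ) m' m'' x y) (brc κ' ϖ' (connFun ϖ' ϕ') m' m'' x' y'))
    {X X' Y Y' : Sec r HFun}
    (hX : ∀ c m, cf X c 0 m = 0) (hX' : ∀ c m, cf X' c 0 m = 0)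
    (hY : ∀ c m, cf Y c 0 m = 0) (hY' : ∀ c m, cf Y' c 0 m = 0) (s : ℕ)
    (hPX : ∀ s' < s, ∀ m, P m (fun c => cf X c s' m) (fun c => cf X' c s' m))
    (hRY : ∀ s' < s, ∀ m, R m (fun c => cf Y c s' m) (fun c => cf Y' c s' m)) (k : ℕ) :
    ∀ s' ≤ s, ∀ m, R m (fun c => cf ((br κ ϖ ϕ X)^[k + 1] Y) c s' m)
      (fun c => cf ((br κ' ϖ' ϕ' X')^[k + 1] Y') c s' m) := by
  have step : ∀ Z Z' : Sec r HFun, (∀ c m, cf Z c 0 m = 0) → (∀ c m, cf Z' c 0 m = 0) →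
      (∀ s' < s, ∀ m, R m (fun c => cf Z c s' m) (fun c => cf Z' c s' m)) →
      ∀ s' ≤ s, ∀ m, R m (fun c => cf (br κ ϖ ϕ X Z) c s' m)
        (fun c => cf (br κ' ϖ' ϕ' X' Z') c s' m) := by
    intro Z Z' hZ hZ' hR s' hs' m
    refine br_relF (R m) (h0 m) (hadd m) hX hX' hZ hZ' s' m fun t ht t' ht' m' m'' e => ?_
    rw [← e]
    exact hbr _ _ _ _ _ _ (hPX t (by omega) m') (hR t' (by omega) m'')
  induction k with
  | zero => exact step Y Y' hY hY' hRY
  | succ k ih =>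
    intro s' hs' m
    rw [Function.iterate_succ_apply' (br κ ϖ ϕ X) (k + 1) Y,
      Function.iterate_succ_apply' (br κ' ϖ' ϕ' X') (k + 1) Y']
    exact step _ _ (cf_iterate_zero hX hY _) (cf_iterate_zero hX' hY' _)
      (fun t ht m => ih t ht.le m) s' hs' m

lemma cf_iterate_smul {X Y : Sec r HFun} (hX : ∀ c m, cf X c 0 m = 0)
    (hY : ∀ c m, cf Y c 0 m = 0) (z : ℂ) (k : ℕ) (c : Comp r) (s : ℕ) (m : Lam) :
    cf ((br κ ϖ ϕ X)^[k] (z • Y)) c s m = z • cf ((br κ ϖ ϕ X)^[k] Y) c s m := by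
  cases k with
  | zero => exact cf_smul _ _ _ _ _
  | succ k =>
    have := iterate_relF (κ := κ) (κ' := κ) (ϖ := ϖ) (ϖ' := ϖ) (ϕ := ϕ) (ϕ' := ϕ)
      (fun _ x x' => x = x') (fun _ y y' => y = z • y') (fun _ => (smul_zero z).symm)
      (fun _ x x' y y' h h' => by rw [h, h', smul_add])
      (fun m' m'' x x' y y' h h' => by
        subst h h'
        funext c
        have := brc_smul_smul κ ϖ (connFun ϖ ϕ) m' m'' 1 z x y' c
        rw [one_mul] at this
        simp only [one_smul] at this
        exact this)
      hX hX (Y := z • Y) (fun c m => by rw [cf_smul, hY, smul_zero]) hY s (fun _ _ _ => rfl)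
      (fun s' _ m => funext fun c => cf_smul _ _ _ _ _) k s le_rfl m
    exact congrFun this c

lemma br_self (X : Sec r HFun) : br κ ϖ ϕ X X = 0 := by
  unfold br
  refine Prod.ext ?_ ?_
  · simp
  · funext k
    simp

lemma cf_dW0_flat (X : Sec r HFun) (q : Fin 2) (c : Comp r) (s : ℕ) (m : Lam) :
    cf (dW0 κ ϖ (fun _ _ => 0) X q) c s m = fun ħ => pd ϖ q (cf X c s m ħ) := by
  rw [cf_dW0]
  have e : ∀ q, pd ϖ q (fun _ => (0 : ℂ)) = 0 := fun q => pd_const _ _ _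
  rcases c with c | c
  · simp only [connFun_flat, e, Pi.zero_apply, mul_zero, Finset.sum_const_zero]
    split_ifs <;> exact add_zero _
  · exact add_zero _

end Relations

/-! ## The gauge of the model -/

section ModelGauge

/-- Smooth functions with decay governed by `W` that are invariant along `v`. -/
def DecInv (W : Pt → ℝ) (v : Pt) (g : Pt → ℂ) : Prop := Gau W g ∧ InvAlong v g

lemma DecInv.linClass {W : Pt → ℝ} (hW : ∀ y, 0 ≤ W y) (v : Pt) : LinClass (DecInv W v) :=
  ⟨⟨Gau.zero, InvAlong.zero v⟩, fun h1 h2 => ⟨h1.1.add hW h2.1, h1.2.add h2.2⟩,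
    fun z _ h => ⟨h.1.smul z, h.2.smul z⟩⟩

lemma sqW_nonneg (η : Pt →L[ℝ] ℝ) (y : Pt) : 0 ≤ sqW η y := sq_nonneg _

lemma negW_nonneg (η : Pt →L[ℝ] ℝ) (y : Pt) : 0 ≤ negW η y := sq_nonneg _

lemma DecInv.rayInt {η : Pt →L[ℝ] ℝ} {n v : Pt} (hn : η n = 1) {g : Pt → ℂ}
    (hg : DecInv (sqW η) v g) : DecInv (negW η) v (rayInt n g) :=
  ⟨(rayDecay_sqW hn).gau hg.1, hg.2.rayInt n⟩

/-- The gradient of the integral along rays of an invariant function. -/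
lemma DecInv.pd_rayInt {η : Pt →L[ℝ] ℝ} {n v : Pt} {k : ℝ} (hη : η = k • detCLM v) (hn : η n = 1)
    {g : Pt → ℂ} (hg : DecInv (sqW η) v g) (q : Fin 2) :
    pd id q (ExtScattering.rayInt n g) = ((η (Pi.single q 1) : ℝ) : ℂ) • g := by
  funext y
  have h1 := (rayDecay_sqW hn).sum_pd_rayInt hg.1 y
  have h2 := (hg.rayInt hn).2.sum_pd ((hg.rayInt hn).1.differentiableAt y)
  have h3 : ((k * (v 0 * n 1 - v 1 * n 0) : ℝ) : ℂ) = 1 := by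
    rw [hη, _root_.smul_apply, detCLM_apply, detP, smul_eq_mul] at hn
    rw [hn, Complex.ofReal_one]
  push_cast at h3
  rw [Fin.sum_univ_two] at h1 h2
  rw [Pi.smul_apply, hη, _root_.smul_apply, detCLM_apply, detP]
  fin_cases q
  · simp only [Fin.zero_eta, Fin.isValue, Pi.single_eq_same, ne_eq, one_ne_zero, not_false_eq_true,
      Pi.single_eq_of_ne, mul_zero, mul_one, smul_eq_mul, Complex.ofReal_mul, Complex.ofReal_sub,
      Complex.ofReal_zero]
    linear_combination (-pd id 0 (ExtScattering.rayInt n g) y) * h3 + (k * n 1 : ℂ) * h2 -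
      (k * v 1 : ℂ) * h1
  · simp only [Fin.mk_one, Fin.isValue, Pi.single_eq_same, ne_eq, zero_ne_one, not_false_eq_true,
      Pi.single_eq_of_ne, mul_zero, mul_one, smul_eq_mul, Complex.ofReal_mul, Complex.ofReal_sub,
      Complex.ofReal_zero]
    linear_combination (-pd id 1 (ExtScattering.rayInt n g) y) * h3 - (k * n 0 : ℂ) * h2 +
      (k * v 0 : ℂ) * h1

namespace Setup

variable {r : ℕ} (S : Setup r)

/-- The sign of the orientation of the line with direction `m_a`. -/
noncomputable def sgn (a : Prim) : ℝ := if a = e2 then -1 else 1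

/-- A vector transverse to `m_a`. -/
noncomputable def nA (a : Prim) : Pt :=
  (sgn a / ((a.1.1 : ℝ) ^ 2 + (a.1.2 : ℝ) ^ 2)) •
    ((a.1.1 : ℝ) • toPt S.w2.m - (a.1.2 : ℝ) • toPt S.w1.m)

/-- The linear form that vanishes on `m_a` and has the value `1` on the transverse vector. -/
noncomputable def etaA (a : Prim) : Pt →L[ℝ] ℝ := (sgn a / S.D) • detCLM (toPt (S.mA a))

/-- The mode `m` is a positive multiple of `m_a`. -/
def Along (a : Prim) (m : Lam) : Prop := ∃ l : ℕ, 1 ≤ l ∧ m = l • S.mA a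

/-- The total flux of the model along lines, as a section. -/
noncomputable def fluxSec : Sec r HFun :=
  S.initSec S.gaussS -
    (2⁻¹ : ℂ) • mapSec (fun m f ε => lineInt (toPt m) (f ε)) (detBr S.κ S.model)

open scoped Classical in
/-- The component of the `1`-form of the model with modes along `m_a` in the transverse
direction. -/
noncomputable def source (a : Prim) : Sec r HFun :=
  mapSec (fun m g => if S.Along a m then ((detP (toPt m) (S.nA a) : ℝ) : ℂ) • g else 0) S.fluxSec

/-- Integration along the transverse vector. -/
noncomputable def rayA (a : Prim) (X : Sec r HFun) : Sec r HFun :=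
  mapSec (fun _ f ε => rayInt (S.nA a) (f ε)) X

variable {S}

lemma sgn_sq (a : Prim) : sgn a * sgn a = 1 := by
  unfold sgn
  split_ifs <;> norm_num

lemma prim_norm_pos (a : Prim) : (0 : ℝ) < (a.1.1 : ℝ) ^ 2 + (a.1.2 : ℝ) ^ 2 := by
  by_contra h
  have h1 : (a.1.1 : ℝ) = 0 := by nlinarith [sq_nonneg (a.1.1 : ℝ), sq_nonneg (a.1.2 : ℝ)]
  have h2 : (a.1.2 : ℝ) = 0 := by nlinarith [sq_nonneg (a.1.1 : ℝ), sq_nonneg (a.1.2 : ℝ)]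
  have h3 := a.2
  rw [Nat.cast_eq_zero.mp h1, Nat.cast_eq_zero.mp h2] at h3
  simp at h3

lemma etaA_nA (a : Prim) : S.etaA a (S.nA a) = 1 := by
  have hD : (S.D : ℝ) ≠ 0 := Int.cast_ne_zero.mpr S.D_ne
  have hN := (prim_norm_pos a).ne'
  have h1 : detP (toPt (S.mA a)) (toPt S.w2.m) = a.1.1 * S.D := by
    rw [detP_toPt, mA, detL_left (S := S) a.1]
    push_cast
    ring
  have h2 : detP (toPt (S.mA a)) (toPt S.w1.m) = -(a.1.2 * S.D) := by
    have := detL_right (S := S) a.1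
    have e : detL (S.mA a) S.w1.m = -detL S.w1.m (a.1.1 • S.w1.m + a.1.2 • S.w2.m) := by
      simp only [mA, detL]
      ring
    rw [detP_toPt, e, this]
    push_cast
    ring
  rw [etaA, _root_.smul_apply, nA, map_smul, map_sub, map_smul, map_smul, detCLM_apply,
    detCLM_apply, h1, h2]
  simp only [smul_eq_mul]
  have hs := sgn_sq a
  field_simp
  linear_combination ((a.1.1 : ℝ) ^ 2 + (a.1.2 : ℝ) ^ 2) * hs

lemma Along.cone {a : Prim} {m : Lam} (h : S.Along a m) : S.Cone m := by
  obtain ⟨l, hl, rfl⟩ := h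
  exact mA_cone a hl

lemma Along.add {a : Prim} {m m' : Lam} (h : S.Along a m) (h' : S.Along a m') :
    S.Along a (m + m') := by
  obtain ⟨l, hl, rfl⟩ := h
  obtain ⟨l', hl', rfl⟩ := h'
  exact ⟨l + l', by omega, by rw [add_smul]⟩

lemma sqW_etaA (a : Prim) (y : Pt) :
    sqW (S.etaA a) y = ((S.D : ℝ) ^ 2)⁻¹ * lineW (toPt (S.mA a)) y := by
  rw [sqW, etaA, _root_.smul_apply, detCLM_apply, lineW, smul_eq_mul, mul_pow, div_pow, sq (sgn a),
    sgn_sq, one_div]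

lemma decInv_of_gauInv {a : Prim} {l : ℕ} (hl : 1 ≤ l) {g : Pt → ℂ}
    (h : GauInv (toPt (l • S.mA a)) g) : DecInv (sqW (S.etaA a)) (toPt (S.mA a)) g := by
  have hD : (S.D : ℝ) ≠ 0 := Int.cast_ne_zero.mpr S.D_ne
  have hl' : (l : ℝ) ≠ 0 := by positivity
  rw [toPt_nsmul] at h
  refine ⟨h.1.mono (k := (l : ℝ) ^ 2 * S.D ^ 2) (by positivity) fun y => ?_, fun y t => ?_⟩
  · rw [sqW_etaA]
    simp only [lineW, detP_smul]
    field_simp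
    exact le_rfl
  · have := h.2 y (t / l)
    rwa [smul_smul, div_mul_cancel₀ _ hl'] at this

lemma cf_fluxSec (c : Comp r) (s : ℕ) (m : Lam) : cf S.fluxSec c s m = S.flux c s m := by
  rw [fluxSec, cf_sub, cf_smul, cf_mapSec]
  · rfl
  · intro m
    funext ε
    simp [lineInt, rayInt_zero]

open scoped Classical in
lemma cf_source (a : Prim) (c : Comp r) (s : ℕ) (m : Lam) : cf (S.source a) c s m =
    if S.Along a m then ((detP (toPt m) (S.nA a) : ℝ) : ℂ) • S.flux c s m else 0 := by
  rw [source, cf_mapSec, cf_fluxSec]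
  simp

lemma polyIn_source (a : Prim) (c : Comp r) (s : ℕ) (m : Lam) :
    PolyIn (DecInv (sqW (S.etaA a)) (toPt (S.mA a))) (cf (S.source a) c s m) := by
  have hC := DecInv.linClass (sqW_nonneg (S.etaA a)) (toPt (S.mA a))
  rw [cf_source]
  split_ifs with h
  · refine PolyIn.smul hC ((polyIn_flux h.cone.ne_zero c s).mono fun g hg => ?_) _
    obtain ⟨l, hl, rfl⟩ := h
    exact decInv_of_gauInv hl hg
  · exact PolyIn.zero hC

lemma cf_source_zero (a : Prim) (c : Comp r) (m : Lam) : cf (S.source a) c 0 m = 0 := by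
  have h : S.flux c 0 m = 0 := by
    funext ε
    rw [flux, cf_detBr_zero S.κ model_isDensity.1, cf_initSec, logθ1_zero, logθ2_zero]
    simp [lineInt, rayInt_zero]
  rw [cf_source, h]
  simp

lemma cf_rayA (a : Prim) (X : Sec r HFun) (c : Comp r) (s : ℕ) (m : Lam) :
    cf (S.rayA a X) c s m = fun ε => rayInt (S.nA a) (cf X c s m ε) := by
  rw [rayA, cf_mapSec]
  exact fun _ => funext fun _ => rayInt_zero

lemma cf_rayA_zero (a : Prim) {X : Sec r HFun} {c : Comp r} {s : ℕ} {m : Lam}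
    (h : cf X c s m = 0) : cf (S.rayA a X) c s m = 0 := by
  rw [cf_rayA, h]
  exact funext fun _ => rayInt_zero

/-- The equation of the transverse derivative of the gauge of the model. -/
def IsGaugeDens (S : Setup r) (a : Prim) (X : Sec r HFun) : Prop :=
  (∀ c m, cf X c 0 m = 0) ∧ ∀ c s m, cf X c s m = -cf (S.source a) c s m -
    ∑ k ∈ Finset.range (s - 1), (((k + 2).factorial : ℂ)⁻¹) •
      cf ((br S.κ id (fun _ _ => 0) (S.rayA a X))^[k + 1] X) c s m

lemma exists_isGaugeDens (a : Prim) : ∃ X, S.IsGaugeDens a X := by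
  obtain ⟨T, hT⟩ : ∃ T : Sec r HFun → Sec r HFun, ∀ X c s m,
      cf (T X) c s m = -cf (S.source a) c s m -
        ∑ k ∈ Finset.range (s - 1), (((k + 2).factorial : ℂ)⁻¹) •
          cf ((br S.κ id (fun _ _ => 0) (S.rayA a X))^[k + 1] X) c s m :=
    ⟨fun X => -S.source a - diagSec (fun s =>
      ∑ k ∈ Finset.range (s - 1), (((k + 2).factorial : ℂ)⁻¹) •
        (br S.κ id (fun _ _ => 0) (S.rayA a X))^[k + 1] X), fun X c s m => by
      rw [cf_sub, cf_neg, cf_diagSec, cf_sum]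
      simp only [cf_smul]⟩
  obtain ⟨X, h1, h2⟩ := exists_fixedPoint T
    (fun X c m => by rw [hT, cf_source_zero]; simp)
    (fun n X Y hX hY h c s hs m => by
      rw [hT, hT]
      refine congrArg (fun z => -cf (S.source a) c s m - z) (Finset.sum_congr rfl fun k _ =>
        congrArg (fun z => (((k + 2).factorial : ℂ)⁻¹) • z) ?_)
      have := iterate_relF (κ := S.κ) (κ' := S.κ) (ϖ := id) (ϖ' := id) (ϕ := fun _ _ => 0)
        (ϕ' := fun _ _ => 0) (fun _ x x' => x = x') (fun _ x x' => x = x') (fun _ => rfl)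
        (fun _ _ _ _ _ h h' => by rw [h, h']) (fun _ _ _ _ _ _ h h' => by rw [h, h'])
        (X := S.rayA a X) (X' := S.rayA a Y) (Y := X) (Y' := Y)
        (fun c m => cf_rayA_zero a (hX c m)) (fun c m => cf_rayA_zero a (hY c m)) hX hY s
        (fun s' hs' m => funext fun c => by rw [cf_rayA, cf_rayA, h c s' (by omega)])
        (fun s' hs' m => funext fun c => h c s' (by omega) m) k s le_rfl m
      exact congrFun this c)
  refine ⟨X, h2, fun c s m => ?_⟩
  conv_lhs => rw [← h1]
  rw [hT]

variable (S) in
/-- The transverse derivative of the gauge of the model. -/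
noncomputable def gaugeDens (a : Prim) : Sec r HFun := (exists_isGaugeDens (S := S) a).choose

lemma gaugeDens_spec (a : Prim) : S.IsGaugeDens a (S.gaugeDens a) :=
  (exists_isGaugeDens (S := S) a).choose_spec

variable (S) in
/-- The gauge of the model. -/
noncomputable def modelGauge (a : Prim) : Sec r HFun := S.rayA a (S.gaugeDens a)

lemma cf_modelGauge (a : Prim) (c : Comp r) (s : ℕ) (m : Lam) :
    cf (S.modelGauge a) c s m = fun ε => rayInt (S.nA a) (cf (S.gaugeDens a) c s m ε) :=
  cf_rayA a _ c s m

lemma polyIn_rayA (a : Prim) {f : HFun}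
    (hf : PolyIn (DecInv (sqW (S.etaA a)) (toPt (S.mA a))) f) :
    PolyIn (DecInv (negW (S.etaA a)) (toPt (S.mA a))) (fun ε => rayInt (S.nA a) (f ε)) :=
  hf.map (DecInv.linClass (sqW_nonneg _) _) _ (fun _ h => h.rayInt (etaA_nA a))
    (fun _ _ h1 h2 => (rayDecay_sqW (etaA_nA a)).rayInt_add h1.1 h2.1) fun z f => rayInt_smul z f

/-- The coefficients of the transverse derivative of the gauge. -/
lemma gaugeDens_prop (a : Prim) (c : Comp r) (s : ℕ) (m : Lam) :
    PolyIn (DecInv (sqW (S.etaA a)) (toPt (S.mA a))) (cf (S.gaugeDens a) c s m) ∧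
      (cf (S.gaugeDens a) c s m ≠ 0 → S.Along a m) := by
  induction s using Nat.strong_induction_on generalizing c m with
  | _ s ih =>
    set C₁ := DecInv (sqW (S.etaA a)) (toPt (S.mA a))
    set C₂ := DecInv (negW (S.etaA a)) (toPt (S.mA a))
    have hC₁ : LinClass C₁ := DecInv.linClass (sqW_nonneg _) _
    have hC₂ : LinClass C₂ := DecInv.linClass (negW_nonneg _) _
    have h1 : ∀ k, PolyIn C₁ (cf ((br S.κ id (fun _ _ => 0)
        (S.rayA a (S.gaugeDens a)))^[k + 1] (S.gaugeDens a)) c s m) ∧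
        (cf ((br S.κ id (fun _ _ => 0)
        (S.rayA a (S.gaugeDens a)))^[k + 1] (S.gaugeDens a)) c s m ≠ 0 → S.Along a m) := by
      intro k
      refine iterate_relF (κ := S.κ) (κ' := S.κ) (ϖ := id) (ϖ' := id) (ϕ := fun _ _ => 0)
        (ϕ' := fun _ _ => 0)
        (fun m x _ => ∀ c, PolyIn C₂ (x c) ∧ (x c ≠ 0 → S.Along a m))
        (fun m x _ => ∀ c, PolyIn C₁ (x c) ∧ (x c ≠ 0 → S.Along a m))
        (fun m c => ⟨PolyIn.zero hC₁, fun h => absurd rfl h⟩) ?_ ?_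
        (X := S.rayA a (S.gaugeDens a)) (X' := S.rayA a (S.gaugeDens a)) (Y := S.gaugeDens a)
        (Y' := S.gaugeDens a) (fun c m => cf_rayA_zero a ((gaugeDens_spec a).1 c m))
        (fun c m => cf_rayA_zero a ((gaugeDens_spec a).1 c m)) (gaugeDens_spec a).1
        (gaugeDens_spec a).1 s (fun s' hs' m c => ?_) (fun s' hs' m c => ih s' hs' c m) k s le_rfl
        m c
      · intro m x _ y _ hx hy c
        refine ⟨(hx c).1.add (hy c).1, fun h => ?_⟩
        by_contra hm
        rw [Pi.add_apply, by_contra fun h => hm ((hx c).2 h),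
          by_contra fun h => hm ((hy c).2 h)] at h
        exact h (add_zero 0)
      · intro m' m'' x _ y _ hx hy c
        rw [connFun_flat]
        refine ⟨PolyIn.brf hC₂ hC₁ hC₁ (fun f q h => ⟨h.1.pd q, h.2.pd q⟩)
          (fun f q h => ⟨h.1.pd q, h.2.pd q⟩) (fun f h y => h.1.differentiableAt y)
          (fun f h y => h.1.differentiableAt y) (fun f g hf hg => ⟨hf.1.mul hg.1 one_pos
            (negW_nonneg _) (sqW_nonneg _) fun y => ?_, fun y t => ?_⟩) S.κ m' m''
          (fun c => (hx c).1) (fun c => (hy c).1) c, fun h => ?_⟩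
        · rw [one_mul]
          exact le_add_of_nonneg_left (negW_nonneg _ y)
        · rw [Pi.mul_apply, hf.2, hg.2, Pi.mul_apply]
        · by_contra hm
          by_cases hm' : S.Along a m'
          · by_cases hm'' : S.Along a m''
            · exact hm (hm'.add hm'')
            · exact h (brc_zero_right _ _ _ _ _ _ _
                (fun c => by_contra fun h => hm'' ((hy c).2 h)) c)
          · exact h (brc_zero_left _ _ _ _ _ _ _
              (fun c => by_contra fun h => hm' ((hx c).2 h)) c)
      · refine ⟨?_, fun h => (ih s' hs' c m).2 fun h0 => h (cf_rayA_zero a h0)⟩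
        change PolyIn C₂ (cf (S.rayA a (S.gaugeDens a)) c s' m)
        rw [cf_rayA]
        exact polyIn_rayA a (ih s' hs' c m).1
    rw [(gaugeDens_spec a).2]
    have hsum : ∀ T : Finset ℕ, PolyIn C₁ (∑ k ∈ T, (((k + 2).factorial : ℂ)⁻¹) •
        cf ((br S.κ id (fun _ _ => 0) (S.rayA a (S.gaugeDens a)))^[k + 1] (S.gaugeDens a)) c s m) := by
      intro T
      induction T using Finset.induction_on with
      | empty => exact PolyIn.zero hC₁
      | insert k T hk ih =>
        rw [Finset.sum_insert hk]
        exact ((h1 k).1.smul hC₁ _).add ih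
    refine ⟨?_, fun h => ?_⟩
    · rw [sub_eq_add_neg]
      exact ((polyIn_source a c s m).neg hC₁).add ((hsum _).neg hC₁)
    · by_contra hm
      apply h
      rw [cf_source, if_neg hm, Finset.sum_eq_zero fun k _ => by
        rw [by_contra fun h => hm ((h1 k).2 h), smul_zero]]
      simp

lemma gaugeDens_along {a : Prim} {c : Comp r} {s : ℕ} {m : Lam}
    (h : cf (S.gaugeDens a) c s m ≠ 0) : S.Along a m := (gaugeDens_prop a c s m).2 h

lemma polyIn_gaugeDens (a : Prim) (c : Comp r) (s : ℕ) (m : Lam) :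
    PolyIn (DecInv (sqW (S.etaA a)) (toPt (S.mA a))) (cf (S.gaugeDens a) c s m) :=
  (gaugeDens_prop a c s m).1

lemma polyIn_modelGauge (a : Prim) (c : Comp r) (s : ℕ) (m : Lam) :
    PolyIn (DecInv (negW (S.etaA a)) (toPt (S.mA a))) (cf (S.modelGauge a) c s m) := by
  rw [cf_modelGauge]
  exact polyIn_rayA a (polyIn_gaugeDens a c s m)

lemma modelGauge_zero (a : Prim) (c : Comp r) (m : Lam) : cf (S.modelGauge a) c 0 m = 0 :=
  cf_rayA_zero a ((gaugeDens_spec a).1 c m)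

/-- The differential of the gauge of the model. -/
lemma dW0_modelGauge (a : Prim) (q : Fin 2) :
    dW0 S.κ id (fun _ _ => 0) (S.modelGauge a) q =
      ((S.etaA a (Pi.single q 1) : ℝ) : ℂ) • S.gaugeDens a := by
  refine sec_ext fun c s m => ?_
  rw [cf_dW0_flat, cf_smul, cf_modelGauge]
  funext ε
  rw [((polyIn_gaugeDens a c s m).apply
    (DecInv.linClass (sqW_nonneg _) _) ε).pd_rayInt rfl (etaA_nA a) q]
  rfl

/-- The gauge of the model trivialises the total flux. -/
lemma cf_gaugeZero_modelGauge (a : Prim) (q : Fin 2) (c : Comp r) (s : ℕ) (m : Lam) :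
    cf (gaugeZero S.κ id (fun _ _ => 0) s (S.modelGauge a) q) c s m =
      ((S.etaA a (Pi.single q 1) : ℝ) : ℂ) • cf (S.source a) c s m := by
  rw [cf_gaugeZero, dW0_modelGauge]
  simp only [cf_iterate_smul (modelGauge_zero a) (gaugeDens_spec a).1]
  cases s with
  | zero =>
    rw [cf_source_zero]
    simp
  | succ s =>
    have h := (gaugeDens_spec (S := S) a).2 c (s + 1) m
    rw [Nat.add_sub_cancel] at h
    have e : cf (S.source a) c (s + 1) m = -cf (S.gaugeDens a) c (s + 1) m -
        ∑ k ∈ Finset.range s, (((k + 2).factorial : ℂ)⁻¹) • cf ((br S.κ id (fun _ _ => 0)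
          (S.rayA a (S.gaugeDens a)))^[k + 1] (S.gaugeDens a)) c (s + 1) m := by
      rw [h]
      abel
    rw [e, Finset.sum_range_succ']
    simp only [smul_comm _ ((S.etaA a (Pi.single q 1) : ℝ) : ℂ), ← Finset.smul_sum, ← smul_add,
      ← smul_neg]
    congr 1
    simp only [zero_add, Nat.factorial_one, Nat.cast_one, inv_one, one_smul,
      Function.iterate_zero, id_eq, modelGauge, add_assoc, Nat.reduceAdd]
    abel

/-- The conormal covectors in terms of the transverse linear form. -/
lemma conormal_eq {a : Prim} {m : Lam} (h : S.Along a m) (q : Fin 2) :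
    conormal m q = ((S.etaA a (Pi.single q 1) : ℝ) : ℂ) * ((detP (toPt m) (S.nA a) : ℝ) : ℂ) := by
  obtain ⟨l, hl, rfl⟩ := h
  have h1 := etaA_nA (S := S) a
  rw [etaA, _root_.smul_apply, detCLM_apply, smul_eq_mul] at h1
  rw [← Complex.ofReal_mul, etaA, _root_.smul_apply, detCLM_apply, toPt_nsmul, detP_smul, smul_eq_mul]
  have e : sgn a / S.D * detP (toPt (S.mA a)) (Pi.single q 1) *
      (l * detP (toPt (S.mA a)) (S.nA a)) = l * detP (toPt (S.mA a)) (Pi.single q 1) := by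
    linear_combination (l * detP (toPt (S.mA a)) (Pi.single q 1)) * h1
  rw [e]
  fin_cases q <;> simp [conormal, detP, toPt]

end Setup
end ModelGauge

/-! ## The leading term of the gauge of the model -/

section LeadingTerm

lemma exists_of_detP_eq_zero {v y : Pt} (hv : v ≠ 0) (h : detP v y = 0) : ∃ t : ℝ, y = t • v := by
  have hN := normSqW_pos hv
  refine ⟨dotP v y / normSqW v, ?_⟩
  have e : ∀ i, normSqW v * y i = dotP v y * v i := by
    intro i
    fin_cases i
    · simp only [normSqW, dotP, detP, Fin.zero_eta] at h ⊢
      linear_combination -(v 1) * h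
    · simp only [normSqW, dotP, detP, Fin.mk_one] at h ⊢
      linear_combination (v 0) * h
  funext i
  rw [Pi.smul_apply, smul_eq_mul, div_mul_eq_mul_div, eq_div_iff hN.ne', mul_comm, e i]

/-- The integral of an invariant function along a transverse line does not depend on the line. -/
lemma DecInv.lineInt_eq {η : Pt →L[ℝ] ℝ} {n v : Pt} {k : ℝ} (hη : η = k • detCLM v)
    (hn : η n = 1) {g : Pt → ℂ} (hg : DecInv (sqW η) v g) (y : Pt) :
    lineInt n g y = lineInt n g 0 := by
  have hk : k ≠ 0 := by
    rintro rfl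
    rw [hη, zero_smul] at hn
    simp at hn
  have hv : v ≠ 0 := by
    rintro rfl
    rw [hη, _root_.smul_apply, detCLM_apply] at hn
    simp [detP] at hn
  have h1 : detP v (y - η y • n) = 0 := by
    have : η (y - η y • n) = 0 := by rw [map_sub, map_smul, hn]; simp
    generalize y - η y • n = w at this ⊢
    rw [hη, _root_.smul_apply, detCLM_apply, smul_eq_mul] at this
    exact (mul_eq_zero.mp this).resolve_left hk
  obtain ⟨t, ht⟩ := exists_of_detP_eq_zero hv h1
  have h2 : InvAlong n (lineInt n g) :=
    invAlong_lineInt hg.1 (rayDecay_sqW hn) (rayDecay_sqW_neg hn)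
  have h3 : InvAlong v (lineInt n g) := (hg.2.rayInt n).add (hg.2.rayInt (-n))
  have e : y = (0 + t • v) + η y • n := by rw [← ht]; abel
  rw [e, h2, h3]

/-- The bracket of coefficients at parameter `0`. -/
lemma brc_param_zero {r : ℕ} {κ : ℂ} {ϖ : Pt → Pt} (m m' : Lam) {x x' y y' : Comp r → HFun}
    {p : Pt} {G g : ℂ} (hx : ∀ c, x c 0 p = G * x' c 0 p) (hy : ∀ c, y c 0 p = g * y' c 0 p)
    (c : Comp r) : brc κ ϖ (fun _ _ _ => 0) m m' x y c 0 p =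
      G * g * brc κ ϖ (fun _ _ _ => 0) m m' x' y' c 0 p := by
  have h1 : ∀ (c : Comp r) m k (f : HFun), covC κ ϖ (fun _ _ _ => 0) c m k f 0 p =
      (m k : ℂ) * f 0 p := by
    intro c m k f
    rw [covC_flat]
    simp
  rcases c with c | c
  · simp only [brc, Pi.add_apply, Finset.sum_apply, Pi.sub_apply, Pi.mul_apply, h1, hx, hy, mul_add,
      Finset.mul_sum]
    congr 1
    · exact Finset.sum_congr rfl fun _ _ => by ring
    · exact Finset.sum_congr rfl fun _ _ => by ring
  · simp only [brc, Pi.add_apply, Finset.sum_apply, Pi.sub_apply, Pi.mul_apply, h1, hx, hy, mul_add,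
      Finset.mul_sum, Pi.zero_apply, mul_zero]
    congr 1
    exact Finset.sum_congr rfl fun _ _ => by ring

namespace Setup

variable {r : ℕ} (S : Setup r)

/-- The value of the gauge of the model far beyond the wall. -/
noncomputable def limitA (a : Prim) (c : Comp r) (s : ℕ) (m : Lam) (ε : ℝ) : ℂ :=
  lineInt (S.nA a) (cf (S.gaugeDens a) c s m ε) 0

/-- The leading term of the gauge. -/
noncomputable def leading (a : Prim) : Sec r ℂ :=
  mapSec (fun _ f => lineInt (S.nA a) (f 0) 0) (S.gaugeDens a)

variable {S}

lemma cf_leading (a : Prim) (c : Comp r) (s : ℕ) (m : Lam) :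
    cf (S.leading a) c s m = S.limitA a c s m 0 := by
  rw [leading, cf_mapSec]
  · rfl
  · intro m
    simp [lineInt, rayInt_zero]

lemma decInv_gaugeDens (a : Prim) (c : Comp r) (s : ℕ) (m : Lam) (ε : ℝ) :
    DecInv (sqW (S.etaA a)) (toPt (S.mA a)) (cf (S.gaugeDens a) c s m ε) :=
  (polyIn_gaugeDens a c s m).apply (DecInv.linClass (sqW_nonneg _) _) ε

/-- The gauge of the model is close to its limit beyond the wall. -/
lemma polyIn_limit_sub (a : Prim) (c : Comp r) (s : ℕ) (m : Lam) :
    PolyIn (DecInv (negW (-S.etaA a)) (toPt (S.mA a)))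
      (fun ε y => S.limitA a c s m ε - cf (S.modelGauge a) c s m ε y) := by
  have hn := rayDecay_sqW_neg (etaA_nA (S := S) a)
  have e : (fun (ε : ℝ) y => S.limitA a c s m ε - cf (S.modelGauge a) c s m ε y) =
      fun ε => rayInt (-S.nA a) (cf (S.gaugeDens a) c s m ε) := by
    funext ε y
    rw [limitA, ← (decInv_gaugeDens a c s m ε).lineInt_eq rfl (etaA_nA a) y, lineInt, Pi.add_apply,
      cf_modelGauge]
    ring
  rw [e]
  exact (polyIn_gaugeDens a c s m).map (DecInv.linClass (sqW_nonneg _) _) _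
    (fun g hg => ⟨hn.gau hg.1, hg.2.rayInt _⟩) (fun f g h1 h2 => hn.rayInt_add h1.1 h2.1)
    fun z f => rayInt_smul z f

lemma limitA_lipschitz (a : Prim) (c : Comp r) (s : ℕ) (m : Lam) : ∃ K : ℝ, 0 ≤ K ∧
    ∀ ε : ℝ, 0 ≤ ε → ε ≤ 1 → ‖S.limitA a c s m ε - cf (S.leading a) c s m‖ ≤ K * ε := by
  rw [cf_leading]
  refine (polyIn_gaugeDens a c s m).lipschitz (DecInv.linClass (sqW_nonneg _) _)
    (fun g => lineInt (S.nA a) g 0) (fun f g h1 h2 => ?_) fun z f => ?_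
  · simp only [lineInt, (rayDecay_sqW (etaA_nA a)).rayInt_add h1.1 h2.1,
      (rayDecay_sqW_neg (etaA_nA a)).rayInt_add h1.1 h2.1, Pi.add_apply]
    ring
  · simp only [lineInt, rayInt_smul, Pi.add_apply, Pi.smul_apply, smul_add]

lemma limitA_eq_zero {a : Prim} {c : Comp r} {s : ℕ} {m : Lam}
    (h : cf (S.gaugeDens a) c s m = 0) (ε : ℝ) : S.limitA a c s m ε = 0 := by
  rw [limitA, h]
  simp [lineInt, rayInt_zero]

lemma sum_gaugeDens_inr (a : Prim) (s : ℕ) (m : Lam) (p : Pt) :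
    ∑ q, (m q : ℂ) * cf (S.gaugeDens a) (Sum.inr q) s m 0 p = 0 := by
  induction s using Nat.strong_induction_on generalizing m p with
  | _ s ih =>
    have h1 : ∀ k, ∑ q, (m q : ℂ) * cf ((br S.κ id (fun _ _ => 0)
        (S.rayA a (S.gaugeDens a)))^[k + 1] (S.gaugeDens a)) (Sum.inr q) s m 0 p = 0 := by
      intro k
      refine iterate_relF (κ := S.κ) (κ' := S.κ) (ϖ := id) (ϖ' := id) (ϕ := fun _ _ => 0)
        (ϕ' := fun _ _ => 0) (fun m x _ => ∀ p, ∑ q, (m q : ℂ) * x (Sum.inr q) 0 p = 0)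
        (fun m x _ => ∀ p, ∑ q, (m q : ℂ) * x (Sum.inr q) 0 p = 0)
        (fun m p => by simp) ?_ ?_
        (X := S.rayA a (S.gaugeDens a)) (X' := S.rayA a (S.gaugeDens a)) (Y := S.gaugeDens a)
        (Y' := S.gaugeDens a) (fun c m => cf_rayA_zero a ((gaugeDens_spec a).1 c m))
        (fun c m => cf_rayA_zero a ((gaugeDens_spec a).1 c m)) (gaugeDens_spec a).1
        (gaugeDens_spec a).1 s (fun s' hs' m p => ?_) (fun s' hs' m p => ih s' hs' m p) k s le_rfl
        m p
      · intro m x _ y _ hx hy p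
        simp only [Pi.add_apply, mul_add, Finset.sum_add_distrib, hx p, hy p, add_zero]
      · intro m' m'' x _ y _ hx hy p
        rw [connFun_flat]
        exact sum_brf_inr_zero S.κ m' m'' x y p (hx p) (hy p)
      · simp only [cf_rayA]
        exact sum_rayInt (rayDecay_sqW (etaA_nA a)) (fun q => (decInv_gaugeDens a _ s' m 0).1)
          (fun p => ih s' hs' m p) p
    have h2 : ∑ q, (m q : ℂ) * cf (S.source a) (Sum.inr q) s m 0 p = 0 := by
      simp only [cf_source]
      split_ifs with h
      · have := sum_flux_inr (S := S) h.cone.ne_zero s p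
        simp only [Pi.smul_apply, smul_eq_mul, mul_left_comm (_ : ℂ) ((detP _ _ : ℝ) : ℂ),
          ← Finset.mul_sum, this, mul_zero]
      · simp
    simp only [fun q => (gaugeDens_spec (S := S) a).2 (Sum.inr q) s m, Pi.sub_apply, Pi.neg_apply,
      Finset.sum_apply, Pi.smul_apply, smul_eq_mul, mul_sub, Finset.sum_sub_distrib, mul_neg,
      Finset.sum_neg_distrib, h2, neg_zero, zero_sub, Finset.mul_sum]
    rw [Finset.sum_comm, neg_eq_zero]
    refine Finset.sum_eq_zero fun k _ => ?_
    simp only [mul_left_comm (_ : ℂ) (((k + 2).factorial : ℂ)⁻¹), ← Finset.mul_sum, h1 k, mul_zero]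

lemma leading_along (a : Prim) : ModesAlong (S.mA a) (S.leading a) := by
  intro c s m h
  by_contra hm
  apply h
  rw [cf_leading, limitA_eq_zero (by_contra fun h => hm (gaugeDens_along h))]

lemma leading_inExtLie (a : Prim) : InExtLie (S.leading a) := by
  refine ⟨fun c s m h => ?_, fun s m => ?_⟩
  · rw [cf_leading]
    refine limitA_eq_zero ?_ 0
    rcases h with rfl | rfl
    · exact (gaugeDens_spec a).1 c m
    · exact by_contra fun h => (gaugeDens_along h).cone.ne_zero rfl
  · have h1 := sum_rayInt (m := m) (rayDecay_sqW (etaA_nA (S := S) a))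
      (fun q => (decInv_gaugeDens a (Sum.inr q) s m 0).1) (fun p => sum_gaugeDens_inr a s m p) 0
    have h2 := sum_rayInt (m := m) (rayDecay_sqW_neg (etaA_nA (S := S) a))
      (fun q => (decInv_gaugeDens a (Sum.inr q) s m 0).1) (fun p => sum_gaugeDens_inr a s m p) 0
    simp only [cf_leading, limitA, lineInt, Pi.add_apply, mul_add, Finset.sum_add_distrib, h1, h2,
      add_zero]

lemma gaugeDens_eq_zero {a : Prim} {s : ℕ} (h : ∀ c, ∀ s' ≤ s, ∀ m, cf (S.source a) c s' m = 0)
    {s' : ℕ} (hs' : s' ≤ s) (c : Comp r) (m : Lam) : cf (S.gaugeDens a) c s' m = 0 := by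
  induction s' using Nat.strong_induction_on generalizing c m with
  | _ s' ih =>
    rw [(gaugeDens_spec a).2, h c s' hs' m, Finset.sum_eq_zero, neg_zero, sub_zero]
    intro k _
    have := iterate_relF (κ := S.κ) (κ' := S.κ) (ϖ := id) (ϖ' := id) (ϕ := fun _ _ => 0)
        (ϕ' := fun _ _ => 0) (fun _ _ _ => True) (fun _ x _ => x = 0) (fun _ => rfl)
        (fun _ x _ y _ hx hy => by rw [hx, hy, add_zero])
        (fun m' m'' x _ y _ _ hy => by
          subst hy
          exact funext fun c => brc_zero_right _ _ _ _ _ _ _ (fun _ => rfl) c)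
        (X := S.rayA a (S.gaugeDens a)) (X' := S.rayA a (S.gaugeDens a)) (Y := S.gaugeDens a)
        (Y' := S.gaugeDens a) (fun c m => cf_rayA_zero a ((gaugeDens_spec a).1 c m))
        (fun c m => cf_rayA_zero a ((gaugeDens_spec a).1 c m)) (gaugeDens_spec a).1
        (gaugeDens_spec a).1 s' (fun _ _ _ => trivial)
        (fun t ht m => funext fun c => ih t ht (by omega) c m) k s' le_rfl m
    rw [show cf ((br S.κ id (fun _ _ => 0) (S.rayA a (S.gaugeDens a)))^[k + 1]
      (S.gaugeDens a)) c s' m = 0 from congrFun this c, smul_zero]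

lemma leading_finite (k : ℕ) :
    {a : Prim | ∃ c s m, s < k ∧ cf (S.leading a) c s m ≠ 0}.Finite := by
  obtain ⟨T, hT⟩ := exists_modes S.fluxSec k
  have hfin : (⋃ m ∈ (T : Set Lam), {a : Prim | S.Along a m}).Finite := by
    refine Set.Finite.biUnion T.finite_toSet fun m _ => Set.Subsingleton.finite ?_
    rintro a ⟨l, hl, rfl⟩ a' ⟨l', hl', e⟩
    exact prim_unique hl hl' e
  refine hfin.subset ?_
  rintro a ⟨c, s, m, hs, h⟩
  by_contra ha
  apply h
  rw [cf_leading]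
  refine limitA_eq_zero (gaugeDens_eq_zero (s := k) (fun c s' hs' m => ?_) hs.le c m) 0
  rw [cf_source]
  split_ifs with hm
  · rw [← cf_fluxSec, by_contra fun h0 => ha (Set.mem_biUnion (hT c s' hs' m h0) hm), smul_zero]
  · rfl

/-- The leading term for a wall whose source is a multiple of a Gaussian function. -/
lemma leading_of_source {a : Prim} {L : Sec r ℂ} {i : Fin 2} (hη : S.etaA a = S.coordL i)
    (hs : ∀ c s m, cf (S.source a) c s m = -cf L c s m • S.gaussS i)
    (hL : ∀ c m, cf L c 0 m = 0) : S.leading a = L := by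
  set g : Pt → ℂ := S.gaussS i 0 with hg
  have hgau : Gau (sqW (S.etaA a)) g := by
    rw [hη]
    exact (gau_gauss (S.coordL i)).smul _
  set Z : Sec r HFun := mapSec (fun _ z _ _ => z) L with hZ
  have hcZ : ∀ c s m, cf Z c s m = fun _ _ => cf L c s m := fun c s m =>
    cf_mapSec _ (fun _ => rfl) _ _ _ _
  have hZ0 : ∀ c m, cf Z c 0 m = 0 := fun c m => by rw [hcZ, hL]; rfl
  have hX0 : ∀ c m, cf (S.rayA a (S.gaugeDens a)) c 0 m = 0 := fun c m =>
    cf_rayA_zero a ((gaugeDens_spec a).1 c m)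
  have key : ∀ s c m p, cf (S.gaugeDens a) c s m 0 p = g p * cf Z c s m 0 p := by
    intro s
    induction s using Nat.strong_induction_on with
    | _ s ih =>
      have hray : ∀ s' < s, ∀ c m p, cf (S.rayA a (S.gaugeDens a)) c s' m 0 p =
          rayInt (S.nA a) g p * cf Z c s' m 0 p := by
        intro s' hs' c m p
        have e : cf (S.gaugeDens a) c s' m 0 = (cf L c s' m) • g := funext fun p => by
          rw [ih s' hs' c m p, hcZ, Pi.smul_apply, smul_eq_mul, mul_comm]
        rw [cf_rayA]
        change rayInt (S.nA a) (cf (S.gaugeDens a) c s' m 0) p = _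
        rw [e, rayInt_smul, hcZ, Pi.smul_apply, smul_eq_mul, mul_comm]
      have h1 : ∀ s' ≤ s, ∀ c m p,
          cf (br S.κ id (fun _ _ => 0) (S.rayA a (S.gaugeDens a)) (S.gaugeDens a)) c s' m 0 p = 0 := by
        intro s' hs' c m p
        have := br_relF (κ := S.κ) (κ' := S.κ) (ϖ := id) (ϖ' := id) (ϕ := fun _ _ => 0)
          (ϕ' := fun _ _ => 0)
          (fun x x' => ∀ c p, x c 0 p = (rayInt (S.nA a) g p * g p) * x' c 0 p)
          (fun c p => by simp)
          (fun x x' y y' hx hy c p => by simp only [Pi.add_apply, hx c p, hy c p, mul_add])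
          (X := S.rayA a (S.gaugeDens a)) (Y := S.gaugeDens a) (X' := Z) (Y' := Z)
          hX0 hZ0 (gaugeDens_spec a).1 hZ0 s' m (fun t ht t' ht' m' m'' _ c p => by
            rw [connFun_flat]
            exact brc_param_zero m' m'' (fun c => hray t (by omega) c m' p)
              (fun c => ih t' (by omega) c m'' p) c) c p
        refine this.trans ?_
        simp only [br_self, cf_zero]
        simp
      have h2 : ∀ k c m p, cf ((br S.κ id (fun _ _ => 0)
          (S.rayA a (S.gaugeDens a)))^[k + 1] (S.gaugeDens a)) c s m 0 p = 0 := by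
        intro k c m p
        rw [Function.iterate_succ_apply]
        cases k with
        | zero => exact h1 s le_rfl c m p
        | succ k =>
          exact iterate_relF (κ := S.κ) (κ' := S.κ) (ϖ := id) (ϖ' := id) (ϕ := fun _ _ => 0)
            (ϕ' := fun _ _ => 0) (fun _ _ _ => True) (fun _ x _ => ∀ c p, x c 0 p = 0)
            (fun _ _ _ => rfl) (fun _ x _ y _ hx hy c p => by
              simp only [Pi.add_apply, hx c p, hy c p, add_zero])
            (fun m' m'' x _ y _ _ hy c p => by
              rw [connFun_flat]
              have := brc_param_zero (κ := S.κ) (ϖ := id) m' m'' (x := x) (x' := x) (y := y)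
                (y' := y) (p := p) (G := 1) (g := 0) (fun c => (one_mul _).symm)
                (fun c => by rw [hy c p, zero_mul]) c
              rw [this]
              simp)
            (X := S.rayA a (S.gaugeDens a)) (X' := S.rayA a (S.gaugeDens a))
            (Y := br S.κ id (fun _ _ => 0) (S.rayA a (S.gaugeDens a)) (S.gaugeDens a))
            (Y' := br S.κ id (fun _ _ => 0) (S.rayA a (S.gaugeDens a)) (S.gaugeDens a))
            hX0 hX0 (cf_br_zero _ _ _ _ hX0) (cf_br_zero _ _ _ _ hX0) s (fun _ _ _ => trivial)
            (fun s' hs' m c p => h1 s' hs'.le c m p) k s le_rfl m c p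
      intro c m p
      rw [(gaugeDens_spec a).2, hs, hcZ]
      simp only [Pi.sub_apply, Pi.neg_apply, Finset.sum_apply, Pi.smul_apply, h2, hg,
        smul_eq_mul]
      rw [Finset.sum_eq_zero fun _ _ => mul_zero _]
      ring
  have hint : lineInt (S.nA a) g 0 = 1 := by
    rw [lineInt_eq hgau (rayDecay_sqW (etaA_nA a)) (rayDecay_sqW_neg (etaA_nA a))]
    have e : ∀ σ : ℝ, g (0 - σ • S.nA a) =
        (((√Real.pi)⁻¹ * Real.exp (-1 * σ ^ 2) : ℝ) : ℂ) := by
      intro σ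
      rw [hg, gaussS, ← hη, map_sub, map_smul, etaA_nA]
      push_cast
      simp
    simp only [e]
    rw [integral_complex_ofReal, MeasureTheory.integral_const_mul, integral_gaussian, div_one,
      inv_mul_cancel₀ (Real.sqrt_ne_zero'.mpr Real.pi_pos), Complex.ofReal_one]
  refine sec_ext fun c s m => ?_
  have e : cf (S.gaugeDens a) c s m 0 = (cf L c s m) • g := funext fun p => by
    rw [key s c m p, hcZ, Pi.smul_apply, smul_eq_mul, mul_comm]
  rw [cf_leading, limitA, e]
  simp only [lineInt, rayInt_smul, Pi.add_apply, Pi.smul_apply, ← smul_add] at hint ⊢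
  rw [hint, smul_eq_mul, mul_one]

lemma detP_nA (a : Prim) : detP (toPt (S.mA a)) (S.nA a) = S.D * sgn a := by
  have hD : (S.D : ℝ) ≠ 0 := Int.cast_ne_zero.mpr S.D_ne
  have h1 := etaA_nA (S := S) a
  rw [etaA, _root_.smul_apply, detCLM_apply, smul_eq_mul] at h1
  have hs := sgn_sq a
  field_simp at h1
  linear_combination (sgn a) * h1 - detP (toPt (S.mA a)) (S.nA a) * hs

lemma e1_ne_e2 : e1 ≠ e2 := by simp [e1, e2]

lemma sgn_e1 : sgn e1 = 1 := if_neg e1_ne_e2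

lemma sgn_e2 : sgn e2 = -1 := if_pos rfl

lemma leading_e1 : S.leading e1 = S.w1.logθ := by
  have hD : (S.D : ℂ) ≠ 0 := Int.cast_ne_zero.mpr S.D_ne
  refine leading_of_source (i := 1) ?_ (fun c s m => ?_) logθ1_zero
  · rw [etaA, sgn_e1, mA_e1, one_div]
    rfl
  · rw [cf_source]
    split_ifs with h
    · obtain ⟨l, hl, rfl⟩ := h
      have hl' : (l : ℂ) ≠ 0 := by
        have : l ≠ 0 := by omega
        exact_mod_cast this
      have e := detL_left (S := S) (l, 0)
      simp only [zero_smul, add_zero] at e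
      rw [toPt_nsmul, detP_smul, detP_nA, sgn_e1, mA_e1, flux_w1 hl, e, smul_smul]
      congr 1
      push_cast
      field_simp
    · have h0 : cf S.w1.logθ c s m = 0 := by
        by_contra h0
        obtain ⟨l, hl, e⟩ := logθ1_mode h0
        exact h ⟨l, hl, by rw [mA_e1]; exact e⟩
      rw [h0, neg_zero, zero_smul]

lemma leading_e2 : S.leading e2 = S.w2.logθ := by
  have hD : (S.D : ℂ) ≠ 0 := Int.cast_ne_zero.mpr S.D_ne
  refine leading_of_source (i := 0) ?_ (fun c s m => ?_) logθ2_zero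
  · rw [etaA, sgn_e2, mA_e2, neg_div, one_div]
    rfl
  · rw [cf_source]
    split_ifs with h
    · obtain ⟨l, hl, rfl⟩ := h
      have hl' : (l : ℂ) ≠ 0 := by
        have : l ≠ 0 := by omega
        exact_mod_cast this
      have e := detL_right (S := S) (0, l)
      simp only [zero_smul, zero_add] at e
      rw [toPt_nsmul, detP_smul, detP_nA, sgn_e2, mA_e2, flux_w2 hl, e, smul_smul]
      congr 1
      push_cast
      field_simp
    · have h0 : cf S.w2.logθ c s m = 0 := by
        by_contra h0
        obtain ⟨l, hl, e⟩ := logθ2_mode h0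
        exact h ⟨l, hl, by rw [mA_e2]; exact e⟩
      rw [h0, neg_zero, zero_smul]

end Setup
end LeadingTerm

/-! ## Pull-back along local diffeomorphisms -/

section PullBack

variable {ϖ : Pt → Pt} {S V : Set Pt}

lemma LocDiffeo.differentiableAt (hS : LocDiffeo ϖ S) {p : Pt} (hp : p ∈ S) :
    DifferentiableAt ℝ ϖ p :=
  (hS.smooth.differentiableOn (by simp)).differentiableAt (hS.isOpen.mem_nhds hp)

lemma pd_comp (hS : LocDiffeo ϖ S) {p : Pt} (hp : p ∈ S) {f : Pt → ℂ}
    (hf : DifferentiableAt ℝ f (ϖ p)) (q : Fin 2) :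
    pd ϖ q (fun p => f (ϖ p)) p = pd id q f (ϖ p) := by
  obtain ⟨e, he⟩ := hS.inv p hp
  have h := fderiv_comp p hf (hS.differentiableAt hp)
  rw [pd, pd_id]
  change fderiv ℝ (f ∘ ϖ) p _ = _
  rw [h, ← he, ContinuousLinearMap.inverse_equiv]
  simp

lemma iterPd_comp (hS : LocDiffeo ϖ S) (hV : IsOpen V) (hmap : Set.MapsTo ϖ S V) {f : Pt → ℂ}
    (hf : ContDiffOn ℝ ∞ f V) (l : List (Fin 2)) :
    Set.EqOn (iterPd ϖ l (fun p => f (ϖ p))) (fun p => iterPd id l f (ϖ p)) S := by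
  induction l with
  | nil => exact fun _ _ => rfl
  | cons q l ih =>
    intro p hp
    simp only [iterPd]
    rw [pd_congr hS.isOpen ih q hp, pd_comp hS hp
      (ContDiffOn.differentiableAt_of_isOpen hV (ContDiffOn.iterPd (locDiffeo_id hV) hf l)
        (hmap hp))]

lemma Smooth.comp (hS : LocDiffeo ϖ S) (hmap : Set.MapsTo ϖ S V) {f : HFun} (hf : Smooth V f) :
    Smooth S (fun ħ p => f ħ (ϖ p)) := fun ħ hħ => (hf ħ hħ).comp hS.smooth hmap

lemma DerivBound.comp (hS : LocDiffeo ϖ S) (hV : IsOpen V) (hmap : Set.MapsTo ϖ S V) {f : HFun}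
    (hf : Smooth V f) {N : Set Pt} {w : ℕ → ℝ → Pt → ℝ} {w' : ℕ → ℝ → Pt → ℝ}
    (hw : ∀ j ħ p, w' j ħ p = w j ħ (ϖ p)) (h : DerivBound id (𝓝[>] 0) N w f) :
    DerivBound ϖ (𝓝[>] 0) (ϖ ⁻¹' N ∩ S) w' (fun ħ p => f ħ (ϖ p)) := by
  intro l
  obtain ⟨C, hC, h⟩ := h l
  refine ⟨C, hC, ?_⟩
  filter_upwards [h, self_mem_nhdsWithin] with ħ h hħ p hp
  rw [iterPd_comp hS hV hmap (hf ħ hħ) l hp.2, hw]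
  exact h _ hp.1

lemma WE.comp (hS : LocDiffeo ϖ S) (hV : IsOpen V) (hmap : Set.MapsTo ϖ S V) {f : HFun}
    (hf : WE id V f) : WE ϖ S (fun ħ p => f ħ (ϖ p)) := by
  refine ⟨hf.1.comp hS hmap, wExp_iff.mpr fun p hp => ?_⟩
  obtain ⟨N, hN, c, hc, h⟩ := wExp_iff.mp hf.2 _ (hmap hp)
  exact ⟨ϖ ⁻¹' N ∩ S, inter_mem ((hS.differentiableAt hp).continuousAt hN) (hS.isOpen.mem_nhds hp),
    c, hc, h.comp hS hV hmap hf.1 fun _ _ _ => rfl⟩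

lemma WP.comp (hS : LocDiffeo ϖ S) (hV : IsOpen V) (hmap : Set.MapsTo ϖ S V) {d : ℤ} {f : HFun}
    (hf : WP id d V f) : WP ϖ d S (fun ħ p => f ħ (ϖ p)) := by
  refine ⟨hf.1.comp hS hmap, wPow_iff.mpr fun p hp => ?_⟩
  obtain ⟨N, hN, h⟩ := wPow_iff.mp hf.2 _ (hmap hp)
  exact ⟨ϖ ⁻¹' N ∩ S, inter_mem ((hS.differentiableAt hp).continuousAt hN) (hS.isOpen.mem_nhds hp),
    h.comp hS hV hmap hf.1 fun _ _ _ => rfl⟩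

lemma AsymEq.comp (hS : LocDiffeo ϖ S) (hV : IsOpen V) (hmap : Set.MapsTo ϖ S V) {f f' : HFun}
    (h : AsymEq id V f f') : AsymEq ϖ S (fun ħ p => f ħ (ϖ p)) (fun ħ p => f' ħ (ϖ p)) :=
  ⟨h.1.comp hS hV hmap, h.2.imp fun _ h => h.comp hS hV hmap⟩

lemma brc_comp {r : ℕ} (κ : ℂ) (hS : LocDiffeo ϖ S) (m m' : Lam) {x x' y y' : Comp r → HFun}
    {ħ : ℝ} (hx : ∀ c, Set.EqOn (x c ħ) (fun p => x' c ħ (ϖ p)) S)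
    (hy : ∀ c, Set.EqOn (y c ħ) (fun p => y' c ħ (ϖ p)) S) {p : Pt} (hp : p ∈ S)
    (hx' : ∀ c, DifferentiableAt ℝ (x' c ħ) (ϖ p)) (hy' : ∀ c, DifferentiableAt ℝ (y' c ħ) (ϖ p))
    (c : Comp r) : brc κ ϖ (fun _ _ _ => 0) m m' x y c ħ p =
      brc κ id (fun _ _ _ => 0) m m' x' y' c ħ (ϖ p) := by
  have h : ∀ {x x' : Comp r → HFun}, (∀ c, Set.EqOn (x c ħ) (fun p => x' c ħ (ϖ p)) S) →
      (∀ c, DifferentiableAt ℝ (x' c ħ) (ϖ p)) → ∀ (c c' : Comp r) m k,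
      covC κ ϖ (fun _ _ _ => 0) c m k (x c') ħ p =
        covC κ id (fun _ _ _ => 0) c m k (x' c') ħ (ϖ p) := by
    intro x x' hx hx' c c' m k
    rw [covC_flat, covC_flat]
    simp only [Pi.add_apply, Pi.smul_apply, Pi.mul_apply]
    rw [hx c' hp, pd_congr hS.isOpen (hx c') k hp, pd_comp hS hp (hx' c')]
  have hx0 := fun c => hx c hp
  have hy0 := fun c => hy c hp
  rcases c with c | c
  · simp only [brc, Pi.add_apply, Finset.sum_apply, Pi.sub_apply, Pi.mul_apply, h hx hx', h hy hy',
      hx0, hy0]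
  · simp only [brc, Pi.add_apply, Finset.sum_apply, Pi.sub_apply, Pi.mul_apply, h hx hx', h hy hy',
      hx0, hy0, Pi.zero_apply]

lemma smooth_brc {r : ℕ} (κ : ℂ) (hS : LocDiffeo ϖ S) (m m' : Lam) {x y : Comp r → HFun} {ε : ℝ}
    (hx : ∀ c, ContDiffOn ℝ ∞ (x c ε) S) (hy : ∀ c, ContDiffOn ℝ ∞ (y c ε) S)
    (c : Comp r) : ContDiffOn ℝ ∞ (brc κ ϖ (fun _ _ _ => 0) m m' x y c ε) S := by
  have h : ∀ (c : Comp r) m k (f : HFun), ContDiffOn ℝ ∞ (f ε) S →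
      ContDiffOn ℝ ∞ (covC κ ϖ (fun _ _ _ => 0) c m k f ε) S := by
    intro c m k f hf
    rw [covC_flat]
    exact (contDiffOn_const.mul hf).add (contDiffOn_const.mul (ContDiffOn.pd hS hf k))
  exact brc_rel κ ϖ _ (fun f _ => ContDiffOn ℝ ∞ (f ε) S)
    (fun f _ => ContDiffOn ℝ ∞ (f ε) S) (fun f _ => ContDiffOn ℝ ∞ (f ε) S) m m'
    (fun c k f _ hf => h c m k f hf) (fun c k f _ hf => h c m' k f hf)
    (fun f _ g _ hf hg => hf.mul hg) contDiffOn_const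
    (fun f _ g _ hf hg => hf.add hg) (fun f _ hf => hf.neg)
    (x := x) (x' := x) (y := y) (y' := y) hx hy c

end PullBack

/-! ## Gauge transformations up to exponentially small functions -/

section Gauge

variable {r : ℕ} {κ : ℂ} {ϖ : Pt → Pt} {N : Set Pt}

lemma AsymEq.sum (hN : LocDiffeo ϖ N) {ι : Type*} (T : Finset ι) {f f' : ι → HFun}
    (h : ∀ i ∈ T, AsymEq ϖ N (f i) (f' i)) : AsymEq ϖ N (∑ i ∈ T, f i) (∑ i ∈ T, f' i) := by
  classical
  induction T using Finset.induction_on with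
  | empty => exact AsymEq.zero
  | insert i T hi ih =>
    rw [Finset.sum_insert hi, Finset.sum_insert hi]
    exact (h i (Finset.mem_insert_self _ _)).add hN
      (ih fun j hj => h j (Finset.mem_insert_of_mem hj))

lemma cf_dW0_zero {ϕ : Fin r → Pt → ℝ} {X : Sec r HFun} (hX : ∀ c m, cf X c 0 m = 0) (q : Fin 2)
    (c : Comp r) (m : Lam) : cf (dW0 κ ϖ ϕ X q) c 0 m = 0 := by
  have h : (fun ħ => pd ϖ q ((0 : HFun) ħ)) = (0 : HFun) := funext fun _ => pd_zero ϖ q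
  rw [cf_dW0, hX, h, zero_add]
  rcases c with c | c
  · simp only [hX, Pi.zero_apply, zero_mul, Finset.sum_const_zero, mul_zero]
    split_ifs <;> rfl
  · rfl

/-- The nonlinear terms of a gauge transformation depend on lower orders only. -/
lemma gaugeZero_asymEq_of_lt (hN : LocDiffeo ϖ N) {X X' : Sec r HFun}
    (hX : ∀ c m, cf X c 0 m = 0) (hX' : ∀ c m, cf X' c 0 m = 0) {s : ℕ}
    (h : ∀ s' < s, ∀ c m, AsymEq ϖ N (cf X c s' m) (cf X' c s' m)) (q : Fin 2) (c : Comp r)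
    (m : Lam) :
    AsymEq ϖ N
      (cf (gaugeZero κ ϖ (fun _ _ => 0) s X q) c s m + fun ħ => pd ϖ q (cf X c s m ħ))
      (cf (gaugeZero κ ϖ (fun _ _ => 0) s X' q) c s m + fun ħ => pd ϖ q (cf X' c s m ħ)) := by
  have key : ∀ {X : Sec r HFun}, (∀ c m, cf X c 0 m = 0) →
      (cf (gaugeZero κ ϖ (fun _ _ => 0) s X q) c s m + fun ħ => pd ϖ q (cf X c s m ħ)) =
      -∑ k ∈ Finset.range (s - 1), (((k + 1 + 1).factorial : ℂ)⁻¹) •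
        cf ((br κ ϖ (fun _ _ => 0) X)^[k + 1] (dW0 κ ϖ (fun _ _ => 0) X q)) c s m := by
    intro X hX
    rw [cf_gaugeZero, ← cf_dW0_flat (κ := κ)]
    cases s with
    | zero => simp [cf_dW0_zero hX]
    | succ s =>
      rw [Nat.add_sub_cancel, Finset.sum_range_succ']
      simp
  rw [key hX, key hX']
  refine (AsymEq.sum hN _ fun k _ => AsymEq.smul ?_ _).neg
  refine iterate_relF (κ := κ) (κ' := κ) (ϖ := ϖ) (ϖ' := ϖ) (ϕ := fun _ _ => 0)
    (ϕ' := fun _ _ => 0) (fun _ x x' => ∀ c, AsymEq ϖ N (x c) (x' c))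
    (fun _ x x' => ∀ c, AsymEq ϖ N (x c) (x' c)) (fun _ _ => AsymEq.zero)
    (fun _ _ _ _ _ h h' c => (h c).add hN (h' c)) (fun m' m'' _ _ _ _ hx hy c => ?_) hX hX'
    (cf_dW0_zero hX q) (cf_dW0_zero hX' q) s (fun s' hs' m c => h s' hs' c m)
    (fun s' hs' m c => ?_) k s le_rfl m c
  · rw [connFun_flat]
    exact AsymEq.brc hN κ m' m'' hx hy c
  · simp only [cf_dW0_flat]
    exact (h s' hs' c m).pd hN q

lemma gaugeZero_asymEq (hN : LocDiffeo ϖ N) {X X' : Sec r HFun}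
    (hX : ∀ c m, cf X c 0 m = 0) (hX' : ∀ c m, cf X' c 0 m = 0)
    (h : ∀ c s m, AsymEq ϖ N (cf X c s m) (cf X' c s m)) (q : Fin 2) (c : Comp r) (s : ℕ)
    (m : Lam) : AsymEq ϖ N (cf (gaugeZero κ ϖ (fun _ _ => 0) s X q) c s m)
      (cf (gaugeZero κ ϖ (fun _ _ => 0) s X' q) c s m) := by
  have h1 := (gaugeZero_asymEq_of_lt (κ := κ) hN hX hX' (s := s) (fun s' _ c m => h c s' m) q c
    m).add hN ((h c s m).pd hN q).neg
  rwa [add_neg_cancel_right, add_neg_cancel_right] at h1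

lemma smooth_gaugeZero (hN : LocDiffeo ϖ N) {X : Sec r HFun} (hX : ∀ c m, cf X c 0 m = 0)
    (h : SmoothOn N X) (q : Fin 2) (c : Comp r) (s : ℕ) (m : Lam) :
    Smooth N (cf (gaugeZero κ ϖ (fun _ _ => 0) s X q) c s m) := by
  have hd : ∀ s m c, Smooth N (cf (dW0 κ ϖ (fun _ _ => 0) X q) c s m) := fun s m c => by
    rw [cf_dW0_flat]
    exact Smooth.pd hN (h c s m) q
  have key : ∀ k, Smooth N (cf ((br κ ϖ (fun _ _ => 0) X)^[k]
      (dW0 κ ϖ (fun _ _ => 0) X q)) c s m) := by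
    intro k
    cases k with
    | zero => exact hd s m c
    | succ k =>
      refine iterate_relF (κ := κ) (κ' := κ) (ϖ := ϖ) (ϖ' := ϖ) (ϕ := fun _ _ => 0)
        (ϕ' := fun _ _ => 0) (X' := X) (Y' := dW0 κ ϖ (fun _ _ => 0) X q)
        (fun _ x _ => ∀ c, Smooth N (x c))
        (fun _ x _ => ∀ c, Smooth N (x c)) (fun _ _ => Smooth.zero)
        (fun _ _ _ _ _ h h' c => (h c).add (h' c)) (fun m' m'' _ _ _ _ hx hy c ħ hħ => ?_) hX hX
        (cf_dW0_zero hX q) (cf_dW0_zero hX q) s (fun s' _ m c => h c s' m)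
        (fun s' _ m c => hd s' m c) k s le_rfl m c
      rw [connFun_flat]
      exact smooth_brc κ hN m' m'' (fun c => hx c ħ hħ) (fun c => hy c ħ hħ) c
  have hsum : ∀ T : Finset ℕ, Smooth N (∑ k ∈ T, (((k + 1).factorial : ℂ)⁻¹) •
      cf ((br κ ϖ (fun _ _ => 0) X)^[k] (dW0 κ ϖ (fun _ _ => 0) X q)) c s m) := by
    intro T
    induction T using Finset.induction_on with
    | empty => exact Smooth.zero
    | insert i T hi ih =>
      rw [Finset.sum_insert hi]
      exact ((key i).smul _).add ih
  rw [cf_gaugeZero]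
  exact (hsum _).neg

lemma gaugeZero_eq_zero {ϕ : Fin r → Pt → ℝ} {X : Sec r HFun} (hX : ∀ c m, cf X c 0 m = 0)
    {q : Fin 2} (h : dW0 κ ϖ ϕ X q = 0) (c : Comp r) (s n : ℕ) (m : Lam) :
    cf (gaugeZero κ ϖ ϕ n X q) c s m = 0 := by
  rw [cf_gaugeZero, h, Finset.sum_eq_zero, neg_zero]
  intro k _
  have := cf_iterate_smul (κ := κ) (ϖ := ϖ) (ϕ := ϕ) hX (Y := 0) (fun c m => cf_zero c 0 m) 0 k c s m
  rw [smul_zero, zero_smul] at this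
  rw [this, smul_zero]

/-- Gauge transformations commute with rescaling and pull-back. -/
lemma gaugeZero_rescale_comp (hN : LocDiffeo ϖ N) {m0 : Pt} {X X' : Sec r HFun}
    (hX : ∀ c m, cf X c 0 m = 0) (hX' : ∀ c m, cf X' c 0 m = 0)
    (hs : ∀ c s m ε, ContDiff ℝ ∞ (cf X' c s m ε))
    (h : ∀ c s m ħ, 0 < ħ → ∀ p ∈ N, cf X c s m ħ p = rescale m0 0 (cf X' c s m) ħ (ϖ p))
    (q : Fin 2) (c : Comp r) (s : ℕ) (m : Lam) {ħ : ℝ} (hħ : 0 < ħ) {p : Pt} (hp : p ∈ N) :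
    cf (gaugeZero κ ϖ (fun _ _ => 0) s X q) c s m ħ p =
      rescale m0 1 (cf (gaugeZero κ id (fun _ _ => 0) s X' q) c s m) ħ (ϖ p) := by
  have hdiff : ∀ (d : ℤ) (f : HFun), (∀ ε, ContDiff ℝ ∞ (f ε)) → ∀ ħ x,
      DifferentiableAt ℝ (rescale m0 d f ħ) x := by
    intro d f hf ħ x
    have : ContDiff ℝ ∞ (rescale m0 d f ħ) := contDiff_const.mul ((hf (√ħ)).comp (by fun_prop))
    exact this.differentiable (by simp) x
  set R : ℤ → Lam → (Comp r → HFun) → (Comp r → HFun) → Prop := fun d _ x x' => ∀ c,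
    (∀ ε, ContDiff ℝ ∞ (x' c ε)) ∧ ∀ ħ, 0 < ħ → ∀ p ∈ N, x c ħ p = rescale m0 d (x' c) ħ (ϖ p)
    with hR
  have hRd : ∀ s m, R 1 m (fun c => cf (dW0 κ ϖ (fun _ _ => 0) X q) c s m)
      (fun c => cf (dW0 κ id (fun _ _ => 0) X' q) c s m) := by
    intro s m c
    simp only [cf_dW0_flat]
    refine ⟨fun ε => contDiffOn_univ.mp (ContDiffOn.pd (locDiffeo_id isOpen_univ)
      (contDiffOn_univ.mpr (hs c s m ε)) q), fun ħ hħ p hp => ?_⟩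
    rw [pd_congr hN.isOpen (h c s m ħ hħ) q hp, pd_comp hN hp (hdiff _ _ (hs c s m) _ _),
      pd_rescale _ hħ]
    rfl
  have key : ∀ k s m, R 1 m
      (fun c => cf ((br κ ϖ (fun _ _ => 0) X)^[k] (dW0 κ ϖ (fun _ _ => 0) X q)) c s m)
      (fun c => cf ((br κ id (fun _ _ => 0) X')^[k] (dW0 κ id (fun _ _ => 0) X' q)) c s m) := by
    intro k s m
    cases k with
    | zero => exact hRd s m
    | succ k =>
      refine iterate_relF (κ := κ) (κ' := κ) (ϖ := ϖ) (ϖ' := id) (ϕ := fun _ _ => 0)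
        (ϕ' := fun _ _ => 0) (R 0) (R 1) (fun m c => ⟨fun _ => contDiff_const, fun ħ _ p _ => ?_⟩)
        (fun m x x' y y' hx hy c => ⟨fun ε => ((hx c).1 ε).add ((hy c).1 ε), fun ħ hħ p hp => ?_⟩)
        (fun m' m'' x x' y y' hx hy c => ⟨fun ε => ?_, fun ħ hħ p hp => ?_⟩) hX hX'
        (cf_dW0_zero hX q) (cf_dW0_zero hX' q) s
        (fun s' _ m c => ⟨hs c s' m, h c s' m⟩) (fun s' _ m => hRd s' m) k s le_rfl m
      · simp [rescale]
      · simp only [Pi.add_apply, rescale_add, (hx c).2 ħ hħ p hp, (hy c).2 ħ hħ p hp]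
      · rw [connFun_flat]
        exact contDiffOn_univ.mp (smooth_brc κ (locDiffeo_id isOpen_univ) m' m''
          (fun c => contDiffOn_univ.mpr ((hx c).1 ε))
          (fun c => contDiffOn_univ.mpr ((hy c).1 ε)) c)
      · rw [connFun_flat, connFun_flat, brc_comp κ hN m' m'' (x' := fun c => rescale m0 0 (x' c))
          (y' := fun c => rescale m0 1 (y' c)) (fun c p hp => (hx c).2 ħ hħ p hp)
          (fun c p hp => (hy c).2 ħ hħ p hp) hp (fun c => hdiff _ _ (hx c).1 _ _)
          (fun c => hdiff _ _ (hy c).1 _ _) c]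
        have := congrFun (brf_rescale (m0 := m0) (d := 0) (d' := 1) κ m' m'' x' y' c hħ) (ϖ p)
        rw [zero_add] at this
        exact this
  have hsum : ∀ (T : Finset ℕ) (f : ℕ → HFun), rescale m0 1 (∑ k ∈ T, f k) =
      ∑ k ∈ T, rescale m0 1 (f k) := by
    intro T f
    induction T using Finset.induction_on with
    | empty => simp [rescale_zero]
    | insert i T hi ih => rw [Finset.sum_insert hi, Finset.sum_insert hi, rescale_add, ih]
  rw [cf_gaugeZero, cf_gaugeZero, ← neg_one_smul ℂ (∑ k ∈ Finset.range s, _ • cf (_^[_] (dW0 κ id _ _ _)) _ _ _),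
    rescale_smul, neg_one_smul, hsum]
  simp only [Pi.neg_apply, Finset.sum_apply, rescale_smul, Pi.smul_apply]
  exact congrArg _ (Finset.sum_congr rfl fun k _ =>
    congrArg (((k + 1).factorial : ℂ)⁻¹ • ·) (((key k s m) c).2 ħ hħ p hp))

end Gauge

/-! ## Exponentially small functions from exponentially small derivatives -/

section Primitive

variable {ϖ : Pt → Pt} {S : Set Pt}

/-- The operator norm of the derivative is locally bounded by the affine derivatives. -/
lemma exists_norm_fderiv_le (hS : LocDiffeo ϖ S) {p : Pt} (hp : p ∈ S) :
    ∃ M : ℝ, 0 ≤ M ∧ ∃ V ∈ 𝓝 p, V ⊆ S ∧ ∀ (f : Pt → ℂ), ∀ x ∈ V,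
      ‖fderiv ℝ f x‖ ≤ M * ∑ q, ‖pd ϖ q f x‖ := by
  have h1 : ContinuousOn (fderiv ℝ ϖ) S := hS.smooth.continuousOn_fderiv_of_isOpen hS.isOpen (by simp)
  have h2 : ∀ᶠ x in 𝓝 p, ‖fderiv ℝ ϖ x‖ < ‖fderiv ℝ ϖ p‖ + 1 :=
    (h1.continuousAt (hS.isOpen.mem_nhds hp)).norm.eventually_lt continuousAt_const (lt_add_one _)
  refine ⟨‖fderiv ℝ ϖ p‖ + 1, by positivity, _, inter_mem h2 (hS.isOpen.mem_nhds hp),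
    Set.inter_subset_right, fun f x hx => ?_⟩
  refine ContinuousLinearMap.opNorm_le_bound _ (by positivity) fun v => ?_
  rw [fderiv_eq_sum_pd hS hx.2]
  refine (norm_sum_le _ _).trans ?_
  rw [Finset.mul_sum, Finset.sum_mul]
  refine Finset.sum_le_sum fun q _ => ?_
  rw [norm_mul, Complex.norm_real, mul_right_comm]
  refine mul_le_mul_of_nonneg_right ?_ (norm_nonneg _)
  refine (norm_le_pi_norm _ q).trans ((ContinuousLinearMap.le_opNorm _ _).trans ?_)
  exact mul_le_mul_of_nonneg_right (le_of_lt hx.1) (norm_nonneg _)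

/-- A function with exponentially small derivatives is exponentially small on a neighbourhood of
a point, if it is so at some point nearby. -/
lemma exists_nhds_small (hS : LocDiffeo ϖ S) {E : HFun} (hE : Smooth S E)
    (h : ∀ q, WE ϖ S (fun ħ => pd ϖ q (E ħ))) {p : Pt} (hp : p ∈ S) :
    ∃ W ∈ 𝓝 p, ∀ x ∈ W, ∀ c > 0, ∀ C, (∀ᶠ ħ in 𝓝[>] (0 : ℝ), ‖E ħ x‖ ≤ C * Real.exp (-c / ħ)) →
      ∃ c' > 0, ∃ C', ∀ᶠ ħ in 𝓝[>] (0 : ℝ), ∀ y ∈ W, ‖E ħ y‖ ≤ C' * Real.exp (-c' / ħ) := by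
  obtain ⟨M, hM, V, hV, hVS, hb⟩ := exists_norm_fderiv_le hS hp
  choose N hN c₁ hc₁ hd using fun q => wExp_iff.mp (h q).2 p hp
  choose C₁ hC₁ hd using fun q => hd q []
  obtain ⟨δ, hδ, hball⟩ := Metric.mem_nhds_iff.mp (inter_mem hV (inter_mem (hN 0) (hN 1)))
  refine ⟨Metric.ball p δ, Metric.ball_mem_nhds p hδ, fun x hx c hc C hC => ?_⟩
  refine ⟨min c (min (c₁ 0) (c₁ 1)), lt_min hc (lt_min (hc₁ 0) (hc₁ 1)),
    |C| + M * (C₁ 0 + C₁ 1) * (2 * δ), ?_⟩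
  filter_upwards [hC, hd 0, hd 1, self_mem_nhdsWithin] with ħ h1 h2 h3 hħ y hy
  have hħ' : (0 : ℝ) < ħ := hħ
  have hexp : ∀ c', min c (min (c₁ 0) (c₁ 1)) ≤ c' →
      Real.exp (-c' / ħ) ≤ Real.exp (-min c (min (c₁ 0) (c₁ 1)) / ħ) := fun c' hc' =>
    Real.exp_le_exp.mpr (div_le_div_of_nonneg_right (neg_le_neg hc') hħ'.le)
  set e := Real.exp (-min c (min (c₁ 0) (c₁ 1)) / ħ) with he
  have hder : ∀ z ∈ Metric.ball p δ, ‖fderiv ℝ (E ħ) z‖ ≤ M * (C₁ 0 + C₁ 1) * e := by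
    intro z hz
    have hz' := hball hz
    refine (hb (E ħ) z hz'.1).trans ?_
    rw [mul_assoc]
    refine mul_le_mul_of_nonneg_left ?_ hM
    rw [Fin.sum_univ_two, add_mul]
    refine add_le_add ((h2 z hz'.2.1).trans ?_) ((h3 z hz'.2.2).trans ?_)
    · exact mul_le_mul_of_nonneg_left
        (hexp _ ((min_le_right _ _).trans (min_le_left _ _))) (hC₁ 0)
    · exact mul_le_mul_of_nonneg_left
        (hexp _ ((min_le_right _ _).trans (min_le_right _ _))) (hC₁ 1)
  have hmv := (convex_ball p δ).norm_image_sub_le_of_norm_fderiv_le (𝕜 := ℝ)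
    (fun z hz => hE.differentiableAt hS.isOpen hħ' (hVS (hball hz).1)) hder hx hy
  have hdist : ‖y - x‖ ≤ 2 * δ := by
    rw [← dist_eq_norm]
    linarith [dist_triangle_right y x p, Metric.mem_ball.mp hx, Metric.mem_ball.mp hy]
  have h4 : ‖E ħ x‖ ≤ |C| * e := (h1.trans (mul_le_mul_of_nonneg_right (le_abs_self C)
    (Real.exp_pos _).le)).trans (mul_le_mul_of_nonneg_left (hexp c (min_le_left _ _)) (abs_nonneg C))
  have h5 : M * (C₁ 0 + C₁ 1) * e * ‖y - x‖ ≤ M * (C₁ 0 + C₁ 1) * e * (2 * δ) :=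
    mul_le_mul_of_nonneg_left hdist (mul_nonneg (mul_nonneg hM (add_nonneg (hC₁ 0) (hC₁ 1)))
      (Real.exp_pos _).le)
  have h6 : ‖E ħ y‖ ≤ ‖E ħ x‖ + ‖E ħ y - E ħ x‖ := by
    have := norm_add_le (E ħ x) (E ħ y - E ħ x)
    rwa [add_sub_cancel] at this
  calc ‖E ħ y‖ ≤ |C| * e + M * (C₁ 0 + C₁ 1) * e * (2 * δ) := by linarith
    _ = _ := by ring

lemma WE.of_pd (hS : LocDiffeo ϖ S) (hc : IsPreconnected S) {E : HFun} (hE : Smooth S E)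
    (h : ∀ q, WE ϖ S (fun ħ => ExtScattering.pd ϖ q (E ħ))) {p₀ : Pt} (hp₀ : p₀ ∈ S)
    (h0 : ∀ ħ : ℝ, 0 < ħ → E ħ p₀ = 0) : WE ϖ S E := by
  set A : Set Pt := {p | ∃ W ∈ 𝓝 p, ∃ c > 0, ∃ C, ∀ᶠ ħ in 𝓝[>] (0 : ℝ), ∀ y ∈ W,
    ‖E ħ y‖ ≤ C * Real.exp (-c / ħ)} with hA
  have hopen : IsOpen A := by
    rw [isOpen_iff_mem_nhds]
    rintro p ⟨W, hW, h⟩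
    filter_upwards [eventually_mem_nhds_iff.mpr hW] with x hx
    exact ⟨W, hx, h⟩
  have hsub : S ⊆ A := by
    refine hc.subset_of_closure_inter_subset hopen ⟨p₀, hp₀, ?_⟩ ?_
    · obtain ⟨W, hW, hs⟩ := exists_nhds_small hS hE h hp₀
      refine ⟨W, hW, hs p₀ (mem_of_mem_nhds hW) 1 one_pos 0 ?_⟩
      filter_upwards [self_mem_nhdsWithin] with ħ hħ
      rw [h0 ħ hħ, norm_zero, zero_mul]
    · rintro p ⟨hp, hpS⟩
      obtain ⟨W, hW, hs⟩ := exists_nhds_small hS hE h hpS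
      obtain ⟨x, hxW, W', hW', c, hc, C, hC⟩ := mem_closure_iff_nhds.mp hp W hW
      refine ⟨W, hW, hs x hxW c hc C ?_⟩
      filter_upwards [hC] with ħ hħ
      exact hħ x (mem_of_mem_nhds hW')
  refine ⟨hE, wExp_iff.mpr fun p hp => ?_⟩
  obtain ⟨W, hW, c, hc, C, hC⟩ := hsub hp
  choose N hN c₁ hc₁ hd using fun q => wExp_iff.mp (h q).2 p hp
  refine ⟨W ∩ (N 0 ∩ N 1), inter_mem hW (inter_mem (hN 0) (hN 1)), min c (min (c₁ 0) (c₁ 1)),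
    lt_min hc (lt_min (hc₁ 0) (hc₁ 1)), fun l => ?_⟩
  have hexp : ∀ c', min c (min (c₁ 0) (c₁ 1)) ≤ c' → ∀ ħ : ℝ, 0 < ħ →
      Real.exp (-c' / ħ) ≤ Real.exp (-min c (min (c₁ 0) (c₁ 1)) / ħ) := fun c' hc' ħ hħ =>
    Real.exp_le_exp.mpr (div_le_div_of_nonneg_right (neg_le_neg hc') hħ.le)
  rcases List.eq_nil_or_concat l with rfl | ⟨l', q, rfl⟩
  · refine ⟨|C|, abs_nonneg C, ?_⟩
    filter_upwards [hC, self_mem_nhdsWithin] with ħ h1 hħ y hy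
    exact ((h1 y hy.1).trans (mul_le_mul_of_nonneg_right (le_abs_self C) (Real.exp_pos _).le)).trans
      (mul_le_mul_of_nonneg_left (hexp c (min_le_left _ _) ħ hħ) (abs_nonneg C))
  · obtain ⟨C', hC', h'⟩ := hd q l'
    refine ⟨C', hC', ?_⟩
    filter_upwards [h', self_mem_nhdsWithin] with ħ h1 hħ y hy
    have hq : min c (min (c₁ 0) (c₁ 1)) ≤ c₁ q ∧ y ∈ N q := by
      fin_cases q
      · exact ⟨(min_le_right _ _).trans (min_le_left _ _), hy.2.1⟩
      · exact ⟨(min_le_right _ _).trans (min_le_right _ _), hy.2.2⟩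
    rw [List.concat_eq_append, iterPd_append]
    exact (h1 y hq.2).trans (mul_le_mul_of_nonneg_left (hexp _ hq.1 ħ hħ) hC')

end Primitive

/-! ## Geometry of the cover -/

section Cover

namespace Setup

variable {r : ℕ} {S : Setup r}

lemma contDiff_pol : ContDiff ℝ ∞ S.pol := by
  unfold pol polar
  fun_prop

lemma isOpen_cover : IsOpen S.cover := by
  have h : S.cover = {p : Pt | 0 < p 0} ∩ ({p | S.ϑ0 - S.ε < p 1} ∩
      ({p | p 1 < S.ϑ0 + 2 * Real.pi} ∩ S.pol ⁻¹' S.U)) := rfl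
  rw [h]
  exact (isOpen_lt continuous_const (continuous_apply 0)).inter
    ((isOpen_lt continuous_const (continuous_apply 1)).inter
    ((isOpen_lt (continuous_apply 1) continuous_const).inter
      (S.isOpen_U.preimage contDiff_pol.continuous)))

lemma p0_mem : S.p0 ∈ S.cover :=
  ⟨S.ρ0_pos, by simp [p0, S.ε_pos], by simp [p0, Real.pi_pos], S.q0_mem⟩

lemma locDiffeo_pol : LocDiffeo S.pol S.cover := by
  refine ⟨isOpen_cover, contDiff_pol.contDiffOn, fun p hp => ?_⟩
  have hd : HasFDerivAt S.pol (fderiv ℝ S.pol p) p :=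
    (contDiff_pol.differentiable (by simp) p).hasFDerivAt
  have hp0 : p 0 ≠ 0 := hp.1.ne'
  have hinj : Function.Injective (fderiv ℝ S.pol p) := by
    refine (injective_iff_map_eq_zero _).mpr fun v hv => ?_
    have hL : ∀ i, HasFDerivAt (fun p => S.coordL i (S.pol p - S.m0))
        ((S.coordL i).comp (fderiv ℝ S.pol p)) p := fun i =>
      (S.coordL i).hasFDerivAt.comp p (hd.sub_const S.m0)
    have e0 : HasFDerivAt (fun p : Pt => p 0 * Real.cos (p 1)) _ p :=
      (hasFDerivAt_apply (𝕜 := ℝ) (0 : Fin 2) p).mul (hasFDerivAt_apply (𝕜 := ℝ) (1 : Fin 2) p).cos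
    have e1 : HasFDerivAt (fun p : Pt => p 0 * Real.sin (p 1)) _ p :=
      (hasFDerivAt_apply (𝕜 := ℝ) (0 : Fin 2) p).mul (hasFDerivAt_apply (𝕜 := ℝ) (1 : Fin 2) p).sin
    have h0 := hL 0
    have h1 := hL 1
    simp only [coordL_pol, Matrix.cons_val_zero, Matrix.cons_val_one] at h0 h1
    have f0 := congrArg (fun L : Pt →L[ℝ] ℝ => L v) (h0.unique e0)
    have f1 := congrArg (fun L : Pt →L[ℝ] ℝ => L v) (h1.unique e1)
    simp only [ContinuousLinearMap.comp_apply, hv, map_zero, _root_.add_apply, _root_.smul_apply,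
      smul_eq_mul, ContinuousLinearMap.proj_apply] at f0 f1
    have hcs := Real.sin_sq_add_cos_sq (p 1)
    have g0 : v 0 = 0 := by
      linear_combination (-Real.cos (p 1)) * f0 - (Real.sin (p 1)) * f1 - v 0 * hcs
    have g1 : p 0 * v 1 = 0 := by
      linear_combination (Real.sin (p 1)) * f0 - (Real.cos (p 1)) * f1 - p 0 * v 1 * hcs
    funext i
    fin_cases i
    · exact g0
    · exact (mul_eq_zero.mp g1).resolve_left hp0
  refine ⟨(LinearEquiv.ofInjectiveEndo (fderiv ℝ S.pol p : Pt →ₗ[ℝ] Pt) hinj).toContinuousLinearEquiv, ?_⟩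
  ext v : 1
  rfl

lemma mapsTo_pol : Set.MapsTo S.pol S.cover S.U := fun _ hp => hp.2.2.2

lemma isPreconnected_cover : IsPreconnected S.cover := by
  have hpol : ∀ (x y : Pt), x 1 = y 1 → ∀ s t : ℝ, s + t = 1 →
      S.pol (s • x + t • y) = s • S.pol x + t • S.pol y := by
    intro x y h s t hst
    have e1 : (s • x + t • y) 1 = y 1 := by
      rw [Pi.add_apply, Pi.smul_apply, Pi.smul_apply, h, ← add_smul, hst, one_smul]
    have e0 : (s • x + t • y) 0 = s * x 0 + t * y 0 := rfl
    simp only [pol, polar, e1, e0, h]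
    have : S.m0 = s • S.m0 + t • S.m0 := by rw [← add_smul, hst, one_smul]
    conv_lhs => rw [this]
    module
  have hsmall : ∃ ρ : ℝ, 0 < ρ ∧ ∀ ϑ, S.pol ![ρ, ϑ] ∈ S.U := by
    obtain ⟨δ, hδ, hb⟩ := Metric.mem_nhds_iff.mp (S.isOpen_U.mem_nhds S.m0_mem)
    set M := ‖toPt S.w1.m‖ + ‖toPt S.w2.m‖ + 1 with hM
    have hMpos : 0 < M := by positivity
    refine ⟨δ / (2 * M), by positivity, fun ϑ => hb ?_⟩
    rw [Metric.mem_ball, dist_eq_norm]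
    have e : S.pol ![δ / (2 * M), ϑ] - S.m0 = (δ / (2 * M)) •
        (Real.cos ϑ • toPt S.w1.m + Real.sin ϑ • toPt S.w2.m) := by
      simp only [pol, polar, Matrix.cons_val_zero, Matrix.cons_val_one]
      module
    rw [e, norm_smul, Real.norm_of_nonneg (by positivity)]
    have h1 : ‖Real.cos ϑ • toPt S.w1.m + Real.sin ϑ • toPt S.w2.m‖ ≤ M := by
      refine (norm_add_le _ _).trans ?_
      rw [norm_smul, norm_smul, Real.norm_eq_abs, Real.norm_eq_abs]
      have := mul_le_of_le_one_left (norm_nonneg (toPt S.w1.m)) (Real.abs_cos_le_one ϑ)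
      have := mul_le_of_le_one_left (norm_nonneg (toPt S.w2.m)) (Real.abs_sin_le_one ϑ)
      linarith
    calc _ ≤ δ / (2 * M) * M := mul_le_mul_of_nonneg_left h1 (by positivity)
      _ = δ / 2 := by field_simp
      _ < δ := by linarith
  obtain ⟨ρ, hρ, hU⟩ := hsmall
  refine isPreconnected_of_forall ![ρ, S.ϑ0] fun p hp => ?_
  refine ⟨segment ℝ ![ρ, S.ϑ0] ![ρ, p 1] ∪ segment ℝ ![ρ, p 1] p, ?_,
    Or.inl (left_mem_segment ℝ _ _), Or.inr (right_mem_segment ℝ _ _),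
    (convex_segment _ _).isPreconnected.union ![ρ, p 1] (right_mem_segment ℝ _ _)
      (left_mem_segment ℝ _ _) (convex_segment _ _).isPreconnected⟩
  rintro x (⟨s, t, hs, ht, hst, rfl⟩ | ⟨s, t, hs, ht, hst, rfl⟩)
  · have e : s • (![ρ, S.ϑ0] : Pt) + t • ![ρ, p 1] = ![ρ, s * S.ϑ0 + t * p 1] := by
      funext i
      fin_cases i
      · simp [← add_mul, hst]
      · simp
    rw [e]
    obtain ⟨-, h1, h2, -⟩ := hp
    have h3 := S.ε_pos
    have h4 := Real.pi_pos
    obtain ⟨h5, h6⟩ := convex_Ioo (S.ϑ0 - S.ε) (S.ϑ0 + 2 * Real.pi)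
      (show S.ϑ0 ∈ Set.Ioo _ _ from ⟨by linarith, by linarith⟩) ⟨h1, h2⟩ hs ht hst
    exact ⟨hρ, h5, h6, hU _⟩
  · have e1 : (s • (![ρ, p 1] : Pt) + t • p) 1 = p 1 := by
      simp [← add_mul, hst]
    refine ⟨?_, by rw [e1]; exact hp.2.1, by rw [e1]; exact hp.2.2.1, ?_⟩
    · have : 0 < p 0 := hp.1
      simp only [Pi.add_apply, Pi.smul_apply, Matrix.cons_val_zero, smul_eq_mul]
      rcases hs.eq_or_lt with rfl | hs
      · have : t = 1 := by linarith
        rw [this]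
        linarith
      · positivity
    · rw [hpol ![ρ, p 1] p rfl s t hst]
      exact S.convex_U (hU _) hp.2.2.2 hs ht hst

lemma etaA_pol (a : Prim) (p : Pt) : S.etaA a (S.pol p - S.m0) =
    sgn a * (p 0 * (a.1.1 * Real.sin (p 1) - a.1.2 * Real.cos (p 1))) := by
  have hD : (S.D : ℝ) ≠ 0 := Int.cast_ne_zero.mpr S.D_ne
  have h1 : detP (toPt (S.mA a)) (toPt S.w2.m) = a.1.1 * S.D := by
    rw [detP_toPt, mA, detL_left (S := S) a.1]
    push_cast
    ring
  have h2 : detP (toPt (S.mA a)) (toPt S.w1.m) = -(a.1.2 * S.D) := by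
    have := detL_right (S := S) a.1
    have e : detL (S.mA a) S.w1.m = -detL S.w1.m (a.1.1 • S.w1.m + a.1.2 • S.w2.m) := by
      simp only [mA, detL]
      ring
    rw [detP_toPt, e, this]
    push_cast
    ring
  have e : S.pol p - S.m0 = (p 0 * Real.cos (p 1)) • toPt S.w1.m +
      (p 0 * Real.sin (p 1)) • toPt S.w2.m := by
    rw [pol, polar]
    abel
  rw [etaA, _root_.smul_apply, e, map_add, map_smul, map_smul, detCLM_apply, detCLM_apply, h1, h2]
  simp only [smul_eq_mul]
  field_simp
  ring

end Setup
end Cover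

/-! ## Cut-off functions on the cover -/

section Cutoff

namespace Setup

variable {r : ℕ}

/-- Cut-off functions: `χ₁` selects a neighbourhood of the wall, `χ₂` the positive side, and the
open sets are a neighbourhood of the wall and its two sides. -/
structure IsCutoff (S : Setup r) (a : Prim) (χ₁ χ₂ : Pt → ℝ) (N₀ N₁ N₂ : Set Pt) : Prop where
  smooth₁ : ContDiff ℝ ∞ χ₁
  smooth₂ : ContDiff ℝ ∞ χ₂
  open₀ : IsOpen N₀
  open₁ : IsOpen N₁
  open₂ : IsOpen N₂
  cover_subset : ∀ p ∈ S.cover, p ∈ N₀ ∨ p ∈ N₁ ∨ p ∈ N₂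
  plus : S.Hplus a ⊆ N₂
  minus : S.Hminus a ⊆ N₁
  base₁ : χ₁ S.p0 = 0
  base₂ : χ₂ S.p0 = 0
  wall : ∀ p ∈ N₀, χ₁ p = 1 ∧ χ₂ p = 0
  neg : ∀ p ∈ N₁, χ₂ p = 0
  pos : ∀ p ∈ N₂, χ₁ p + χ₂ p = 1
  wall_dir : (a = e1 ∨ a = e2) ∨ ∀ p ∈ N₀ ∩ S.cover, ∀ m, S.Along a m →
    0 < rayW (-toPt m) (S.pol p - S.m0)
  neg_val : ∀ p ∈ N₁ ∩ S.cover, S.etaA a (S.pol p - S.m0) < 0 ∨ ∀ᶠ p' in 𝓝 p, χ₁ p' = 0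
  pos_val : ∀ p ∈ N₂ ∩ S.cover, 0 < S.etaA a (S.pol p - S.m0) ∨ ∀ᶠ p' in 𝓝 p, χ₁ p' = 0
  off_line : (a = e1 ∨ a = e2) → ∀ p ∈ (N₁ ∪ N₂) ∩ S.cover, S.etaA a (S.pol p - S.m0) ≠ 0
  off_ray : ¬(a = e1 ∨ a = e2) → ∀ p ∈ (N₁ ∪ N₂) ∩ S.cover, ∀ m, S.Along a m →
    0 < rayW (toPt m) (S.pol p - S.m0)

variable {S : Setup r}

lemma exists_isCutoff_line {a : Prim} (ha : a = e1 ∨ a = e2)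
    (hp : ∀ p ∈ S.Hplus a, 0 < S.etaA a (S.pol p - S.m0))
    (hm : ∀ p ∈ S.Hminus a, S.etaA a (S.pol p - S.m0) < 0)
    (h0 : S.etaA a (S.pol S.p0 - S.m0) < 0) :
    ∃ χ₁ χ₂ N₀ N₁ N₂, S.IsCutoff a χ₁ χ₂ N₀ N₁ N₂ := by
  set v : Pt → ℝ := fun p => S.etaA a (S.pol p - S.m0) with hv
  have hvs : ContDiff ℝ ∞ v := (S.etaA a).contDiff.comp (contDiff_pol.sub contDiff_const)
  have hvc := hvs.continuous
  set v₀ := v S.p0 with hv₀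
  have h0' : v₀ < 0 := h0
  refine ⟨fun p => Real.smoothTransition ((v p - v₀) / (-v₀ / 2)), fun _ => 0, {p | v₀ / 2 < v p},
    {p | v p < 0}, {p | 0 < v p}, ?_⟩
  have h1 : ∀ p, v₀ / 2 < v p → Real.smoothTransition ((v p - v₀) / (-v₀ / 2)) = 1 := fun p hp =>
    Real.smoothTransition.one_of_one_le (by rw [le_div_iff₀ (by linarith)]; linarith)
  refine ⟨Real.smoothTransition.contDiff.comp ((hvs.sub contDiff_const).div_const _), contDiff_const,
    isOpen_lt continuous_const hvc, isOpen_lt hvc continuous_const, isOpen_lt continuous_const hvc,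
    fun p _ => ?_, hp, hm, ?_, rfl, fun p hp => ⟨h1 p hp, rfl⟩, fun _ _ => rfl, fun p hp => ?_,
    Or.inl ha, fun p hp => Or.inl hp.1, fun p hp => Or.inl hp.1, fun _ p hp => ?_,
    fun h => absurd ha h⟩
  · rcases lt_or_ge (v p) 0 with h | h
    · exact Or.inr (Or.inl h)
    · exact Or.inl (show v₀ / 2 < v p by linarith)
  · exact Real.smoothTransition.zero_of_nonpos (by simp [hv₀])
  · have hp' : 0 < v p := hp
    rw [h1 p (by linarith), add_zero]
  · rcases hp.1 with h | h
    · exact ne_of_lt h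
    · exact ne_of_gt h

lemma exists_isCutoff_e1 : ∃ χ₁ χ₂ N₀ N₁ N₂, S.IsCutoff e1 χ₁ χ₂ N₀ N₁ N₂ := by
  have h : ∀ p, S.etaA e1 (S.pol p - S.m0) = p 0 * Real.sin (p 1) := fun p => by
    rw [etaA_pol, sgn_e1]
    simp [e1]
  refine exists_isCutoff_line (Or.inl rfl) (fun p hp => ?_) (fun p hp => ?_) ?_
  · have h2 : 0 < Real.sin (p 1) := by simpa using hp.2
    rw [h]
    exact mul_pos hp.1.1 h2
  · have h2 : Real.sin (p 1) < 0 := by simpa using hp.2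
    rw [h]
    exact mul_neg_of_pos_of_neg hp.1.1 h2
  · rw [h]
    exact mul_neg_of_pos_of_neg S.ρ0_pos sin_ϑ0_neg

lemma exists_isCutoff_e2 : ∃ χ₁ χ₂ N₀ N₁ N₂, S.IsCutoff e2 χ₁ χ₂ N₀ N₁ N₂ := by
  have h : ∀ p, S.etaA e2 (S.pol p - S.m0) = p 0 * Real.cos (p 1) := fun p => by
    rw [etaA_pol, sgn_e2]
    simp [e2]
  refine exists_isCutoff_line (Or.inr rfl) (fun p hp => ?_) (fun p hp => ?_) ?_
  · have h2 : 0 < Real.cos (p 1) := by simpa [e1_ne_e2.symm] using hp.2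
    rw [h]
    exact mul_pos hp.1.1 h2
  · have h2 : Real.cos (p 1) < 0 := by simpa [e1_ne_e2.symm] using hp.2
    rw [h]
    exact mul_neg_of_pos_of_neg hp.1.1 h2
  · rw [h]
    exact mul_neg_of_pos_of_neg S.ρ0_pos cos_ϑ0_neg

lemma prim_pos {a : Prim} (ha : ¬(a = e1 ∨ a = e2)) : 0 < a.1.1 ∧ 0 < a.1.2 := by
  obtain ⟨⟨x, y⟩, h⟩ := a
  refine ⟨Nat.pos_of_ne_zero fun h0 => ha (Or.inr (Subtype.ext (Prod.ext h0 ?_))),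
    Nat.pos_of_ne_zero fun h0 => ha (Or.inl (Subtype.ext (Prod.ext ?_ h0)))⟩
  · change x = 0 at h0
    subst h0
    simpa [e2] using h
  · change y = 0 at h0
    subst h0
    simpa [e1] using h

lemma exists_isCutoff_ray {a : Prim} (ha : ¬(a = e1 ∨ a = e2)) :
    ∃ χ₁ χ₂ N₀ N₁ N₂, S.IsCutoff a χ₁ χ₂ N₀ N₁ N₂ := by
  have hpi := Real.pi_pos
  obtain ⟨ha1, ha2⟩ := prim_pos ha
  have ha1' : (0 : ℝ) < a.1.1 := by exact_mod_cast ha1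
  have ha2' : (0 : ℝ) < a.1.2 := by exact_mod_cast ha2
  set z : ℂ := ⟨(a.1.1 : ℝ), (a.1.2 : ℝ)⟩ with hz
  set n := ‖z‖ with hn
  have hz0 : z ≠ 0 := fun h => ha1'.ne' (congrArg Complex.re h)
  have hn0 : 0 < n := norm_pos_iff.mpr hz0
  have hα0 : 0 ≤ Complex.arg z := Complex.arg_nonneg_iff.mpr ha2'.le
  have hα1 : Complex.arg z < Real.pi / 2 := Complex.arg_lt_pi_div_two_iff.mpr (Or.inl ha1')
  have hc : (a.1.1 : ℝ) = n * Real.cos (Complex.arg z) := (Complex.norm_mul_cos_arg z).symm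
  have hs : (a.1.2 : ℝ) = n * Real.sin (Complex.arg z) := (Complex.norm_mul_sin_arg z).symm
  set δ : Pt → ℝ := fun p => p 1 - angle a with hδ
  have hδe : ∀ p, δ p = p 1 - Complex.arg z - 2 * Real.pi := fun p => by
    simp only [hδ, angle]
    ring
  have hcos : ∀ p, n * Real.cos (δ p) = a.1.1 * Real.cos (p 1) + a.1.2 * Real.sin (p 1) := by
    intro p
    rw [hδe, Real.cos_sub_two_pi, Real.cos_sub, hc, hs]
    ring
  have hsin : ∀ p, n * Real.sin (δ p) = a.1.1 * Real.sin (p 1) - a.1.2 * Real.cos (p 1) := by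
    intro p
    rw [hδe, Real.sin_sub_two_pi, Real.sin_sub, hc, hs]
    ring
  have heta : ∀ p, S.etaA a (S.pol p - S.m0) = p 0 * (n * Real.sin (δ p)) := by
    intro p
    rw [etaA_pol, hsin, sgn, if_neg fun h => ha (Or.inr h), one_mul]
  have hbd : ∀ p ∈ S.cover, -(3 * Real.pi / 2) < δ p ∧ δ p < 3 * Real.pi / 2 := by
    rintro p ⟨-, h1, h2, -⟩
    have h3 := S.ε_le
    have h4 := S.ϑ0_lt
    rw [hδe]
    constructor <;> linarith
  have hdir : ∀ (p : Pt) (m : Lam) (t : ℝ), S.Along a m → S.pol p - S.m0 = t • toPt m →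
      ∃ l : ℝ, 0 < l ∧ p 0 * Real.cos (p 1) = t * (l * a.1.1) ∧
        p 0 * Real.sin (p 1) = t * (l * a.1.2) := by
    rintro p m t ⟨l, hl, rfl⟩ h
    have e0 := congrArg (S.coordL 0) h
    have e1 := congrArg (S.coordL 1) h
    rw [coordL_pol, map_smul, toPt_nsmul, map_smul, mA, coordL_toPt] at e0 e1
    refine ⟨l, by exact_mod_cast hl, ?_, ?_⟩
    · simpa using e0
    · simpa using e1
  have hδc : Continuous δ := (continuous_apply 1).sub continuous_const
  have hδs : ContDiff ℝ ∞ δ := by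
    simp only [hδ]
    fun_prop
  set s₁ : Pt → ℝ := fun p => Real.smoothTransition ((δ p + Real.pi / 2) / (Real.pi / 4)) with hs₁
  set s₂ : Pt → ℝ := fun p => Real.smoothTransition ((δ p - Real.pi / 4) / (Real.pi / 4)) with hs₂
  have c₁ : ContDiff ℝ ∞ s₁ :=
    Real.smoothTransition.contDiff.comp ((hδs.add contDiff_const).div_const _)
  have c₂ : ContDiff ℝ ∞ s₂ :=
    Real.smoothTransition.contDiff.comp ((hδs.sub contDiff_const).div_const _)
  have z₁ : ∀ p, δ p ≤ -(Real.pi / 2) → s₁ p = 0 := fun p h =>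
    Real.smoothTransition.zero_of_nonpos (div_nonpos_of_nonpos_of_nonneg (by linarith) (by linarith))
  have z₂ : ∀ p, δ p ≤ Real.pi / 4 → s₂ p = 0 := fun p h =>
    Real.smoothTransition.zero_of_nonpos (div_nonpos_of_nonpos_of_nonneg (by linarith) (by linarith))
  have o₁ : ∀ p, -(Real.pi / 4) ≤ δ p → s₁ p = 1 := fun p h =>
    Real.smoothTransition.one_of_one_le (by rw [le_div_iff₀ (by linarith)]; linarith)
  have o₂ : ∀ p, Real.pi / 2 ≤ δ p → s₂ p = 1 := fun p h =>
    Real.smoothTransition.one_of_one_le (by rw [le_div_iff₀ (by linarith)]; linarith)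
  have hb : δ S.p0 ≤ -(Real.pi / 2) := by
    have := S.ϑ0_lt
    rw [hδe]
    simp only [p0, Matrix.cons_val_one, Matrix.cons_val_fin_one]
    linarith
  refine ⟨fun p => s₁ p * (1 - s₂ p), s₂, {p | -(Real.pi / 4) < δ p} ∩ {p | δ p < Real.pi / 4},
    {p | δ p < 0}, {p | 0 < δ p}, ?_⟩
  refine ⟨c₁.mul (contDiff_const.sub c₂), c₂,
    (isOpen_lt continuous_const hδc).inter (isOpen_lt hδc continuous_const),
    isOpen_lt hδc continuous_const, isOpen_lt continuous_const hδc, fun p _ => ?_, fun p hp => ?_,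
    fun p hp => ?_, ?_, z₂ _ (by linarith), fun p hp => ⟨?_, z₂ _ (le_of_lt hp.2)⟩, fun p hp => ?_,
    fun p hp => ?_, Or.inr fun p hp m hm => ?_, fun p hp => ?_, fun p hp => ?_,
    fun h => absurd h ha, fun _ p hp m hm => ?_⟩
  · rcases lt_trichotomy (δ p) 0 with h | h | h
    · exact Or.inr (Or.inl h)
    · exact Or.inl ⟨show -(Real.pi / 4) < δ p by linarith, show δ p < Real.pi / 4 by linarith⟩
    · exact Or.inr (Or.inr h)
  · have h2 := hp.2
    rw [if_neg fun h => ha (Or.inl h), if_neg fun h => ha (Or.inr h)] at h2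
    exact sub_pos.mpr h2
  · have h2 := hp.2
    rw [if_neg fun h => ha (Or.inl h), if_neg fun h => ha (Or.inr h)] at h2
    exact sub_neg.mpr h2
  · rw [z₁ _ hb, zero_mul]
  · rw [o₁ _ (le_of_lt hp.1), z₂ _ (le_of_lt hp.2), sub_zero, mul_one]
  · exact z₂ _ ((le_of_lt hp).trans (by linarith))
  · have hp' : 0 < δ p := hp
    rw [o₁ p (by linarith), one_mul, sub_add_cancel]
  · refine lt_of_le_of_ne (rayW_nonneg _ _) fun h0 => ?_
    obtain ⟨t, ht, e⟩ := exists_of_rayW_eq_zero (neg_ne_zero.mpr (toPt_ne_zero hm.cone.ne_zero)) h0.symm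
    rw [smul_neg, ← neg_smul] at e
    obtain ⟨l, hl, e0, e1⟩ := hdir p m (-t) hm e
    have h1 : 0 < Real.cos (δ p) := Real.cos_pos_of_mem_Ioo
      ⟨by linarith [show -(Real.pi / 4) < δ p from hp.1.1],
        by linarith [show δ p < Real.pi / 4 from hp.1.2]⟩
    have h2 : p 0 * (n * Real.cos (δ p)) = -(t * l * (a.1.1 ^ 2 + a.1.2 ^ 2)) := by
      rw [hcos]
      linear_combination (a.1.1 : ℝ) * e0 + (a.1.2 : ℝ) * e1
    have h3 : 0 < p 0 * (n * Real.cos (δ p)) := mul_pos hp.2.1 (mul_pos hn0 h1)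
    have h4 : 0 ≤ t * l * ((a.1.1 : ℝ) ^ 2 + (a.1.2 : ℝ) ^ 2) := by positivity
    linarith
  · have hp' : δ p < 0 := hp.1
    rcases lt_or_ge (-Real.pi) (δ p) with h | h
    · left
      rw [heta]
      exact mul_neg_of_pos_of_neg hp.2.1 (mul_neg_of_pos_of_neg hn0
        (Real.sin_neg_of_neg_of_neg_pi_lt hp' h))
    · right
      filter_upwards [(isOpen_lt hδc continuous_const).mem_nhds
        (show δ p < -(Real.pi / 2) by linarith)] with p' h'
      rw [z₁ p' (le_of_lt h'), zero_mul]
  · have hp' : 0 < δ p := hp.1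
    rcases lt_or_ge (δ p) Real.pi with h | h
    · left
      rw [heta]
      exact mul_pos hp.2.1 (mul_pos hn0 (Real.sin_pos_of_pos_of_lt_pi hp' h))
    · right
      filter_upwards [(isOpen_lt continuous_const hδc).mem_nhds
        (show Real.pi / 2 < δ p by linarith)] with p' h'
      rw [o₂ p' (le_of_lt h'), sub_self, mul_zero]
  · refine lt_of_le_of_ne (rayW_nonneg _ _) fun h0 => ?_
    obtain ⟨t, ht, e⟩ := exists_of_rayW_eq_zero (toPt_ne_zero hm.cone.ne_zero) h0.symm
    obtain ⟨l, hl, e0, e1⟩ := hdir p m t hm e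
    have hp0 : 0 < p 0 := hp.2.1
    have h2 : p 0 * (n * Real.cos (δ p)) = t * l * (a.1.1 ^ 2 + a.1.2 ^ 2) := by
      rw [hcos]
      linear_combination (a.1.1 : ℝ) * e0 + (a.1.2 : ℝ) * e1
    have h3 : p 0 * (n * Real.sin (δ p)) = 0 := by
      rw [hsin]
      linear_combination (a.1.1 : ℝ) * e1 - (a.1.2 : ℝ) * e0
    have h4 : Real.sin (δ p) = 0 := ((mul_eq_zero.mp h3).resolve_left hp0.ne' |>
      mul_eq_zero.mp).resolve_left hn0.ne'
    have h5 : 0 ≤ Real.cos (δ p) := by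
      by_contra h
      have h6 := mul_neg_of_pos_of_neg hp0 (mul_neg_of_pos_of_neg hn0 (not_le.mp h))
      have h7 : 0 ≤ t * l * ((a.1.1 : ℝ) ^ 2 + (a.1.2 : ℝ) ^ 2) := by positivity
      linarith
    obtain ⟨b1, b2⟩ := hbd p hp.2
    have hne : δ p ≠ 0 := by
      rcases hp.1 with h | h
      · exact ne_of_lt h
      · exact ne_of_gt h
    rcases lt_or_ge (δ p) Real.pi with h | h
    · rcases lt_or_ge (-Real.pi) (δ p) with h' | h'
      · exact hne ((Real.sin_eq_zero_iff_of_lt_of_lt h' h).mp h4)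
      · have := Real.cos_neg_of_pi_div_two_lt_of_lt (x := -δ p) (by linarith) (by linarith)
        rw [Real.cos_neg] at this
        linarith
    · have := Real.cos_neg_of_pi_div_two_lt_of_lt (x := δ p) (by linarith) (by linarith)
      linarith

lemma exists_isCutoff (a : Prim) : ∃ χ₁ χ₂ N₀ N₁ N₂, S.IsCutoff a χ₁ χ₂ N₀ N₁ N₂ := by
  by_cases ha : a = e1 ∨ a = e2
  · rcases ha with rfl | rfl
    · exact exists_isCutoff_e1
    · exact exists_isCutoff_e2
  · exact exists_isCutoff_ray ha

end Setup
end Cutoff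

/-! ## The gauge on the cover, for the flat metric -/

section FlatGauge

lemma rescale_order_zero {m0 : Pt} (f : HFun) (ħ : ℝ) (x : Pt) :
    rescale m0 0 f ħ x = f (√ħ) ((√ħ)⁻¹ • (x - m0)) := by
  simp [rescale]

lemma negW_smul (η : Pt →L[ℝ] ℝ) {t : ℝ} (ht : 0 ≤ t) (y : Pt) :
    negW η (t • y) = t ^ 2 * negW η y := by
  have : min (t * η y) 0 = t * min (η y) 0 := by rw [mul_min_of_nonneg _ _ ht, mul_zero]
  rw [negW, negW, map_smul, smul_eq_mul, this, mul_pow]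

lemma cont_negW (η : Pt →L[ℝ] ℝ) : Continuous (negW η) := by
  unfold negW
  fun_prop

lemma negW_pos {η : Pt →L[ℝ] ℝ} {y : Pt} (h : η y < 0) : 0 < negW η y := by
  rw [negW, min_eq_left h.le]
  exact sq_pos_of_neg h

namespace Setup

variable {r : ℕ} (S : Setup r)

/-- The solution of the Kuranishi equation for the flat metric. -/
noncomputable def flatForm : Form1 r := fun q => conormalSec q S.dens

/-- The gauge on the cover: the gauge of the model near the wall, and its limit beyond the wall. -/
noncomputable def coverGauge (a : Prim) (χ₁ χ₂ : Pt → ℝ) : Sec r HFun :=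
  mapSec (fun _ f ħ p => (χ₁ p : ℂ) * rescale S.m0 0 f ħ (S.pol p)) (S.modelGauge a) +
    mapSec (fun _ f ħ p => (χ₂ p : ℂ) * lineInt (S.nA a) (f (√ħ)) 0) (S.gaugeDens a)

/-- The limit of the gauge beyond the wall, as a section. -/
noncomputable def limitSec (a : Prim) : Sec r HFun :=
  mapSec (fun _ f ħ _ => lineInt (S.nA a) (f (√ħ)) 0) (S.gaugeDens a)

/-- `φ` is a normalised gauge for the flat metric. -/
def IsFlatGauge (a : Prim) (φ : Sec r HFun) : Prop :=
  (∀ c m, cf φ c 0 m = 0) ∧ SmoothOn S.cover φ ∧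
    (∀ c s m, ∀ ħ : ℝ, 0 < ħ → cf φ c s m ħ S.p0 = 0) ∧
    ∀ q c s m, WExp S.pol S.cover (cf (gaugeZero S.κ S.pol (fun _ _ => 0) s φ q) c s m -
      cf (S.pull (S.part a S.flatForm) q) c s m)

open scoped Classical in
/-- The rescaled model of the pull-back of the part of the solution along `m_a`. -/
noncomputable def modelForm (a : Prim) (q : Fin 2) (c : Comp r) (s : ℕ) (m : Lam) : HFun :=
  if S.Along a m then conormal m q • fun ħ p => rescale S.m0 1 (cf S.model c s m) ħ (S.pol p)
  else 0

variable {S}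

lemma cf_pull (Φ : Form1 r) (q : Fin 2) (c : Comp r) (s : ℕ) (m : Lam) :
    cf (S.pull Φ q) c s m = fun ħ p => cf (Φ q) c s m ħ (S.pol p) := by
  rw [pull, cf_mapSec]
  exact fun _ => rfl

open scoped Classical in
lemma cf_part (a : Prim) (Φ : Form1 r) (q : Fin 2) (c : Comp r) (s : ℕ) (m : Lam) :
    cf (S.part a Φ q) c s m = if S.Along a m then cf (Φ q) c s m else 0 := by
  rw [part, cf_mapSec]
  · rfl
  · intro m
    split_ifs <;> rfl

lemma cf_coverGauge (a : Prim) (χ₁ χ₂ : Pt → ℝ) (c : Comp r) (s : ℕ) (m : Lam) :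
    cf (S.coverGauge a χ₁ χ₂) c s m = fun ħ p =>
      (χ₁ p : ℂ) * rescale S.m0 0 (cf (S.modelGauge a) c s m) ħ (S.pol p) +
        (χ₂ p : ℂ) * S.limitA a c s m (√ħ) := by
  rw [coverGauge, cf_add, cf_mapSec, cf_mapSec]
  · rfl
  · intro m
    funext ħ p
    simp [lineInt, rayInt_zero]
  · intro m
    rw [rescale_zero]
    funext ħ p
    simp

lemma cf_limitSec (a : Prim) (c : Comp r) (s : ℕ) (m : Lam) :
    cf (S.limitSec a) c s m = fun ħ _ => S.limitA a c s m (√ħ) := by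
  rw [limitSec, cf_mapSec]
  · rfl
  · intro m
    funext ħ p
    simp [lineInt, rayInt_zero]

lemma limitA_zero (a : Prim) (c : Comp r) (m : Lam) (ε : ℝ) : S.limitA a c 0 m ε = 0 :=
  limitA_eq_zero ((gaugeDens_spec a).1 c m) ε

lemma coverGauge_zero (a : Prim) (χ₁ χ₂ : Pt → ℝ) (c : Comp r) (m : Lam) :
    cf (S.coverGauge a χ₁ χ₂) c 0 m = 0 := by
  rw [cf_coverGauge, modelGauge_zero, rescale_zero]
  funext ħ p
  simp [limitA_zero]

lemma limitSec_zero (a : Prim) (c : Comp r) (m : Lam) : cf (S.limitSec a) c 0 m = 0 := by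
  rw [cf_limitSec]
  funext ħ p
  simp [limitA_zero]

lemma wP_limitA_sub {ϖ : Pt → Pt} {N : Set Pt} (a : Prim) (c : Comp r) (s : ℕ) (m : Lam) :
    WP ϖ (-1) N (fun ħ _ => S.limitA a c s m (√ħ) - cf (S.leading a) c s m) := by
  obtain ⟨K, hK, h⟩ := limitA_lipschitz (S := S) a c s m
  refine WP.of_const hK ?_
  filter_upwards [Ioo_mem_nhdsGT (zero_lt_one (α := ℝ))] with ħ hħ
  have e : ħ ^ (-(((-1 : ℤ)) : ℝ) / 2) = √ħ := by
    rw [Real.sqrt_eq_rpow]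
    norm_num
  rw [e]
  exact h _ (Real.sqrt_nonneg _) (Real.sqrt_le_one.mpr hħ.2.le)

lemma wP_limitA {ϖ : Pt → Pt} {N : Set Pt} (hN : LocDiffeo ϖ N) (a : Prim) (c : Comp r) (s : ℕ)
    (m : Lam) : WP ϖ 0 N (fun ħ _ => S.limitA a c s m (√ħ)) := by
  have h1 := (wP_limitA_sub (S := S) (ϖ := ϖ) (N := N) a c s m).mono_order (s' := 0) (by omega)
  have h2 : WP ϖ 0 N (fun _ _ => cf (S.leading a) c s m) := WP.of_smooth hN contDiffOn_const
  refine (h1.add hN h2).congr hN.isOpen fun ħ _ p _ => ?_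
  simp

lemma limitSec_dW0 {ϖ : Pt → Pt} (a : Prim) (q : Fin 2) :
    dW0 S.κ ϖ (fun _ _ => 0) (S.limitSec a) q = 0 := by
  refine sec_ext fun c s m => ?_
  rw [cf_dW0_flat, cf_limitSec, cf_zero]
  exact funext fun ħ => pd_const _ _ _

lemma dW0_zero {ϖ : Pt → Pt} (q : Fin 2) :
    dW0 S.κ ϖ (fun _ _ => 0) (0 : Sec r HFun) q = 0 := by
  refine sec_ext fun c s m => ?_
  rw [cf_dW0_flat, cf_zero]
  exact funext fun ħ => pd_zero _ _

lemma wP_pol {V : Set Pt} {W : Pt → ℝ} (hW : ∀ y, 0 ≤ W y) {f : HFun} (hf : PolyIn (Gau W) f)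
    (d : ℤ) (hV : V ⊆ S.cover) (hVo : IsOpen V) :
    WP S.pol d V (fun ħ p => rescale S.m0 d f ħ (S.pol p)) :=
  (hf.wP_rescale (m0 := S.m0) (d := d) hW Set.univ).comp (locDiffeo_pol.mono hVo hV) isOpen_univ
    fun _ _ => trivial

lemma wE_pol {V : Set Pt} {W : Pt → ℝ} (hW : ∀ y, 0 ≤ W y) (hWc : Continuous W)
    (hWh : ∀ t : ℝ, 0 ≤ t → ∀ y, W (t • y) = t ^ 2 * W y) {f : HFun} (hf : PolyIn (Gau W) f)
    (d : ℤ) (hV : V ⊆ S.cover) (hVo : IsOpen V) (h : ∀ p ∈ V, 0 < W (S.pol p - S.m0)) :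
    WE S.pol V (fun ħ p => rescale S.m0 d f ħ (S.pol p)) :=
  (hf.wE_rescale (m0 := S.m0) (d := d) (S := {x | 0 < W (x - S.m0)}) hW hWc hWh
    fun _ hx => hx).comp (locDiffeo_pol.mono hVo hV)
    (isOpen_lt continuous_const (hWc.comp (continuous_id.sub continuous_const))) h

lemma polyIn_modelGauge' (a : Prim) (c : Comp r) (s : ℕ) (m : Lam) :
    PolyIn (Gau (negW (S.etaA a))) (cf (S.modelGauge a) c s m) :=
  (polyIn_modelGauge a c s m).mono fun _ h => h.1

lemma cont_etaA_pol (a : Prim) : Continuous fun p => S.etaA a (S.pol p - S.m0) :=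
  (S.etaA a).continuous.comp (contDiff_pol.continuous.sub continuous_const)

section WithCutoff

variable {a : Prim} {χ₁ χ₂ : Pt → ℝ} {N₀ N₁ N₂ : Set Pt}

lemma IsCutoff.tempered (h : S.IsCutoff a χ₁ χ₂ N₀ N₁ N₂) (c : Comp r) (s : ℕ) (m : Lam) :
    WP S.pol 0 S.cover (cf (S.coverGauge a χ₁ χ₂) c s m) := by
  have hS := locDiffeo_pol (S := S)
  have h1 : WP S.pol 0 S.cover (fun _ p => (χ₁ p : ℂ)) :=
    WP.of_smooth hS (Complex.ofRealCLM.contDiff.comp h.smooth₁).contDiffOn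
  have h2 : WP S.pol 0 S.cover (fun _ p => (χ₂ p : ℂ)) :=
    WP.of_smooth hS (Complex.ofRealCLM.contDiff.comp h.smooth₂).contDiffOn
  have h3 := h1.mul hS (wP_pol (negW_nonneg _) (polyIn_modelGauge' (S := S) a c s m) 0 subset_rfl isOpen_cover)
  have h4 := h2.mul hS (wP_limitA (S := S) hS a c s m)
  rw [cf_coverGauge]
  exact h3.add hS h4

lemma IsCutoff.wE_neg (h : S.IsCutoff a χ₁ χ₂ N₀ N₁ N₂) (c : Comp r) (s : ℕ) (m : Lam) :
    WE S.pol (N₁ ∩ S.cover) (cf (S.coverGauge a χ₁ χ₂) c s m) := by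
  refine WE.of_local fun p hp => ?_
  rcases h.neg_val p hp with h1 | h1
  · refine ⟨{p | S.etaA a (S.pol p - S.m0) < 0}, isOpen_lt (cont_etaA_pol a) continuous_const, h1, ?_⟩
    set V := {p | S.etaA a (S.pol p - S.m0) < 0} ∩ (N₁ ∩ S.cover)
    have hVo : IsOpen V := (isOpen_lt (cont_etaA_pol a) continuous_const).inter
      (h.open₁.inter isOpen_cover)
    have hVc : V ⊆ S.cover := fun p hp => hp.2.2
    have hS := locDiffeo_pol.mono hVo hVc
    have e1 := wE_pol (negW_nonneg _) (cont_negW _) (fun t ht y => negW_smul _ ht y)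
      (polyIn_modelGauge' (S := S) a c s m) 0 hVc hVo fun p hp => negW_pos hp.1
    have e2 : WP S.pol 0 V (fun _ p => (χ₁ p : ℂ)) :=
      WP.of_smooth hS (Complex.ofRealCLM.contDiff.comp h.smooth₁).contDiffOn
    refine (e1.mul hS e2).congr hVo fun ħ hħ p hp => ?_
    rw [cf_coverGauge]
    simp only [Pi.mul_apply, h.neg p hp.2.1, Complex.ofReal_zero, zero_mul, add_zero]
    rw [mul_comm]
  · obtain ⟨N, hN, hNo, hpN⟩ := eventually_nhds_iff.mp h1
    refine ⟨N, hNo, hpN, WE.zero.congr (hNo.inter (h.open₁.inter isOpen_cover)) fun ħ _ p hp => ?_⟩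
    rw [cf_coverGauge]
    simp [hN p hp.1, h.neg p hp.2.1]

lemma IsCutoff.wE_pos (h : S.IsCutoff a χ₁ χ₂ N₀ N₁ N₂) (c : Comp r) (s : ℕ) (m : Lam) :
    WE S.pol (N₂ ∩ S.cover)
      (cf (S.coverGauge a χ₁ χ₂) c s m - cf (S.limitSec a) c s m) := by
  have key : ∀ ħ p, p ∈ N₂ → (cf (S.coverGauge a χ₁ χ₂) c s m - cf (S.limitSec a) c s m) ħ p =
      -(χ₁ p : ℂ) * rescale S.m0 0 (fun ε y => S.limitA a c s m ε - cf (S.modelGauge a) c s m ε y)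
        ħ (S.pol p) := by
    intro ħ p hp
    have e : (χ₂ p : ℂ) = 1 - χ₁ p := by
      have h3 : (χ₁ p : ℂ) + χ₂ p = 1 := by exact_mod_cast h.pos p hp
      linear_combination h3
    rw [cf_coverGauge, cf_limitSec]
    simp only [Pi.sub_apply, rescale_order_zero, e]
    ring
  refine WE.of_local fun p hp => ?_
  rcases h.pos_val p hp with h1 | h1
  · refine ⟨{p | 0 < S.etaA a (S.pol p - S.m0)}, isOpen_lt continuous_const (cont_etaA_pol a), h1, ?_⟩
    set V := {p | 0 < S.etaA a (S.pol p - S.m0)} ∩ (N₂ ∩ S.cover)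
    have hVo : IsOpen V := (isOpen_lt continuous_const (cont_etaA_pol a)).inter
      (h.open₂.inter isOpen_cover)
    have hVc : V ⊆ S.cover := fun p hp => hp.2.2
    have hS := locDiffeo_pol.mono hVo hVc
    have e1 := wE_pol (negW_nonneg _) (cont_negW _) (fun t ht y => negW_smul _ ht y)
      ((polyIn_limit_sub a c s m).mono fun _ h => h.1) 0 hVc hVo fun p hp =>
        negW_pos (neg_lt_zero.mpr hp.1)
    have e2 : WP S.pol 0 V (fun _ p => (χ₁ p : ℂ)) :=
      WP.of_smooth hS (Complex.ofRealCLM.contDiff.comp h.smooth₁).contDiffOn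
    refine (e1.mul hS e2).neg.congr hVo fun ħ hħ p hp => ?_
    rw [key ħ p hp.2.1]
    simp only [Pi.mul_apply, Pi.neg_apply]
    ring
  · obtain ⟨N, hN, hNo, hpN⟩ := eventually_nhds_iff.mp h1
    refine ⟨N, hNo, hpN, WE.zero.congr (hNo.inter (h.open₂.inter isOpen_cover)) fun ħ _ p hp => ?_⟩
    rw [key ħ p hp.2.1, hN p hp.1]
    simp

lemma flux_eq_model (ha : a = e1 ∨ a = e2) {m : Lam} (hm : S.Along a m) (c : Comp r) (s : ℕ) :
    S.flux c s m = cf S.model c s m := by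
  obtain ⟨l, hl, rfl⟩ := hm
  have h : cf (detBr S.κ S.model) c s (l • S.mA a) = 0 := by
    rcases ha with rfl | rfl
    · rw [mA_e1]
      exact model_isDensity.detBr_w1 rayOp_zero l c s
    · rw [mA_e2]
      exact model_isDensity.detBr_w2 rayOp_zero l c s
  funext ε
  rw [flux, model_isDensity.2, h, rayOp_zero]
  simp [lineInt, rayInt_zero]

/-- Near the wall, the gauge transformation gives the form of the model. -/
lemma IsCutoff.wE_wall (h : S.IsCutoff a χ₁ χ₂ N₀ N₁ N₂) (q : Fin 2) (c : Comp r) (s : ℕ)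
    (m : Lam) : WE S.pol (N₀ ∩ S.cover)
      (cf (gaugeZero S.κ S.pol (fun _ _ => 0) s (S.coverGauge a χ₁ χ₂) q) c s m -
        S.modelForm a q c s m) := by
  have hVo : IsOpen (N₀ ∩ S.cover) := h.open₀.inter isOpen_cover
  have hVc : N₀ ∩ S.cover ⊆ S.cover := Set.inter_subset_right
  have hS := locDiffeo_pol.mono hVo hVc
  have key : ∀ ħ, 0 < ħ → ∀ p ∈ N₀ ∩ S.cover,
      cf (gaugeZero S.κ S.pol (fun _ _ => 0) s (S.coverGauge a χ₁ χ₂) q) c s m ħ p =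
        rescale S.m0 1 (((S.etaA a (Pi.single q 1) : ℝ) : ℂ) • cf (S.source a) c s m) ħ
          (S.pol p) := by
    intro ħ hħ p hp
    rw [gaugeZero_rescale_comp hS (coverGauge_zero a χ₁ χ₂) (modelGauge_zero a)
      (fun c s m ε => ((polyIn_modelGauge' a c s m).bound (negW_nonneg _)).1 ε)
      (fun c s m ħ _ p hp => ?_) q c s m hħ hp, cf_gaugeZero_modelGauge]
    obtain ⟨e1, e2⟩ := h.wall p hp.1
    rw [cf_coverGauge]
    simp [e1, e2]
  by_cases hm : S.Along a m
  · have e : WE S.pol (N₀ ∩ S.cover)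
        (fun ħ p => rescale S.m0 1 (S.flux c s m - cf S.model c s m) ħ (S.pol p)) := by
      rcases h.wall_dir with ha | hd
      · rw [flux_eq_model ha hm, sub_self, rescale_zero]
        exact WE.zero
      · exact wE_pol (rayW_nonneg _) (cont_rayW _) (fun t ht y => rayW_smul ht y)
          (polyIn_flux_sub hm.cone.ne_zero c s) 1 hVc hVo fun p hp => hd p hp m hm
    refine (e.smul (conormal m q)).congr hVo fun ħ hħ p hp => ?_
    rw [Pi.sub_apply, Pi.sub_apply, key ħ hħ p hp, cf_source, if_pos hm, modelForm, if_pos hm,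
      smul_smul, ← conormal_eq hm]
    simp only [rescale, Pi.sub_apply, Pi.smul_apply, smul_eq_mul]
    ring
  · refine WE.zero.congr hVo fun ħ hħ p hp => ?_
    rw [Pi.sub_apply, Pi.sub_apply, key ħ hħ p hp, cf_source, if_neg hm, modelForm, if_neg hm,
      smul_zero, rescale_zero]
    simp

lemma lineW_eq_etaA (p : Pt) (hp : S.etaA a (S.pol p - S.m0) ≠ 0) {m : Lam} (hm : S.Along a m) :
    0 < lineW (toPt m) (S.pol p - S.m0) := by
  obtain ⟨l, hl, rfl⟩ := hm
  have hl' : (l : ℝ) ≠ 0 := by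
    have : l ≠ 0 := by omega
    exact_mod_cast this
  rw [lineW, toPt_nsmul, detP_smul]
  refine sq_pos_of_ne_zero (mul_ne_zero hl' fun h0 => hp ?_)
  rw [etaA, _root_.smul_apply, detCLM_apply, h0, smul_zero]

/-- Away from the wall, the form of the model is exponentially small. -/
lemma IsCutoff.wE_modelForm (h : S.IsCutoff a χ₁ χ₂ N₀ N₁ N₂) {V : Set Pt} (hVo : IsOpen V)
    (hV : V ⊆ (N₁ ∪ N₂) ∩ S.cover) (q : Fin 2) (c : Comp r) (s : ℕ) (m : Lam) :
    WE S.pol V (S.modelForm a q c s m) := by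
  have hVc : V ⊆ S.cover := fun p hp => (hV hp).2
  by_cases hm : S.Along a m
  · rw [modelForm, if_pos hm]
    refine WE.smul ?_ _
    by_cases ha : a = e1 ∨ a = e2
    · refine wE_pol (lineW_nonneg (toPt m)) ?_ (fun t ht y => ?_) (polyIn_model c s m) 1 hVc hVo
        fun p hp => lineW_eq_etaA p (h.off_line ha p (hV hp)) hm
      · unfold lineW detP
        fun_prop
      · simp only [lineW, detP, Pi.smul_apply, smul_eq_mul]
        ring
    · have hr : PolyIn (Gau (rayW (toPt m))) (cf S.model c s m) := by
        obtain ⟨l, hl, rfl⟩ := hm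
        exact polyIn_model_ray (fun h => ha (Or.inl h)) (fun h => ha (Or.inr h)) hl c s
      exact wE_pol (rayW_nonneg _) (cont_rayW _) (fun t ht y => rayW_smul ht y) hr 1 hVc hVo
        fun p hp => h.off_ray ha p (hV hp) m hm
  · rw [modelForm, if_neg hm]
    exact WE.zero

lemma IsCutoff.wE_gauge (h : S.IsCutoff a χ₁ χ₂ N₀ N₁ N₂) (q : Fin 2) (c : Comp r) (s : ℕ)
    (m : Lam) : WE S.pol S.cover
      (cf (gaugeZero S.κ S.pol (fun _ _ => 0) s (S.coverGauge a χ₁ χ₂) q) c s m -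
        S.modelForm a q c s m) := by
  refine WE.of_local fun p hp => ?_
  rcases h.cover_subset p hp with h0 | h1 | h2
  · exact ⟨N₀, h.open₀, h0, h.wE_wall q c s m⟩
  · have hVo : IsOpen (N₁ ∩ S.cover) := h.open₁.inter isOpen_cover
    have hS := locDiffeo_pol.mono hVo Set.inter_subset_right
    have e1 := (gaugeZero_asymEq (κ := S.κ) hS (coverGauge_zero a χ₁ χ₂) (X' := 0)
      (fun c m => cf_zero _ _ _) (fun c s m => ⟨by
        rw [cf_zero, sub_zero]
        exact h.wE_neg c s m, by rw [cf_zero]; exact Tempered.zero⟩) q c s m).1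
    rw [gaugeZero_eq_zero (fun c m => cf_zero _ _ _) (dW0_zero q), sub_zero] at e1
    exact ⟨N₁, h.open₁, h1, e1.sub hS (h.wE_modelForm hVo
      (Set.inter_subset_inter_left _ Set.subset_union_left) q c s m)⟩
  · have hVo : IsOpen (N₂ ∩ S.cover) := h.open₂.inter isOpen_cover
    have hS := locDiffeo_pol.mono hVo Set.inter_subset_right
    have e1 := (gaugeZero_asymEq (κ := S.κ) hS (coverGauge_zero a χ₁ χ₂) (limitSec_zero a)
      (fun c s m => ⟨h.wE_pos c s m, 0, by rw [cf_limitSec]; exact wP_limitA (S := S) hS a c s m⟩) q c s m).1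
    rw [gaugeZero_eq_zero (limitSec_zero a) (limitSec_dW0 a q), sub_zero] at e1
    exact ⟨N₂, h.open₂, h2, e1.sub hS (h.wE_modelForm hVo
      (Set.inter_subset_inter_left _ Set.subset_union_right) q c s m)⟩

end WithCutoff

/-- The pull-back of the solution equals its model up to exponentially small forms. -/
lemma pull_asymEq (a : Prim) (q : Fin 2) (c : Comp r) (s : ℕ) (m : Lam) :
    AsymEq S.pol S.cover (cf (S.pull (S.part a S.flatForm) q) c s m) (S.modelForm a q c s m) := by
  rw [cf_pull, cf_part, modelForm]
  split_ifs
  · rw [flatForm, cf_conormalSec]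
    exact ((dens_asymEq c s m).comp locDiffeo_pol S.isOpen_U mapsTo_pol).smul _
  · exact AsymEq.zero

lemma isOpen_Hplus (a : Prim) : IsOpen (S.Hplus a) := by
  have h1 : Continuous fun p : Pt => p 1 := continuous_apply 1
  by_cases ha : a = e1
  · simp only [Hplus, ha, if_true]
    exact isOpen_cover.inter (isOpen_lt continuous_const (Real.continuous_sin.comp h1))
  · by_cases ha' : a = e2
    · simp only [Hplus, ha', e1_ne_e2.symm, if_true, if_false]
      exact isOpen_cover.inter (isOpen_lt continuous_const (Real.continuous_cos.comp h1))
    · simp only [Hplus, ha, ha', if_false]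
      exact isOpen_cover.inter (isOpen_lt continuous_const h1)

lemma isOpen_Hminus (a : Prim) : IsOpen (S.Hminus a) := by
  have h1 : Continuous fun p : Pt => p 1 := continuous_apply 1
  by_cases ha : a = e1
  · simp only [Hminus, ha, if_true]
    exact isOpen_cover.inter (isOpen_lt (Real.continuous_sin.comp h1) continuous_const)
  · by_cases ha' : a = e2
    · simp only [Hminus, ha', e1_ne_e2.symm, if_true, if_false]
      exact isOpen_cover.inter (isOpen_lt (Real.continuous_cos.comp h1) continuous_const)
    · simp only [Hminus, ha, ha', if_false]
      exact isOpen_cover.inter (isOpen_lt h1 continuous_const)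

/-- The existence of the gauge for the flat metric. -/
lemma exists_isFlatGauge (a : Prim) : ∃ φ, S.IsFlatGauge a φ ∧ ModesAlong (S.mA a) φ ∧
    (∀ c s m, WP S.pol 0 S.cover (cf φ c s m)) ∧ S.HasAsymptotics a φ (S.leading a) := by
  obtain ⟨χ₁, χ₂, N₀, N₁, N₂, h⟩ := exists_isCutoff (S := S) a
  refine ⟨S.coverGauge a χ₁ χ₂, ⟨coverGauge_zero a χ₁ χ₂, fun c s m => (h.tempered c s m).1,
    fun c s m ħ _ => ?_, fun q c s m => ?_⟩, fun c s m hne => ?_, h.tempered, fun c s m => ⟨?_, ?_⟩⟩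
  · rw [cf_coverGauge]
    simp [h.base₁, h.base₂]
  · have e := (h.wE_gauge q c s m).sub locDiffeo_pol (pull_asymEq a q c s m).1
    rw [sub_sub_sub_cancel_right] at e
    exact e.2
  · by_contra hm
    have h0 : cf (S.gaugeDens a) c s m = 0 := by_contra fun h => hm (gaugeDens_along h)
    apply hne
    rw [cf_coverGauge, cf_modelGauge, h0]
    funext ħ p
    simp [limitA_eq_zero h0, rescale_order_zero, rayInt_zero]
  · have hS := locDiffeo_pol.mono (isOpen_Hplus (S := S) a) fun p hp => hp.1
    have e1 := ((h.wE_pos c s m).mono (S' := S.Hplus a) fun p hp => ⟨h.plus hp, hp.1⟩).toWP (-1)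
    have e2 := e1.add hS (wP_limitA_sub (S := S) a c s m)
    refine (e2.congr hS.isOpen fun ħ _ p _ => ?_).2
    rw [cf_limitSec]
    simp
  · exact ((h.wE_neg c s m).mono (S' := S.Hminus a) fun p hp => ⟨h.minus hp, hp.1⟩).2

/-- Flat gauges are unique up to exponentially small functions. -/
lemma IsFlatGauge.asymEq {a : Prim} {φ φ₀ : Sec r HFun} (h : S.IsFlatGauge a φ)
    (h₀ : S.IsFlatGauge a φ₀) (ht : ∀ c s m, WP S.pol 0 S.cover (cf φ₀ c s m)) (c : Comp r) (s : ℕ)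
    (m : Lam) : AsymEq S.pol S.cover (cf φ c s m) (cf φ₀ c s m) := by
  have hS := locDiffeo_pol (S := S)
  induction s using Nat.strong_induction_on generalizing c m with
  | _ s ih =>
    refine ⟨?_, 0, ht c s m⟩
    refine WE.of_pd hS isPreconnected_cover (Smooth.sub (h.2.1 c s m) (h₀.2.1 c s m)) (fun q => ?_)
      p0_mem fun ħ hħ => ?_
    · have e1 := (gaugeZero_asymEq_of_lt (κ := S.κ) hS h.1 h₀.1 (fun s' hs' c m => ih s' hs' c m) q
        c m).1
      have e2 : WE S.pol S.cover (cf (gaugeZero S.κ S.pol (fun _ _ => 0) s φ q) c s m -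
          cf (gaugeZero S.κ S.pol (fun _ _ => 0) s φ₀ q) c s m) := by
        refine ⟨(smooth_gaugeZero hS h.1 h.2.1 q c s m).sub
          (smooth_gaugeZero hS h₀.1 h₀.2.1 q c s m), ?_⟩
        have hp := (pull_asymEq (S := S) a q c s m).smooth_left hS
        have e3 : WE S.pol S.cover _ :=
          ⟨(smooth_gaugeZero hS h.1 h.2.1 q c s m).sub hp, h.2.2.2 q c s m⟩
        have e4 : WE S.pol S.cover _ :=
          ⟨(smooth_gaugeZero hS h₀.1 h₀.2.1 q c s m).sub hp, h₀.2.2.2 q c s m⟩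
        have e5 := e3.sub hS e4
        rw [sub_sub_sub_cancel_right] at e5
        exact e5.2
      refine (e1.sub hS e2).congr hS.isOpen fun ħ hħ p hp => ?_
      rw [Smooth.pd_sub hS (h.2.1 c s m) (h₀.2.1 c s m) q hħ hp]
      simp only [Pi.sub_apply, Pi.add_apply]
      ring
    · rw [Pi.sub_apply, Pi.sub_apply, h.2.2.1 c s m ħ hħ, h₀.2.2.1 c s m ħ hħ, sub_zero]

lemma IsFlatGauge.wE_sub {a : Prim} {φ φ' : Sec r HFun} (h : S.IsFlatGauge a φ)
    (h' : S.IsFlatGauge a φ') (c : Comp r) (s : ℕ) (m : Lam) :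
    WE S.pol S.cover (cf φ c s m - cf φ' c s m) := by
  obtain ⟨φ₀, h₀, -, ht, -⟩ := exists_isFlatGauge (S := S) a
  have := (h.asymEq h₀ ht c s m).1.sub locDiffeo_pol (h'.asymEq h₀ ht c s m).1
  rwa [sub_sub_sub_cancel_right] at this

lemma HasAsymptotics.congr {a : Prim} {φ φ' : Sec r HFun} {L : Sec r ℂ}
    (h : S.HasAsymptotics a φ L) (hs : SmoothOn S.cover φ)
    (hE : ∀ c s m, WE S.pol S.cover (cf φ' c s m - cf φ c s m)) : S.HasAsymptotics a φ' L := by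
  refine fun c s m => ⟨?_, ?_⟩
  · have hS := locDiffeo_pol.mono (isOpen_Hplus (S := S) a) fun p hp => hp.1
    have h1 : WP S.pol (-1) (S.Hplus a) (fun ħ p => cf φ c s m ħ p - cf L c s m) :=
      ⟨fun ħ hħ => ((hs c s m ħ hħ).mono fun p hp => hp.1).sub contDiffOn_const, (h c s m).1⟩
    have h2 := ((hE c s m).mono (S' := S.Hplus a) fun p hp => hp.1).toWP (-1)
    refine ((h2.add hS h1).congr hS.isOpen fun ħ _ p _ => ?_).2
    simp
  · have hS := locDiffeo_pol.mono (isOpen_Hminus (S := S) a) fun p hp => hp.1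
    have h1 : WE S.pol (S.Hminus a) (cf φ c s m) :=
      ⟨fun ħ hħ => (hs c s m ħ hħ).mono fun p hp => hp.1, (h c s m).2⟩
    have h2 := (hE c s m).mono (S' := S.Hminus a) fun p hp => hp.1
    have h3 := (h2.add hS h1).2
    rwa [sub_add_cancel] at h3

lemma IsFlatGauge.hasAsymptotics {a : Prim} {φ : Sec r HFun} (h : S.IsFlatGauge a φ) :
    S.HasAsymptotics a φ (S.leading a) := by
  obtain ⟨φ₀, h₀, -, -, hL⟩ := exists_isFlatGauge (S := S) a
  exact hL.congr h₀.2.1 fun c s m => h.wE_sub h₀ c s m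

end Setup
end FlatGauge

/-! ## Removal of the metric -/

section Twist

variable {r : ℕ}

/-- The effect of `(N, ψ) ↦ (N + κ ħ ∑ ψ ^ j A_j, ψ)` on coefficients. -/
noncomputable def twC (κ : ℂ) (a : Fin 2 → Fin r → Pt → ℂ) (x : Comp r → HFun) : Comp r → HFun
  | Sum.inl ij => x (Sum.inl ij) + if ij.1 = ij.2 then
      ∑ k, x (Sum.inr k) * (fun (ħ : ℝ) p => κ * ħ * a k ij.1 p) else 0
  | Sum.inr k => x (Sum.inr k)

/-- The translation `(N, ψ) ↦ (N + κ ħ ∑ ψ ^ j A_j, ψ)`, which intertwines the dgLa of a metric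
with that of the flat metric. -/
noncomputable def twist (κ : ℂ) (ϖ : Pt → Pt) (ϕ : Fin r → Pt → ℝ) (X : Sec r HFun) :
    Sec r HFun :=
  (X.1 + kh κ • ∑ j, X.2 j • connMat ϖ ϕ j, X.2)

/-- The connection coefficients are smooth and closed. -/
structure ClosedConn (ϖ : Pt → Pt) (S : Set Pt) (a : Fin 2 → Fin r → Pt → ℂ) : Prop where
  smooth : ∀ k i, ContDiffOn ℝ ∞ (a k i) S
  closed : ∀ k l i, ∀ p ∈ S, pd ϖ k (a l i) p = pd ϖ l (a k i) p

section Coefficients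

variable {κ : ℂ} {ϖ : Pt → Pt} {ϕ : Fin r → Pt → ℝ} {S : Set Pt} {a : Fin 2 → Fin r → Pt → ℂ}

lemma cf_twist (X : Sec r HFun) (c : Comp r) (s : ℕ) (m : Lam) :
    cf (twist κ ϖ ϕ X) c s m = twC κ (connFun ϖ ϕ) (fun c => cf X c s m) c := by
  rcases c with ⟨i, j⟩ | j
  · simp only [cf, twist, twC, Matrix.add_apply, Matrix.smul_apply, smul_eq_mul, Matrix.sum_apply,
      Ser.cf_add, kh, Ser.cf_const_mul, Ser.cf_sum, connMat]
    by_cases h : i = j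
    · subst h
      simp only [Matrix.diagonal_apply_eq, if_true, mul_comm ((X.2 _)), Ser.cf_const_mul,
        Finset.mul_sum]
      refine congrArg _ (Finset.sum_congr rfl fun k _ => ?_)
      funext ħ p
      simp only [Pi.mul_apply, connFun]
      ring
    · simp only [Matrix.diagonal_apply_ne _ h, if_neg h]
      simp
  · rfl

lemma twC_neg_twC (x : Comp r → HFun) : twC κ a (twC (-κ) a x) = x := by
  funext c
  rcases c with ij | k
  · simp only [twC]
    split_ifs
    · funext ħ p
      simp only [Pi.add_apply, Finset.sum_apply, Pi.mul_apply]
      rw [add_assoc, ← Finset.sum_add_distrib, Finset.sum_eq_zero fun k _ => by ring, add_zero]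
    · simp
  · rfl

lemma twist_twist_neg (X : Sec r HFun) : twist κ ϖ ϕ (twist (-κ) ϖ ϕ X) = X := by
  refine sec_ext fun c s m => ?_
  rw [cf_twist]
  simp only [cf_twist]
  exact congrFun (twC_neg_twC _) c

lemma twist_neg_twist (X : Sec r HFun) : twist (-κ) ϖ ϕ (twist κ ϖ ϕ X) = X := by
  have := twist_twist_neg (κ := -κ) (ϖ := ϖ) (ϕ := ϕ) X
  rwa [neg_neg] at this

lemma twC_zero : twC κ a 0 = 0 := by
  funext c
  rcases c with ij | k
  · simp [twC]
  · rfl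

lemma twC_add (x y : Comp r → HFun) : twC κ a (x + y) = twC κ a x + twC κ a y := by
  funext c
  rcases c with ij | k
  · simp only [twC, Pi.add_apply]
    split_ifs
    · simp only [add_mul, Finset.sum_add_distrib]
      abel
    · simp
  · rfl

lemma twC_smul (z : ℂ) (x : Comp r → HFun) : twC κ a (z • x) = z • twC κ a x := by
  funext c
  rcases c with ij | k
  · simp only [twC, Pi.smul_apply]
    split_ifs
    · simp only [smul_add, Finset.smul_sum, smul_mul_assoc]
    · simp
  · rfl

lemma twC_congr {x y : Comp r → HFun} {ħ : ℝ} {p : Pt} (h : ∀ c, x c ħ p = y c ħ p)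
    (c : Comp r) : twC κ a x c ħ p = twC κ a y c ħ p := by
  rcases c with ij | k
  · simp only [twC]
    split_ifs
    · simp [h]
    · simp [h]
  · exact h _

lemma smooth_coef (ha : ∀ k i, ContDiffOn ℝ ∞ (a k i) S) (k : Fin 2) (i : Fin r) :
    Smooth S (fun (ħ : ℝ) p => κ * ħ * a k i p) := fun _ _ => contDiffOn_const.mul (ha k i)

lemma smooth_sum {ι : Type*} (T : Finset ι) {f : ι → HFun} (h : ∀ i ∈ T, Smooth S (f i)) :
    Smooth S (∑ i ∈ T, f i) := by
  classical
  induction T using Finset.induction_on with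
  | empty => exact Smooth.zero
  | insert i T hi ih =>
    rw [Finset.sum_insert hi]
    exact (h i (Finset.mem_insert_self _ _)).add (ih fun j hj => h j (Finset.mem_insert_of_mem hj))

lemma smooth_twC (ha : ∀ k i, ContDiffOn ℝ ∞ (a k i) S) {x : Comp r → HFun}
    (hx : ∀ c, Smooth S (x c)) (c : Comp r) : Smooth S (twC κ a x c) := by
  rcases c with ij | k
  · refine (hx _).add ?_
    split_ifs
    · exact smooth_sum _ fun k _ => (hx _).mul (smooth_coef ha k _)
    · exact Smooth.zero
  · exact hx _

lemma pd_twC (hS : LocDiffeo ϖ S) (ha : ∀ k i, ContDiffOn ℝ ∞ (a k i) S) {x : Comp r → HFun}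
    (hx : ∀ c, Smooth S (x c)) (q : Fin 2) (ij : Fin r × Fin r) {ħ : ℝ} (hħ : 0 < ħ) {p : Pt}
    (hp : p ∈ S) : pd ϖ q (twC κ a x (Sum.inl ij) ħ) p = pd ϖ q (x (Sum.inl ij) ħ) p +
      if ij.1 = ij.2 then ∑ k, κ * ħ * (pd ϖ q (x (Sum.inr k) ħ) p * a k ij.1 p +
        x (Sum.inr k) ħ p * pd ϖ q (a k ij.1) p) else 0 := by
  have hd : ∀ {f : HFun}, Smooth S f → DifferentiableAt ℝ (f ħ) p := fun hf =>
    hf.differentiableAt hS.isOpen hħ hp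
  have hk : ∀ k, Smooth S (x (Sum.inr k) * fun (ħ : ℝ) p => κ * ħ * a k ij.1 p) := fun k =>
    (hx _).mul (smooth_coef ha k _)
  have e : ∀ k, pd ϖ q ((x (Sum.inr k) * fun (ħ : ℝ) p => κ * ħ * a k ij.1 p : HFun) ħ) p =
      κ * ħ * (pd ϖ q (x (Sum.inr k) ħ) p * a k ij.1 p +
        x (Sum.inr k) ħ p * pd ϖ q (a k ij.1) p) := by
    intro k
    have h1 : (x (Sum.inr k) * fun (ħ : ℝ) p => κ * ħ * a k ij.1 p : HFun) ħ =
        (κ * ħ : ℂ) • (x (Sum.inr k) ħ * a k ij.1) := by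
      funext p
      simp only [Pi.mul_apply, Pi.smul_apply, smul_eq_mul]
      ring
    rw [h1, pd_smul, Pi.smul_apply, pd_mul (hd (hx _))
      (ContDiffOn.differentiableAt_of_isOpen hS.isOpen (ha k _) hp), smul_eq_mul]
  simp only [twC]
  split_ifs
  · simp only [Fin.sum_univ_two]
    rw [show (x (Sum.inl ij) + ((x (Sum.inr 0) * fun (ħ : ℝ) p => κ * ħ * a 0 ij.1 p) +
      x (Sum.inr 1) * fun (ħ : ℝ) p => κ * ħ * a 1 ij.1 p) : HFun) ħ = x (Sum.inl ij) ħ +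
      ((x (Sum.inr 0) * fun (ħ : ℝ) p => κ * ħ * a 0 ij.1 p : HFun) ħ +
      (x (Sum.inr 1) * fun (ħ : ℝ) p => κ * ħ * a 1 ij.1 p : HFun) ħ) from rfl,
      pd_add (hd (hx _)) ((hd (hk 0)).add (hd (hk 1))), pd_add (hd (hk 0)) (hd (hk 1)), e, e]
  · simp

lemma brc_eqOn (hS : IsOpen S) (m m' : Lam) {x x' y y' : Comp r → HFun}
    (hx : ∀ c, ∀ ħ, 0 < ħ → Set.EqOn (x c ħ) (x' c ħ) S)
    (hy : ∀ c, ∀ ħ, 0 < ħ → Set.EqOn (y c ħ) (y' c ħ) S) (c : Comp r) :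
    ∀ ħ, 0 < ħ → Set.EqOn (brc κ ϖ a m m' x y c ħ) (brc κ ϖ a m m' x' y' c ħ) S := by
  have h : ∀ (c : Comp r) m k (f f' : HFun), (∀ ħ, 0 < ħ → Set.EqOn (f ħ) (f' ħ) S) →
      ∀ ħ, 0 < ħ → Set.EqOn (covC κ ϖ a c m k f ħ) (covC κ ϖ a c m k f' ħ) S := by
    intro c m k f f' hf ħ hħ p hp
    simp only [covC, hf ħ hħ hp, pd_congr hS (hf ħ hħ) k hp]
  refine brc_rel κ ϖ a (fun f f' => ∀ ħ, 0 < ħ → Set.EqOn (f ħ) (f' ħ) S)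
    (fun f f' => ∀ ħ, 0 < ħ → Set.EqOn (f ħ) (f' ħ) S)
    (fun f f' => ∀ ħ, 0 < ħ → Set.EqOn (f ħ) (f' ħ) S) m m' (fun c k => h c m k)
    (fun c k => h c m' k) ?_ (fun _ _ => Set.eqOn_refl _ _) ?_ ?_ hx hy c
  · intro f f' g g' hf hg ħ hħ p hp
    simp only [Pi.mul_apply, hf ħ hħ hp, hg ħ hħ hp]
  · intro f f' g g' hf hg ħ hħ p hp
    simp only [Pi.add_apply, hf ħ hħ hp, hg ħ hħ hp]
  · intro f f' hf ħ hħ p hp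
    simp only [Pi.neg_apply, hf ħ hħ hp]

lemma smooth_brc_conn (hS : LocDiffeo ϖ S) (ha : ∀ k i, ContDiffOn ℝ ∞ (a k i) S) (m m' : Lam)
    {x y : Comp r → HFun} (hx : ∀ c, Smooth S (x c)) (hy : ∀ c, Smooth S (y c)) (c : Comp r) :
    Smooth S (brc κ ϖ a m m' x y c) := by
  have h : ∀ (c : Comp r) m k (f : HFun), Smooth S f → Smooth S (covC κ ϖ a c m k f) := by
    intro c m k f hf ħ hħ
    refine ((contDiffOn_const.mul (hf ħ hħ)).add (contDiffOn_const.mul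
      (ContDiffOn.pd hS (hf ħ hħ) k))).add ?_
    rcases c with c | c
    · exact contDiffOn_const.mul (((ha _ _).sub (ha _ _)).mul (hf ħ hħ))
    · exact contDiffOn_const
  exact brc_rel κ ϖ _ (fun f _ => Smooth S f) (fun f _ => Smooth S f) (fun f _ => Smooth S f) m m'
    (fun c k f _ hf => h c m k f hf) (fun c k f _ hf => h c m' k f hf)
    (fun f _ g _ hf hg => hf.mul hg) Smooth.zero (fun f _ g _ hf hg => hf.add hg)
    (fun f _ hf => hf.neg) (x := x) (x' := x) (y := y) (y' := y) hx hy c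

/-- The translation intertwines the brackets. -/
lemma brc_twC (hS : LocDiffeo ϖ S) (ha : ClosedConn ϖ S a) (m m' : Lam) {x y : Comp r → HFun}
    (hx : ∀ c, Smooth S (x c)) (hy : ∀ c, Smooth S (y c)) (c : Comp r) {ħ : ℝ} (hħ : 0 < ħ)
    {p : Pt} (hp : p ∈ S) :
    brc κ ϖ (fun _ _ _ => 0) m m' (twC κ a x) (twC κ a y) c ħ p =
      twC κ a (brc κ ϖ a m m' x y) c ħ p := by
  rcases c with ⟨i, j⟩ | k
  · have comm : ∀ d d' : Fin r → ℂ, ∀ n n' : Fin r → Fin r → ℂ,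
        ∑ l, ((n i l + if i = l then d i else 0) * (n' l j + if l = j then d' l else 0) -
          (n l j + if l = j then d l else 0) * (n' i l + if i = l then d' i else 0)) =
        ∑ l, (n i l * n' l j - n l j * n' i l) + (d i - d j) * n' i j -
          (d' i - d' j) * n i j := by
      intro d d' n n'
      simp only [add_mul, mul_add, Finset.sum_sub_distrib, Finset.sum_add_distrib, mul_ite, ite_mul,
        zero_mul, mul_zero, Finset.sum_ite_eq, Finset.sum_ite_eq', Finset.mem_univ, if_true]
      by_cases h : i = j
      · subst h
        simp
      · simp [h]
        ring
    have hc := ha.closed 0 1 i p hp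
    have hval : ∀ z : Comp r → HFun, ∀ i j : Fin r, twC κ a z (Sum.inl (i, j)) ħ p =
        z (Sum.inl (i, j)) ħ p + if i = j then
          κ * ħ * ∑ k, z (Sum.inr k) ħ p * a k i p else 0 := by
      intro z i j
      simp only [twC]
      split_ifs
      · simp only [Pi.add_apply, Finset.sum_apply, Pi.mul_apply, Finset.mul_sum]
        exact congrArg _ (Finset.sum_congr rfl fun k _ => by ring)
      · simp
    have hcm := comm (fun i => κ * ħ * ∑ k, x (Sum.inr k) ħ p * a k i p)
      (fun i => κ * ħ * ∑ k, y (Sum.inr k) ħ p * a k i p) (fun i l => x (Sum.inl (i, l)) ħ p)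
      (fun i l => y (Sum.inl (i, l)) ħ p)
    rw [hval]
    simp only [brc, Pi.add_apply, Finset.sum_apply, Pi.sub_apply, Pi.mul_apply, covC,
      pd_twC hS ha.smooth hx _ _ hħ hp, pd_twC hS ha.smooth hy _ _ hħ hp, hval]
    have hl : ∀ l, (if l = j then κ * ħ * ∑ k, x (Sum.inr k) ħ p * a k l p else 0) =
      (if l = j then (fun i => κ * ħ * ∑ k, x (Sum.inr k) ħ p * a k i p) l else 0) := fun _ => rfl
    rw [hcm]
    simp only [twC, Fin.sum_univ_two, add_zero, sub_self, zero_mul, mul_zero, Pi.zero_apply]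
    by_cases h : i = j
    · subst h
      simp only [if_true, hc]
      ring
    · simp only [if_neg h]
      ring
  · simp only [twC, brc]
    rfl

/-- `x'` is the translation of the smooth family `x`. -/
def TwRel (κ : ℂ) (S : Set Pt) (a : Fin 2 → Fin r → Pt → ℂ) (x x' : Comp r → HFun) : Prop :=
  (∀ c, Smooth S (x c)) ∧ ∀ c, ∀ ħ, 0 < ħ → Set.EqOn (x' c ħ) (twC κ a x c ħ) S

lemma TwRel.zero : TwRel κ S a 0 0 :=
  ⟨fun _ => Smooth.zero, fun _ _ _ => by rw [twC_zero]; exact Set.eqOn_refl _ _⟩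

lemma TwRel.add {x x' y y' : Comp r → HFun} (h : TwRel κ S a x x') (h' : TwRel κ S a y y') :
    TwRel κ S a (x + y) (x' + y') := by
  refine ⟨fun c => (h.1 c).add (h'.1 c), fun c ħ hħ p hp => ?_⟩
  rw [twC_add]
  simp only [Pi.add_apply, h.2 c ħ hħ hp, h'.2 c ħ hħ hp]

lemma TwRel.smul {x x' : Comp r → HFun} (h : TwRel κ S a x x') (z : ℂ) :
    TwRel κ S a (z • x) (z • x') := by
  refine ⟨fun c => (h.1 c).smul z, fun c ħ hħ p hp => ?_⟩
  rw [twC_smul]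
  simp only [Pi.smul_apply, h.2 c ħ hħ hp]

lemma TwRel.brc (hS : LocDiffeo ϖ S) (ha : ClosedConn ϖ S a) (m m' : Lam)
    {x x' y y' : Comp r → HFun} (h : TwRel κ S a x x') (h' : TwRel κ S a y y') :
    TwRel κ S a (brc κ ϖ a m m' x y) (ExtScattering.brc κ ϖ (fun _ _ _ => 0) m m' x' y') := by
  refine ⟨smooth_brc_conn hS ha.smooth m m' h.1 h'.1, fun c ħ hħ p hp => ?_⟩
  rw [brc_eqOn hS.isOpen m m' h.2 h'.2 c ħ hħ hp, brc_twC hS ha m m' h.1 h'.1 c hħ hp]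

end Coefficients

variable {κ : ℂ} {ϖ : Pt → Pt} {ϕ : Fin r → Pt → ℝ} {S : Set Pt}

lemma twRel_twist {X : Sec r HFun} (hX : SmoothOn S X) (s : ℕ) (m : Lam) :
    TwRel κ S (connFun ϖ ϕ) (fun c => cf X c s m) (fun c => cf (twist κ ϖ ϕ X) c s m) :=
  ⟨fun c => hX c s m, fun c ħ _ p _ => by simp only [cf_twist]⟩

lemma twist_order_zero {X : Sec r HFun} (hX : ∀ c m, cf X c 0 m = 0) (c : Comp r) (m : Lam) :
    cf (twist κ ϖ ϕ X) c 0 m = 0 := by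
  rw [cf_twist, show (fun c => cf X c 0 m) = 0 from funext fun c => hX c m, twC_zero]
  rfl

lemma twRel_br (hS : LocDiffeo ϖ S) (ha : ClosedConn ϖ S (connFun ϖ ϕ)) {X Y : Sec r HFun}
    (hX : ∀ c m, cf X c 0 m = 0) (hY : ∀ c m, cf Y c 0 m = 0) (hXs : SmoothOn S X)
    (hYs : SmoothOn S Y) (s : ℕ) (m : Lam) :
    TwRel κ S (connFun ϖ ϕ) (fun c => cf (br κ ϖ ϕ X Y) c s m)
      (fun c => cf (br κ ϖ (fun _ _ => 0) (twist κ ϖ ϕ X) (twist κ ϖ ϕ Y)) c s m) := by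
  refine br_relF _ TwRel.zero (fun _ _ _ _ => TwRel.add) hX (twist_order_zero hX) hY
    (twist_order_zero hY) s m fun s' _ s'' _ m' m'' _ => ?_
  rw [connFun_flat]
  exact (twRel_twist hXs s' m').brc hS ha m' m'' (twRel_twist hYs s'' m'')

lemma twRel_dW0 (hS : LocDiffeo ϖ S) (ha : ClosedConn ϖ S (connFun ϖ ϕ)) {X : Sec r HFun}
    (hX : SmoothOn S X) (q : Fin 2) (s : ℕ) (m : Lam) :
    TwRel κ S (connFun ϖ ϕ) (fun c => cf (dW0 κ ϖ ϕ X q) c s m)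
      (fun c => cf (dW0 κ ϖ (fun _ _ => 0) (twist κ ϖ ϕ X) q) c s m) := by
  have hd : ∀ c, Smooth S (fun ħ => pd ϖ q (cf X c s m ħ)) := fun c => Smooth.pd hS (hX c s m) q
  refine ⟨fun c ħ hħ => ?_, fun c ħ hħ p hp => ?_⟩
  · simp only [cf_dW0]
    refine (hd c ħ hħ).add ?_
    rcases c with c | c
    · simp only
      split_ifs
      · exact contDiffOn_const.mul (ContDiffOn.sum fun k _ => (hX _ s m ħ hħ).mul
          (ContDiffOn.pd hS (ha.smooth k c.1) q))
      · exact contDiffOn_const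
    · exact contDiffOn_const
  · simp only [cf_dW0_flat, cf_twist]
    rcases c with ij | k
    · rw [pd_twC hS ha.smooth (fun c => hX c s m) q ij hħ hp]
      simp only [twC, cf_dW0]
      split_ifs
      · simp only [Pi.add_apply, Fin.sum_univ_two, Pi.mul_apply, add_zero]
        ring
      · simp
    · simp only [twC, cf_dW0, add_zero]

lemma twRel_gaugeZero (hS : LocDiffeo ϖ S) (ha : ClosedConn ϖ S (connFun ϖ ϕ)) {X : Sec r HFun}
    (hX : ∀ c m, cf X c 0 m = 0) (hXs : SmoothOn S X) (q : Fin 2) (n s : ℕ) (m : Lam) :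
    TwRel κ S (connFun ϖ ϕ) (fun c => cf (gaugeZero κ ϖ ϕ n X q) c s m)
      (fun c => cf (gaugeZero κ ϖ (fun _ _ => 0) n (twist κ ϖ ϕ X) q) c s m) := by
  have key : ∀ k, TwRel κ S (connFun ϖ ϕ)
      (fun c => cf ((br κ ϖ ϕ X)^[k] (dW0 κ ϖ ϕ X q)) c s m)
      (fun c => cf ((br κ ϖ (fun _ _ => 0) (twist κ ϖ ϕ X))^[k]
        (dW0 κ ϖ (fun _ _ => 0) (twist κ ϖ ϕ X) q)) c s m) := by
    intro k
    cases k with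
    | zero => exact twRel_dW0 hS ha hXs q s m
    | succ k =>
      refine iterate_relF (fun _ => TwRel κ S (connFun ϖ ϕ)) (fun _ => TwRel κ S (connFun ϖ ϕ))
        (fun _ => TwRel.zero) (fun _ _ _ _ _ => TwRel.add) (fun m' m'' _ _ _ _ hx hy => ?_)
        hX (twist_order_zero hX) (cf_dW0_zero hX q) (cf_dW0_zero (twist_order_zero hX) q) s
        (fun s' _ m => twRel_twist hXs s' m) (fun s' _ m => twRel_dW0 hS ha hXs q s' m) k s le_rfl m
      rw [connFun_flat]
      exact hx.brc hS ha m' m'' hy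
  have hsum : ∀ T : Finset ℕ, TwRel κ S (connFun ϖ ϕ)
      (∑ k ∈ T, (((k + 1).factorial : ℂ)⁻¹) •
        fun c => cf ((br κ ϖ ϕ X)^[k] (dW0 κ ϖ ϕ X q)) c s m)
      (∑ k ∈ T, (((k + 1).factorial : ℂ)⁻¹) • fun c =>
        cf ((br κ ϖ (fun _ _ => 0) (twist κ ϖ ϕ X))^[k]
          (dW0 κ ϖ (fun _ _ => 0) (twist κ ϖ ϕ X) q)) c s m) := by
    intro T
    induction T using Finset.induction_on with
    | empty => exact TwRel.zero
    | insert i T hi ih =>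
      rw [Finset.sum_insert hi, Finset.sum_insert hi]
      exact ((key i).smul _).add ih
  have e := (hsum (Finset.range n)).smul (-1)
  convert e using 1 <;>
  · funext c
    rw [cf_gaugeZero]
    simp only [neg_smul, one_smul, Finset.sum_apply, Pi.smul_apply]

lemma twRel_dW1 (hS : LocDiffeo ϖ S) (ha : ClosedConn ϖ S (connFun ϖ ϕ)) {α : Form1 r}
    (hα : ∀ q, SmoothOn S (α q)) (s : ℕ) (m : Lam) (c : Comp r) {ħ : ℝ} (hħ : 0 < ħ) {p : Pt}
    (hp : p ∈ S) : cf (dW1 κ ϖ (fun _ _ => 0) (fun q => twist κ ϖ ϕ (α q))) c s m ħ p =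
      twC κ (connFun ϖ ϕ) (fun c => cf (dW1 κ ϖ ϕ α) c s m) c ħ p := by
  have e : ∀ q, pd ϖ q (fun _ => (0 : ℂ)) = 0 := fun q => pd_const _ _ _
  rcases c with ij | k
  · simp only [cf_dW1, connFun_flat, e, cf_twist, Pi.add_apply, Pi.sub_apply]
    rw [pd_twC hS ha.smooth (fun c => hα 0 c s m) _ ij hħ hp,
      pd_twC hS ha.smooth (fun c => hα 1 c s m) _ ij hħ hp]
    simp only [twC]
    split_ifs
    · simp only [Pi.add_apply, Fin.sum_univ_two, Pi.mul_apply, Pi.zero_apply, add_zero, mul_zero,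
        sub_zero, Pi.sub_apply]
      ring
    · simp
  · simp only [cf_dW1, cf_twist, twC]

end Twist

/-! ## The solution of the Kuranishi equation -/

section Solution

namespace Setup

variable {r : ℕ} {S : Setup r}

lemma closedConn_id : ClosedConn id S.U (connFun id S.ϕ) := by
  have hf : ∀ i, ContDiffOn ℝ ∞ (fun x => (S.ϕ i x : ℂ)) S.U := fun i =>
    Complex.ofRealCLM.contDiff.comp_contDiffOn (S.smooth_ϕ i)
  have hS := locDiffeo_id S.isOpen_U
  refine ⟨fun k i => (ContDiffOn.pd hS (hf i) k).neg, fun k l i p hp => ?_⟩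
  have key : ∀ k l, pd id k (connFun id S.ϕ l i) p =
      -fderiv ℝ (fderiv ℝ fun x => (S.ϕ i x : ℂ)) p (Pi.single k 1) (Pi.single l 1) := by
    intro k l
    have e : connFun id S.ϕ l i =
        (-1 : ℂ) • fun x => fderiv ℝ (fun x => (S.ϕ i x : ℂ)) x (Pi.single l 1) := by
      funext x
      simp [connFun, pd_id]
    have hd : DifferentiableAt ℝ (fderiv ℝ fun x => (S.ϕ i x : ℂ)) p :=
      (((hf i).contDiffAt (S.isOpen_U.mem_nhds hp)).fderiv_right (m := 1)
        (WithTop.coe_le_coe.mpr le_top)).differentiableAt one_ne_zero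
    rw [e, pd_smul, Pi.smul_apply, pd_id, fderiv_clm_apply hd (differentiableAt_const _)]
    simp
  have hsym : IsSymmSndFDerivAt ℝ (fun x => (S.ϕ i x : ℂ)) p :=
    ((hf i).contDiffAt (S.isOpen_U.mem_nhds hp)).isSymmSndFDerivAt
      (by simp only [minSmoothness_of_isRCLikeNormedField]; exact WithTop.coe_le_coe.mpr le_top)
  rw [key, key, hsym.eq]

lemma closedConn_pol : ClosedConn S.pol S.cover (connFun S.pol S.ϕ) := by
  have e : ∀ l i, connFun S.pol S.ϕ l i = fun p => connFun id S.ϕ l i (S.pol p) := fun _ _ => rfl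
  have hs := (closedConn_id (S := S)).smooth
  refine ⟨fun k i => (hs k i).comp contDiff_pol.contDiffOn mapsTo_pol, fun k l i p hp => ?_⟩
  have hd : ∀ l, DifferentiableAt ℝ (connFun id S.ϕ l i) (S.pol p) := fun l =>
    ContDiffOn.differentiableAt_of_isOpen S.isOpen_U (hs l i) (mapsTo_pol hp)
  rw [e, e, pd_comp locDiffeo_pol hp (hd l), pd_comp locDiffeo_pol hp (hd k)]
  exact (closedConn_id (S := S)).closed k l i _ (mapsTo_pol hp)

variable (S) in
/-- The solution of the Kuranishi equation. -/
noncomputable def solution : Form1 r := fun q => twist (-S.κ) id S.ϕ (S.flatForm q)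

lemma twist_solution (q : Fin 2) : twist S.κ id S.ϕ (S.solution q) = S.flatForm q :=
  twist_twist_neg _

lemma twC_inj {κ : ℂ} {a : Fin 2 → Fin r → Pt → ℂ} {x y : Comp r → HFun} {ħ : ℝ} {p : Pt}
    (h : ∀ c, twC κ a x c ħ p = twC κ a y c ħ p) (c : Comp r) : x c ħ p = y c ħ p := by
  have e : ∀ x : Comp r → HFun, twC (-κ) a (twC κ a x) = x := fun x => by
    have := twC_neg_twC (κ := -κ) (a := a) x
    rwa [neg_neg] at this
  have := twC_congr (κ := -κ) (a := a) h c
  rwa [e, e] at this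

lemma flowInt_congr {m : Lam} (hm : m ≠ 0) {f g : HFun} {ħ : ℝ} (h : Set.EqOn (f ħ) (g ħ) S.U)
    {x : Pt} (hx : x ∈ S.U) : S.flowInt m f ħ x = S.flowInt m g ħ x := by
  rw [flowInt_eq, flowInt_eq]
  exact (adapted hm).flowInt'_congr h hx

lemma conormal_zero (q : Fin 2) : conormal 0 q = 0 := by
  fin_cases q <;> simp [conormal]

/-- The translation intertwines the homotopy operators. -/
lemma hom_twC {Z : Sec r HFun} (q : Fin 2) (s : ℕ) (m : Lam) (hZ : ∀ c, Smooth S.U (cf Z c s m))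
    (c : Comp r) {ħ : ℝ} (hħ : 0 < ħ) {x : Pt} (hx : x ∈ S.U) :
    twC S.κ (connFun id S.ϕ) (fun c => cf (S.hom Z q) c s m) c ħ x =
      conormal m q * S.flowInt m (twC S.κ (connFun id S.ϕ) (fun c => cf Z c s m) c) ħ x := by
  rcases c with ij | k
  swap
  · simp only [twC, cf_hom_inr]
  by_cases hm : m = 0
  · subst hm
    simp only [twC, cf_hom_inr, cf_hom_inl, conormal_zero, zero_mul]
    split_ifs <;> simp
  have hA := adapted (S := S) hm
  have ha := (closedConn_id (S := S)).smooth
  have hS := locDiffeo_id S.isOpen_U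
  by_cases hij : ij.1 = ij.2
  swap
  · simp only [twC, cf_hom_inl, if_neg hij, sub_zero, add_zero, Pi.add_apply, Pi.zero_apply]
  set y : Comp r → HFun := Sum.elim 0 fun k => S.flowInt m (cf Z (Sum.inr k) s m) with hy
  have hys : ∀ c, Smooth S.U (y c) := by
    rintro (c | k)
    · exact Smooth.zero
    · intro ħ hħ
      simp only [hy, Sum.elim_inr, flowInt_eq]
      exact hA.contDiffOn_flowInt' (hZ _ ħ hħ)
  set G : HFun := twC S.κ (connFun id S.ϕ) y (Sum.inl ij) with hG
  have hGs : Smooth S.U G := smooth_twC ha hys _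
  set B : HFun := fun ħ p => S.κ * ħ * ∑ k,
      (conormal m 1 * S.flowInt m (cf Z (Sum.inr k) s m) ħ p * pd id 0 (connFun id S.ϕ k ij.1) p -
      conormal m 0 * S.flowInt m (cf Z (Sum.inr k) s m) ħ p * pd id 1 (connFun id S.ϕ k ij.1) p)
    with hB
  have hpd : Set.EqOn (fun p => ∑ q, ((toPt m q : ℝ) : ℂ) * pd id q (G ħ) p)
      (fun p => (∑ k, cf Z (Sum.inr k) s m ħ p * (S.κ * ħ * connFun id S.ϕ k ij.1 p)) + B ħ p)
      S.U := by
    intro p hp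
    have h1 : ∀ k, ∑ q, ((toPt m q : ℝ) : ℂ) *
        pd id q (S.flowInt m (cf Z (Sum.inr k) s m) ħ) p = cf Z (Sum.inr k) s m ħ p := by
      intro k
      rw [flowInt_eq]
      exact hA.sum_pd_flowInt' (hZ _ ħ hħ) hp
    have h2 : ∀ q, pd id q (y (Sum.inl ij) ħ) p = 0 := fun q => by
      rw [show y (Sum.inl ij) ħ = 0 from rfl, pd_zero]
      rfl
    have h3 : ∀ q, pd id q (G ħ) p = _ := fun q => pd_twC hS ha hys q ij hħ hp
    simp only [h3, if_pos hij, h2, ← h1]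
    simp only [hB, Fin.sum_univ_two, hy, Sum.elim_inr, conormal, toPt, Matrix.cons_val_zero,
      Matrix.cons_val_one]
    push_cast
    ring
  have hBs : ContDiffOn ℝ ∞ (cf Z (Sum.inl ij) s m ħ - B ħ) S.U := by
    refine (hZ _ ħ hħ).sub (contDiffOn_const.mul (ContDiffOn.sum fun k _ => ?_))
    have hF := hys (Sum.inr k) ħ hħ
    exact ((contDiffOn_const.mul hF).mul (ContDiffOn.pd hS (ha k _) 0)).sub
      ((contDiffOn_const.mul hF).mul (ContDiffOn.pd hS (ha k _) 1))
  have hsum : ContDiffOn ℝ ∞ (fun p => ∑ q, ((toPt m q : ℝ) : ℂ) * pd id q (G ħ) p) S.U :=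
    ContDiffOn.sum fun q _ => contDiffOn_const.mul (ContDiffOn.pd hS (hGs ħ hħ) q)
  have hval : ∀ p, G ħ p = ∑ k, S.flowInt m (cf Z (Sum.inr k) s m) ħ p *
      (S.κ * ħ * connFun id S.ϕ k ij.1 p) := by
    intro p
    simp only [hG, twC, if_pos hij, hy, Sum.elim_inl, Sum.elim_inr, Pi.zero_apply, zero_add,
      Finset.sum_apply, Pi.mul_apply]
  have hfoot : G ħ (x - S.timeL m (x - S.q0) • toPt m) = 0 := by
    rw [hval]
    refine Finset.sum_eq_zero fun k _ => ?_
    rw [flowInt_eq]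
    simp only [hA.flowInt'_foot, zero_mul]
  have hint := hA.flowInt'_add hBs hsum hx
  rw [hA.flowInt'_deriv (hGs ħ hħ) hx, hfoot, sub_zero] at hint
  have hfl : S.flowInt m (twC S.κ (connFun id S.ϕ) (fun c => cf Z c s m) (Sum.inl ij)) ħ x =
      S.flowInt m (cf Z (Sum.inl ij) s m - B) ħ x + G ħ x := by
    rw [flowInt_eq, flowInt_eq]
    refine (hA.flowInt'_congr (fun p hp => ?_) hx).trans hint
    rw [Pi.add_apply, Pi.sub_apply]
    have := hpd hp
    simp only at this
    rw [this]
    simp only [twC, if_pos hij, Pi.add_apply, Finset.sum_apply, Pi.mul_apply]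
    ring
  rw [hfl, hval]
  simp only [twC, if_pos hij, cf_hom_inl, cf_hom_inr, Pi.add_apply, Finset.sum_apply, Pi.mul_apply]
  rw [mul_add, Finset.mul_sum]
  exact congrArg _ (Finset.sum_congr rfl fun k _ => by ring)

lemma twist_wallForm (L : Sec r ℂ) (i q : Fin 2) : twist S.κ id S.ϕ (S.wallForm L i q) =
    mapSec (fun _ (z : ℂ) ħ x => -z * S.delta i q ħ x) L :=
  Prod.ext (sub_add_cancel _ _) rfl

lemma twC_wallForm (L : Sec r ℂ) (i q : Fin 2) (c : Comp r) (s : ℕ) (m : Lam) :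
    twC S.κ (connFun id S.ϕ) (fun c => cf (S.wallForm L i q) c s m) c =
      fun ħ x => -cf L c s m * S.delta i q ħ x := by
  rw [← cf_twist, twist_wallForm, cf_mapSec]
  intro m
  funext ħ x
  simp

lemma conormal_wall1 (q : Fin 2) (c : Comp r) (s : ℕ) (m : Lam) (ħ : ℝ) (x : Pt) :
    conormal m q * (-cf S.w1.logθ c s m / (detL m S.w2.m : ℂ) * gauss (S.coord 1) ħ x) =
      -cf S.w1.logθ c s m * S.delta 1 q ħ x := by
  by_cases h : cf S.w1.logθ c s m = 0
  · simp [h]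
  obtain ⟨l, hl, rfl⟩ := logθ1_mode h
  have hl' : (l : ℂ) ≠ 0 := by
    have : l ≠ 0 := by omega
    exact_mod_cast this
  have hD : (S.w1.m 0 * S.w2.m 1 - S.w1.m 1 * S.w2.m 0 : ℂ) ≠ 0 := by
    exact_mod_cast S.nonparallel
  have e : (detL (l • S.w1.m) S.w2.m : ℂ) =
      l * (S.w1.m 0 * S.w2.m 1 - S.w1.m 1 * S.w2.m 0 : ℂ) := by
    simp [detL]
    ring
  rw [e, delta]
  have e2 : ((coords S.w1.m S.w2.m (Pi.single q 1) 1 : ℝ) : ℂ) = conormal S.w1.m q /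
      (S.w1.m 0 * S.w2.m 1 - S.w1.m 1 * S.w2.m 0 : ℂ) := by
    fin_cases q <;> simp [conormal, coords]
  have e3 : conormal (l • S.w1.m) q = l * conormal S.w1.m q := by
    fin_cases q <;> simp [conormal]
  rw [e2, e3]
  field_simp

lemma conormal_wall2 (q : Fin 2) (c : Comp r) (s : ℕ) (m : Lam) (ħ : ℝ) (x : Pt) :
    conormal m q * (cf S.w2.logθ c s m / (detL S.w1.m m : ℂ) * gauss (S.coord 0) ħ x) =
      -cf S.w2.logθ c s m * S.delta 0 q ħ x := by
  by_cases h : cf S.w2.logθ c s m = 0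
  · simp [h]
  obtain ⟨l, hl, rfl⟩ := logθ2_mode h
  have hl' : (l : ℂ) ≠ 0 := by
    have : l ≠ 0 := by omega
    exact_mod_cast this
  have hD : (S.w1.m 0 * S.w2.m 1 - S.w1.m 1 * S.w2.m 0 : ℂ) ≠ 0 := by
    exact_mod_cast S.nonparallel
  have e : (detL S.w1.m (l • S.w2.m) : ℂ) =
      l * (S.w1.m 0 * S.w2.m 1 - S.w1.m 1 * S.w2.m 0 : ℂ) := by
    simp [detL]
    ring
  rw [e, delta]
  have e2 : ((coords S.w1.m S.w2.m (Pi.single q 1) 0 : ℝ) : ℂ) = -conormal S.w2.m q /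
      (S.w1.m 0 * S.w2.m 1 - S.w1.m 1 * S.w2.m 0 : ℂ) := by
    fin_cases q <;> simp [conormal, coords]
  have e3 : conormal (l • S.w2.m) q = l * conormal S.w2.m q := by
    fin_cases q <;> simp [conormal]
  rw [e2, e3]
  field_simp

lemma smooth_flatForm (q : Fin 2) : SmoothOn S.U (S.flatForm q) := fun c s m => by
  rw [flatForm, cf_conormalSec]
  exact (dens_smooth c s m).smul _

lemma flatForm_zero (q : Fin 2) (c : Comp r) (m : Lam) : cf (S.flatForm q) c 0 m = 0 := by
  rw [flatForm, cf_conormalSec, dens_isDensity.1, smul_zero]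

lemma smooth_solution (q : Fin 2) : SmoothOn S.U (S.solution q) := fun c s m => by
  rw [solution, cf_twist]
  exact smooth_twC closedConn_id.smooth (fun c => smooth_flatForm q c s m) c

lemma solution_zero (q : Fin 2) (c : Comp r) (m : Lam) : cf (S.solution q) c 0 m = 0 :=
  twist_order_zero (flatForm_zero q) c m

lemma twC_solution (q : Fin 2) (c : Comp r) (s : ℕ) (m : Lam) (ħ : ℝ) (x : Pt) :
    twC S.κ (connFun id S.ϕ) (fun c => cf (S.solution q) c s m) c ħ x =
      conormal m q * (cf (S.initSec fun i => gauss (S.coord i)) c s m ħ x -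
        2⁻¹ * S.flowInt m (cf (detBr S.κ S.dens) c s m) ħ x) := by
  rw [← cf_twist, twist_solution, flatForm, cf_conormalSec, dens_isDensity.2]
  rfl

lemma twRel_br11 (s : ℕ) (m : Lam) : TwRel S.κ S.U (connFun id S.ϕ)
    (fun c => cf (br11 S.κ id S.ϕ S.solution S.solution) c s m)
    (fun c => cf (detBr S.κ S.dens) c s m) := by
  have h := fun q q' => twRel_br (κ := S.κ) (locDiffeo_id S.isOpen_U) closedConn_id
    (solution_zero (S := S) q) (solution_zero q') (smooth_solution q) (smooth_solution q') s m
  have := (h 0 1).add ((h 1 0).smul (-1))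
  simp only [twist_solution] at this
  convert this using 1 <;>
  · funext c
    simp only [detBr, br11, cf_sub, Pi.add_apply, Pi.neg_apply, neg_smul, one_smul, flatForm]
    exact sub_eq_add_neg _ _

lemma cf_kuranishi (Φ : Form1 r) (q : Fin 2) (s : ℕ) (m : Lam) :
    (fun c => cf ((S.Pi1 + S.Pi2 - (2⁻¹ : ℂ) • S.hom (br11 S.κ id S.ϕ Φ Φ)) q) c s m) =
      (fun c => cf (S.Pi1 q) c s m) + (fun c => cf (S.Pi2 q) c s m) +
        (-2⁻¹ : ℂ) • fun c => cf (S.hom (br11 S.κ id S.ϕ Φ Φ) q) c s m := by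
  funext c
  simp only [Pi.sub_apply, Pi.add_apply, Pi.smul_apply, Pi.neg_apply, cf_sub, cf_add, cf_smul,
    neg_smul]
  exact sub_eq_add_neg _ _

lemma solution_isKuranishi : S.IsKuranishi S.solution := by
  refine ⟨fun q => solution_zero q, smooth_solution, fun q c s m ħ hħ x hx => ?_⟩
  refine twC_inj (x := fun c => cf (S.solution q) c s m) (y := fun c => cf ((S.Pi1 + S.Pi2 -
    (2⁻¹ : ℂ) • S.hom (br11 S.κ id S.ϕ S.solution S.solution)) q) c s m) (κ := S.κ)
    (a := connFun id S.ϕ) (fun c => ?_) c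
  have hZ := twRel_br11 (S := S) s m
  rw [twC_solution, cf_kuranishi, twC_add, twC_add, twC_smul]
  simp only [Pi.add_apply, Pi.smul_apply, smul_eq_mul, hom_twC q s m hZ.1 c hħ hx]
  rw [Pi1, Pi2, twC_wallForm, twC_wallForm]
  simp only [← conormal_wall1, ← conormal_wall2, cf_initSec]
  by_cases hm : m = 0
  · simp [hm, conormal_zero]
  rw [flowInt_congr hm (hZ.2 c ħ hħ) hx]
  simp only [Pi.add_apply, Pi.smul_apply, smul_eq_mul]
  ring

lemma solution_isMaurerCartan : S.IsMaurerCartan S.solution := by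
  intro c s m ħ hħ x hx
  have hZ := twRel_br11 (S := S) s m
  rw [cf_zero]
  refine twC_inj (y := 0) (κ := S.κ) (a := connFun id S.ϕ) (x := fun c => cf (dW1 S.κ id S.ϕ
    S.solution + (2⁻¹ : ℂ) • br11 S.κ id S.ϕ S.solution S.solution) c s m) (fun c => ?_) c
  have e : (fun c => cf (dW1 S.κ id S.ϕ S.solution +
      (2⁻¹ : ℂ) • br11 S.κ id S.ϕ S.solution S.solution) c s m) =
      (fun c => cf (dW1 S.κ id S.ϕ S.solution) c s m) +
        (2⁻¹ : ℂ) • fun c => cf (br11 S.κ id S.ϕ S.solution S.solution) c s m := by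
    funext c
    simp only [cf_add, cf_smul, Pi.add_apply, Pi.smul_apply]
  have e0 : ∀ q, pd id q (fun _ => (0 : ℂ)) = 0 := fun q => pd_const _ _ _
  rw [e, twC_add, twC_smul, twC_zero]
  simp only [Pi.add_apply, Pi.smul_apply, smul_eq_mul, ← hZ.2 c ħ hħ hx,
    ← twRel_dW1 (locDiffeo_id S.isOpen_U) closedConn_id smooth_solution s m c hħ hx,
    twist_solution]
  have h := sum_pd_dens (S := S) c s m hħ hx
  rw [Fin.sum_univ_two] at h
  have hpd : ∀ q k, pd id k (cf (S.flatForm q) c s m ħ) x =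
      conormal m q * pd id k (cf S.dens c s m ħ) x := by
    intro q k
    rw [flatForm, cf_conormalSec, Pi.smul_apply, pd_smul]
    rfl
  have hd : cf (dW1 S.κ id (fun _ _ => 0) fun q => S.flatForm q) c s m ħ x =
      pd id 0 (cf (S.flatForm 1) c s m ħ) x - pd id 1 (cf (S.flatForm 0) c s m ħ) x := by
    rw [cf_dW1]
    rcases c with c | c
    · simp only [connFun_flat, e0, Pi.zero_apply, mul_zero, sub_zero, Finset.sum_const_zero]
      split_ifs <;> simp
    · simp
  rw [hd, hpd, hpd]
  simp only [conormal, Matrix.cons_val_zero, Matrix.cons_val_one, Pi.zero_apply]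
  linear_combination h

lemma hom_congr {Z Z' : Sec r HFun} (q : Fin 2) (s : ℕ) (m : Lam) {ħ : ℝ}
    (h : ∀ c, Set.EqOn (cf Z c s m ħ) (cf Z' c s m ħ) S.U) (c : Comp r) :
    Set.EqOn (cf (S.hom Z q) c s m ħ) (cf (S.hom Z' q) c s m ħ) S.U := by
  intro x hx
  by_cases hm : m = 0
  · subst hm
    rcases c with c | c
    · simp only [cf_hom_inl, conormal_zero, zero_mul]
    · simp only [cf_hom_inr, conormal_zero, zero_mul]
  rcases c with ij | k
  · simp only [cf_hom_inl]
    refine congrArg _ (flowInt_congr hm (fun p hp => ?_) hx)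
    rw [Pi.sub_apply, Pi.sub_apply, Pi.sub_apply, Pi.sub_apply, h _ hp]
    split_ifs
    · simp only [fun k => flowInt_congr hm (h (Sum.inr k)) hp]
    · rfl
  · simp only [cf_hom_inr, flowInt_congr hm (h _) hx]

lemma IsKuranishi.agreeOn {Φ Φ' : Form1 r} (h : S.IsKuranishi Φ) (h' : S.IsKuranishi Φ')
    (q : Fin 2) : AgreeOn S.U (Φ q) (Φ' q) := by
  have key : ∀ s q c m ħ, 0 < ħ → Set.EqOn (cf (Φ q) c s m ħ) (cf (Φ' q) c s m ħ) S.U := by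
    intro s
    induction s using Nat.strong_induction_on with
    | _ s ih =>
      intro q c m ħ hħ x hx
      have hbr : ∀ q q' c m ħ, 0 < ħ → Set.EqOn (cf (br S.κ id S.ϕ (Φ q) (Φ q')) c s m ħ)
          (cf (br S.κ id S.ϕ (Φ' q) (Φ' q')) c s m ħ) S.U := by
        intro q q' c m
        refine br_rel_pos S.κ id S.ϕ (fun f g => ∀ ħ, 0 < ħ → Set.EqOn (f ħ) (g ħ) S.U)
          (fun _ _ => Set.eqOn_refl _ _) ?_ (h.1 q) (h'.1 q) (h.1 q') (h'.1 q') c s m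
          fun s' hs' s'' hs'' m' m'' _ => brc_eqOn S.isOpen_U m' m''
            (fun c => ih s' hs' q c m') (fun c => ih s'' hs'' q' c m'') c
        intro f f' g g' hf hg ħ hħ p hp
        simp only [Pi.add_apply, hf ħ hħ hp, hg ħ hħ hp]
      have hb : ∀ c, Set.EqOn (cf (br11 S.κ id S.ϕ Φ Φ) c s m ħ)
          (cf (br11 S.κ id S.ϕ Φ' Φ') c s m ħ) S.U := by
        intro c p hp
        simp only [br11, cf_sub, Pi.sub_apply, hbr _ _ c m ħ hħ hp]
      have e := fun Φ => congrFun (congrFun (congrFun (cf_kuranishi (S := S) Φ q s m) c) ħ) x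
      rw [h.2.2 q c s m ħ hħ x hx, h'.2.2 q c s m ħ hħ x hx, e, e]
      simp only [Pi.add_apply, Pi.smul_apply, hom_congr q s m hb c hx]
  exact fun c s m ħ hħ x hx => key s q c m ħ hħ hx

lemma solution_eq_zero (q : Fin 2) {m : Lam} (hm : ¬ S.Cone m) (c : Comp r) (s : ℕ) :
    cf (S.solution q) c s m = 0 := by
  have h0 : ∀ c, cf S.dens c s m = 0 := fun c => by_contra fun h =>
    hm (dens_isDensity.cone flowInt_zero h)
  rw [solution, cf_twist, show (fun c => cf (S.flatForm q) c s m) = 0 from funext fun c => by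
    rw [flatForm, cf_conormalSec, h0, smul_zero]; rfl, twC_zero]
  rfl

lemma solution_eq_finsum (q : Fin 2) (c : Comp r) (s : ℕ) (m : Lam) (ħ : ℝ) (x : Pt) :
    cf (S.solution q) c s m ħ x = ∑ᶠ a : Prim, cf (S.part a S.solution q) c s m ħ x := by
  by_cases hm : S.Cone m
  · obtain ⟨a, l, hl, rfl⟩ := hm.exists_prim
    rw [finsum_eq_single _ a, cf_part, if_pos ⟨l, hl, rfl⟩]
    intro a' ha'
    rw [cf_part, if_neg]
    · rfl
    · rintro ⟨l', hl', e⟩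
      exact ha' (prim_unique hl' hl e.symm)
  · simp only [cf_part, solution_eq_zero q hm, ite_self, Pi.zero_apply, finsum_zero]

lemma part_eq_wallForm {a : Prim} {w : Wall r} {i : Fin 2} (q : Fin 2)
    (hL : ∀ c s m, ¬ S.Along a m → cf w.logθ c s m = 0)
    (h : ∀ c s m, S.Along a m → ∀ ħ x, conormal m q *
      (cf (S.initSec fun i => gauss (S.coord i)) c s m ħ x -
        2⁻¹ * S.flowInt m (cf (detBr S.κ S.dens) c s m) ħ x) =
      -cf w.logθ c s m * S.delta i q ħ x) :
    AgreeOn S.U (S.part a S.solution q) (S.wallForm w.logθ i q) := by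
  intro c s m ħ hħ x hx
  refine twC_inj (κ := S.κ) (a := connFun id S.ϕ) (x := fun c => cf (S.part a S.solution q) c s m)
    (y := fun c => cf (S.wallForm w.logθ i q) c s m) (fun c => ?_) c
  rw [twC_wallForm]
  simp only [cf_part]
  by_cases hm : S.Along a m
  · simp only [if_pos hm]
    rw [twC_solution, h c s m hm]
  · simp only [if_neg hm, hL c s m hm]
    rw [show (fun _ : Comp r => (0 : HFun)) = 0 from rfl, twC_zero]
    simp

lemma part_e1 (q : Fin 2) : AgreeOn S.U (S.part e1 S.solution q) (S.Pi1 q) := by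
  refine part_eq_wallForm q (fun c s m hm => by_contra fun h => hm ?_) fun c s m hm ħ x => ?_
  · rw [Along, mA_e1]
    exact logθ1_mode h
  · obtain ⟨l, hl, rfl⟩ := hm
    rw [mA_e1, ← conormal_wall1, dens_isDensity.detBr_w1 flowInt_zero, flowInt_zero, cf_initSec,
      logθ2_w1 hl]
    simp

lemma part_e2 (q : Fin 2) : AgreeOn S.U (S.part e2 S.solution q) (S.Pi2 q) := by
  refine part_eq_wallForm q (fun c s m hm => by_contra fun h => hm ?_) fun c s m hm ħ x => ?_
  · rw [Along, mA_e2]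
    exact logθ2_mode h
  · obtain ⟨l, hl, rfl⟩ := hm
    rw [mA_e2, ← conormal_wall2, dens_isDensity.detBr_w2 flowInt_zero, flowInt_zero, cf_initSec,
      logθ1_w2 hl]
    simp

end Setup
end Solution

/-! ## Gauges for the given metric -/

section Gauges

lemma twC_sub {r : ℕ} {κ : ℂ} {a : Fin 2 → Fin r → Pt → ℂ} (x y : Comp r → HFun) :
    twC κ a (x - y) = twC κ a x - twC κ a y := by
  have := twC_add (κ := κ) (a := a) (x - y) y
  rw [sub_add_cancel] at this
  rw [this, add_sub_cancel_right]

lemma TwRel.sub {r : ℕ} {κ : ℂ} {S : Set Pt} {a : Fin 2 → Fin r → Pt → ℂ}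
    {x x' y y' : Comp r → HFun} (h : TwRel κ S a x x') (h' : TwRel κ S a y y') :
    TwRel κ S a (x - y) (x' - y') := by
  refine ⟨fun c => (h.1 c).sub (h'.1 c), fun c ħ hħ p hp => ?_⟩
  rw [twC_sub]
  simp only [Pi.sub_apply, h.2 c ħ hħ hp, h'.2 c ħ hħ hp]

lemma WE.twC {r : ℕ} {κ : ℂ} {ϖ : Pt → Pt} {S : Set Pt} {a : Fin 2 → Fin r → Pt → ℂ}
    (hS : LocDiffeo ϖ S) (ha : ∀ k i, ContDiffOn ℝ ∞ (a k i) S) {x : Comp r → HFun}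
    (hx : ∀ c, WE ϖ S (x c)) (c : Comp r) : WE ϖ S (twC κ a x c) := by
  rcases c with ij | k
  · refine (hx _).add hS ?_
    split_ifs
    · exact WE.sum hS _ fun k _ => (hx _).mul hS ((WP.hbar_smul κ).mul hS (WP.of_smooth hS (ha k _)))
    · exact WE.zero
  · exact hx _

lemma TwRel.wE_iff {r : ℕ} {κ : ℂ} {ϖ : Pt → Pt} {S : Set Pt} {a : Fin 2 → Fin r → Pt → ℂ}
    (hS : LocDiffeo ϖ S) (ha : ∀ k i, ContDiffOn ℝ ∞ (a k i) S) {x x' : Comp r → HFun}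
    (h : TwRel κ S a x x') : (∀ c, WE ϖ S (x c)) ↔ ∀ c, WE ϖ S (x' c) := by
  refine ⟨fun hx c => (WE.twC hS ha hx c).congr hS.isOpen fun ħ hħ p hp => (h.2 c ħ hħ hp).symm,
    fun hx c => (WE.twC (κ := -κ) hS ha hx c).congr hS.isOpen fun ħ hħ p hp => ?_⟩
  rw [twC_congr (fun c => h.2 c ħ hħ hp) c]
  have := twC_neg_twC (κ := -κ) (a := a) x
  rw [neg_neg] at this
  rw [this]

namespace Setup

variable {r : ℕ} {S : Setup r}

lemma smoothOn_twist {κ : ℂ} {φ : Sec r HFun} (h : SmoothOn S.cover φ) :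
    SmoothOn S.cover (twist κ S.pol S.ϕ φ) := fun c s m => by
  rw [cf_twist]
  exact smooth_twC closedConn_pol.smooth (fun c => h c s m) c

lemma twist_apply_eq_zero {κ : ℂ} {ϖ : Pt → Pt} {φ : Sec r HFun} {s : ℕ} {m : Lam} {ħ : ℝ} {p : Pt}
    (h : ∀ c, cf φ c s m ħ p = 0) (c : Comp r) : cf (twist κ ϖ S.ϕ φ) c s m ħ p = 0 := by
  rw [cf_twist, twC_congr (y := 0) h, twC_zero]
  rfl

lemma twRel_pull (a : Prim) (q : Fin 2) (s : ℕ) (m : Lam) :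
    TwRel S.κ S.cover (connFun S.pol S.ϕ)
      (fun c => cf (S.pull (S.part a S.solution) q) c s m)
      (fun c => cf (S.pull (S.part a S.flatForm) q) c s m) := by
  simp only [cf_pull, cf_part]
  by_cases hm : S.Along a m
  · simp only [if_pos hm]
    refine ⟨fun c ħ hħ => (smooth_solution q c s m ħ hħ).comp contDiff_pol.contDiffOn mapsTo_pol,
      fun c ħ hħ p hp => ?_⟩
    simp only [← twist_solution, cf_twist]
    rcases c with ij | k
    · simp only [twC]
      split_ifs
      · simp only [Pi.add_apply, Finset.sum_apply, Pi.mul_apply]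
        rfl
      · rfl
    · rfl
  · simp only [if_neg hm]
    exact TwRel.zero

lemma isGauge_iff {a : Prim} {φ : Sec r HFun} :
    S.IsGauge S.solution a φ ↔ S.IsFlatGauge a (twist S.κ S.pol S.ϕ φ) := by
  have hS := locDiffeo_pol (S := S)
  have ha := closedConn_pol (S := S)
  have key : (∀ c m, cf φ c 0 m = 0) → SmoothOn S.cover φ → ∀ q s m,
      ((∀ c, WExp S.pol S.cover (cf (gaugeZero S.κ S.pol S.ϕ s φ q) c s m -
        cf (S.pull (S.part a S.solution) q) c s m)) ↔
      ∀ c, WExp S.pol S.cover (cf (gaugeZero S.κ S.pol (fun _ _ => 0) s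
        (twist S.κ S.pol S.ϕ φ) q) c s m - cf (S.pull (S.part a S.flatForm) q) c s m)) := by
    intro h0 hs q s m
    have h := (twRel_gaugeZero (κ := S.κ) hS ha h0 hs q s s m).sub (twRel_pull a q s m)
    have hsm : ∀ c, Smooth S.cover (cf (gaugeZero S.κ S.pol (fun _ _ => 0) s
        (twist S.κ S.pol S.ϕ φ) q) c s m - cf (S.pull (S.part a S.flatForm) q) c s m) := fun c =>
      (smooth_twC (κ := S.κ) ha.smooth h.1 c).congr fun ħ hħ p hp => (h.2 c ħ hħ hp).symm
    exact ⟨fun H c => ((h.wE_iff hS ha.smooth).mp (fun c => ⟨h.1 c, H c⟩) c).2,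
      fun H c => ((h.wE_iff hS ha.smooth).mpr (fun c => ⟨hsm c, H c⟩) c).2⟩
  constructor
  · rintro ⟨h0, hs, hp, hE⟩
    exact ⟨twist_order_zero h0, smoothOn_twist hs,
      fun c s m ħ hħ => twist_apply_eq_zero (fun c => hp c s m ħ hħ) c,
      fun q c s m => (key h0 hs q s m).mp (fun c => hE q c s m) c⟩
  · rintro ⟨h0, hs, hp, hE⟩
    have e := twist_neg_twist (κ := S.κ) (ϖ := S.pol) (ϕ := S.ϕ) φ
    have h0' : ∀ c m, cf φ c 0 m = 0 := by
      rw [← e]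
      exact twist_order_zero h0
    have hs' : SmoothOn S.cover φ := by
      rw [← e]
      exact smoothOn_twist hs
    refine ⟨h0', hs', fun c s m ħ hħ => ?_,
      fun q c s m => (key h0' hs' q s m).mpr (fun c => hE q c s m) c⟩
    rw [← e]
    exact twist_apply_eq_zero (fun c => hp c s m ħ hħ) c

lemma HasAsymptotics.twist {a : Prim} {φ : Sec r HFun} {L : Sec r ℂ} (h : S.HasAsymptotics a φ L)
    (hs : SmoothOn S.cover φ) (κ : ℂ) :
    S.HasAsymptotics a (ExtScattering.twist κ S.pol S.ϕ φ) L := by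
  have ha := (closedConn_pol (S := S)).smooth
  intro c s m
  constructor
  · have hS := locDiffeo_pol.mono (isOpen_Hplus (S := S) a) fun p hp => hp.1
    have hd : ∀ c, WP S.pol (-1) (S.Hplus a) (fun ħ p => cf φ c s m ħ p - cf L c s m) := fun c =>
      ⟨fun ħ hħ => ((hs c s m ħ hħ).mono fun p hp => hp.1).sub contDiffOn_const, (h c s m).1⟩
    have hφ : ∀ c, WP S.pol 0 (S.Hplus a) (cf φ c s m) := fun c =>
      (((hd c).mono_order (s' := 0) (by omega)).add hS
        (WP.of_smooth hS (contDiffOn_const (c := cf L c s m)))).congr hS.isOpen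
        fun ħ _ p _ => by simp
    rcases c with ij | k
    · have hk : ∀ k, WP S.pol (-1) (S.Hplus a)
          (cf φ (Sum.inr k) s m * fun (ħ : ℝ) p => κ * ħ * connFun S.pol S.ϕ k ij.1 p) := fun k =>
        ((hφ _).mul hS ((WP.hbar_smul κ).mul hS (WP.of_smooth hS
          ((ha k ij.1).mono fun p hp => hp.1)))).mono_order (by omega)
      have e : WP S.pol (-1) (S.Hplus a) (if ij.1 = ij.2 then ∑ k, cf φ (Sum.inr k) s m *
          (fun (ħ : ℝ) p => κ * ħ * connFun S.pol S.ϕ k ij.1 p) else 0) := by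
        split_ifs
        · rw [Fin.sum_univ_two]
          exact (hk 0).add hS (hk 1)
        · exact WP.zero
      refine (((hd (Sum.inl ij)).add hS e).congr hS.isOpen fun ħ _ p _ => ?_).2
      rw [cf_twist]
      simp only [twC, Pi.add_apply]
      ring
    · rw [cf_twist]
      exact (hd (Sum.inr k)).2
  · have hS := locDiffeo_pol.mono (isOpen_Hminus (S := S) a) fun p hp => hp.1
    rw [cf_twist]
    exact (WE.twC hS (fun k i => (ha k i).mono fun p hp => hp.1) (fun c =>
      ⟨fun ħ hħ => (hs c s m ħ hħ).mono fun p hp => hp.1, (h c s m).2⟩) c).2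

lemma nonempty_Hplus (a : Prim) : (S.Hplus a).Nonempty := by
  have hcov : ∀ ϑ, S.ϑ0 - S.ε < ϑ → ϑ < S.ϑ0 + 2 * Real.pi →
      ∃ p ∈ S.cover, p 1 = ϑ := by
    intro ϑ h1 h2
    have hc : Continuous fun ρ : ℝ => S.pol ![ρ, ϑ] := contDiff_pol.continuous.comp (by fun_prop)
    have h0 : S.pol ![0, ϑ] ∈ S.U := by simpa [pol, polar] using S.m0_mem
    obtain ⟨ρ, hρ, hρU⟩ := ((hc.tendsto 0).eventually (S.isOpen_U.mem_nhds h0)).filter_mono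
      nhdsWithin_le_nhds |>.and self_mem_nhdsWithin |>.exists (f := 𝓝[>] (0 : ℝ))
    exact ⟨![ρ, ϑ], ⟨hρU, h1, h2, hρ⟩, rfl⟩
  have hπ := Real.pi_pos
  have h1 := S.lt_ϑ0
  have h2 := S.ϑ0_lt
  have h3 := S.ε_pos
  by_cases ha : a = e1
  · obtain ⟨p, hp, e⟩ := hcov (2 * Real.pi + Real.pi / 2) (by linarith) (by linarith)
    refine ⟨p, hp, ?_⟩
    rw [if_pos ha, e, add_comm, Real.sin_add_two_pi, Real.sin_pi_div_two]
    exact one_pos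
  by_cases ha' : a = e2
  · obtain ⟨p, hp, e⟩ := hcov (2 * Real.pi) (by linarith) (by linarith)
    refine ⟨p, hp, ?_⟩
    rw [if_neg ha, if_pos ha', e, Real.cos_two_pi]
    exact one_pos
  · obtain ⟨p, hp, e⟩ := hcov (3 * Real.pi) (by linarith) (by linarith)
    refine ⟨p, hp, ?_⟩
    rw [if_neg ha, if_neg ha', e, angle]
    have : Complex.arg ⟨(a.1.1 : ℝ), (a.1.2 : ℝ)⟩ ≤ Real.pi / 2 :=
      Complex.arg_le_pi_div_two_iff.mpr (Or.inl (Nat.cast_nonneg _))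
    linarith

/-- The leading term of a gauge is unique. -/
lemma HasAsymptotics.unique {a : Prim} {φ : Sec r HFun} {L L' : Sec r ℂ}
    (h : S.HasAsymptotics a φ L) (h' : S.HasAsymptotics a φ L') : L = L' := by
  obtain ⟨p, hp⟩ := nonempty_Hplus (S := S) a
  refine sec_ext fun c s m => ?_
  have key : ∀ {L : Sec r ℂ}, S.HasAsymptotics a φ L →
      Tendsto (fun ħ => cf φ c s m ħ p) (𝓝[>] 0) (𝓝 (cf L c s m)) := by
    intro L h
    obtain ⟨V, hV, hb⟩ := (h c s m).1 p hp
    obtain ⟨C, hC⟩ := hb 0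
    rw [tendsto_iff_norm_sub_tendsto_zero]
    refine squeeze_zero' (Eventually.of_forall fun _ => norm_nonneg _)
      (hC.mono fun ħ hħ => hħ p (mem_of_mem_nhds hV) [] rfl) ?_
    have : Tendsto (fun ħ : ℝ => C * ħ ^ (1 / 2 : ℝ)) (𝓝[>] 0) (𝓝 (C * 0 ^ (1 / 2 : ℝ))) :=
      (((Real.continuous_rpow_const (by norm_num)).tendsto 0).mono_left
        nhdsWithin_le_nhds).const_mul C
    rw [Real.zero_rpow (by norm_num), mul_zero] at this
    convert this using 3
    norm_num
  exact tendsto_nhds_unique (key h) (key h')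

lemma IsGauge.hasAsymptotics {a : Prim} {φ : Sec r HFun} (h : S.IsGauge S.solution a φ) :
    S.HasAsymptotics a φ (S.leading a) := by
  have h' := isGauge_iff.mp h
  have := h'.hasAsymptotics.twist h'.2.1 (-S.κ)
  rwa [twist_neg_twist] at this

lemma exists_isGauge (a : Prim) :
    ∃ φ, S.IsGauge S.solution a φ ∧ ModesAlong (S.mA a) φ := by
  obtain ⟨ψ, hψ, hm, -⟩ := exists_isFlatGauge (S := S) a
  refine ⟨twist (-S.κ) S.pol S.ϕ ψ, isGauge_iff.mpr (by rwa [twist_twist_neg]),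
    fun c s m hne => ?_⟩
  by_contra hal
  refine hne (funext fun ħ => funext fun p => twist_apply_eq_zero (fun c => ?_) c)
  rw [show cf ψ c s m = 0 from by_contra fun h => hal (hm c s m h)]
  rfl

lemma IsGauge.wExp_sub {a : Prim} {φ φ' : Sec r HFun} (h : S.IsGauge S.solution a φ)
    (h' : S.IsGauge S.solution a φ') (c : Comp r) (s : ℕ) (m : Lam) :
    WExp S.pol S.cover (cf φ c s m - cf φ' c s m) :=
  (((TwRel.sub (twRel_twist h.2.1 s m) (twRel_twist h'.2.1 s m)).wE_iff locDiffeo_pol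
    closedConn_pol.smooth).mpr
    (fun c => (isGauge_iff.mp h).wE_sub (isGauge_iff.mp h') c s m) c).2

lemma diagram_e1 : S.diagram S.leading e1 = S.w1 := by
  have : S.diagram S.leading e1 = ⟨S.w1.m, S.w1.P, S.w1.logθ⟩ := by
    rw [diagram, supp, if_pos (Or.inl rfl), mA_e1, leading_e1, S.line1]
  exact this

lemma diagram_e2 : S.diagram S.leading e2 = S.w2 := by
  have : S.diagram S.leading e2 = ⟨S.w2.m, S.w2.P, S.w2.logθ⟩ := by
    rw [diagram, supp, if_pos (Or.inr rfl), mA_e2, leading_e2, S.line2]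
  exact this

lemma diagram_isScatteringDiagram : IsScatteringDiagram S.m0 (S.diagram S.leading) := by
  refine ⟨fun a => ⟨mA_ne_zero a, ?_, leading_inExtLie a, leading_along a⟩, leading_finite⟩
  simp only [diagram, supp]
  split_ifs
  · exact Or.inl rfl
  · exact Or.inr rfl

end Setup
end Gauges
end ExtScattering

theorem theorem3p9 {r : ℕ} (S : Setup r) :
    -- the solution of the Kuranishi equation exists, is unique on the chart,
    -- and solves the Maurer-Cartan equation
    ∃ Φ : Form1 r, S.IsKuranishi Φ ∧
      (∀ Φ' : Form1 r, S.IsKuranishi Φ' → ∀ q, AgreeOn S.U (Φ' q) (Φ q)) ∧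
      S.IsMaurerCartan Φ ∧
      -- it is the sum of its parts along the primitive directions
      (∀ q c s m, ∀ ħ : ℝ, 0 < ħ → ∀ x ∈ S.U,
        cf (Φ q) c s m ħ x = ∑ᶠ a : Prim, cf (S.part a Φ q) c s m ħ x) ∧
      (∀ q, AgreeOn S.U (S.part e1 Φ q) (S.Pi1 q) ∧ AgreeOn S.U (S.part e2 Φ q) (S.Pi2 q)) ∧
      ∃ L : Prim → Sec r ℂ,
        (∀ a : Prim,
          -- the normalised gauge exists, and is unique up to exponentially small terms
          (∃ φ : Sec r HFun, S.IsGauge Φ a φ ∧ ModesAlong (S.mA a) φ) ∧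
          (∀ φ φ' : Sec r HFun, S.IsGauge Φ a φ → S.IsGauge Φ a φ' →
            ∀ c s m, WExp S.pol S.cover (cf φ c s m - cf φ' c s m)) ∧
          -- its asymptotic behaviour determines its leading term
          S.IsLeadingTerm Φ a (L a) ∧
          (∀ L' : Sec r ℂ, S.IsLeadingTerm Φ a L' → L' = L a)) ∧
        -- the leading terms define a scattering diagram that contains the two initial walls
        S.diagram L e1 = S.w1 ∧ S.diagram L e2 = S.w2 ∧
        IsScatteringDiagram S.m0 (S.diagram L) := by
  refine ⟨S.solution, Setup.solution_isKuranishi, fun Φ' h q => h.agreeOn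
    Setup.solution_isKuranishi q, Setup.solution_isMaurerCartan,
    fun q c s m ħ _ x _ => Setup.solution_eq_finsum q c s m ħ x,
    fun q => ⟨Setup.part_e1 q, Setup.part_e2 q⟩, S.leading,
    fun a => ⟨Setup.exists_isGauge a, fun φ φ' h h' => h.wExp_sub h',
      ⟨Setup.leading_inExtLie a, Setup.leading_along a, fun φ h => h.hasAsymptotics⟩,
      fun L' hL' => ?_⟩,
    Setup.diagram_e1, Setup.diagram_e2, Setup.diagram_isScatteringDiagram⟩
  obtain ⟨φ, hφ, -⟩ := Setup.exists_isGauge (S := S) a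
  exact (hL'.2.2 φ hφ).unique hφ.hasAsymptotics
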